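/- **Setting.** Let $m_+,m_-\ge 1$, $n=m_++1+m_-$, $\Sigma=\mathrm{diag}(I_{m_+},0,-I_{m_-})$ with block values $\Sigma_1=1,\Sigma_2=0,\Sigma_3=-1$, and index the three blocks by $+,0,-$. Let $e_+,e_0,e_-$ be the corresponding block columns of $I_n$. Let $\mathcal Q:\mathbb R\to\mathbb C^{n\times n}$ have vanishing diagonal blocks, with off-diagonal blocks $q_{+0},q_{+-},q_{0+},q_{0-},q_{-+},q_{-0}$ whose entries lie in $L^1(\mathbb R)$. Let $$M(x,k)=I-\int_x^\infty e^{-ik(y-x)\Sigma}\mathcal Q(y)M(y,k)e^{ik(y-x)\Sigma}\,dy,\qquad N(x,k)=I+\int_{-\infty}^x e^{ik(x-y)\Sigma}\mathcal Q(y)N(y,k)e^{-ik(x-y)\Sigma}\,dy,$$ $$\breve M(x,k)=I+\int_x^\infty e^{-ik(y-x)\Sigma}\breve M(y,k)\mathcal Q(y)e^{ik(y-x)\Sigma}\,dy,\qquad \breve N(x,k)=I-\int_{-\infty}^x e^{ik(x-y)\Sigma}\breve N(y,k)\mathcal Q(y)e^{-ik(x-y)\Sigma}\,dy,$$ solved by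 bounded continuous functions for real $k$. The columns $Me_+,Ne_-$ and the rows $e_+^T\breve N,e_-^T\breve M$ are solved for $\operatorname{Im}k\ge0$, and $Ne_+,Me_-,e_+^T\breve M,e_-^T\breve N$ for $\operatorname{Im}k\le0$. Let $\Omega^+$ be the wedge product of the $m_+$ rows $e_+^T\breve N$ and the $m_-$ rows $e_-^T\breve M$, identified with the vector whose $i$-th coordinate is the determinant of the matrix with rows $e_+^T\breve N$, then the $i$-th unit row, then $e_-^T\breve M$; let $\Omega^-$ be the same with $\breve M,\breve N$ interchanged. Put $$\Xi^+=[Me_+\;\;\Omega^+\;\;Ne_-]\,e^{ikx\Sigma},\qquad \Xi^-=[Ne_+\;\;\Omega^-\;\;Me_-]\,e^{ikx\Sigma},$$ $$A_l(k)=I-\int_{\mathbb R} e^{-iky\Sigma}\mathcal Q M e^{iky\Sigma}dy,\qquad A_r(k)=I+\int_{\mathbb R} e^{-iky\Sigma}\mathcal Q N e^{iky\Sigma}dy$$ ($A_l(k)_{++}$ and $A_r(k)_{--}$ are defined for $\operatorname{Im}k\ge0$, $A_r(k)_{++}$ and $A_l(k)_{--}$ for $\operatorname{Im}k\le 0$).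 For $k\in\mathbb R$, $S(k),\tilde S(k)$ are the scattering matrices: $\Xi^-=\Xi^+S$, $\Xi^+=\Xi^-\tilde S$. **Hypotheses.** (i) No spectral singularities: $\det A_l(k)_{++}$, $\det A_r(k)_{++}$, $\det A_l(k)_{--}$, $\det A_r(k)_{--}$, $S(k)_{00}$, $\tilde S(k)_{00}$ have no real zeros. (ii) The zeros $k_j$ of $\det A_l(k)_{++}$ and of $\det A_r(k)_{--}$ in $\mathbb C^+$ are simple, and these two functions have no common zero there; likewise for the zeros $\tilde k_j$ of $\det A_r(k)_{++}$ and $\det A_l(k)_{--}$ in $\mathbb C^-$. (iii) The curves $S(k)_{00}$ and $\tilde S(k)_{00}$, $k\in\mathbb R$, have winding number $0$ about the origin. **Scattering data.** Let $S_{00}=\mathbb A_l^+\mathbb A_l^-$ and $\tilde S_{00}=\mathbb A_r^+\mathbb A_r^-$ be the Wiener–Hopf factorizations on $\mathbb R$: the $\pm$ factors are continuous and zero-free on $\mathbb C^\pm\cup\mathbb R$, analytic on $\mathbb C^\pm$, and tend to $1$ at infinity. Put $\mathcal T=\mathrm{diag}(A_{l,++}^{-1},\mathbb A_l^+,A_{r,--}^{-1})$,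 $\tilde{\mathcal T}=\mathrm{diag}(A_{r,++}^{-1},\mathbb A_r^-,A_{l,--}^{-1})$, $\mathcal C=\mathrm{diag}(I,\mathbb A_l^-,I)$, $\tilde{\mathcal C}=\mathrm{diag}(I,\mathbb A_r^+,I)$, and define $\mathcal R,\tilde{\mathcal R}$ on $\mathbb R$ by $S=(\mathcal T-\tilde{\mathcal C}^{-1}\mathcal R)\mathcal C$, $\tilde S=(\tilde{\mathcal T}-\mathcal C^{-1}\tilde{\mathcal R})\tilde{\mathcal C}$. With $\tau_j=\operatorname{Res}_{k_j}\mathcal T$ and $\tilde\tau_j=\operatorname{Res}_{\tilde k_j}\tilde{\mathcal T}$, norming constants are off-block-diagonal matrices $N_j,\tilde N_j$ with, for all $x\in\mathbb R$, $$\Xi^+(x,k_j)\tau_j=i\,\Xi^+(x,k_j)\tilde{\mathcal C}(k_j)^{-1}N_j,\qquad \Xi^-(x,\tilde k_j)\tilde\tau_j=-i\,\Xi^-(x,\tilde k_j)\mathcal C(\tilde k_j)^{-1}\tilde N_j.$$ **Theorem.** The identities $\Xi^-=\Xi^+S$ and $\Xi^+=\Xi^-\tilde S$ hold for all $x,k\in\mathbb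 R$ with $S,\tilde S$ independent of $x$. There are finitely many $k_j,\tilde k_j$; norming constants exist; and there are off-block-diagonal $\hat{\mathcal R},\hat{\tilde{\mathcal R}}$ with $L^1(\mathbb R)$ entries such that $\mathcal R(k)=\int e^{-ik\gamma}\hat{\mathcal R}(\gamma)d\gamma$, $\tilde{\mathcal R}(k)=\int e^{ik\gamma}\hat{\tilde{\mathcal R}}(\gamma)d\gamma$. There are kernels $\mathbb K^\pm$ with $\mathbb K^\pm(x,x\pm\gamma)$ integrable in $\gamma>0$ for each $x$, such that $$\Xi^+\tilde{\mathcal C}^{-1}=\Big[I+\int_0^\infty e^{ik\gamma}\mathbb K^+(x,x+\gamma)d\gamma\Big]e^{ikx\Sigma}\ (\operatorname{Im}k\ge0),\qquad \Xi^-\mathcal C^{-1}=\Big[I+\int_0^\infty e^{-ik\gamma}\mathbb K^-(x,x-\gamma)d\gamma\Big]e^{ikx\Sigma}\ (\operatorname{Im}k\le0).$$ For every choice of these data and kernels put, blockwise, $$\omega^+(\gamma;x)_{ij}=\sum_s e^{ik_s(\gamma+[\Sigma_i-\Sigma_j]x)}(N_s)_{ij}+\hat{\mathcal R}(\gamma+[\Sigma_i-\Sigma_j]x)_{ij},$$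 $$\omega^-(\gamma;x)_{ij}=\sum_s e^{-i\tilde k_s(\gamma+[\Sigma_j-\Sigma_i]x)}(\tilde N_s)_{ij}+\hat{\tilde{\mathcal R}}(\gamma+[\Sigma_j-\Sigma_i]x)_{ij}.$$ Then $\omega^\pm(\cdot;x)$ are off-block-diagonal with entries in $L^1(0,\infty)$, and for every $x$ and almost every $\gamma>0$ (with absolutely convergent integrals) $$\mathbb K^-(x,x-\gamma)+\omega^+(\gamma;x)+\int_0^\infty \mathbb K^+(x,x+\bar\gamma)\,\omega^+(\bar\gamma+\gamma;x)\,d\bar\gamma=0,$$ $$\mathbb K^+(x,x+\gamma)+\omega^-(\gamma;x)+\int_0^\infty \mathbb K^-(x,x-\bar\gamma)\,\omega^-(\bar\gamma+\gamma;x)\,d\bar\gamma=0.$$ Let $\mathbb K^\pm(x,x)=\lim_{\varepsilon\downarrow0}\frac1\varepsilon\int_0^\varepsilon\mathbb K^\pm(x,x\pm\gamma)d\gamma$, entry by entry where the limit exists. 1. For almost every $x$ the following limits exist and $\mathbb K^\pm(x,x)_{0+}=\mp q_{0+}(x)$, $\mathbb K^\pm(x,x)_{0-}=\pm q_{0-}(x)$,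 $\mathbb K^\pm(x,x)_{+-}=\pm\tfrac12q_{+-}(x)$, $\mathbb K^\pm(x,x)_{-+}=\mp\tfrac12q_{-+}(x)$. 2. If $\mathcal Q^\dagger=-\sigma\mathcal Q\sigma$ a.e., where $\sigma$ is hermitian, unitary and commutes or anticommutes with $\Sigma$, then for almost every $x$, with $E=\mathbb K^+(x,x)$ and also with $E=-\mathbb K^-(x,x)$, and for every index $l$ in the blocks $\pm$, $\mathcal Q(x)_{l0}=\sum_i\Sigma_{ii}\,\sigma_{li}\,\overline{E_{0i}}\,\sigma_{00}$, the sum being over the indices $i$ of the blocks $\pm$. 3. If moreover the entries of $\mathcal Q$ are in $L^2(\mathbb R)$, then for every $x$, with $P=q_{+0}q_{0+}+\tfrac12q_{+-}q_{-+}$ and $D=\tfrac12q_{-+}q_{+-}+q_{-0}q_{0-}$, $$\mathbb K^+(x,x)_{++}=\int_x^\infty P,\quad \mathbb K^-(x,x)_{++}=\int_{-\infty}^xP,\quad \mathbb K^+(x,x)_{--}=\int_{-\infty}^xD,\quad \mathbb K^-(x,x)_{--}=\int_x^\infty D.$$ For almost every $x$ at which $q_{0+}(x)\ne0$ and $q_{0-}(x)\neq0$,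 the whole of $\mathcal Q(x)$ is recovered from $E(x)=\mathbb K^+(x,x)$ alone, and also from $E(x)=-\mathbb K^-(x,x)$ alone: $q_{0+}=-E_{0+}$, $q_{0-}=E_{0-}$, $q_{+-}=2E_{+-}$, $q_{-+}=-2E_{-+}$, and $$q_{+0}=\frac{(E_{++}'-2E_{+-}E_{-+})E_{0+}^\dagger}{\|E_{0+}\|^2},\qquad q_{-0}=\frac{(E_{--}'+2E_{-+}E_{+-})E_{0-}^\dagger}{\|E_{0-}\|^2}.$$ -/

import Mathlib

open MeasureTheory Set Filter Topology

noncomputable section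

namespace AKNS

/-- Index set of order `n = p + 1 + m`, split into the `+`, `0` and `-` blocks. -/
abbrev Idx (p m : ℕ) : Type := Fin p ⊕ Unit ⊕ Fin m

variable {p m : ℕ}

/-- Indices of the `+` block. -/
abbrev pl (a : Fin p) : Idx p m := Sum.inl a

/-- The index of the `0` block. -/
abbrev ze : Idx p m := Sum.inr (Sum.inl ())

/-- Indices of the `-` block. -/
abbrev mi (b : Fin m) : Idx p m := Sum.inr (Sum.inr b)

/-- Diagonal entries of `diag (I_p, 0, -I_m)`. -/
def sg : Idx p m → ℝ
  | Sum.inl _ => 1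
  | Sum.inr (Sum.inl _) => 0
  | Sum.inr (Sum.inr _) => -1

/-- Off-block-diagonal matrices: the three diagonal blocks vanish. -/
def OffBlock (A : Matrix (Idx p m) (Idx p m) ℂ) : Prop :=
  ∀ i j, (sg i : ℝ) = sg j → A i j = 0

/-- `diag (P, z, R)`. -/
def blockDiag (P : Matrix (Fin p) (Fin p) ℂ) (z : ℂ) (R : Matrix (Fin m) (Fin m) ℂ) :
    Matrix (Idx p m) (Idx p m) ℂ :=
  Matrix.fromBlocks P 0 0 (Matrix.fromBlocks (Matrix.of fun _ _ : Unit => z) 0 0 R)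

/-- The `++` block. -/
def blkP (A : Matrix (Idx p m) (Idx p m) ℂ) : Matrix (Fin p) (Fin p) ℂ := A.submatrix pl pl

/-- The `--` block. -/
def blkM (A : Matrix (Idx p m) (Idx p m) ℂ) : Matrix (Fin m) (Fin m) ℂ := A.submatrix mi mi

/-- `exp (i k x Σ)` with `Σ = diag (I_p, 0, -I_m)`. -/
def expS (k : ℂ) (x : ℝ) : Matrix (Idx p m) (Idx p m) ℂ :=
  Matrix.diagonal fun j => Complex.exp (Complex.I * k * x * (sg j : ℝ))

/-- Admissible potentials: off-block-diagonal, with entries in `L¹(ℝ)`. -/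
structure IsPotential (Q : ℝ → Matrix (Idx p m) (Idx p m) ℂ) : Prop where
  off : ∀ x, OffBlock (Q x)
  int : ∀ i j, Integrable (fun x => Q x i j) volume

/-- Bounded continuous vector functions on the line. -/
def BddCont (f : ℝ → Idx p m → ℂ) : Prop :=
  Continuous f ∧ ∃ C : ℝ, ∀ x i, ‖f x i‖ ≤ C

/-! ### Faddeev functions

Every column of `M`, `N` and every row of the duals is the bounded continuous solution of its own
Volterra equation, for those spectral parameters `k` for which the exponentials stay bounded:
all real `k`; `0 ≤ im k` for `M e₊`, `N e₋` and the rows `e₊ᵀ N̆`, `e₋ᵀ M̆`;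
`im k ≤ 0` for `N e₊`, `M e₋` and the rows `e₊ᵀ M̆`, `e₋ᵀ N̆`. -/

/-- `f` is the `j`-th column of `M(·,k)`:
`M(x,k) = I - ∫_x^∞ e^{-ik(y-x)Σ} Q(y) M(y,k) e^{ik(y-x)Σ} dy`. -/
def IsColM (Q : ℝ → Matrix (Idx p m) (Idx p m) ℂ) (k : ℂ) (j : Idx p m)
    (f : ℝ → Idx p m → ℂ) : Prop :=
  BddCont f ∧ ∀ x i, f x i = (1 : Matrix (Idx p m) (Idx p m) ℂ) i j -
    ∫ y in Ioi x, Complex.exp (-Complex.I * k * ((y - x : ℝ) : ℂ) * ((sg i - sg j : ℝ) : ℂ)) *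
      ∑ l, Q y i l * f y l

/-- `f` is the `j`-th column of `N(·,k)`:
`N(x,k) = I + ∫_{-∞}^x e^{ik(x-y)Σ} Q(y) N(y,k) e^{-ik(x-y)Σ} dy`. -/
def IsColN (Q : ℝ → Matrix (Idx p m) (Idx p m) ℂ) (k : ℂ) (j : Idx p m)
    (f : ℝ → Idx p m → ℂ) : Prop :=
  BddCont f ∧ ∀ x i, f x i = (1 : Matrix (Idx p m) (Idx p m) ℂ) i j +
    ∫ y in Iio x, Complex.exp (Complex.I * k * ((x - y : ℝ) : ℂ) * ((sg i - sg j : ℝ) : ℂ)) *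
      ∑ l, Q y i l * f y l

/-- `f` is the `i`-th row of the dual function `M̆(·,k)`:
`M̆(x,k) = I + ∫_x^∞ e^{-ik(y-x)Σ} M̆(y,k) Q(y) e^{ik(y-x)Σ} dy`. -/
def IsRowM (Q : ℝ → Matrix (Idx p m) (Idx p m) ℂ) (k : ℂ) (i : Idx p m)
    (f : ℝ → Idx p m → ℂ) : Prop :=
  BddCont f ∧ ∀ x j, f x j = (1 : Matrix (Idx p m) (Idx p m) ℂ) i j +
    ∫ y in Ioi x, Complex.exp (-Complex.I * k * ((y - x : ℝ) : ℂ) * ((sg i - sg j : ℝ) : ℂ)) *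
      ∑ l, f y l * Q y l j

/-- `f` is the `i`-th row of the dual function `N̆(·,k)`:
`N̆(x,k) = I - ∫_{-∞}^x e^{ik(x-y)Σ} N̆(y,k) Q(y) e^{-ik(x-y)Σ} dy`. -/
def IsRowN (Q : ℝ → Matrix (Idx p m) (Idx p m) ℂ) (k : ℂ) (i : Idx p m)
    (f : ℝ → Idx p m → ℂ) : Prop :=
  BddCont f ∧ ∀ x j, f x j = (1 : Matrix (Idx p m) (Idx p m) ℂ) i j -
    ∫ y in Iio x, Complex.exp (Complex.I * k * ((x - y : ℝ) : ℂ) * ((sg i - sg j : ℝ) : ℂ)) *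
      ∑ l, f y l * Q y l j

/-- The Faddeev function `M(x,k) = Ψ(x,k) e^{-ikxΣ}`. -/
def faddM (Q : ℝ → Matrix (Idx p m) (Idx p m) ℂ) (x : ℝ) (k : ℂ) :
    Matrix (Idx p m) (Idx p m) ℂ :=
  Matrix.of fun i j => Classical.epsilon (IsColM Q k j) x i

/-- The Faddeev function `N(x,k) = Φ(x,k) e^{-ikxΣ}`. -/
def faddN (Q : ℝ → Matrix (Idx p m) (Idx p m) ℂ) (x : ℝ) (k : ℂ) :
    Matrix (Idx p m) (Idx p m) ℂ :=
  Matrix.of fun i j => Classical.epsilon (IsColN Q k j) x i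

/-- The dual Faddeev function `M̆(x,k)`. -/
def dualM (Q : ℝ → Matrix (Idx p m) (Idx p m) ℂ) (x : ℝ) (k : ℂ) :
    Matrix (Idx p m) (Idx p m) ℂ :=
  Matrix.of fun i j => Classical.epsilon (IsRowM Q k i) x j

/-- The dual Faddeev function `N̆(x,k)`. -/
def dualN (Q : ℝ → Matrix (Idx p m) (Idx p m) ℂ) (x : ℝ) (k : ℂ) :
    Matrix (Idx p m) (Idx p m) ℂ :=
  Matrix.of fun i j => Classical.epsilon (IsRowN Q k i) x j

/-! ### The two missing Jost solutions

The wedge product of the `n - 1` rows `r₊`, `r₋` is identified with the vector whose `i`-th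
coordinate is the determinant of the matrix with rows `r₊`, then the unit row `eᵢ` in the place of
the `0` block, then `r₋`. It is `e₀` when the rows are those of the identity. -/

/-- Coordinates of the wedge product of the rows of `A` in the `+` block with the rows of `B` in
the `-` block. -/
def wedgeVec (A B : Matrix (Idx p m) (Idx p m) ℂ) (i : Idx p m) : ℂ :=
  Matrix.det (Matrix.of fun r c : Idx p m =>
    match r with
    | Sum.inl a => A (pl a) c
    | Sum.inr (Sum.inl _) => (1 : Matrix (Idx p m) (Idx p m) ℂ) i c
    | Sum.inr (Sum.inr b) => B (mi b) c)

/-- `Ω⁺(x,k)`. -/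
def omegaVecP (Q : ℝ → Matrix (Idx p m) (Idx p m) ℂ) (x : ℝ) (k : ℂ) : Idx p m → ℂ :=
  wedgeVec (dualN Q x k) (dualM Q x k)

/-- `Ω⁻(x,k)`. -/
def omegaVecM (Q : ℝ → Matrix (Idx p m) (Idx p m) ℂ) (x : ℝ) (k : ℂ) : Idx p m → ℂ :=
  wedgeVec (dualM Q x k) (dualN Q x k)

/-- `F⁺ = [M e₊, Ω⁺, N e₋]`. -/
def FP (Q : ℝ → Matrix (Idx p m) (Idx p m) ℂ) (x : ℝ) (k : ℂ) :
    Matrix (Idx p m) (Idx p m) ℂ :=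
  Matrix.of fun i j =>
    match j with
    | Sum.inl a => faddM Q x k i (pl a)
    | Sum.inr (Sum.inl _) => omegaVecP Q x k i
    | Sum.inr (Sum.inr b) => faddN Q x k i (mi b)

/-- `F⁻ = [N e₊, Ω⁻, M e₋]`. -/
def FM (Q : ℝ → Matrix (Idx p m) (Idx p m) ℂ) (x : ℝ) (k : ℂ) :
    Matrix (Idx p m) (Idx p m) ℂ :=
  Matrix.of fun i j =>
    match j with
    | Sum.inl a => faddN Q x k i (pl a)
    | Sum.inr (Sum.inl _) => omegaVecM Q x k i
    | Sum.inr (Sum.inr b) => faddM Q x k i (mi b)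

/-- `Ξ⁺(x,k) = [Ψ e₊, Ω⁺, Φ e₋] = F⁺(x,k) e^{ikxΣ}`. -/
def XiP (Q : ℝ → Matrix (Idx p m) (Idx p m) ℂ) (x : ℝ) (k : ℂ) :
    Matrix (Idx p m) (Idx p m) ℂ := FP Q x k * expS k x

/-- `Ξ⁻(x,k) = [Φ e₊, Ω⁻, Ψ e₋] = F⁻(x,k) e^{ikxΣ}`. -/
def XiM (Q : ℝ → Matrix (Idx p m) (Idx p m) ℂ) (x : ℝ) (k : ℂ) :
    Matrix (Idx p m) (Idx p m) ℂ := FM Q x k * expS k x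

/-! ### Transition and scattering matrices -/

/-- The transition matrix `A_l(k) = I - ∫ e^{-ikyΣ} Q(y) M(y,k) e^{ikyΣ} dy`
(so `Ψ = Φ A_l` for real `k`); its block `++` extends to `0 ≤ im k`, its block `--` to
`im k ≤ 0`. -/
def transL (Q : ℝ → Matrix (Idx p m) (Idx p m) ℂ) (k : ℂ) : Matrix (Idx p m) (Idx p m) ℂ :=
  Matrix.of fun i j => (1 : Matrix (Idx p m) (Idx p m) ℂ) i j -
    ∫ y : ℝ, Complex.exp (-Complex.I * k * (y : ℂ) * ((sg i - sg j : ℝ) : ℂ)) *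
      (Q y * faddM Q y k) i j

/-- The transition matrix `A_r(k) = I + ∫ e^{-ikyΣ} Q(y) N(y,k) e^{ikyΣ} dy`
(so `Φ = Ψ A_r` for real `k`); its block `++` extends to `im k ≤ 0`, its block `--` to
`0 ≤ im k`. -/
def transR (Q : ℝ → Matrix (Idx p m) (Idx p m) ℂ) (k : ℂ) : Matrix (Idx p m) (Idx p m) ℂ :=
  Matrix.of fun i j => (1 : Matrix (Idx p m) (Idx p m) ℂ) i j +
    ∫ y : ℝ, Complex.exp (-Complex.I * k * (y : ℂ) * ((sg i - sg j : ℝ) : ℂ)) *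
      (Q y * faddN Q y k) i j

/-- The scattering matrix: `Ξ⁻(x,k) = Ξ⁺(x,k) S(k)` for real `k`, read off at `x = 0`. -/
def scatS (Q : ℝ → Matrix (Idx p m) (Idx p m) ℂ) (k : ℝ) : Matrix (Idx p m) (Idx p m) ℂ :=
  (XiP Q 0 k)⁻¹ * XiM Q 0 k

/-- The scattering matrix: `Ξ⁺(x,k) = Ξ⁻(x,k) S̃(k)` for real `k`, read off at `x = 0`. -/
def scatSt (Q : ℝ → Matrix (Idx p m) (Idx p m) ℂ) (k : ℝ) : Matrix (Idx p m) (Idx p m) ℂ :=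
  (XiM Q 0 k)⁻¹ * XiP Q 0 k

def detLP (Q : ℝ → Matrix (Idx p m) (Idx p m) ℂ) (k : ℂ) : ℂ := (blkP (transL Q k)).det
def detLM (Q : ℝ → Matrix (Idx p m) (Idx p m) ℂ) (k : ℂ) : ℂ := (blkM (transL Q k)).det
def detRP (Q : ℝ → Matrix (Idx p m) (Idx p m) ℂ) (k : ℂ) : ℂ := (blkP (transR Q k)).det
def detRM (Q : ℝ → Matrix (Idx p m) (Idx p m) ℂ) (k : ℂ) : ℂ := (blkM (transR Q k)).det

/-- Absence of spectral singularities. -/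
def NoSpectralSingularities (Q : ℝ → Matrix (Idx p m) (Idx p m) ℂ) : Prop :=
  ∀ k : ℝ, detLP Q k ≠ 0 ∧ detRP Q k ≠ 0 ∧ detLM Q k ≠ 0 ∧ detRM Q k ≠ 0 ∧
    scatS Q k ze ze ≠ 0 ∧ scatSt Q k ze ze ≠ 0

/-- Discrete eigenvalues in the upper half-plane. -/
def eigUp (Q : ℝ → Matrix (Idx p m) (Idx p m) ℂ) : Set ℂ :=
  {k | 0 < k.im ∧ (detLP Q k = 0 ∨ detRM Q k = 0)}

/-- Discrete eigenvalues in the lower half-plane. -/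
def eigLo (Q : ℝ → Matrix (Idx p m) (Idx p m) ℂ) : Set ℂ :=
  {k | k.im < 0 ∧ (detRP Q k = 0 ∨ detLM Q k = 0)}

/-- The discrete eigenvalues are simple zeros of the determinants, and the zeros of the two
determinants that live in the same half-plane do not overlap. -/
structure SimpleNonoverlapping (Q : ℝ → Matrix (Idx p m) (Idx p m) ℂ) : Prop where
  simpleLP : ∀ k : ℂ, 0 < k.im → detLP Q k = 0 → deriv (detLP Q) k ≠ 0
  simpleRM : ∀ k : ℂ, 0 < k.im → detRM Q k = 0 → deriv (detRM Q) k ≠ 0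
  simpleRP : ∀ k : ℂ, k.im < 0 → detRP Q k = 0 → deriv (detRP Q) k ≠ 0
  simpleLM : ∀ k : ℂ, k.im < 0 → detLM Q k = 0 → deriv (detLM Q) k ≠ 0
  disjUp : ∀ k : ℂ, 0 < k.im → ¬ (detLP Q k = 0 ∧ detRM Q k = 0)
  disjLo : ∀ k : ℂ, k.im < 0 → ¬ (detRP Q k = 0 ∧ detLM Q k = 0)

/-- The curve `f`, closed up at infinity, winds `w` times around `0` as its parameter runs from
`-∞` to `+∞`. -/
def HasWindingNumber (f : ℝ → ℂ) (w : ℤ) : Prop :=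
  ∃ φ : ℝ → ℂ, Continuous φ ∧ (∀ t, Complex.exp (φ t) = f t) ∧
    ∃ a b : ℂ, Tendsto φ atBot (𝓝 a) ∧ Tendsto φ atTop (𝓝 b) ∧
      b - a = 2 * Real.pi * Complex.I * w

/-- `f = A⁺ A⁻` on the real line is the Wiener-Hopf factorization (with winding number zero). -/
structure IsWienerHopf (f : ℝ → ℂ) (A : (ℂ → ℂ) × (ℂ → ℂ)) : Prop where
  contP : ContinuousOn A.1 {k | 0 ≤ k.im}
  contM : ContinuousOn A.2 {k | k.im ≤ 0}
  analP : DifferentiableOn ℂ A.1 {k | 0 < k.im}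
  analM : DifferentiableOn ℂ A.2 {k | k.im < 0}
  nzP : ∀ k : ℂ, 0 ≤ k.im → A.1 k ≠ 0
  nzM : ∀ k : ℂ, k.im ≤ 0 → A.2 k ≠ 0
  limP : Tendsto A.1 (cocompact ℂ ⊓ 𝓟 {k | 0 ≤ k.im}) (𝓝 1)
  limM : Tendsto A.2 (cocompact ℂ ⊓ 𝓟 {k | k.im ≤ 0}) (𝓝 1)
  fact : ∀ k : ℝ, f k = A.1 k * A.2 k

/-- The pair of Wiener-Hopf factors of `f`. -/
def wienerHopf (f : ℝ → ℂ) : (ℂ → ℂ) × (ℂ → ℂ) := Classical.epsilon (IsWienerHopf f)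

/-- `𝔸_l⁺`, the plus factor of `S₀₀`. -/
def AlP (Q : ℝ → Matrix (Idx p m) (Idx p m) ℂ) : ℂ → ℂ :=
  (wienerHopf fun k => scatS Q k ze ze).1
/-- `𝔸_l⁻`, the minus factor of `S₀₀`. -/
def AlM (Q : ℝ → Matrix (Idx p m) (Idx p m) ℂ) : ℂ → ℂ :=
  (wienerHopf fun k => scatS Q k ze ze).2
/-- `𝔸_r⁺`, the plus factor of `S̃₀₀`. -/
def ArP (Q : ℝ → Matrix (Idx p m) (Idx p m) ℂ) : ℂ → ℂ :=
  (wienerHopf fun k => scatSt Q k ze ze).1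
/-- `𝔸_r⁻`, the minus factor of `S̃₀₀`. -/
def ArM (Q : ℝ → Matrix (Idx p m) (Idx p m) ℂ) : ℂ → ℂ :=
  (wienerHopf fun k => scatSt Q k ze ze).2

/-- Corrected transmission coefficients `T`. -/
def corrT (Q : ℝ → Matrix (Idx p m) (Idx p m) ℂ) (k : ℂ) : Matrix (Idx p m) (Idx p m) ℂ :=
  blockDiag (blkP (transL Q k))⁻¹ (AlP Q k) (blkM (transR Q k))⁻¹

/-- Corrected transmission coefficients `T̃`. -/
def corrTt (Q : ℝ → Matrix (Idx p m) (Idx p m) ℂ) (k : ℂ) : Matrix (Idx p m) (Idx p m) ℂ :=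
  blockDiag (blkP (transR Q k))⁻¹ (ArM Q k) (blkM (transL Q k))⁻¹

/-- Correction factor `C`. -/
def corrC (Q : ℝ → Matrix (Idx p m) (Idx p m) ℂ) (k : ℂ) : Matrix (Idx p m) (Idx p m) ℂ :=
  blockDiag 1 (AlM Q k) 1

/-- Correction factor `C̃`. -/
def corrCt (Q : ℝ → Matrix (Idx p m) (Idx p m) ℂ) (k : ℂ) : Matrix (Idx p m) (Idx p m) ℂ :=
  blockDiag 1 (ArP Q k) 1

/-- Corrected reflection coefficients `R`, from `S = (T - C̃⁻¹ R) C`. -/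
def corrR (Q : ℝ → Matrix (Idx p m) (Idx p m) ℂ) (k : ℝ) : Matrix (Idx p m) (Idx p m) ℂ :=
  corrCt Q k * (corrT Q k - scatS Q k * (corrC Q k)⁻¹)

/-- Corrected reflection coefficients `R̃`, from `S̃ = (T̃ - C⁻¹ R̃) C̃`. -/
def corrRt (Q : ℝ → Matrix (Idx p m) (Idx p m) ℂ) (k : ℝ) : Matrix (Idx p m) (Idx p m) ℂ :=
  corrC Q k * (corrTt Q k - scatSt Q k * (corrCt Q k)⁻¹)

/-- `N` is a norming constant at the pole `kj` of `T` in the upper half-plane: it is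
off-block-diagonal and `Ξ⁺(x,kj) τ = i Ξ⁺(x,kj) C̃(kj)⁻¹ N` with `τ` the residue of `T` at `kj`. -/
def IsNormingUp (Q : ℝ → Matrix (Idx p m) (Idx p m) ℂ) (kj : ℂ)
    (N : Matrix (Idx p m) (Idx p m) ℂ) : Prop :=
  OffBlock N ∧ ∃ τ : Matrix (Idx p m) (Idx p m) ℂ,
    Tendsto (fun k : ℂ => (k - kj) • corrT Q k) (𝓝[≠] kj) (𝓝 τ) ∧
    ∀ x : ℝ, XiP Q x kj * τ = Complex.I • (XiP Q x kj * (corrCt Q kj)⁻¹ * N)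

/-- `N` is a norming constant at the pole `kj` of `T̃` in the lower half-plane: it is
off-block-diagonal and `Ξ⁻(x,kj) τ = -i Ξ⁻(x,kj) C(kj)⁻¹ N` with `τ` the residue of `T̃` at `kj`. -/
def IsNormingLo (Q : ℝ → Matrix (Idx p m) (Idx p m) ℂ) (kj : ℂ)
    (N : Matrix (Idx p m) (Idx p m) ℂ) : Prop :=
  OffBlock N ∧ ∃ τ : Matrix (Idx p m) (Idx p m) ℂ,
    Tendsto (fun k : ℂ => (k - kj) • corrTt Q k) (𝓝[≠] kj) (𝓝 τ) ∧
    ∀ x : ℝ, XiM Q x kj * τ = -Complex.I • (XiM Q x kj * (corrC Q kj)⁻¹ * N)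

/-- The data entering the Marchenko kernels: the norming constants `N`, `Nt` (as functions of the
discrete eigenvalue) and the `L¹` Fourier transforms `Rh`, `Rht` of the corrected reflection
coefficients, `R(k) = ∫ e^{-ikγ} Rh(γ) dγ` and `R̃(k) = ∫ e^{ikγ} Rht(γ) dγ`. -/
structure IsScatteringData (Q : ℝ → Matrix (Idx p m) (Idx p m) ℂ)
    (N Nt : ℂ → Matrix (Idx p m) (Idx p m) ℂ)
    (Rh Rht : ℝ → Matrix (Idx p m) (Idx p m) ℂ) : Prop where
  normUp : ∀ k ∈ eigUp Q, IsNormingUp Q k (N k)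
  normLo : ∀ k ∈ eigLo Q, IsNormingLo Q k (Nt k)
  offR : ∀ γ, OffBlock (Rh γ)
  offRt : ∀ γ, OffBlock (Rht γ)
  intR : ∀ i j, Integrable (fun γ => Rh γ i j) volume
  intRt : ∀ i j, Integrable (fun γ => Rht γ i j) volume
  fourR : ∀ (k : ℝ) (i j), corrR Q k i j = ∫ γ : ℝ, Complex.exp (-Complex.I * k * γ) * Rh γ i j
  fourRt : ∀ (k : ℝ) (i j), corrRt Q k i j = ∫ γ : ℝ, Complex.exp (Complex.I * k * γ) * Rht γ i j

/-- The Marchenko kernel `ω⁺(γ;x)`. -/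
def omegaP (Q : ℝ → Matrix (Idx p m) (Idx p m) ℂ) (N : ℂ → Matrix (Idx p m) (Idx p m) ℂ)
    (Rh : ℝ → Matrix (Idx p m) (Idx p m) ℂ) (x γ : ℝ) : Matrix (Idx p m) (Idx p m) ℂ :=
  Matrix.of fun i j =>
    (∑ᶠ k ∈ eigUp Q, Complex.exp (Complex.I * k * ((γ + (sg i - sg j) * x : ℝ) : ℂ)) * N k i j) +
      Rh (γ + (sg i - sg j) * x) i j

/-- The Marchenko kernel `ω⁻(γ;x)`. -/
def omegaM (Q : ℝ → Matrix (Idx p m) (Idx p m) ℂ) (Nt : ℂ → Matrix (Idx p m) (Idx p m) ℂ)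
    (Rht : ℝ → Matrix (Idx p m) (Idx p m) ℂ) (x γ : ℝ) : Matrix (Idx p m) (Idx p m) ℂ :=
  Matrix.of fun i j =>
    (∑ᶠ k ∈ eigLo Q, Complex.exp (-Complex.I * k * ((γ + (sg j - sg i) * x : ℝ) : ℂ)) * Nt k i j) +
      Rht (γ + (sg j - sg i) * x) i j

/-- The kernels `𝕂⁺(x,y)` (for `y > x`) and `𝕂⁻(x,y)` (for `y < x`), determined for almost every
`y` by the triangular representations
`Ξ⁺ C̃⁻¹ = [I + ∫₀^∞ e^{ikγ} 𝕂⁺(x,x+γ) dγ] e^{ikxΣ}` for `0 ≤ im k` and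
`Ξ⁻ C⁻¹ = [I + ∫₀^∞ e^{-ikγ} 𝕂⁻(x,x-γ) dγ] e^{ikxΣ}` for `im k ≤ 0`. -/
structure IsKernelPair (Q : ℝ → Matrix (Idx p m) (Idx p m) ℂ)
    (KP KM : ℝ → ℝ → Matrix (Idx p m) (Idx p m) ℂ) : Prop where
  intP : ∀ x i j, IntegrableOn (fun γ => KP x (x + γ) i j) (Ioi 0) volume
  intM : ∀ x i j, IntegrableOn (fun γ => KM x (x - γ) i j) (Ioi 0) volume
  repP : ∀ (x : ℝ) (k : ℂ), 0 ≤ k.im → XiP Q x k * (corrCt Q k)⁻¹ =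
    (1 + Matrix.of fun i j => ∫ γ in Ioi (0 : ℝ),
      Complex.exp (Complex.I * k * γ) * KP x (x + γ) i j) * expS k x
  repM : ∀ (x : ℝ) (k : ℂ), k.im ≤ 0 → XiM Q x k * (corrC Q k)⁻¹ =
    (1 + Matrix.of fun i j => ∫ γ in Ioi (0 : ℝ),
      Complex.exp (-Complex.I * k * γ) * KM x (x - γ) i j) * expS k x

/-! ### Values on the diagonal -/

/-- The mean value of `g` over `(0, ε)`. -/
def mean (g : ℝ → ℂ) (ε : ℝ) : ℂ := (ε : ℂ)⁻¹ * ∫ γ in (0 : ℝ)..ε, g γ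

/-- The locally integrable function `g` on `(0, ∞)` has the (one-sided Lebesgue) value `v` at `0`.
This does not depend on the choice of `g` in its class modulo null sets. -/
def HasValueAtZero (g : ℝ → ℂ) (v : ℂ) : Prop := Tendsto (mean g) (𝓝[>] 0) (𝓝 v)

/-- `𝕂⁺(x,x)`. -/
def diagP (KP : ℝ → ℝ → Matrix (Idx p m) (Idx p m) ℂ) (x : ℝ) : Matrix (Idx p m) (Idx p m) ℂ :=
  Matrix.of fun i j => limUnder (𝓝[>] 0) (mean fun γ => KP x (x + γ) i j)

/-- `𝕂⁻(x,x)`. -/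
def diagM (KM : ℝ → ℝ → Matrix (Idx p m) (Idx p m) ℂ) (x : ℝ) : Matrix (Idx p m) (Idx p m) ℂ :=
  Matrix.of fun i j => limUnder (𝓝[>] 0) (mean fun γ => KM x (x - γ) i j)

/-- The potential computed from the diagonal values `E(x) = 𝕂⁺(x,x)` or `E(x) = -𝕂⁻(x,x)`. -/
def reconstruct (E : ℝ → Matrix (Idx p m) (Idx p m) ℂ) (x : ℝ) : Matrix (Idx p m) (Idx p m) ℂ :=
  Matrix.of fun i j =>
    match i, j with
    | Sum.inr (Sum.inl _), Sum.inl b => -E x ze (pl b)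
    | Sum.inr (Sum.inl _), Sum.inr (Sum.inr b) => E x ze (mi b)
    | Sum.inl a, Sum.inr (Sum.inr b) => 2 * E x (pl a) (mi b)
    | Sum.inr (Sum.inr a), Sum.inl b => -2 * E x (mi a) (pl b)
    | Sum.inl a, Sum.inr (Sum.inl _) =>
        (∑ b, (deriv (fun t => E t (pl a) (pl b)) x
          - 2 * ∑ c, E x (pl a) (mi c) * E x (mi c) (pl b)) * star (E x ze (pl b))) /
        ∑ b : Fin p, ((‖E x ze (pl b)‖ ^ 2 : ℝ) : ℂ)
    | Sum.inr (Sum.inr a), Sum.inr (Sum.inl _) =>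
        (∑ b, (deriv (fun t => E t (mi a) (mi b)) x
          + 2 * ∑ c, E x (mi a) (pl c) * E x (pl c) (mi b)) * star (E x ze (mi b))) /
        ∑ b : Fin m, ((‖E x ze (mi b)‖ ^ 2 : ℝ) : ℂ)
    | _, _ => 0

/-- `Q` is `σ`-focusing, with `σ` hermitian, unitary and commuting or anticommuting
with `diag (I_p, 0, -I_m)`. -/
structure IsFocusing (σ : Matrix (Idx p m) (Idx p m) ℂ)
    (Q : ℝ → Matrix (Idx p m) (Idx p m) ℂ) : Prop where
  herm : σ.IsHermitian
  unit : σ * σ = 1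
  comm : (∀ i j, ((sg i : ℝ) : ℂ) * σ i j = σ i j * ((sg j : ℝ) : ℂ)) ∨
    (∀ i j, ((sg i : ℝ) : ℂ) * σ i j = -(σ i j * ((sg j : ℝ) : ℂ)))
  foc : ∀ᵐ x : ℝ, (Q x).conjTranspose = -(σ * Q x * σ)

/-- The entries of the second column of a `σ`-focusing potential from `E(x) = 𝕂⁺(x,x)` or
`E(x) = -𝕂⁻(x,x)`. -/
def focusColumn (σ : Matrix (Idx p m) (Idx p m) ℂ) (E : Matrix (Idx p m) (Idx p m) ℂ)
    (l : Idx p m) : ℂ :=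
  ∑ i, ((sg i : ℝ) : ℂ) * σ l i * star (E ze i) * σ ze ze

/-- `q₊₀ q₀₊ + ½ q₊₋ q₋₊`. -/
def prodP (Q : ℝ → Matrix (Idx p m) (Idx p m) ℂ) (z : ℝ) (a b : Fin p) : ℂ :=
  Q z (pl a) ze * Q z ze (pl b) + (1 / 2) * ∑ c : Fin m, Q z (pl a) (mi c) * Q z (mi c) (pl b)

/-- `½ q₋₊ q₊₋ + q₋₀ q₀₋`. -/
def prodM (Q : ℝ → Matrix (Idx p m) (Idx p m) ℂ) (z : ℝ) (a b : Fin m) : ℂ :=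
  (1 / 2) * (∑ c : Fin p, Q z (mi a) (pl c) * Q z (pl c) (mi b)) + Q z (mi a) ze * Q z ze (mi b)

end AKNS

end

open AKNS

noncomputable section

namespace AKNS

/-! ### Gluing across the real line -/

section Liouville
open Complex

lemma rect_integral_eq_zero_of_half {h : ℂ → ℂ} (hc : Continuous h)
    (hu : DifferentiableOn ℂ h {k | 0 < k.im}) (hl : DifferentiableOn ℂ h {k | k.im < 0})
    (a b c d : ℝ) (h0 : (0 ≤ c ∧ 0 ≤ d) ∨ (c ≤ 0 ∧ d ≤ 0)) :
    (∫ x : ℝ in a..b, h (x + c * I)) - (∫ x : ℝ in a..b, h (x + d * I)) +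
      I • (∫ y : ℝ in c..d, h (b + y * I)) - I • (∫ y : ℝ in c..d, h (a + y * I)) = 0 := by
  have := integral_boundary_rect_eq_zero_of_continuousOn_of_differentiableOn h ⟨a, c⟩ ⟨b, d⟩
    hc.continuousOn
  simp only at this
  apply this
  rcases h0 with h0 | h0
  · refine hu.mono fun z hz => ?_
    have := (mem_reProdIm.1 hz).2
    simp only [mem_Ioo, mem_ofPred_eq] at this ⊢
    exact lt_of_le_of_lt (le_min h0.1 h0.2) this.1
  · refine hl.mono fun z hz => ?_
    have := (mem_reProdIm.1 hz).2
    simp only [mem_Ioo, mem_ofPred_eq] at this ⊢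
    exact lt_of_lt_of_le this.2 (max_le h0.1 h0.2)

/-- A continuous function on `ℂ` that is holomorphic off the real line is entire. -/
lemma differentiable_of_off_real {h : ℂ → ℂ} (hc : Continuous h)
    (hu : DifferentiableOn ℂ h {k | 0 < k.im}) (hl : DifferentiableOn ℂ h {k | k.im < 0}) :
    Differentiable ℂ h := by
  have hcons : IsConservativeOn h univ := by
    intro z w _
    rw [← add_eq_zero_iff_eq_neg, wedgeIntegral_add_wedgeIntegral_eq]
    have h1 := rect_integral_eq_zero_of_half hc hu hl z.re w.re z.im 0
      (by rcases le_total 0 z.im with h | h <;> simp [h])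
    have h2 := rect_integral_eq_zero_of_half hc hu hl z.re w.re 0 w.im
      (by rcases le_total 0 w.im with h | h <;> simp [h])
    have i1 : ∀ r : ℝ, ∀ s t : ℝ, IntervalIntegrable (fun y : ℝ => h (r + y * I)) volume s t :=
      fun r s t => (hc.comp (by fun_prop)).intervalIntegrable _ _
    have e1 := intervalIntegral.integral_add_adjacent_intervals (i1 w.re z.im 0) (i1 w.re 0 w.im)
    have e2 := intervalIntegral.integral_add_adjacent_intervals (i1 z.re z.im 0) (i1 z.re 0 w.im)
    rw [← e1, ← e2]
    simp only [smul_eq_mul] at *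
    linear_combination h1 + h2
  have := (isConservativeOn_and_continuousOn_iff_isDifferentiableOn isOpen_univ).1
    ⟨hcons, hc.continuousOn⟩
  exact differentiableOn_univ.1 this

lemma eq_const_of_off_real {h : ℂ → ℂ} {c : ℂ} (hc : Continuous h)
    (hu : DifferentiableOn ℂ h {k | 0 < k.im}) (hl : DifferentiableOn ℂ h {k | k.im < 0})
    (hlim : Tendsto h (cocompact ℂ) (𝓝 c)) (z : ℂ) : h z = c :=
  (differentiable_of_off_real hc hu hl).apply_eq_of_tendsto_cocompact z hlim

/-- Two functions on the closed half-planes that agree on the real line and tend to the same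
limit at infinity are constant. -/
lemma eq_const_of_glue {f g : ℂ → ℂ} {c : ℂ}
    (hf : ContinuousOn f {k | 0 ≤ k.im}) (hg : ContinuousOn g {k | k.im ≤ 0})
    (hf' : DifferentiableOn ℂ f {k | 0 < k.im}) (hg' : DifferentiableOn ℂ g {k | k.im < 0})
    (lf : Tendsto f (cocompact ℂ ⊓ 𝓟 {k | 0 ≤ k.im}) (𝓝 c))
    (lg : Tendsto g (cocompact ℂ ⊓ 𝓟 {k | k.im ≤ 0}) (𝓝 c))
    (hfg : ∀ k : ℝ, f k = g k) :
    (∀ k : ℂ, 0 ≤ k.im → f k = c) ∧ ∀ k : ℂ, k.im ≤ 0 → g k = c := by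
  classical
  have hr : ∀ k : ℂ, k.im = 0 → f k = g k := by
    intro k hk
    have : k = (k.re : ℂ) := Complex.ext rfl (by simp [hk])
    rw [this, hfg]
  set h : ℂ → ℂ := fun k => if 0 ≤ k.im then f k else g k with hh
  have e1 : ∀ k : ℂ, 0 ≤ k.im → h k = f k := fun k hk => by simp [hh, hk]
  have e2 : ∀ k : ℂ, k.im ≤ 0 → h k = g k := fun k hk => by
    rcases hk.lt_or_eq with hk' | hk'
    · simp [hh, not_le.2 hk']
    · simp [hh, hk', hr k hk']
  have hc : Continuous h := by
    rw [← continuousOn_univ]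
    have : (univ : Set ℂ) = {k | 0 ≤ k.im} ∪ {k | k.im ≤ 0} := by
      ext k; simpa using le_total 0 k.im
    rw [this]
    exact (hf.congr e1).union_of_isClosed (hg.congr e2)
      (isClosed_le continuous_const continuous_im) (isClosed_le continuous_im continuous_const)
  have lim : Tendsto h (cocompact ℂ) (𝓝 c) := by
    have : cocompact ℂ = (cocompact ℂ ⊓ 𝓟 {k | 0 ≤ k.im}) ⊔ (cocompact ℂ ⊓ 𝓟 {k | k.im ≤ 0}) := by
      rw [← inf_sup_left, sup_principal]
      have : {k : ℂ | 0 ≤ k.im} ∪ {k | k.im ≤ 0} = univ := by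
        ext k; simpa using le_total 0 k.im
      rw [this]; simp
    rw [this]
    refine Tendsto.sup (lf.congr' ?_) (lg.congr' ?_)
    · filter_upwards [mem_inf_of_right (mem_principal_self _)] with k hk using (e1 k hk).symm
    · filter_upwards [mem_inf_of_right (mem_principal_self _)] with k hk using (e2 k hk).symm
  have key := eq_const_of_off_real hc (hf'.congr fun k hk => e1 k (le_of_lt hk))
    (hg'.congr fun k hk => e2 k (le_of_lt hk)) lim
  exact ⟨fun k hk => by rw [← e1 k hk, key], fun k hk => by rw [← e2 k hk, key]⟩

end Liouville

/-! ### The Fourier-Laplace transform of integrable functions -/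

/-- `∫ e^{ikγ} u(γ) dγ`. -/
def ft (u : ℝ → ℂ) (k : ℂ) : ℂ := ∫ γ : ℝ, Complex.exp (Complex.I * k * γ) * u γ

lemma norm_cexp_I (k : ℂ) (γ : ℝ) :
    ‖Complex.exp (Complex.I * k * γ)‖ = Real.exp (-(k.im * γ)) := by
  rw [Complex.norm_exp]; simp

lemma norm_cexp_I_real (k γ : ℝ) : ‖Complex.exp (Complex.I * k * γ)‖ = 1 := by
  rw [norm_cexp_I]; simp

lemma continuous_cexp_I (k : ℂ) : Continuous fun γ : ℝ => Complex.exp (Complex.I * k * γ) := by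
  fun_prop

/-- A support set `s`, closed under addition, and a set `D` of spectral parameters for which
`e^{ikγ}` is bounded by `1` on `s`. -/
structure Dom where
  s : Set ℝ
  D : Set ℂ
  add : ∀ a ∈ s, ∀ b ∈ s, a + b ∈ s
  im : ∀ k ∈ D, ∀ a ∈ s, 0 ≤ k.im * a

/-- All of `ℝ`, with real spectral parameters. -/
def Dom.R : Dom := ⟨univ, {k | k.im = 0}, by simp, by
  intro k hk a _; have : k.im = 0 := hk; simp [this]⟩
/-- The positive half-line, with the closed upper half-plane. -/
def Dom.P : Dom := ⟨Ioi 0, {k | 0 ≤ k.im}, by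
  intro a ha b hb; simp only [mem_Ioi] at *; linarith, by
  intro k hk a ha; exact mul_nonneg hk (le_of_lt ha)⟩
/-- The negative half-line, with the closed lower half-plane. -/
def Dom.M : Dom := ⟨Iio 0, {k | k.im ≤ 0}, by
  intro a ha b hb; simp only [mem_Iio] at *; linarith, by
  intro k hk a ha; exact mul_nonneg_of_nonpos_of_nonpos hk (le_of_lt ha)⟩

/-- Integrable functions that vanish off `d.s`. -/
structure Dom.L1 (d : Dom) (u : ℝ → ℂ) : Prop where
  int : Integrable u
  supp : ∀ γ ∉ d.s, u γ = 0

variable {d : Dom} {u v : ℝ → ℂ} {k : ℂ}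

lemma Dom.L1.norm_le (hu : d.L1 u) (hk : k ∈ d.D) (γ : ℝ) :
    ‖Complex.exp (Complex.I * k * γ) * u γ‖ ≤ ‖u γ‖ := by
  by_cases hγ : γ ∈ d.s
  · rw [norm_mul, norm_cexp_I]
    have : Real.exp (-(k.im * γ)) ≤ 1 := by
      rw [Real.exp_le_one_iff]; linarith [d.im k hk γ hγ]
    exact mul_le_of_le_one_left (norm_nonneg _) this
  · simp [hu.supp γ hγ]

lemma Dom.L1.integrable_exp (hu : d.L1 u) (hk : k ∈ d.D) :
    Integrable fun γ : ℝ => Complex.exp (Complex.I * k * γ) * u γ :=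
  hu.int.mono ((continuous_cexp_I k).aestronglyMeasurable.mul hu.int.1)
    (.of_forall fun γ => hu.norm_le hk γ)

lemma Dom.L1.norm_ft_le (hu : d.L1 u) (hk : k ∈ d.D) : ‖ft u k‖ ≤ ∫ γ, ‖u γ‖ :=
  norm_integral_le_of_norm_le hu.int.norm (.of_forall fun γ => hu.norm_le hk γ)

lemma Dom.L1.add (hu : d.L1 u) (hv : d.L1 v) : d.L1 (fun γ => u γ + v γ) :=
  ⟨hu.int.add hv.int, fun γ h => by simp [hu.supp γ h, hv.supp γ h]⟩

lemma Dom.L1.const_mul (hu : d.L1 u) (c : ℂ) : d.L1 (fun γ => c * u γ) :=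
  ⟨hu.int.const_mul c, fun γ h => by simp [hu.supp γ h]⟩

lemma Dom.L1.zero : d.L1 (fun _ => 0) := ⟨integrable_zero _ _ _, fun _ _ => rfl⟩

lemma ft_add (hu : d.L1 u) (hv : d.L1 v) (hk : k ∈ d.D) :
    ft (fun γ => u γ + v γ) k = ft u k + ft v k := by
  simp only [ft, mul_add]
  exact integral_add (hu.integrable_exp hk) (hv.integrable_exp hk)

lemma ft_const_mul (c : ℂ) : ft (fun γ => c * u γ) k = c * ft u k := by
  simp only [ft]
  rw [← integral_const_mul]
  congr 1; ext γ; ring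

lemma ft_zero : ft (fun _ => 0) k = 0 := by simp [ft]

open scoped Convolution

/-- Convolution of complex functions on the line. -/
def cv (u v : ℝ → ℂ) : ℝ → ℂ := u ⋆[ContinuousLinearMap.mul ℂ ℂ, volume] v

lemma cv_apply (u v : ℝ → ℂ) (γ : ℝ) : cv u v γ = ∫ t, u t * v (γ - t) := rfl

lemma Dom.L1.cv (hu : d.L1 u) (hv : d.L1 v) : d.L1 (cv u v) := by
  refine ⟨hu.int.integrable_convolution _ hv.int, fun γ h => ?_⟩
  rw [cv_apply]
  rw [integral_eq_zero_of_ae]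
  refine .of_forall fun t => ?_
  by_cases h1 : t ∈ d.s
  · by_cases h2 : γ - t ∈ d.s
    · exact absurd (by simpa using d.add _ h1 _ h2) h
    · simp [hv.supp _ h2]
  · simp [hu.supp _ h1]

lemma ft_cv (hu : d.L1 u) (hv : d.L1 v) (hk : k ∈ d.D) : ft (cv u v) k = ft u k * ft v k := by
  have := integral_convolution (ContinuousLinearMap.mul ℂ ℂ) (μ := volume) (ν := volume)
    (hu.integrable_exp hk) (hv.integrable_exp hk)
  simp only [ContinuousLinearMap.mul_apply'] at this
  rw [ft, ft, ft, ← this]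
  congr 1; ext γ
  change _ = ∫ t, _
  rw [cv_apply, ← integral_const_mul]
  congr 1; ext t
  simp only [ContinuousLinearMap.mul_apply']
  have : Complex.exp (Complex.I * k * γ) =
      Complex.exp (Complex.I * k * t) * Complex.exp (Complex.I * k * ((γ - t : ℝ) : ℂ)) := by
    rw [← Complex.exp_add]; congr 1; push_cast; ring
  rw [this]; ring

lemma integral_norm_cv_le (hu : Integrable u) (hv : Integrable v) :
    ∫ γ, ‖cv u v γ‖ ≤ (∫ γ, ‖u γ‖) * ∫ γ, ‖v γ‖ := by
  have h1 := integral_convolution (ContinuousLinearMap.mul ℝ ℝ) (μ := volume) (ν := volume)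
    hu.norm hv.norm
  simp only [ContinuousLinearMap.mul_apply'] at h1
  rw [← h1]
  refine integral_mono (hu.integrable_convolution _ hv).norm
    (hu.norm.integrable_convolution _ hv.norm) fun γ => ?_
  refine (norm_integral_le_integral_norm _).trans (le_of_eq ?_)
  change _ = ∫ t, _
  congr 1; ext t; simp

/-! ### Injectivity -/

lemma ft_two_pi (u : ℝ → ℂ) (ξ : ℝ) :
    FourierTransform.fourier u ξ = ft u ((-(2 * Real.pi * ξ) : ℝ) : ℂ) := by
  rw [Real.fourier_eq', ft]
  congr 1; ext γ
  rw [smul_eq_mul]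
  congr 2
  push_cast
  simp
  ring

lemma ae_eq_zero_of_ft_eq_zero (hu : Integrable u) (h : ∀ k : ℝ, ft u k = 0) : u =ᵐ[volume] 0 := by
  have h0 : FourierTransform.fourier u = 0 := by
    ext ξ; rw [ft_two_pi, h]; rfl
  refine ae_eq_zero_of_integral_contDiff_smul_eq_zero hu.locallyIntegrable fun g hg hgc => ?_
  have hG : ContDiff ℝ (⊤ : ℕ∞) (fun x => (g x : ℂ)) := by
    exact (Complex.ofRealCLM.contDiff).comp hg
  let φ : SchwartzMap ℝ ℂ := HasCompactSupport.toSchwartzMap (f := fun x => (g x : ℂ))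
    (hgc.comp_left (g := fun x : ℝ => (x : ℂ)) (by simp)) hG
  let ψ : SchwartzMap ℝ ℂ := FourierTransform.fourierInv φ
  have hψ : FourierTransform.fourier (ψ : ℝ → ℂ) = φ := by
    have : FourierTransform.fourier ψ = φ := by simp [ψ]
    rw [← this]; exact (SchwartzMap.fourier_coe ψ)
  have key := VectorFourier.integral_fourierIntegral_smul_eq_flip (L := innerₗ ℝ)
    (e := Real.fourierChar) (μ := volume) (ν := volume) (f := (ψ : ℝ → ℂ)) (g := u)
    Real.continuous_fourierChar continuous_inner ψ.integrable hu
  have e1 : VectorFourier.fourierIntegral Real.fourierChar volume (innerₗ ℝ) (ψ : ℝ → ℂ) = φ := hψ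
  have e2 : VectorFourier.fourierIntegral Real.fourierChar volume (innerₗ ℝ).flip u = 0 := by
    rw [flip_innerₗ]; exact h0
  rw [e1, e2] at key
  simp only [Pi.zero_apply, smul_zero, integral_zero] at key
  rw [← key]
  congr 1

lemma ae_eq_of_ft_eq (hu : Integrable u) (hv : Integrable v) (h : ∀ k : ℝ, ft u k = ft v k) :
    u =ᵐ[volume] v := by
  have h1 : Dom.R.L1 u := ⟨hu, by simp [Dom.R]⟩
  have h2 : Dom.R.L1 v := ⟨hv, by simp [Dom.R]⟩
  have := ae_eq_zero_of_ft_eq_zero (u := fun γ => u γ + (-1) * v γ)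
    (hu.add (hv.const_mul _)) fun k => by
      rw [ft_add h1 (h2.const_mul _) (by simp [Dom.R]), ft_const_mul, h]; ring
  filter_upwards [this] with γ hγ
  have : u γ + (-1) * v γ = 0 := hγ
  linear_combination this

end AKNS

namespace AKNS

variable {d : Dom} {u v : ℝ → ℂ} {k : ℂ}

lemma exists_smooth_approx (hu : Integrable u) {ε : ℝ} (hε : 0 < ε) :
    ∃ g : ℝ → ℂ, HasCompactSupport g ∧ ContDiff ℝ (⊤ : ℕ∞) g ∧ ∫ γ, ‖u γ - g γ‖ ≤ ε := by
  obtain ⟨g, h1, h2, h3⟩ := MemLp.exist_eLpNorm_sub_le (p := 1) (by simp) le_rfl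
    (memLp_one_iff_integrable.2 hu) hε
  refine ⟨g, h1, h2, ?_⟩
  have hg : Integrable g := h2.continuous.integrable_of_hasCompactSupport h1
  change ∫ γ, ‖(u - g) γ‖ ≤ ε
  rw [integral_norm_eq_lintegral_enorm (hu.sub hg).1]
  rw [eLpNorm_one_eq_lintegral_enorm] at h3
  exact ENNReal.toReal_le_of_le_ofReal hε.le h3

lemma Dom.L1.continuousOn_ft (hu : d.L1 u) : ContinuousOn (ft u) d.D := by
  intro k hk
  refine tendsto_integral_filter_of_dominated_convergence (fun γ => ‖u γ‖) ?_ ?_ hu.int.norm ?_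
  · exact .of_forall fun k => (continuous_cexp_I k).aestronglyMeasurable.mul hu.int.1
  · filter_upwards [self_mem_nhdsWithin] with k' hk'
    exact .of_forall fun γ => hu.norm_le hk' γ
  · refine .of_forall fun γ => ?_
    refine Tendsto.mono_left ?_ nhdsWithin_le_nhds
    exact Continuous.tendsto (by fun_prop) k

lemma tendsto_ft_real (u : ℝ → ℂ) : Tendsto (fun k : ℝ => ft u k) (cocompact ℝ) (𝓝 0) := by
  have h := Real.zero_at_infty_fourier u
  have hm : Tendsto (fun k : ℝ => k * (-(2 * Real.pi))⁻¹) (cocompact ℝ) (cocompact ℝ) :=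
    (Homeomorph.mulRight₀ ((-(2 * Real.pi))⁻¹ : ℝ)
      (by simp [Real.pi_ne_zero])).isClosedEmbedding.tendsto_cocompact
  refine (h.comp hm).congr fun k => ?_
  simp only [Function.comp]
  rw [ft_two_pi]
  congr 2
  have := Real.pi_ne_zero
  field_simp

lemma ft_eq_of_deriv {g : ℝ → ℂ} (hg : HasCompactSupport g) (hg' : ContDiff ℝ (⊤ : ℕ∞) g)
    (hk : 0 ≤ k.im) (hk0 : k ≠ 0) :
    ‖ft ((Ioi (0:ℝ)).indicator g) k‖ ≤ (‖g 0‖ + ∫ γ, ‖deriv g γ‖) / ‖k‖ := by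
  have hd : ∀ x, HasDerivAt g (deriv g x) x := fun x =>
    (hg'.differentiable (by simp) x).hasDerivAt
  have hcd : Continuous (deriv g) := hg'.continuous_deriv (by simp)
  have ig : Integrable g := hg'.continuous.integrable_of_hasCompactSupport hg
  have ig' : Integrable (deriv g) := hcd.integrable_of_hasCompactSupport hg.deriv
  have e1 : ∀ w : ℝ → ℂ, ft ((Ioi (0:ℝ)).indicator w) k =
      ∫ γ in Ioi (0:ℝ), Complex.exp (Complex.I * k * γ) * w γ := by
    intro w
    rw [ft, ← integral_indicator measurableSet_Ioi]
    congr 1; ext γ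
    by_cases h : γ ∈ Ioi (0:ℝ) <;> simp [h]
  have L : ∀ w : ℝ → ℂ, Integrable w → Dom.P.L1 ((Ioi (0:ℝ)).indicator w) := fun w hw =>
    ⟨hw.indicator measurableSet_Ioi, fun γ h => indicator_of_notMem h _⟩
  have I : ∀ w : ℝ → ℂ, Integrable w →
      IntegrableOn (fun γ : ℝ => Complex.exp (Complex.I * k * γ) * w γ) (Ioi 0) := by
    intro w hw
    have := (L w hw).integrable_exp (k := k) hk
    rw [← integrable_indicator_iff measurableSet_Ioi]
    refine this.congr (.of_forall fun γ => ?_)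
    by_cases h : γ ∈ Ioi (0:ℝ) <;> simp [h]
  have h1 := integral_Ioi_of_hasDerivAt_of_tendsto' (a := 0) (m := 0)
    (f := fun γ : ℝ => Complex.exp (Complex.I * k * γ) * g γ)
    (f' := fun γ : ℝ => (Complex.I * k) * (Complex.exp (Complex.I * k * γ) * g γ) +
      Complex.exp (Complex.I * k * γ) * deriv g γ) ?_ ?_ ?_
  · rw [integral_add ((I g ig).const_mul _) (I _ ig'), integral_const_mul, ← e1 g, ← e1] at h1
    have h2 : ft ((Ioi (0:ℝ)).indicator g) k =
        -(g 0 + ft ((Ioi (0:ℝ)).indicator (deriv g)) k) / (Complex.I * k) := by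
      rw [eq_div_iff (by simp [hk0])]
      simp only [Complex.ofReal_zero, mul_zero, Complex.exp_zero, one_mul] at h1
      linear_combination h1
    rw [h2, norm_div, norm_neg]
    simp only [Complex.norm_mul, Complex.norm_I, one_mul]
    gcongr
    refine (norm_add_le _ _).trans ?_
    gcongr
    refine ((L _ ig').norm_ft_le (k := k) hk).trans (integral_mono (L _ ig').int.norm ig'.norm ?_)
    intro γ
    exact norm_indicator_le_norm_self _ _
  · intro x _
    have := ((((hasDerivAt_id (x : ℂ)).const_mul (Complex.I * k)).cexp).comp_ofReal).mul (hd x)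
    refine HasDerivAt.congr_deriv this ?_
    simp only [id]; ring
  · exact ((I g ig).const_mul _).add (I _ ig')
  · refine tendsto_const_nhds.congr' ?_
    have := hg.isCompact.bddAbove
    obtain ⟨B, hB⟩ := this
    filter_upwards [eventually_gt_atTop B] with x hx
    have : g x = 0 := by
      by_contra h
      exact absurd (hB (subset_tsupport g h)) (not_le.2 hx)
    simp [this]

lemma tendsto_ft_P (hu : Dom.P.L1 u) :
    Tendsto (ft u) (cocompact ℂ ⊓ 𝓟 {k | 0 ≤ k.im}) (𝓝 0) := by
  rw [Metric.tendsto_nhds]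
  intro ε hε
  obtain ⟨g, h1, h2, h3⟩ := exists_smooth_approx hu.int (half_pos (half_pos hε))
  set C := ‖g 0‖ + ∫ γ, ‖deriv g γ‖
  have ig : Integrable g := h2.continuous.integrable_of_hasCompactSupport h1
  have hw : Dom.P.L1 ((Ioi (0:ℝ)).indicator g) :=
    ⟨ig.indicator measurableSet_Ioi, fun γ h => indicator_of_notMem h _⟩
  have hbig : ∀ᶠ k in cocompact ℂ, C / (ε / 2) + 1 ≤ ‖k‖ :=
    tendsto_norm_cocompact_atTop.eventually (eventually_ge_atTop _)
  filter_upwards [mem_inf_of_left hbig, mem_inf_of_right (mem_principal_self _)] with k hk hk'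
  have hC : 0 ≤ C := by positivity
  have hk0 : 0 < ‖k‖ := lt_of_lt_of_le (by positivity) hk
  have e : ft u k = ft (fun γ => u γ + (-1) * (Ioi (0:ℝ)).indicator g γ) k +
      ft ((Ioi (0:ℝ)).indicator g) k := by
    rw [ft_add hu (hw.const_mul _) (show k ∈ Dom.P.D from hk'), ft_const_mul]; ring
  rw [dist_zero_right, e]
  refine (norm_add_le _ _).trans_lt ?_
  have b1 := (hu.add (hw.const_mul (-1))).norm_ft_le (k := k) hk'
  have b2 : ∫ γ, ‖u γ + (-1) * (Ioi (0:ℝ)).indicator g γ‖ ≤ ε / 2 / 2 := by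
    refine le_trans (integral_mono (hu.add (hw.const_mul (-1))).int.norm (hu.int.sub ig).norm ?_) h3
    intro γ
    by_cases h : γ ∈ Ioi (0:ℝ)
    · simp [h, sub_eq_add_neg]
    · simp [h, hu.supp γ h]
  have b3 := ft_eq_of_deriv h1 h2 hk' (norm_pos_iff.1 hk0)
  have b4 : C / ‖k‖ < ε / 2 := by
    rw [div_lt_iff₀ hk0]
    rw [div_add_one (by positivity), div_le_iff₀ (by positivity)] at hk
    nlinarith
  linarith

lemma ft_neg_neg (u : ℝ → ℂ) (k : ℂ) : ft (fun γ => u (-γ)) (-k) = ft u k := by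
  rw [ft, ft, ← integral_neg_eq_self]
  congr 1; ext γ
  simp

lemma Dom.L1.neg (hu : Dom.M.L1 u) : Dom.P.L1 (fun γ => u (-γ)) :=
  ⟨hu.int.comp_neg, fun γ h => hu.supp _ (by simpa [Dom.M, Dom.P] using h)⟩

lemma tendsto_ft_M (hu : Dom.M.L1 u) :
    Tendsto (ft u) (cocompact ℂ ⊓ 𝓟 {k | k.im ≤ 0}) (𝓝 0) := by
  have h := tendsto_ft_P hu.neg
  have hm : Tendsto (fun k : ℂ => -k) (cocompact ℂ ⊓ 𝓟 {k | k.im ≤ 0})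
      (cocompact ℂ ⊓ 𝓟 {k | 0 ≤ k.im}) := by
    refine Tendsto.inf (Homeomorph.neg ℂ).isClosedEmbedding.tendsto_cocompact ?_
    rw [tendsto_principal_principal]; intro k hk; simpa using hk
  exact (h.comp hm).congr fun k => ft_neg_neg u k

lemma hasDerivAt_ft_P (hu : Dom.P.L1 u) (hk : 0 < k.im) :
    HasDerivAt (ft u)
      (∫ γ : ℝ, (Complex.I * γ) * (Complex.exp (Complex.I * k * γ) * u γ)) k := by
  have hs : {z : ℂ | k.im / 2 < z.im} ∈ 𝓝 k :=
    (isOpen_lt continuous_const Complex.continuous_im).mem_nhds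
      (show k.im / 2 < k.im by linarith)
  refine (hasDerivAt_integral_of_dominated_loc_of_deriv_le (bound := fun γ => (2 / k.im) * ‖u γ‖)
    (F := fun z γ => Complex.exp (Complex.I * z * γ) * u γ)
    (F' := fun z γ => (Complex.I * γ) * (Complex.exp (Complex.I * z * γ) * u γ))
    hs ?_ ?_ ?_ ?_ ?_ ?_).2
  · exact .of_forall fun k => (continuous_cexp_I k).aestronglyMeasurable.mul hu.int.1
  · exact hu.integrable_exp hk.le
  · exact (by fun_prop : Continuous fun γ : ℝ => Complex.I * γ).aestronglyMeasurable.mul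
      ((continuous_cexp_I k).aestronglyMeasurable.mul hu.int.1)
  · refine .of_forall fun γ z hz => ?_
    by_cases h : 0 < γ
    · have hz' : k.im / 2 < z.im := hz
      rw [norm_mul, norm_mul, norm_mul, norm_cexp_I, ← mul_assoc]
      gcongr
      simp only [Complex.norm_I, one_mul, Complex.norm_real, Real.norm_eq_abs, abs_of_pos h]
      have h1 : z.im * γ ≤ Real.exp (z.im * γ) := by
        linarith [Real.add_one_le_exp (z.im * γ)]
      have h2 : 0 < z.im := by linarith
      rw [Real.exp_neg, ← div_eq_mul_inv, div_le_div_iff₀ (Real.exp_pos _) hk]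
      nlinarith
    · have : u γ = 0 := hu.supp γ h
      simp [this]
  · exact hu.int.norm.const_mul _
  · refine .of_forall fun γ z _ => ?_
    have := (((hasDerivAt_id z).const_mul Complex.I).mul_const (γ : ℂ)).cexp.mul_const (u γ)
    refine HasDerivAt.congr_deriv this ?_
    simp only [id]; ring

lemma differentiableOn_ft_P (hu : Dom.P.L1 u) : DifferentiableOn ℂ (ft u) {k | 0 < k.im} :=
  fun _ hk => (hasDerivAt_ft_P hu hk).differentiableAt.differentiableWithinAt

lemma differentiableOn_ft_M (hu : Dom.M.L1 u) : DifferentiableOn ℂ (ft u) {k | k.im < 0} := by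
  have := (differentiableOn_ft_P hu.neg).comp (f := fun k : ℂ => -k) (s := {k | k.im < 0})
    (by fun_prop) (fun k hk => by simpa using hk)
  exact this.congr fun k _ => (ft_neg_neg u k).symm

/-! ### Wiener classes -/

/-- `F = c + û` on `d.D`, with `u` integrable and supported in `d.s`. -/
def Wie (d : Dom) (c : ℂ) (F : ℂ → ℂ) : Prop :=
  ∃ u, d.L1 u ∧ ∀ k ∈ d.D, F k = c + ft u k

variable {b c : ℂ} {F H : ℂ → ℂ}

lemma Wie.congr (hF : Wie d c F) (h : ∀ k ∈ d.D, F k = H k) : Wie d c H := by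
  obtain ⟨u, hu, e⟩ := hF
  exact ⟨u, hu, fun k hk => by rw [← h k hk, e k hk]⟩

lemma Wie.const (c : ℂ) : Wie d c (fun _ => c) := ⟨_, Dom.L1.zero, by simp [ft_zero]⟩

lemma Wie.add (hF : Wie d b F) (hH : Wie d c H) : Wie d (b + c) (fun k => F k + H k) := by
  obtain ⟨u, hu, e⟩ := hF
  obtain ⟨v, hv, e'⟩ := hH
  exact ⟨_, hu.add hv, fun k hk => by simp only [e k hk, e' k hk, ft_add hu hv hk]; ring⟩

lemma Wie.mul (hF : Wie d b F) (hH : Wie d c H) : Wie d (b * c) (fun k => F k * H k) := by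
  obtain ⟨u, hu, e⟩ := hF
  obtain ⟨v, hv, e'⟩ := hH
  refine ⟨_, ((hv.const_mul b).add (hu.const_mul c)).add (hu.cv hv), fun k hk => ?_⟩
  simp only [e k hk, e' k hk]
  rw [ft_add ((hv.const_mul b).add (hu.const_mul c)) (hu.cv hv) hk,
    ft_add (hv.const_mul b) (hu.const_mul c) hk, ft_cv hu hv hk, ft_const_mul, ft_const_mul]
  ring

lemma Wie.const_mul (a : ℂ) (hF : Wie d c F) : Wie d (a * c) (fun k => a * F k) :=
  (Wie.const a).mul hF

lemma Wie.neg (hF : Wie d c F) : Wie d (-c) (fun k => -F k) := by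
  simpa using hF.const_mul (-1)

lemma Wie.sub (hF : Wie d b F) (hH : Wie d c H) : Wie d (b - c) (fun k => F k - H k) := by
  simpa [sub_eq_add_neg] using hF.add hH.neg

lemma Wie.sum {ι : Type*} (s : Finset ι) {c : ι → ℂ} {F : ι → ℂ → ℂ}
    (h : ∀ i ∈ s, Wie d (c i) (F i)) : Wie d (∑ i ∈ s, c i) (fun k => ∑ i ∈ s, F i k) := by
  classical
  induction s using Finset.induction_on with
  | empty => simpa using Wie.const 0
  | insert a s ha ih =>
    simp only [Finset.sum_insert ha]
    exact (h a (by simp)).add (ih fun i hi => h i (by simp [hi]))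

lemma Wie.prod {ι : Type*} (s : Finset ι) {c : ι → ℂ} {F : ι → ℂ → ℂ}
    (h : ∀ i ∈ s, Wie d (c i) (F i)) : Wie d (∏ i ∈ s, c i) (fun k => ∏ i ∈ s, F i k) := by
  classical
  induction s using Finset.induction_on with
  | empty => simpa using Wie.const 1
  | insert a s ha ih =>
    simp only [Finset.prod_insert ha]
    exact (h a (by simp)).mul (ih fun i hi => h i (by simp [hi]))

lemma Wie.det {ι : Type*} [Fintype ι] [DecidableEq ι] {C : Matrix ι ι ℂ}
    {A : ℂ → Matrix ι ι ℂ} (h : ∀ i j, Wie d (C i j) (fun k => A k i j)) :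
    Wie d C.det (fun k => (A k).det) := by
  simp only [Matrix.det_apply']
  exact Wie.sum _ fun σ _ => (Wie.prod _ fun i _ => h _ _).const_mul _

lemma Wie.adjugate {ι : Type*} [Fintype ι] [DecidableEq ι] {C : Matrix ι ι ℂ}
    {A : ℂ → Matrix ι ι ℂ} (h : ∀ i j, Wie d (C i j) (fun k => A k i j)) (i j : ι) :
    Wie d (C.adjugate i j) (fun k => (A k).adjugate i j) := by
  simp only [Matrix.adjugate_apply]
  refine Wie.det fun a b => ?_
  by_cases hab : a = j
  · subst hab; simpa using Wie.const _
  · simpa [Matrix.updateRow_ne hab] using h a b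

lemma Wie.continuousOn (hF : Wie d c F) : ContinuousOn F d.D := by
  obtain ⟨u, hu, e⟩ := hF
  exact (continuousOn_const.add hu.continuousOn_ft).congr e

lemma Wie.continuous_real (hF : Wie .R c F) : Continuous fun k : ℝ => F k :=
  hF.continuousOn.comp_continuous Complex.continuous_ofReal (by simp [Dom.R])

lemma Wie.real (hF : Wie .P c F) : Wie .R c F := by
  obtain ⟨u, hu, e⟩ := hF
  refine ⟨u, ⟨hu.int, by simp [Dom.R]⟩, fun k hk => e k ?_⟩
  have : k.im = 0 := hk
  simp [Dom.P, this]

lemma Wie.real' (hF : Wie .M c F) : Wie .R c F := by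
  obtain ⟨u, hu, e⟩ := hF
  refine ⟨u, ⟨hu.int, by simp [Dom.R]⟩, fun k hk => e k ?_⟩
  have : k.im = 0 := hk
  simp [Dom.M, this]

lemma Wie.tendsto_real (hF : Wie .R c F) : Tendsto (fun k : ℝ => F k) (cocompact ℝ) (𝓝 c) := by
  obtain ⟨u, hu, e⟩ := hF
  have := (tendsto_ft_real u).const_add c
  rw [add_zero] at this
  exact this.congr fun k => (e k (by simp [Dom.R])).symm

lemma Wie.tendsto_P (hF : Wie .P c F) :
    Tendsto F (cocompact ℂ ⊓ 𝓟 {k | 0 ≤ k.im}) (𝓝 c) := by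
  obtain ⟨u, hu, e⟩ := hF
  have := (tendsto_ft_P hu).const_add c
  rw [add_zero] at this
  refine this.congr' ?_
  filter_upwards [mem_inf_of_right (mem_principal_self _)] with k hk using (e k hk).symm

lemma Wie.tendsto_M (hF : Wie .M c F) :
    Tendsto F (cocompact ℂ ⊓ 𝓟 {k | k.im ≤ 0}) (𝓝 c) := by
  obtain ⟨u, hu, e⟩ := hF
  have := (tendsto_ft_M hu).const_add c
  rw [add_zero] at this
  refine this.congr' ?_
  filter_upwards [mem_inf_of_right (mem_principal_self _)] with k hk using (e k hk).symm

lemma Wie.differentiableOn_P (hF : Wie .P c F) : DifferentiableOn ℂ F {k | 0 < k.im} := by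
  obtain ⟨u, hu, e⟩ := hF
  exact ((differentiableOn_ft_P hu).const_add c).congr fun k (hk : 0 < k.im) => e k hk.le

lemma Wie.differentiableOn_M (hF : Wie .M c F) : DifferentiableOn ℂ F {k | k.im < 0} := by
  obtain ⟨u, hu, e⟩ := hF
  exact ((differentiableOn_ft_M hu).const_add c).congr fun k (hk : k.im < 0) => e k hk.le

lemma Wie.of_M (hF : Wie .M c F) : Wie .P c (fun k => F (-k)) := by
  obtain ⟨u, hu, e⟩ := hF
  exact ⟨_, hu.neg, fun k hk => by
    simp only [e (-k) (by simpa [Dom.M, Dom.P] using hk)]; congr 1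
    rw [← ft_neg_neg u (-k), neg_neg]⟩

lemma Wie.neg_real (hF : Wie .R c F) : Wie .R c (fun k => F (-k)) := by
  obtain ⟨u, hu, e⟩ := hF
  exact ⟨fun γ => u (-γ), ⟨hu.int.comp_neg, by simp [Dom.R]⟩, fun k hk => by
    simp only [e (-k) (by simpa [Dom.R] using hk)]; congr 1
    rw [← ft_neg_neg u (-k), neg_neg]⟩

/-- Splitting of an integrable function at the origin. -/
lemma exists_split (hu : Integrable u) : ∃ v w, Dom.P.L1 v ∧ Dom.M.L1 w ∧
    (u =ᵐ[volume] fun γ => v γ + w γ) ∧ ∀ k : ℝ, ft u k = ft v k + ft w k := by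
  have hae : u =ᵐ[volume] fun γ => (Ioi (0:ℝ)).indicator u γ + (Iio (0:ℝ)).indicator u γ := by
    have : ∀ᵐ γ : ℝ, γ ≠ 0 := by simp [ae_iff]
    filter_upwards [this] with γ hγ
    rcases lt_or_gt_of_ne hγ with h | h
    · simp [h, not_lt.2 h.le]
    · simp [h, not_lt.2 h.le]
  refine ⟨(Ioi (0:ℝ)).indicator u, (Iio (0:ℝ)).indicator u,
    ⟨hu.indicator measurableSet_Ioi, fun γ h => indicator_of_notMem h _⟩,
    ⟨hu.indicator measurableSet_Iio, fun γ h => indicator_of_notMem h _⟩, hae, fun k => ?_⟩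
  rw [← ft_add (d := .R) ⟨hu.indicator measurableSet_Ioi, by simp [Dom.R]⟩
    ⟨hu.indicator measurableSet_Iio, by simp [Dom.R]⟩ (by simp [Dom.R])]
  refine integral_congr_ae ?_
  filter_upwards [hae] with γ hγ
  exact congrArg _ hγ

/-- A function that is analytic in the upper half-plane, continuous up to the boundary, tends to
`c` at infinity and is in the Wiener class on the real line is in the Wiener class of the upper
half-plane. -/
lemma Wie.of_analytic (hF : Wie .R c F) (hc : ContinuousOn F {k | 0 ≤ k.im})
    (ha : DifferentiableOn ℂ F {k | 0 < k.im})
    (hl : Tendsto F (cocompact ℂ ⊓ 𝓟 {k | 0 ≤ k.im}) (𝓝 c)) : Wie .P c F := by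
  obtain ⟨u, hu, e⟩ := hF
  obtain ⟨v, w, hv, hw, -, hvw⟩ := exists_split hu.int
  have := eq_const_of_glue (f := fun k => F k - c - ft v k) (g := ft w) (c := 0)
    ((hc.sub continuousOn_const).sub hv.continuousOn_ft) hw.continuousOn_ft
    ((ha.sub_const c).sub (differentiableOn_ft_P hv)) (differentiableOn_ft_M hw)
    (by simpa using (hl.sub_const c).sub (tendsto_ft_P hv)) (tendsto_ft_M hw)
    (fun k => by
      rw [e k (by simp [Dom.R]), hvw k]; ring)
  exact ⟨v, hv, fun k hk => by have := this.1 k hk; linear_combination this⟩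

end AKNS

namespace AKNS

/-! ### Functionals on `L¹` -/

/-- The space `L¹(ℝ)`. -/
abbrev E1 : Type := Lp ℂ 1 (volume : Measure ℝ)

lemma integrable_mul_of_bound {w u : ℝ → ℂ} (hw : AEStronglyMeasurable w volume)
    (hb : ∀ γ, ‖w γ‖ ≤ 1) (hu : Integrable u) : Integrable fun γ => w γ * u γ :=
  hu.bdd_mul hw (.of_forall hb)

/-- Integration against a measurable function bounded by `1`. -/
def wInt (w : ℝ → ℂ) (hw : AEStronglyMeasurable w volume) (hb : ∀ γ, ‖w γ‖ ≤ 1) : E1 →L[ℂ] ℂ :=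
  LinearMap.mkContinuous
    { toFun := fun f => ∫ γ, w γ * f γ
      map_add' := fun f g => by
        rw [← integral_add (integrable_mul_of_bound hw hb (L1.integrable_coeFn f))
          (integrable_mul_of_bound hw hb (L1.integrable_coeFn g))]
        refine integral_congr_ae ?_
        filter_upwards [Lp.coeFn_add f g] with γ hγ
        rw [hγ, Pi.add_apply]; ring
      map_smul' := fun c f => by
        rw [RingHom.id_apply, smul_eq_mul, ← integral_const_mul]
        refine integral_congr_ae ?_
        filter_upwards [Lp.coeFn_smul c f] with γ hγ
        rw [hγ, Pi.smul_apply, smul_eq_mul]; ring }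
    1 fun f => by
      rw [one_mul, L1.norm_eq_integral_norm]
      refine norm_integral_le_of_norm_le (L1.integrable_coeFn f).norm (.of_forall fun γ => ?_)
      rw [norm_mul]
      exact mul_le_of_le_one_left (norm_nonneg _) (hb γ)

lemma wInt_apply (w : ℝ → ℂ) (hw hb) (f : E1) : wInt w hw hb f = ∫ γ, w γ * f γ := rfl

lemma norm_wInt_le (w : ℝ → ℂ) (hw hb) (f : E1) : ‖wInt w hw hb f‖ ≤ ‖f‖ := by
  simpa using (wInt w hw hb).le_of_opNorm_le (LinearMap.mkContinuous_norm_le _ zero_le_one _) f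

lemma norm_toL1 {u : ℝ → ℂ} (hu : Integrable u) : ‖(hu.toL1 u : E1)‖ = ∫ γ, ‖u γ‖ := by
  rw [L1.norm_eq_integral_norm]
  refine integral_congr_ae ?_
  filter_upwards [hu.coeFn_toL1] with γ hγ
  rw [hγ]

lemma wInt_toL1 (w : ℝ → ℂ) (hw hb) {u : ℝ → ℂ} (hu : Integrable u) :
    wInt w hw hb (hu.toL1 u) = ∫ γ, w γ * u γ := by
  rw [wInt_apply]
  refine integral_congr_ae ?_
  filter_upwards [hu.coeFn_toL1] with γ hγ
  rw [hγ]

/-- The Fourier transform at a real point as a functional. -/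
def ftReal (k : ℝ) : E1 →L[ℂ] ℂ :=
  wInt (fun γ => Complex.exp (Complex.I * k * γ)) (continuous_cexp_I k).aestronglyMeasurable
    fun γ => (norm_cexp_I_real k γ).le

lemma ftReal_apply (k : ℝ) (f : E1) : ftReal k f = ft f k := rfl

lemma ftReal_toL1 (k : ℝ) {u : ℝ → ℂ} (hu : Integrable u) : ftReal k (hu.toL1 u) = ft u k :=
  wInt_toL1 _ _ _ hu

/-! ### The Wiener norm -/

/-- `f = c + û` on the real line with `‖c‖ + ‖u‖₁ ≤ r`. -/
def WN (f : ℝ → ℂ) (r : ℝ) : Prop :=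
  ∃ c u, Integrable u ∧ ‖c‖ + ∫ γ, ‖u γ‖ ≤ r ∧ ∀ k : ℝ, f k = c + ft u k

variable {f g : ℝ → ℂ} {r s : ℝ} {c : ℂ} {u v : ℝ → ℂ}

lemma L1_R (hu : Integrable u) : Dom.R.L1 u := ⟨hu, by simp [Dom.R]⟩

lemma mem_R (k : ℝ) : (k : ℂ) ∈ Dom.R.D := by simp [Dom.R]

lemma Wie.wn {F : ℂ → ℂ} (hF : Wie .R c F) : ∃ r, WN (fun k => F k) r := by
  obtain ⟨u, hu, e⟩ := hF
  exact ⟨_, c, u, hu.int, le_rfl, fun k => e k (mem_R k)⟩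

lemma WN.wie (hf : WN f r) : ∃ c, Wie .R c (fun k => f k.re) := by
  obtain ⟨c, u, hu, -, e⟩ := hf
  refine ⟨c, u, L1_R hu, fun k hk => ?_⟩
  have : k = (k.re : ℂ) := Complex.ext rfl (by simpa [Dom.R] using hk)
  conv_rhs => rw [this]
  exact e k.re

lemma WN.congr (hf : WN f r) (h : ∀ k, f k = g k) : WN g r := by
  rwa [← show f = g from funext h]

lemma WN.mono (hf : WN f r) (h : r ≤ s) : WN f s := by
  obtain ⟨c, u, hu, hr, e⟩ := hf
  exact ⟨c, u, hu, hr.trans h, e⟩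

lemma WN.nonneg (hf : WN f r) : 0 ≤ r := by
  obtain ⟨c, u, hu, hr, e⟩ := hf
  exact le_trans (by positivity) hr

lemma WN.const (c : ℂ) : WN (fun _ => c) ‖c‖ :=
  ⟨c, fun _ => 0, integrable_zero _ _ _, by simp, by simp [ft_zero]⟩

lemma WN.add (hf : WN f r) (hg : WN g s) : WN (fun k => f k + g k) (r + s) := by
  obtain ⟨c, u, hu, hr, e⟩ := hf
  obtain ⟨d, v, hv, hs, e'⟩ := hg
  refine ⟨c + d, _, hu.add hv, ?_, fun k => ?_⟩
  · have h1 := norm_add_le c d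
    have h2 : ∫ γ, ‖(u + v) γ‖ ≤ (∫ γ, ‖u γ‖) + ∫ γ, ‖v γ‖ := by
      rw [← integral_add hu.norm hv.norm]
      exact integral_mono (hu.add hv).norm (hu.norm.add hv.norm) fun γ => norm_add_le _ _
    linarith
  · have := ft_add (L1_R hu) (L1_R hv) (mem_R k)
    change _ = _ + ft (fun γ => u γ + v γ) k
    simp only [e k, e' k, this]; ring

lemma WN.mul (hf : WN f r) (hg : WN g s) : WN (fun k => f k * g k) (r * s) := by
  have hr0 := hf.nonneg
  obtain ⟨c, u, hu, hr, e⟩ := hf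
  obtain ⟨d, v, hv, hs, e'⟩ := hg
  have i1 := hv.const_mul c
  have i2 := hu.const_mul d
  have i3 : Integrable (cv u v) := ((L1_R hu).cv (L1_R hv)).int
  refine ⟨c * d, fun γ => c * v γ + d * u γ + cv u v γ, (i1.add i2).add i3, ?_, fun k => ?_⟩
  · have h0 := integral_norm_cv_le hu hv
    have h2 : ∫ γ, ‖c * v γ + d * u γ + cv u v γ‖ ≤
        ‖c‖ * (∫ γ, ‖v γ‖) + ‖d‖ * (∫ γ, ‖u γ‖) + ∫ γ, ‖cv u v γ‖ := by
      have j1 : Integrable fun γ => ‖c‖ * ‖v γ‖ := hv.norm.const_mul _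
      have j2 : Integrable fun γ => ‖d‖ * ‖u γ‖ := hu.norm.const_mul _
      have j3 : Integrable fun γ => ‖c‖ * ‖v γ‖ + ‖d‖ * ‖u γ‖ := j1.add j2
      rw [← integral_const_mul, ← integral_const_mul, ← integral_add j1 j2,
        ← integral_add j3 i3.norm]
      refine integral_mono ((i1.add i2).add i3).norm (j3.add i3.norm) fun γ => ?_
      refine (norm_add_le _ _).trans ?_
      gcongr
      refine (norm_add_le _ _).trans ?_
      simp
    have h3 : 0 ≤ ∫ γ, ‖u γ‖ := by positivity
    have h4 : 0 ≤ ∫ γ, ‖v γ‖ := by positivity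
    have h5 := norm_nonneg c
    have h6 := norm_nonneg d
    calc ‖c * d‖ + ∫ γ, ‖c * v γ + d * u γ + cv u v γ‖
        ≤ (‖c‖ + ∫ γ, ‖u γ‖) * (‖d‖ + ∫ γ, ‖v γ‖) := by rw [norm_mul]; nlinarith
      _ ≤ r * s := by gcongr
  · simp only [e k, e' k]
    rw [ft_add ((L1_R i1).add (L1_R i2)) (L1_R i3) (mem_R k), ft_add (L1_R i1) (L1_R i2) (mem_R k),
      ft_cv (L1_R hu) (L1_R hv) (mem_R k), ft_const_mul, ft_const_mul]
    ring

lemma WN.const_mul (a : ℂ) (hf : WN f r) : WN (fun k => a * f k) (‖a‖ * r) := (WN.const a).mul hf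

lemma WN.pow (hf : WN f r) (n : ℕ) : WN (fun k => f k ^ n) (r ^ n) := by
  induction n with
  | zero => simpa using WN.const 1
  | succ n ih => simpa [pow_succ] using ih.mul hf

lemma WN.sum {ι : Type*} (t : Finset ι) {f : ι → ℝ → ℂ} {r : ι → ℝ}
    (h : ∀ i ∈ t, WN (f i) (r i)) : WN (fun k => ∑ i ∈ t, f i k) (∑ i ∈ t, r i) := by
  classical
  induction t using Finset.induction_on with
  | empty => simpa using WN.const 0
  | insert a t ha ih =>
    simp only [Finset.sum_insert ha]
    exact (h a (by simp)).add (ih fun i hi => h i (by simp [hi]))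

lemma WN.tsum {f : ℕ → ℝ → ℂ} {r : ℕ → ℝ} (h : ∀ n, WN (f n) (r n)) (hr : Summable r)
    (hg : ∀ k, HasSum (fun n => f n k) (g k)) : ∃ s, WN g s := by
  choose c u hu hn e using h
  have s1 : Summable c := Summable.of_norm_bounded hr fun n =>
    le_trans (le_add_of_nonneg_right (by positivity)) (hn n)
  have s2 : Summable fun n => ((hu n).toL1 (u n) : E1) := Summable.of_norm_bounded hr fun n => by
    rw [norm_toL1]
    exact le_trans (le_add_of_nonneg_left (norm_nonneg _)) (hn n)
  refine ⟨_, ∑' n, c n, (∑' n, ((hu n).toL1 (u n) : E1) : E1), L1.integrable_coeFn _, le_rfl,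
    fun k => ?_⟩
  have h1 := s1.hasSum.add ((ftReal k).hasSum s2.hasSum)
  rw [ftReal_apply] at h1
  refine (hg k).unique (h1.congr_fun ?_ )
  intro n
  rw [e n k, ftReal_toL1]

/-! ### A smoothness criterion -/

lemma WN.of_deriv {ψ ψ' ψ'' : ℝ → ℂ} (h1 : ∀ k, HasDerivAt ψ (ψ' k) k)
    (h2 : ∀ k, HasDerivAt ψ' (ψ'' k) k) (i0 : Integrable ψ) (i1 : Integrable ψ')
    (i2 : Integrable ψ'') : WN ψ (Real.pi * ((∫ k, ‖ψ k‖) + ∫ k, ‖ψ'' k‖)) := by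
  set C := (∫ k, ‖ψ k‖) + ∫ k, ‖ψ'' k‖
  set w : ℝ → ℂ := FourierTransform.fourier ψ
  have hC : 0 ≤ C := by positivity
  have cψ : Continuous ψ := continuous_iff_continuousAt.2 fun k => (h1 k).continuousAt
  have e1 : deriv ψ = ψ' := funext fun k => (h1 k).deriv
  have e2 : deriv ψ' = ψ'' := funext fun k => (h2 k).deriv
  have F1 := Real.fourier_deriv i0 (fun k => (h1 k).differentiableAt) (e1 ▸ i1)
  have F2 := Real.fourier_deriv i1 (fun k => (h2 k).differentiableAt) (e2 ▸ i2)
  rw [e1] at F1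
  rw [e2, F1] at F2
  have bound : ∀ φ : ℝ → ℂ, ∀ ξ, ‖FourierTransform.fourier φ ξ‖ ≤ ∫ k, ‖φ k‖ := fun φ ξ =>
    VectorFourier.norm_fourierIntegral_le_integral_norm _ _ _ φ ξ
  have hw : ∀ ξ : ℝ, ‖w ξ‖ ≤ C * (1 + ξ ^ 2)⁻¹ := by
    intro ξ
    have b0 : ‖w ξ‖ ≤ _ := bound ψ ξ
    have b2 := bound ψ'' ξ
    rw [F2] at b2
    simp only [smul_eq_mul, norm_mul, Complex.norm_I, Complex.norm_real, Real.norm_eq_abs,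
      Complex.norm_ofNat, abs_of_pos Real.pi_pos, mul_one] at b2
    change 2 * Real.pi * |ξ| * (2 * Real.pi * |ξ| * ‖w ξ‖) ≤ _ at b2
    rw [← div_eq_mul_inv, le_div_iff₀ (by positivity)]
    have h3 : ξ ^ 2 * ‖w ξ‖ ≤ 2 * Real.pi * |ξ| * (2 * Real.pi * |ξ| * ‖w ξ‖) := by
      have : 2 * Real.pi * |ξ| * (2 * Real.pi * |ξ| * ‖w ξ‖) =
        (4 * Real.pi ^ 2) * (ξ ^ 2 * ‖w ξ‖) := by rw [← sq_abs ξ]; ring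
      rw [this]
      have h4 : (1 : ℝ) ≤ 4 * Real.pi ^ 2 := by nlinarith [Real.pi_gt_three]
      exact le_mul_of_one_le_left (by positivity) h4
    have : ‖w ξ‖ * (1 + ξ ^ 2) = ‖w ξ‖ + ξ ^ 2 * ‖w ξ‖ := by ring
    rw [this]
    linarith
  have cw : Continuous w := VectorFourier.fourierIntegral_continuous Real.continuous_fourierChar
    (by exact continuous_inner) i0
  have iw : Integrable w := (integrable_inv_one_add_sq.const_mul C).mono' cw.aestronglyMeasurable
    (.of_forall hw)
  have hinv := Continuous.fourierInv_fourier_eq cψ i0 iw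
  have hpi : (0:ℝ) < (2 * Real.pi)⁻¹ := by positivity
  refine ⟨0, fun γ => ((2 * Real.pi)⁻¹ : ℝ) * w ((2 * Real.pi)⁻¹ * γ),
    (iw.comp_mul_left' hpi.ne').const_mul _, ?_, fun k => ?_⟩
  · have : ∫ γ : ℝ, ‖(((2 * Real.pi)⁻¹ : ℝ) : ℂ) * w ((2 * Real.pi)⁻¹ * γ)‖ = ∫ ξ, ‖w ξ‖ := by
      simp only [norm_mul, Complex.norm_real, Real.norm_eq_abs, abs_of_pos hpi]
      rw [integral_const_mul, Measure.integral_comp_mul_left (fun ξ => ‖w ξ‖), inv_inv, smul_eq_mul,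
        abs_of_pos (by positivity), ← mul_assoc, inv_mul_cancel₀ (by positivity), one_mul]
    rw [norm_zero, zero_add, this, mul_comm, ← integral_univ_inv_one_add_sq, ← integral_const_mul]
    exact integral_mono iw.norm (integrable_inv_one_add_sq.const_mul C) hw
  · rw [zero_add]
    conv_lhs => rw [← hinv]
    rw [Real.fourierInv_eq', ft]
    have := Measure.integral_comp_mul_left (fun ξ : ℝ =>
      Complex.exp (↑(2 * Real.pi * inner ℝ ξ k) * Complex.I) • w ξ) ((2 * Real.pi)⁻¹)
    rw [inv_inv, abs_of_pos (by positivity)] at this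
    have h5 : (∫ ξ : ℝ, Complex.exp (↑(2 * Real.pi * inner ℝ ξ k) * Complex.I) • w ξ) =
        ((2 * Real.pi)⁻¹ : ℝ) • ((2 * Real.pi : ℝ) •
          ∫ ξ : ℝ, Complex.exp (↑(2 * Real.pi * inner ℝ ξ k) * Complex.I) • w ξ) := by
      rw [smul_smul, inv_mul_cancel₀ (by positivity), one_smul]
    rw [h5, ← this, ← integral_smul]
    congr 1; ext γ
    have hp := Real.pi_ne_zero
    have h6 : 2 * Real.pi * inner ℝ ((2 * Real.pi)⁻¹ * γ) k = k * γ := by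
      simp; field_simp
    rw [h6]
    simp only [smul_eq_mul, Complex.real_smul]
    rw [show Complex.I * k * γ = ((k * γ : ℝ) : ℂ) * Complex.I by push_cast; ring]
    ring

end AKNS

namespace AKNS
variable {f g : ℝ → ℂ} {r s : ℝ} {c : ℂ} {u v : ℝ → ℂ}

/-! ### Powers -/

/-- The Fourier transform of a Schwartz function is a Schwartz function. -/
lemma exists_schwartz_ft (g : SchwartzMap ℝ ℂ) : ∃ w : SchwartzMap ℝ ℂ, ∀ k : ℝ, ft g k = w k := by
  have hp : (-(2 * Real.pi))⁻¹ ≠ 0 := by simp [Real.pi_ne_zero]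
  let L : ℝ ≃L[ℝ] ℝ := ContinuousLinearEquiv.unitsEquivAut ℝ (Units.mk0 _ hp)
  refine ⟨SchwartzMap.compCLMOfContinuousLinearEquiv ℂ L (FourierTransform.fourier g), fun k => ?_⟩
  rw [SchwartzMap.compCLMOfContinuousLinearEquiv_apply]
  have : L k = k * (-(2 * Real.pi))⁻¹ := by simp [L]
  rw [Function.comp_apply, this, SchwartzMap.fourier_coe, ft_two_pi]
  congr 2
  have := Real.pi_ne_zero
  field_simp

lemma WN.pow_schwartz (c : ℂ) (w : SchwartzMap ℝ ℂ) {ρ : ℝ} (hρ : 0 < ρ) (hc : ‖c‖ ≤ ρ)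
    (hw : ∀ k, ‖c + w k‖ ≤ ρ) :
    ∃ K, 0 ≤ K ∧ ∀ n : ℕ, WN (fun k => (c + w k) ^ n) (K * (n + 1) ^ 2 * ρ ^ n) := by
  set w1 : SchwartzMap ℝ ℂ := SchwartzMap.derivCLM ℂ ℂ w
  set w2 : SchwartzMap ℝ ℂ := SchwartzMap.derivCLM ℂ ℂ w1
  have d1 : ∀ k, HasDerivAt w (w1 k) k := fun k => w.hasDerivAt k
  have d2 : ∀ k, HasDerivAt w1 (w2 k) k := fun k => w1.hasDerivAt k
  have b1 : ∃ B, ∀ k, ‖w1 k‖ ≤ B := by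
    obtain ⟨B, hB⟩ := w1.decay 0 0
    exact ⟨B, fun k => by simpa using hB.2 k⟩
  obtain ⟨B, hB⟩ := b1
  set s : ℝ → ℂ := fun k => c + w k
  have cs : Continuous s := continuous_const.add w.continuous
  have ds : ∀ k, HasDerivAt s (w1 k) k := fun k => (d1 k).const_add c
  set A0 := ∫ k, ‖w k‖
  set A2 := ∫ k, (‖w1 k‖ * ‖w1 k‖ + ρ * ‖w2 k‖)
  have hint11 : Integrable fun k => ‖w1 k‖ * ‖w1 k‖ := by
    refine (w1.integrable.norm.const_mul B).mono' (by fun_prop) (.of_forall fun k => ?_)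
    simp only [norm_mul, norm_norm]
    exact mul_le_mul_of_nonneg_right (hB k) (norm_nonneg _)
  have hint2 : Integrable fun k => ‖w1 k‖ * ‖w1 k‖ + ρ * ‖w2 k‖ :=
    hint11.add (w2.integrable.norm.const_mul ρ)
  have hA0 : 0 ≤ A0 := by positivity
  have hA2 : 0 ≤ A2 := by positivity
  refine ⟨1 + Real.pi * (A0 / ρ + A2 / ρ ^ 2), by positivity, fun n => ?_⟩
  have ps : ∀ (k : ℝ) (j : ℕ), ‖s k ^ j‖ ≤ ρ ^ j := fun k j => by
    rw [norm_pow]; exact pow_le_pow_left₀ (norm_nonneg _) (hw k) _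
  have psm : ∀ (k : ℝ) (j : ℕ), ‖(n : ℂ) * s k ^ (n - j)‖ ≤ (n + 1) * ρ ^ n / ρ ^ j ∨ n < j := by
    intro k j
    rcases le_or_gt j n with hj | hj
    · left
      rw [norm_mul, Complex.norm_natCast, mul_div_assoc, div_eq_mul_inv, ← pow_sub₀ ρ hρ.ne' hj]
      gcongr
      · simp
      · exact ps k _
    · exact .inr hj
  -- the function `s ^ n - c ^ n` and its derivatives
  set ψ : ℝ → ℂ := fun k => s k ^ n - c ^ n
  set ψ' : ℝ → ℂ := fun k => n * s k ^ (n - 1) * w1 k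
  set ψ'' : ℝ → ℂ := fun k => (n * ((n - 1 : ℕ) * s k ^ (n - 1 - 1) * w1 k)) * w1 k
    + n * s k ^ (n - 1) * w2 k
  have h1 : ∀ k, HasDerivAt ψ (ψ' k) k := fun k => ((ds k).pow n).sub_const _
  have h2 : ∀ k, HasDerivAt ψ' (ψ'' k) k := fun k =>
    ((((ds k).pow (n - 1)).const_mul (n : ℂ)).mul (d2 k))
  have q1 : ∀ k, ‖(n : ℂ) * s k ^ (n - 1)‖ ≤ (n + 1) * ρ ^ n / ρ := by
    intro k
    rcases psm k 1 with h | h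
    · simpa using h
    · have : n = 0 := by omega
      subst this; simp; positivity
  have q2 : ∀ k, ‖(n : ℂ) * ((n - 1 : ℕ) * s k ^ (n - 1 - 1))‖ ≤ (n + 1) ^ 2 * ρ ^ n / ρ ^ 2 := by
    intro k
    rcases psm k 2 with h | h
    · rw [Nat.sub_sub, mul_left_comm, norm_mul, Complex.norm_natCast]
      have h3 : ((n - 1 : ℕ) : ℝ) ≤ n + 1 := by
        have : n - 1 ≤ n + 1 := by omega
        exact_mod_cast this
      calc _ ≤ ((n:ℝ) + 1) * ((n + 1) * ρ ^ n / ρ ^ 2) := by gcongr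
        _ = _ := by ring
    · interval_cases n <;> simp <;> positivity
  have q0 : ∀ k, ‖ψ k‖ ≤ (n + 1) * ρ ^ n / ρ * ‖w k‖ := by
    intro k
    have e : ψ k = (∑ i ∈ Finset.range n, s k ^ i * c ^ (n - 1 - i)) * w k := by
      have := (Commute.all (s k) c).geom_sum₂_mul n
      simp only [ψ]
      rw [← this]; simp [s]
    rw [e, norm_mul]
    gcongr
    refine (norm_sum_le _ _).trans ?_
    have : ∀ i ∈ Finset.range n, ‖s k ^ i * c ^ (n - 1 - i)‖ ≤ ρ ^ n / ρ := by
      intro i hi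
      have hi' := Finset.mem_range.1 hi
      rw [norm_mul, norm_pow c]
      calc _ ≤ ρ ^ i * ρ ^ (n - 1 - i) := by
            gcongr
            exact ps k i
        _ = ρ ^ n / ρ := by
            rw [← pow_add, eq_div_iff hρ.ne', ← pow_succ]; congr 1; omega
    refine (Finset.sum_le_sum this).trans ?_
    rw [Finset.sum_const, Finset.card_range, nsmul_eq_mul, mul_div_assoc]
    gcongr
    linarith
  have i0 : Integrable ψ := by
    refine (w.integrable.norm.const_mul _).mono' ?_ (.of_forall q0)
    exact ((cs.pow n).sub continuous_const).aestronglyMeasurable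
  have i1 : Integrable ψ' := by
    refine w1.integrable.bdd_mul (c := (n + 1) * ρ ^ n / ρ) ?_ (.of_forall q1)
    exact (continuous_const.mul (cs.pow _)).aestronglyMeasurable
  have q3 : ∀ k, ‖ψ'' k‖ ≤ (n + 1) ^ 2 * ρ ^ n / ρ ^ 2 * (‖w1 k‖ * ‖w1 k‖ + ρ * ‖w2 k‖) := by
    intro k
    have t1 : ‖((n : ℂ) * ((n - 1 : ℕ) * s k ^ (n - 1 - 1) * w1 k)) * w1 k‖ ≤
        (n + 1) ^ 2 * ρ ^ n / ρ ^ 2 * (‖w1 k‖ * ‖w1 k‖) := by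
      rw [← mul_assoc, mul_assoc, norm_mul, norm_mul (w1 k)]
      gcongr
      exact q2 k
    have t2 : ‖(n : ℂ) * s k ^ (n - 1) * w2 k‖ ≤ (n + 1) ^ 2 * ρ ^ n / ρ ^ 2 * (ρ * ‖w2 k‖) := by
      rw [norm_mul, ← mul_assoc]
      gcongr
      refine (q1 k).trans ?_
      rw [div_mul_eq_mul_div, div_le_div_iff₀ hρ (by positivity)]
      have : ((n:ℝ) + 1) ≤ (n + 1) ^ 2 := by nlinarith [Nat.cast_nonneg (α := ℝ) n]
      calc (↑n + 1) * ρ ^ n * ρ ^ 2 ≤ (n + 1) ^ 2 * ρ ^ n * ρ ^ 2 := by gcongr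
        _ = _ := by ring
    exact (norm_add_le _ _).trans (by linarith)
  have i2 : Integrable ψ'' := by
    refine (hint2.const_mul _).mono' ?_ (.of_forall q3)
    have := w1.continuous
    have := w2.continuous
    exact (by fun_prop : Continuous ψ'').aestronglyMeasurable
  have key := (WN.const (c ^ n)).add (WN.of_deriv h1 h2 i0 i1 i2)
  refine (key.congr fun k => by simp [ψ, s]).mono ?_
  have e0 : ∫ k, ‖ψ k‖ ≤ (n + 1) * ρ ^ n / ρ * A0 := by
    rw [← integral_const_mul]
    exact integral_mono i0.norm (w.integrable.norm.const_mul _) q0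
  have e2 : ∫ k, ‖ψ'' k‖ ≤ (n + 1) ^ 2 * ρ ^ n / ρ ^ 2 * A2 := by
    rw [← integral_const_mul]
    exact integral_mono i2.norm (hint2.const_mul _) q3
  have e3 : ‖c ^ n‖ ≤ ρ ^ n := by rw [norm_pow]; gcongr
  have h5 : (1:ℝ) ≤ (n + 1) ^ 2 := by nlinarith [Nat.cast_nonneg (α := ℝ) n]
  have h6 : ((n:ℝ) + 1) ≤ (n + 1) ^ 2 := by nlinarith [Nat.cast_nonneg (α := ℝ) n]
  have hp := Real.pi_pos
  have e0' : (n + 1) * ρ ^ n / ρ * A0 ≤ (n + 1) ^ 2 * ρ ^ n / ρ * A0 := by gcongr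
  calc ‖c ^ n‖ + Real.pi * ((∫ k, ‖ψ k‖) + ∫ k, ‖ψ'' k‖)
      ≤ (n + 1) ^ 2 * ρ ^ n + Real.pi * ((n + 1) ^ 2 * ρ ^ n / ρ * A0 +
        (n + 1) ^ 2 * ρ ^ n / ρ ^ 2 * A2) := by
        gcongr
        · exact e3.trans (le_mul_of_one_le_left (by positivity) h5)
        · exact e0.trans e0'
    _ = _ := by ring

lemma summable_sq_mul_geometric {q : ℝ} (h0 : 0 < q) (h1 : q < 1) :
    Summable fun n : ℕ => ((n + 1 : ℕ) : ℝ) ^ 2 * q ^ n := by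
  have hq : ‖q‖ < 1 := by rwa [Real.norm_eq_abs, abs_of_pos h0]
  have h2 := (summable_nat_add_iff 1).2 (summable_pow_mul_geometric_of_norm_lt_one (R := ℝ) 2 hq)
  refine (h2.mul_left q⁻¹).congr fun n => ?_
  field_simp
  ring

/-- Wiener's spectral radius estimate. -/
lemma WN.pow_summable (hf : WN f r) {ρ : ℝ} (hρ : ρ < 1) (hb : ∀ k, ‖f k‖ ≤ ρ) :
    ∃ a : ℕ → ℝ, Summable a ∧ ∀ n, WN (fun k => f k ^ n) (a n) := by
  obtain ⟨c, u, hu, -, e⟩ := hf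
  have hρ0 : 0 ≤ ρ := (norm_nonneg _).trans (hb 0)
  have hc : ‖c‖ ≤ ρ := by
    have := ((tendsto_ft_real u).const_add c).norm
    rw [add_zero] at this
    exact le_of_tendsto this (.of_forall fun k => by rw [← e k]; exact hb k)
  set ε := (1 - ρ) / 4
  have hε : 0 < ε := by simp only [ε]; linarith
  obtain ⟨g0, g1, g2, g3⟩ := exists_smooth_approx hu hε
  obtain ⟨w, hw⟩ := exists_schwartz_ft (g1.toSchwartzMap g2)
  have ig : Integrable g0 := g2.continuous.integrable_of_hasCompactSupport g1
  have hw' : ∀ k : ℝ, ft g0 k = w k := hw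
  have he : ∀ k : ℝ, f k - (c + w k) = ft (fun γ => u γ + (-1) * g0 γ) k := fun k => by
    rw [ft_add (L1_R hu) (L1_R (ig.const_mul _)) (mem_R k), ft_const_mul, e k, hw']; ring
  have ie : Integrable fun γ => u γ + (-1) * g0 γ := hu.add (ig.const_mul _)
  have hn : ∫ γ, ‖u γ + (-1) * g0 γ‖ ≤ ε := by
    simpa [sub_eq_add_neg] using g3
  have We : WN (fun k => f k - (c + w k)) ε :=
    ⟨0, _, ie, by simpa [sub_eq_add_neg] using g3, fun k => by simp only [he, zero_add]⟩
  have hs : ∀ k, ‖c + w k‖ ≤ ρ + ε := fun k => by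
    have h1 : ‖f k - (c + w k)‖ ≤ ε := by
      rw [he]; exact ((L1_R ie).norm_ft_le (mem_R k)).trans hn
    have := norm_sub_norm_le (c + w k) (f k)
    rw [norm_sub_rev] at this
    linarith [hb k]
  obtain ⟨K, hK, hKn⟩ := WN.pow_schwartz c w (by positivity) (by linarith : ‖c‖ ≤ ρ + ε) hs
  refine ⟨fun n => K * (((n + 1 : ℕ) : ℝ) ^ 2 * (ρ + ε + ε) ^ n),
    (summable_sq_mul_geometric (by positivity) (by simp only [ε]; linarith)).mul_left K,
    fun n => ?_⟩
  have : ∀ k, ∑ j ∈ Finset.range (n + 1), (n.choose j : ℂ) *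
      ((c + w k) ^ j * (f k - (c + w k)) ^ (n - j)) = f k ^ n := fun k => by
    have := add_pow (c + w k) (f k - (c + w k)) n
    rw [add_sub_cancel] at this
    rw [this]; refine Finset.sum_congr rfl fun j _ => by ring
  refine ((WN.sum (Finset.range (n + 1)) fun j _ =>
    ((hKn j).mul (We.pow (n - j))).const_mul (n.choose j)).congr this).mono ?_
  simp only
  rw [add_pow, Finset.mul_sum, Finset.mul_sum]
  refine Finset.sum_le_sum fun j hj => ?_
  have hj' : j ≤ n := by simpa [Nat.lt_succ_iff] using hj
  rw [Complex.norm_natCast]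
  have h3 : ((j:ℝ) + 1) ^ 2 ≤ ((n + 1 : ℕ):ℝ) ^ 2 := by push_cast; gcongr
  calc (n.choose j : ℝ) * (K * (j + 1) ^ 2 * (ρ + ε) ^ j * ε ^ (n - j))
      ≤ (n.choose j : ℝ) * (K * ((n + 1 : ℕ):ℝ) ^ 2 * (ρ + ε) ^ j * ε ^ (n - j)) := by gcongr
    _ = _ := by ring

/-- A power series with bounded coefficients in an element of sup norm less than `1`. -/
lemma WN.series (hf : WN f r) {ρ : ℝ} (hρ : ρ < 1) (hb : ∀ k, ‖f k‖ ≤ ρ) (a : ℕ → ℂ)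
    (ha : ∀ n, ‖a n‖ ≤ 1) (hg : ∀ k, HasSum (fun n => a n * f k ^ n) (g k)) : ∃ s, WN g s := by
  obtain ⟨b, hb1, hb2⟩ := hf.pow_summable hρ hb
  exact WN.tsum (fun n => ((hb2 n).const_mul (a n)).mono
    (mul_le_of_le_one_left (hb2 n).nonneg (ha n))) hb1 hg

lemma WN.exp (hf : WN f r) : ∃ s, WN (fun k => Complex.exp (f k)) s := by
  refine WN.tsum (r := fun n => r ^ n / n.factorial)
    (fun n => ((hf.pow n).const_mul ((n.factorial : ℂ)⁻¹)).mono (le_of_eq ?_))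
    (Real.summable_pow_div_factorial r) fun k => ?_
  · rw [norm_inv, Complex.norm_natCast]; ring
  · have := NormedSpace.expSeries_div_hasSum_exp (f k)
    rw [← Complex.exp_eq_exp_ℂ] at this
    refine this.congr_fun fun n => by ring

lemma exists_lower_bound {f : ℝ → ℂ} (hf : Continuous f) (h0 : ∀ k, f k ≠ 0) (hc : c ≠ 0)
    (hl : Tendsto f (cocompact ℝ) (𝓝 c)) : ∃ δ > 0, ∀ k, δ ≤ ‖f k‖ := by
  have h1 : ∀ᶠ k in cocompact ℝ, ‖c‖ / 2 < ‖f k‖ :=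
    hl.norm.eventually (lt_mem_nhds (by linarith [norm_pos_iff.2 hc]))
  obtain ⟨K, hK, hK'⟩ := mem_cocompact.1 h1
  rcases K.eq_empty_or_nonempty with rfl | hne
  · exact ⟨‖c‖ / 2, by linarith [norm_pos_iff.2 hc], fun k => le_of_lt (hK' (by simp))⟩
  · obtain ⟨x, -, hx⟩ := hK.exists_isMinOn hne hf.norm.continuousOn
    refine ⟨min (‖c‖ / 2) ‖f x‖, lt_min (by linarith [norm_pos_iff.2 hc]) (norm_pos_iff.2 (h0 x)),
      fun k => ?_⟩
    by_cases hk : k ∈ K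
    · exact (min_le_right _ _).trans (hx hk)
    · exact (min_le_left _ _).trans (le_of_lt (hK' hk))

lemma WN.conj (hf : WN f r) : WN (fun k => star (f k)) r := by
  obtain ⟨c, u, hu, hr, e⟩ := hf
  refine ⟨star c, fun γ => star (u (-γ)), ?_, ?_, fun k => ?_⟩
  · exact (Complex.conjCLE : ℂ →L[ℝ] ℂ).integrable_comp hu.comp_neg
  · simp only [norm_star]
    rwa [integral_neg_eq_self (fun γ => ‖u γ‖)]
  · simp only [e k, star_add, ft]
    congr 1
    rw [← integral_neg_eq_self]
    have : ∀ z : ℂ, star z = (starRingEnd ℂ) z := fun _ => rfl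
    rw [this, ← integral_conj]
    congr 1; ext γ
    rw [map_mul, ← Complex.exp_conj]
    simp [Complex.conj_ofReal]

/-- **Wiener's lemma**. -/
lemma Wie.inv_real {F : ℂ → ℂ} (hF : Wie .R c F) (hc : c ≠ 0) (h0 : ∀ k : ℝ, F k ≠ 0) :
    Wie .R c⁻¹ (fun k => (F k)⁻¹) := by
  obtain ⟨r, hr⟩ := hF.wn
  set f : ℝ → ℂ := fun k => F k with hf
  have cf : Continuous f := hF.continuous_real
  obtain ⟨δ, hδ, hδ'⟩ := exists_lower_bound cf h0 hc hF.tendsto_real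
  have hub : ∀ k, ‖f k‖ ≤ r := by
    intro k
    obtain ⟨c, u, hu, hr, e⟩ := hr
    rw [e k]
    exact (norm_add_le _ _).trans (le_trans (by gcongr; exact (L1_R hu).norm_ft_le (mem_R k)) hr)
  have hr0 : 0 < r := hδ.trans_le ((hδ' 0).trans (hub 0))
  have hss : ∀ k, f k * star (f k) = ((‖f k‖ ^ 2 : ℝ) : ℂ) := fun k => by
    have := Complex.mul_conj (f k)
    rw [Complex.normSq_eq_norm_sq] at this
    exact this
  set h : ℝ → ℂ := fun k => 1 - ((r ^ 2)⁻¹ : ℝ) * (f k * star (f k)) with hh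
  have hhr : ∀ k, h k = ((1 - (r ^ 2)⁻¹ * ‖f k‖ ^ 2 : ℝ) : ℂ) := fun k => by
    simp only [hh, hss]; push_cast; ring
  have Wh : WN h _ := ((WN.const 1).add ((hr.mul hr.conj).const_mul (-((r ^ 2)⁻¹ : ℝ)))).congr
    fun k => by simp only [hh]; ring
  set ρ := 1 - (r ^ 2)⁻¹ * δ ^ 2
  have hρ : ρ < 1 := by simp only [ρ]; linarith [show 0 < (r ^ 2)⁻¹ * δ ^ 2 by positivity]
  have hb : ∀ k, ‖h k‖ ≤ ρ := by
    intro k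
    rw [hhr, Complex.norm_real, Real.norm_eq_abs, abs_of_nonneg]
    · simp only [ρ]
      gcongr
      exact hδ' k
    · have : (r ^ 2)⁻¹ * ‖f k‖ ^ 2 ≤ 1 := by
        rw [inv_mul_le_iff₀ (by positivity), mul_one]
        gcongr
        exact hub k
      linarith
  obtain ⟨s, hs⟩ := Wh.series hρ hb (fun _ => 1) (by simp) (g := fun k => (1 - h k)⁻¹) fun k => by
    simpa using hasSum_geometric_of_norm_lt_one ((hb k).trans_lt hρ)
  have hinv : WN (fun k => (f k)⁻¹) _ := ((hr.conj.mul hs).const_mul ((r ^ 2)⁻¹ : ℝ)).congr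
    fun k => by
      have h1 : star (f k) ≠ 0 := by simpa using h0 k
      have h2 := h0 k
      have h3 : (r : ℂ) ≠ 0 := by exact_mod_cast hr0.ne'
      simp only [hh]
      have : f k ≠ 0 := h2
      push_cast
      rw [sub_sub_cancel, mul_inv, inv_inv]
      field_simp
  obtain ⟨b, hb⟩ := hinv.wie
  have hb' : Wie .R b (fun k => (F k)⁻¹) := hb.congr fun k hk => by
    have : k = (k.re : ℂ) := Complex.ext rfl (by simpa [Dom.R] using hk)
    simp only [hf]
    rw [← this]
  have : b = c⁻¹ := tendsto_nhds_unique hb'.tendsto_real (hF.tendsto_real.inv₀ hc)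
  rwa [← this]

end AKNS

namespace AKNS
variable {f g : ℝ → ℂ} {r s : ℝ} {c : ℂ} {u v : ℝ → ℂ} {F : ℂ → ℂ}

/-! ### Logarithms -/

lemma exists_smooth_uniform_approx {φ : ℝ → ℂ} (hφ : Continuous φ)
    (hl : Tendsto φ (cocompact ℝ) (𝓝 0)) {ε : ℝ} (hε : 0 < ε) :
    ∃ g : ℝ → ℂ, HasCompactSupport g ∧ ContDiff ℝ (⊤ : ℕ∞) g ∧ ∀ k, ‖φ k - g k‖ ≤ ε + ε := by
  obtain ⟨R, hR⟩ : ∃ R : ℝ, ∀ k : ℝ, R < |k| → ‖φ k‖ < ε := by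
    have h1 : ∀ᶠ k in cocompact ℝ, ‖φ k‖ < ε := by
      have := hl.norm; rw [norm_zero] at this
      exact this.eventually (gt_mem_nhds hε)
    obtain ⟨K, hK, hK'⟩ := mem_cocompact.1 h1
    obtain ⟨R, hR⟩ := hK.isBounded.exists_norm_le
    exact ⟨R, fun k hk => hK' fun hkK => absurd (hR k hkK) (not_le.2 hk)⟩
  set χ : ℝ → ℝ := fun x => max 0 (min 1 (R + 1 - |x|))
  have cχ : Continuous χ := by fun_prop
  have hχ0 : ∀ x, 0 ≤ χ x := fun x => le_max_left _ _
  have hχ1 : ∀ x, χ x ≤ 1 := fun x => max_le zero_le_one (min_le_left _ _)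
  have hψ : Continuous fun x => (χ x : ℂ) * φ x := by fun_prop
  obtain ⟨g, g1, g2, g3⟩ := hψ.exists_contDiff_approx ⊤ (ε := fun _ => ε) continuous_const
    fun _ => hε
  refine ⟨g, ?_, g1, fun k => ?_⟩
  · refine HasCompactSupport.of_support_subset_isCompact (isCompact_closedBall (0:ℝ) (R + 1)) ?_
    refine g3.trans fun x hx => ?_
    rw [mem_closedBall_zero_iff, Real.norm_eq_abs]
    by_contra h
    have : χ x = 0 := by
      simp only [χ]; rw [max_eq_left]; exact (min_le_right _ _).trans (by linarith)
    simp [this] at hx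
  · have h1 : ‖φ k - χ k * φ k‖ ≤ ε := by
      have e : φ k - χ k * φ k = ((1 - χ k : ℝ) : ℂ) * φ k := by push_cast; ring
      rw [e, norm_mul, Complex.norm_real, Real.norm_eq_abs, abs_of_nonneg (by linarith [hχ1 k])]
      rcases le_or_gt |k| R with h | h
      · have : χ k = 1 := by
          simp only [χ]; rw [min_eq_left (by linarith), max_eq_right zero_le_one]
        simp [this, hε.le]
      · exact (mul_le_of_le_one_left (norm_nonneg _) (by linarith [hχ0 k])).trans (hR k h).le
    have h2 := g2 k
    rw [dist_eq_norm, norm_sub_rev] at h2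
    calc ‖φ k - g k‖ = ‖(φ k - χ k * φ k) + (χ k * φ k - g k)‖ := by congr 1; ring
      _ ≤ _ := (norm_add_le _ _).trans (by gcongr)

lemma WN.of_smooth (h1 : HasCompactSupport g) (h2 : ContDiff ℝ (⊤ : ℕ∞) g) : ∃ r, WN g r := by
  have h3 : ContDiff ℝ (⊤ : ℕ∞) (deriv g) := by
    exact (contDiff_infty_iff_deriv.1 h2).2
  have h4 : Continuous (deriv (deriv g)) := h3.continuous_deriv (by simp)
  exact ⟨_, WN.of_deriv (ψ := g) (fun k => (h2.differentiable (by simp) k).hasDerivAt)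
    (fun k => (h3.differentiable (by simp) k).hasDerivAt)
    (h2.continuous.integrable_of_hasCompactSupport h1)
    (h3.continuous.integrable_of_hasCompactSupport h1.deriv)
    (h4.integrable_of_hasCompactSupport h1.deriv.deriv)⟩

/-- Continuous logarithms, with a limit at infinity, of functions in the Wiener class. -/
lemma WN.log {φ : ℝ → ℂ} {a : ℂ} (hφ : Continuous φ) (hl : Tendsto φ (cocompact ℝ) (𝓝 a))
    (hF : WN (fun k => Complex.exp (φ k)) r) :
    ∃ u, Integrable u ∧ ∀ k : ℝ, φ k = a + ft u k := by
  obtain ⟨g, g1, g2, g3⟩ := exists_smooth_uniform_approx (φ := fun k => φ k - a)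
    (hφ.sub continuous_const) (by simpa using hl.sub_const a) (ε := 1 / 8) (by norm_num)
  obtain ⟨t, ht⟩ := WN.of_smooth g1 g2
  obtain ⟨q, hq⟩ := (((WN.const a).add ht).const_mul (-1)).exp
  set h : ℝ → ℂ := fun k => Complex.exp (φ k - a - g k) - 1 with hh
  have Wh : WN h _ := ((hF.mul hq).add (WN.const (-1))).congr fun k => by
    simp only [hh]; rw [← Complex.exp_add, sub_eq_add_neg]; congr 2; ring
  have hb : ∀ k, ‖h k‖ ≤ 1 / 2 := fun k => by
    have := g3 k
    have h1 := Complex.norm_exp_sub_one_le (x := φ k - a - g k) (by linarith)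
    simp only [hh]; linarith
  obtain ⟨s, hs⟩ := Wh.series (by norm_num : (1:ℝ) / 2 < 1) hb (fun n => (-1) ^ (n + 1) / n)
    (fun n => by
      rw [norm_div, norm_pow, norm_neg, norm_one, one_pow, Complex.norm_natCast]
      rcases n.eq_zero_or_pos with rfl | hn
      · simp
      · rw [div_le_one (by exact_mod_cast hn)]; exact_mod_cast hn)
    (g := fun k => Complex.log (1 + h k)) fun k => by
      refine (Complex.hasSum_taylorSeries_log (z := h k) ((hb k).trans_lt (by norm_num))).congr_fun
        fun n => by ring
  have hlog : ∀ k, Complex.log (1 + h k) = φ k - a - g k := fun k => by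
    simp only [hh]
    rw [add_sub_cancel, Complex.log_exp]
    all_goals
      have h1 := (abs_le.1 (Complex.abs_im_le_norm (φ k - a - g k)))
      have := g3 k
      have := Real.pi_gt_three
      linarith [h1.1, h1.2]
  have key : WN (fun k => φ k - a) _ := (ht.add hs).congr fun k => by rw [hlog]; ring
  obtain ⟨b, u, hu, -, e⟩ := key
  refine ⟨u, hu, fun k => ?_⟩
  have hb0 : b = 0 := by
    have h1 := (tendsto_ft_real u).const_add b
    have h2 := hl.sub_const a
    rw [add_zero] at h1; rw [sub_self] at h2
    exact tendsto_nhds_unique h1 (h2.congr e)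
  have := e k
  rw [hb0, zero_add] at this
  linear_combination this

/-! ### Wiener-Hopf factorization -/

lemma Wie.exp_P (hF : Wie .P 0 F) : Wie .P 1 (fun k => Complex.exp (F k)) := by
  obtain ⟨r, hr⟩ := hF.real.wn
  obtain ⟨s, hs⟩ := hr.exp
  obtain ⟨b, hb⟩ := hs.wie
  have hb' : Wie .R b (fun k => Complex.exp (F k)) := hb.congr fun k hk => by
    have : k = (k.re : ℂ) := Complex.ext rfl (by simpa [Dom.R] using hk)
    rw [← this]
  have e1 : b = 1 := by
    have := (Complex.continuous_exp.tendsto 0).comp hF.real.tendsto_real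
    rw [Complex.exp_zero] at this
    exact tendsto_nhds_unique hb'.tendsto_real this
  subst e1
  refine hb'.of_analytic hF.continuousOn.cexp hF.differentiableOn_P.cexp ?_
  have := (Complex.continuous_exp.tendsto 0).comp hF.tendsto_P
  rwa [Complex.exp_zero] at this

lemma Wie.to_M (hF : Wie .P c F) : Wie .M c (fun k => F (-k)) := by
  obtain ⟨u, hu, e⟩ := hF
  refine ⟨fun γ => u (-γ), ⟨hu.int.comp_neg, fun γ h => hu.supp _ ?_⟩, fun k hk => ?_⟩
  · simpa [Dom.M, Dom.P] using h
  · simp only [e (-k) (by simpa [Dom.M, Dom.P] using hk)]; congr 1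
    rw [← ft_neg_neg u (-k), neg_neg]

lemma Wie.exp_M (hF : Wie .M 0 F) : Wie .M 1 (fun k => Complex.exp (F k)) := by
  simpa using hF.of_M.exp_P.to_M

lemma IsWienerHopf.unique {A B : (ℂ → ℂ) × (ℂ → ℂ)} (hA : IsWienerHopf f A)
    (hB : IsWienerHopf f B) :
    (∀ k : ℂ, 0 ≤ k.im → A.1 k = B.1 k) ∧ ∀ k : ℂ, k.im ≤ 0 → A.2 k = B.2 k := by
  have key := eq_const_of_glue (f := fun k => A.1 k / B.1 k) (g := fun k => B.2 k / A.2 k) (c := 1)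
    (hA.contP.div hB.contP hB.nzP) (hB.contM.div hA.contM hA.nzM)
    (hA.analP.div hB.analP fun k hk => hB.nzP k (le_of_lt hk))
    (hB.analM.div hA.analM fun k hk => hA.nzM k (le_of_lt hk))
    (by have := hA.limP.div hB.limP one_ne_zero; rw [div_one] at this; exact this)
    (by have := hB.limM.div hA.limM one_ne_zero; rw [div_one] at this; exact this)
    (fun k => by
      rw [div_eq_div_iff (hB.nzP _ (by simp)) (hA.nzM _ (by simp)), ← hA.fact, hB.fact]; ring)
  refine ⟨fun k hk => ?_, fun k hk => ?_⟩
  · have := key.1 k hk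
    exact (div_eq_one_iff_eq (hB.nzP k hk)).1 this
  · have := key.2 k hk
    exact ((div_eq_one_iff_eq (hA.nzM k hk)).1 this).symm

/-- Existence of the Wiener-Hopf factorization, with factors in the Wiener classes of the two
half-planes. -/
lemma wienerHopf_spec (hF : Wie .R 1 F) (hf : ∀ k : ℝ, F k = f k) (hw : HasWindingNumber f 0) :
    IsWienerHopf f (wienerHopf f) ∧ Wie .P 1 (wienerHopf f).1 ∧
      Wie .P 1 (fun k => ((wienerHopf f).1 k)⁻¹) ∧ Wie .M 1 (wienerHopf f).2 ∧
      Wie .M 1 (fun k => ((wienerHopf f).2 k)⁻¹) := by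
  obtain ⟨φ, hφ, he, a, b, ha, hb, hab⟩ := hw
  have hab' : b = a := by simpa [sub_eq_zero] using hab
  rw [hab'] at hb
  have hl : Tendsto φ (cocompact ℝ) (𝓝 a) := by
    rw [cocompact_eq_atBot_atTop]; exact ha.sup hb
  obtain ⟨r, hr⟩ := hF.wn
  obtain ⟨u, hu, e⟩ := WN.log hφ hl (hr.congr fun k => by rw [he, hf])
  have hea : Complex.exp a = 1 := by
    have h1 := (Complex.continuous_exp.tendsto a).comp hl
    exact tendsto_nhds_unique h1 (hF.tendsto_real.congr fun k => by simp [he, hf])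
  obtain ⟨v, w, hv, hw, -, hvw⟩ := exists_split hu
  have Wv : Wie .P 0 (ft v) := ⟨v, hv, by simp⟩
  have Ww : Wie .M 0 (ft w) := ⟨w, hw, by simp⟩
  have Wv' : Wie .P 0 (fun k => -ft v k) := by simpa using Wv.neg
  have Ww' : Wie .M 0 (fun k => -ft w k) := by simpa using Ww.neg
  set A : (ℂ → ℂ) × (ℂ → ℂ) := (fun k => Complex.exp (ft v k), fun k => Complex.exp (ft w k))
  have hA : IsWienerHopf f A :=
    { contP := Wv.exp_P.continuousOn
      contM := Ww.exp_M.continuousOn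
      analP := Wv.exp_P.differentiableOn_P
      analM := Ww.exp_M.differentiableOn_M
      nzP := fun k _ => Complex.exp_ne_zero _
      nzM := fun k _ => Complex.exp_ne_zero _
      limP := Wv.exp_P.tendsto_P
      limM := Ww.exp_M.tendsto_M
      fact := fun k => by
        rw [← he k, e k, hvw k, Complex.exp_add, hea, one_mul, Complex.exp_add] }
  have hW : IsWienerHopf f (wienerHopf f) := Classical.epsilon_spec ⟨A, hA⟩
  obtain ⟨u1, u2⟩ := hW.unique hA
  refine ⟨hW, Wv.exp_P.congr fun k hk => (u1 k hk).symm, Wv'.exp_P.congr fun k hk => ?_,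
    Ww.exp_M.congr fun k hk => (u2 k hk).symm, Ww'.exp_M.congr fun k hk => ?_⟩
  · simp only [u1 k hk, A, Complex.exp_neg]
  · simp only [u2 k hk, A, Complex.exp_neg]

end AKNS

namespace AKNS

/-! ### A weight for Volterra equations -/

lemma integral_Ioi_eq_sub {E : Type*} [NormedAddCommGroup E] [NormedSpace ℝ E] {f : ℝ → E}
    (hf : Integrable f) (x : ℝ) :
    ∫ y in Ioi x, f y = (∫ y in Ioi 0, f y) - ∫ y in (0:ℝ)..x, f y := by
  rw [← intervalIntegral.integral_interval_add_Ioi (a := 0) (b := x) hf.integrableOn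
    hf.integrableOn]
  abel

lemma continuous_integral_Ioi {E : Type*} [NormedAddCommGroup E] [NormedSpace ℝ E]
    {f : ℝ → E} (hf : Integrable f) : Continuous fun x => ∫ y in Ioi x, f y := by
  have : (fun x => ∫ y in Ioi x, f y) = fun x => (∫ y in Ioi 0, f y) - ∫ y in (0:ℝ)..x, f y :=
    funext fun x => integral_Ioi_eq_sub hf x
  rw [this]
  exact continuous_const.sub (intervalIntegral.continuous_primitive
    (fun a b => hf.intervalIntegrable) 0)

lemma absolutelyContinuous_const {X : Type*} [PseudoMetricSpace X] (c : X) (a b : ℝ) :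
    AbsolutelyContinuousOnInterval (fun _ => c) a b := by
  have : LipschitzOnWith 0 (fun _ : ℝ => c) (uIcc a b) := (LipschitzWith.const c).lipschitzOnWith
  exact this.absolutelyContinuousOnInterval

lemma exists_volterra_weight {a : ℝ → ℝ} (ha : Integrable a) (h0 : ∀ x, 0 ≤ a x) :
    ∃ (W : ℝ → ℝ) (C : ℝ), Continuous W ∧ (∀ x, 1 ≤ W x) ∧ (∀ x, W x ≤ C) ∧
      ∀ x, ∫ y in Ioi x, a y * W y ≤ W x / 2 := by
  set U : ℝ → ℝ := fun x => 1 + ∫ y in Ioi x, a y with hU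
  set c : ℝ := 1 + ∫ y, a y with hc
  have cU : Continuous U := continuous_const.add (continuous_integral_Ioi ha)
  have U1 : ∀ x, 1 ≤ U x := fun x => by
    have : 0 ≤ ∫ y in Ioi x, a y := integral_nonneg h0
    simp only [hU]; linarith
  have Uc : ∀ x, U x ≤ c := fun x => by
    have := setIntegral_le_integral (s := Ioi x) ha (.of_forall h0)
    simp only [hU, hc]; linarith
  have hc1 : 1 ≤ c := (U1 0).trans (Uc 0)
  obtain ⟨N, hN⟩ := exists_nat_ge (2 * c)
  have hU' : U = fun x => (1 + ∫ y in Ioi 0, a y) + -(∫ y in (0:ℝ)..x, a y) := by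
    ext x; simp only [hU]; rw [integral_Ioi_eq_sub ha]; ring
  have acU : ∀ s t, AbsolutelyContinuousOnInterval U s t := by
    intro s t
    have h1 : IntervalIntegrable a volume (min 0 (min s t)) (max 0 (max s t)) :=
      ha.intervalIntegrable
    have h2 := h1.absolutelyContinuousOnInterval_intervalIntegral (c := 0)
      (by rw [uIcc_of_le (by simp)]; simp)
    have h3 := (absolutelyContinuous_const (1 + ∫ y in Ioi 0, a y) s t).fun_add
      (h2.mono (c := s) (d := t) (by
        rw [uIcc_of_le (a := min 0 (min s t)) (by simp)]
        exact Icc_subset_Icc (by simp) (by simp))).fun_neg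
    rw [hU']; exact h3
  have acP : ∀ n : ℕ, ∀ s t, AbsolutelyContinuousOnInterval (fun x => U x ^ n) s t := by
    intro n s t
    induction n with
    | zero => simpa using absolutelyContinuous_const (1:ℝ) s t
    | succ n ih => simpa [pow_succ] using ih.fun_mul (acU s t)
  have dU : ∀ᵐ x, HasDerivAt U (-a x) x := by
    filter_upwards [LocallyIntegrable.ae_hasDerivAt_integral ha.locallyIntegrable] with x hx
    rw [hU']; exact (hx 0).neg.const_add _
  refine ⟨fun x => U x ^ N, c ^ N, by fun_prop, fun x => one_le_pow₀ (U1 x),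
    fun x => pow_le_pow_left₀ (by linarith [U1 x]) (Uc x) N, fun x => ?_⟩
  have hint : Integrable fun y => a y * U y ^ N := by
    refine ha.mul_bdd (c := c ^ N) (cU.pow N).aestronglyMeasurable (.of_forall fun y => ?_)
    rw [Real.norm_eq_abs, abs_of_nonneg (by have := U1 y; positivity)]
    exact pow_le_pow_left₀ (by linarith [U1 y]) (Uc y) N
  refine le_of_tendsto (intervalIntegral_tendsto_integral_Ioi x hint.integrableOn tendsto_id)
    (.of_forall fun b => ?_)
  have key := (acP (N + 1) x b).integral_deriv_eq_sub
  have e1 : ∫ y in x..b, deriv (fun x => U x ^ (N + 1)) y =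
      -((N + 1) * ∫ y in x..b, a y * U y ^ N) := by
    rw [← intervalIntegral.integral_const_mul, ← intervalIntegral.integral_neg]
    refine intervalIntegral.integral_congr_ae ?_
    filter_upwards [dU] with y hy _
    rw [HasDerivAt.deriv (f := fun x => U x ^ (N + 1)) (hy.pow (N + 1))]; push_cast; simp; ring
  rw [e1] at key
  simp only [id]
  have h1 : 0 ≤ U b ^ (N + 1) := by have := U1 b; positivity
  have h2 : U x ^ (N + 1) ≤ U x ^ N * c := by
    rw [pow_succ]; have := U1 x; gcongr; exact Uc x
  have h3 : (N + 1) * ∫ y in x..b, a y * U y ^ N ≤ U x ^ N * c := by linarith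
  have h4 : 0 < U x ^ N := by have := U1 x; positivity
  rw [← sub_nonneg]
  have h5 : 0 ≤ ((N:ℝ) + 1) * (U x ^ N / 2 - ∫ y in x..b, a y * U y ^ N) := by nlinarith
  exact nonneg_of_mul_nonneg_right h5 (by positivity)

/-- Uniqueness for Volterra inequalities. -/
lemma volterra_unique {a h : ℝ → ℝ} (ha : Integrable a) (h0 : ∀ x, 0 ≤ a x)
    (hm : AEStronglyMeasurable h volume) {B : ℝ} (hB : ∀ x, |h x| ≤ B)
    (hle : ∀ x, h x ≤ ∫ y in Ioi x, a y * h y) (x : ℝ) : h x ≤ 0 := by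
  obtain ⟨W, C, cW, W1, WC, hW⟩ := exists_volterra_weight ha h0
  have W0 : ∀ x, 0 < W x := fun x => by linarith [W1 x]
  set s := ⨆ x, h x / W x with hs
  have hbdd : BddAbove (range fun x => h x / W x) := by
    refine ⟨B, ?_⟩
    rintro _ ⟨y, rfl⟩
    have hB0 : 0 ≤ B := (abs_nonneg _).trans (hB y)
    rw [div_le_iff₀ (W0 y)]
    nlinarith [W1 y, (abs_le.1 (hB y)).2]
  have hle' : ∀ y, h y ≤ s * W y := fun y => by
    have := le_ciSup hbdd y
    rwa [div_le_iff₀ (W0 y)] at this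
  by_contra hx
  rw [not_le] at hx
  have hspos : 0 < s := by
    have := hle' x
    by_contra hs'
    nlinarith [W0 x]
  have i1 : Integrable fun y => a y * h y := ha.mul_bdd hm (.of_forall fun y => hB y)
  have i2 : Integrable fun y => a y * W y := ha.mul_bdd cW.aestronglyMeasurable
    (.of_forall fun y => by rw [Real.norm_eq_abs, abs_of_pos (W0 y)]; exact WC y)
  have hhalf : ∀ z, h z / W z ≤ s / 2 := by
    intro z
    rw [div_le_iff₀ (W0 z)]
    calc h z ≤ ∫ y in Ioi z, a y * h y := hle z
      _ ≤ ∫ y in Ioi z, s * (a y * W y) := by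
          refine setIntegral_mono i1.integrableOn (i2.const_mul s).integrableOn fun y => ?_
          have := mul_le_mul_of_nonneg_left (hle' y) (h0 y)
          simp only; linarith
      _ = s * ∫ y in Ioi z, a y * W y := integral_const_mul _ _
      _ ≤ s * (W z / 2) := by gcongr; exact hW z
      _ = _ := by ring
  have := ciSup_le hhalf
  rw [← hs] at this
  linarith

/-! ### Shifts on `L¹` -/

/-- The shift `u(γ) ↦ u(γ - s)` on `L¹(ℝ)`. -/
def shift (s : ℝ) : E1 →L[ℂ] E1 :=
  (Lp.compMeasurePreservingₗᵢ ℂ (fun γ : ℝ => γ - s)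
    (measurePreserving_sub_right volume s)).toContinuousLinearMap

lemma shift_eq (s : ℝ) (f : E1) : shift s f = Lp.compMeasurePreserving (fun γ : ℝ => γ - s)
    (measurePreserving_sub_right volume s) f := rfl

lemma shift_ae (s : ℝ) (f : E1) : shift s f =ᵐ[volume] fun γ => f (γ - s) :=
  Lp.coeFn_compMeasurePreserving f (measurePreserving_sub_right volume s)

lemma norm_shift (s : ℝ) (f : E1) : ‖shift s f‖ = ‖f‖ :=
  (Lp.compMeasurePreservingₗᵢ ℂ (fun γ : ℝ => γ - s)
    (measurePreserving_sub_right volume s)).norm_map f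

lemma continuous_shift : Continuous fun z : ℝ × E1 => shift z.1 z.2 := by
  simp only [shift_eq]
  let g : ℝ × E1 → C(ℝ, ℝ) := fun z => ⟨fun γ => γ - z.1, by fun_prop⟩
  have hg : Continuous g := by
    let G : C((ℝ × E1) × ℝ, ℝ) := ⟨fun w => w.2 - w.1.1, by fun_prop⟩
    exact G.curry.continuous
  exact Continuous.compMeasurePreservingLp (f := fun z : ℝ × E1 => z.2) continuous_snd hg
    (fun z => measurePreserving_sub_right volume z.1) (by simp)

lemma shift_shift (s t : ℝ) (f : E1) : shift s (shift t f) = shift (t + s) f := by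
  refine Lp.ext ?_
  have h1 := (measurePreserving_sub_right volume s).quasiMeasurePreserving.ae_eq (shift_ae t f)
  filter_upwards [shift_ae s (shift t f), shift_ae (t + s) f, h1] with γ h2 h3 h4
  rw [h2, h3]
  simp only [Function.comp] at h4
  rw [h4]; congr 1; ring

/-- Classes supported in the positive half-line, in terms of functionals. -/
def Pos : Set E1 := {f | ∀ w hw hb, (∀ γ : ℝ, 0 < γ → w γ = 0) → wInt w hw hb f = 0}

lemma isClosed_Pos : IsClosed Pos := by
  simp only [Pos, ofPred_forall]
  exact isClosed_iInter fun w => isClosed_iInter fun hw => isClosed_iInter fun hb =>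
    isClosed_iInter fun _ => isClosed_eq (wInt w hw hb).continuous continuous_const

lemma Pos.add {f g : E1} (hf : f ∈ Pos) (hg : g ∈ Pos) : f + g ∈ Pos := fun w hw hb h => by
  rw [map_add, hf w hw hb h, hg w hw hb h, add_zero]

lemma Pos.smul {f : E1} (c : ℂ) (hf : f ∈ Pos) : c • f ∈ Pos := fun w hw hb h => by
  rw [map_smul, hf w hw hb h, smul_zero]

lemma Pos.zero : (0 : E1) ∈ Pos := fun _ _ _ _ => map_zero _

lemma Pos.sum {ι : Type*} (s : Finset ι) {f : ι → E1} (h : ∀ i ∈ s, f i ∈ Pos) :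
    ∑ i ∈ s, f i ∈ Pos := fun w hw hb h' => by
  rw [map_sum]; exact Finset.sum_eq_zero fun i hi => h i hi w hw hb h'

lemma wInt_shift (w : ℝ → ℂ) (hw hb) (s : ℝ) (f : E1) : wInt w hw hb (shift s f) =
    wInt (fun γ => w (γ + s)) (hw.comp_quasiMeasurePreserving
      (measurePreserving_add_right volume s).quasiMeasurePreserving) (fun _ => hb _) f := by
  rw [wInt_apply, wInt_apply]
  rw [← integral_sub_right_eq_self (fun γ => w (γ + s) * f γ) s]
  refine integral_congr_ae ?_
  filter_upwards [shift_ae s f] with γ hγ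
  rw [hγ]; simp

lemma Pos.shift {f : E1} {s : ℝ} (hs : 0 ≤ s) (hf : f ∈ Pos) : shift s f ∈ Pos :=
  fun w hw hb h => by
    rw [wInt_shift]
    exact hf _ _ _ fun γ hγ => h _ (by linarith)

lemma Pos.ae {f : E1} (hf : f ∈ Pos) : ∀ᵐ γ : ℝ, γ ≤ 0 → f γ = 0 := by
  have hm := (Lp.stronglyMeasurable f)
  set w : ℝ → ℂ := (Iic (0:ℝ)).indicator fun γ => star (f γ) / ‖f γ‖ with hw
  have hwm : StronglyMeasurable w := by
    refine StronglyMeasurable.indicator ?_ measurableSet_Iic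
    refine StronglyMeasurable.div (hm.star) ?_
    exact Complex.continuous_ofReal.comp_stronglyMeasurable hm.norm
  have hb : ∀ γ, ‖w γ‖ ≤ 1 := fun γ => by
    refine (norm_indicator_le_norm_self _ _).trans ?_
    rw [norm_div, norm_star, Complex.norm_real, norm_norm]
    exact div_self_le_one _
  have h0 := hf w hwm.aestronglyMeasurable hb fun γ hγ => by simp [hw, hγ]
  rw [wInt_apply] at h0
  have e : ∀ γ, w γ * f γ = (((Iic (0:ℝ)).indicator (fun γ => ‖f γ‖) γ : ℝ) : ℂ) := by
    intro γ
    by_cases hγ : γ ∈ Iic (0:ℝ)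
    · simp only [hw, indicator_of_mem hγ]
      by_cases hz : f γ = 0
      · simp [hz]
      · have : (‖f γ‖ : ℂ) ≠ 0 := by simpa using hz
        field_simp
        exact Complex.conj_mul' _
    · simp [hw, indicator_of_notMem hγ]
  simp only [e] at h0
  rw [integral_complex_ofReal, Complex.ofReal_eq_zero] at h0
  rw [integral_eq_zero_iff_of_nonneg (fun γ => indicator_nonneg (fun _ _ => norm_nonneg _) _)
    ((L1.integrable_coeFn f).norm.indicator measurableSet_Iic)] at h0
  filter_upwards [h0] with γ hγ hγ0
  have : γ ∈ Iic (0:ℝ) := hγ0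
  simpa [indicator_of_mem this] using hγ

end AKNS

namespace AKNS

/-! ### Volterra equations with values in `L¹` -/

section Volt

variable {ι : Type*} [Fintype ι] {q : ℝ → ι → ι → ℂ} {θ : ι → ℝ} {K : ℝ → ι → E1} {B : ℝ}

/-- `∫_x^∞ T_{θ_i (y - x)} (Σ_l q_{il}(y) K_l(y)) dy`. -/
def volt (q : ℝ → ι → ι → ℂ) (θ : ι → ℝ) (K : ℝ → ι → E1) (x : ℝ) (i : ι) : E1 :=
  ∫ y in Ioi x, shift (θ i * (y - x)) (∑ l, q y i l • K y l)

/-- The sum of the norms of the entries of `q`. -/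
def qnorm (q : ℝ → ι → ι → ℂ) (y : ℝ) : ℝ := ∑ i, ∑ l, ‖q y i l‖

lemma qnorm_nonneg (y : ℝ) : 0 ≤ qnorm q y := by unfold qnorm; positivity

lemma integrable_qnorm (hq : ∀ i l, Integrable fun y => q y i l) : Integrable (qnorm q) :=
  integrable_finsetSum _ fun i _ => integrable_finsetSum _ fun l _ => (hq i l).norm

lemma sum_norm_le_qnorm (i : ι) (y : ℝ) : ∑ l, ‖q y i l‖ ≤ qnorm q y :=
  Finset.single_le_sum (f := fun i => ∑ l, ‖q y i l‖) (fun _ _ => by positivity) (Finset.mem_univ i)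

lemma norm_sum_smul_le {E : Type*} [NormedAddCommGroup E] [NormedSpace ℂ E] {v : ι → E} {b : ℝ}
    (hv : ∀ l, ‖v l‖ ≤ b) (i : ι) (y : ℝ) : ‖∑ l, q y i l • v l‖ ≤ qnorm q y * b := by
  refine (norm_sum_le _ _).trans ?_
  by_cases hb : 0 ≤ b
  · calc ∑ l, ‖q y i l • v l‖ ≤ ∑ l, ‖q y i l‖ * b := by
          refine Finset.sum_le_sum fun l _ => ?_
          rw [norm_smul]; gcongr; exact hv l
      _ ≤ _ := by rw [← Finset.sum_mul]; gcongr; exact sum_norm_le_qnorm i y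
  · rcases isEmpty_or_nonempty ι with h | ⟨⟨l⟩⟩
    · simp [qnorm]
    · exact absurd ((norm_nonneg _).trans (hv l)) hb

lemma integrable_sum_smul {E : Type*} [NormedAddCommGroup E] [NormedSpace ℂ E]
    (hq : ∀ i l, Integrable fun y => q y i l) {v : ℝ → ι → E} (hv : Continuous v)
    (hB : ∀ y l, ‖v y l‖ ≤ B) (i : ι) : Integrable fun y => ∑ l, q y i l • v y l := by
  have h1 : ∀ l, AEStronglyMeasurable (fun y => q y i l • v y l) volume := fun l =>
    (hq i l).aestronglyMeasurable.smul (continuous_pi_iff.1 hv l).aestronglyMeasurable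
  have h2 : Integrable (fun y => qnorm q y * B) := (integrable_qnorm hq).mul_const B
  exact h2.mono'
    (Finset.aestronglyMeasurable_fun_sum _ fun l _ => h1 l)
    (.of_forall fun y => norm_sum_smul_le (hB y) i y)

lemma integrable_shift {G : ℝ → E1} (hG : Integrable G) {φ : ℝ → ℝ} (hφ : Continuous φ) :
    Integrable fun y => shift (φ y) (G y) := by
  have h1 : AEStronglyMeasurable (fun y => (φ y, G y)) volume :=
    hφ.aestronglyMeasurable.prodMk hG.1
  have h2 := continuous_shift.comp_aestronglyMeasurable h1
  simp only at h2
  exact Integrable.mono hG h2 (.of_forall fun y => (norm_shift _ _).le)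

lemma volt_eq (hq : ∀ i l, Integrable fun y => q y i l) (hK : Continuous K)
    (hB : ∀ y l, ‖K y l‖ ≤ B) (x : ℝ) (i : ι) :
    volt q θ K x i = shift (-(θ i * x)) (∫ y in Ioi x, shift (θ i * y) (∑ l, q y i l • K y l)) := by
  rw [← ContinuousLinearMap.integral_comp_comm]
  · unfold volt
    congr 1; ext1 y
    rw [shift_shift]; congr 1; ring_nf
  · exact (integrable_shift (integrable_sum_smul hq hK hB i) (by fun_prop)).integrableOn

lemma continuous_volt (hq : ∀ i l, Integrable fun y => q y i l) (hK : Continuous K)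
    (hB : ∀ y l, ‖K y l‖ ≤ B) : Continuous (volt q θ K) := by
  refine continuous_pi fun i => ?_
  simp only [volt_eq hq hK hB]
  have h1 := continuous_integral_Ioi
    (integrable_shift (integrable_sum_smul hq hK hB i) (φ := fun y => θ i * y) (by fun_prop))
  have h2 : Continuous fun x : ℝ => -(θ i * x) := by fun_prop
  exact continuous_shift.comp (h2.prodMk h1)

lemma norm_volt_le {D : ℝ → ℝ}
    (hD : ∀ y l, ‖K y l‖ ≤ D y) (hi : Integrable fun y => qnorm q y * D y) (x : ℝ) (i : ι) :
    ‖volt q θ K x i‖ ≤ ∫ y in Ioi x, qnorm q y * D y := by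
  refine norm_integral_le_of_norm_le hi.integrableOn (.of_forall fun y => ?_)
  rw [norm_shift]
  exact norm_sum_smul_le (hD y) i y

lemma Pos.volt (hq : ∀ i l, Integrable fun y => q y i l) (hθ : ∀ i, 0 ≤ θ i) (hK : Continuous K)
    (hB : ∀ y l, ‖K y l‖ ≤ B) (hp : ∀ y l, K y l ∈ Pos) (x : ℝ) (i : ι) :
    volt q θ K x i ∈ Pos := by
  intro w hw hb h'
  have hint : IntegrableOn (fun y => AKNS.shift (θ i * (y - x)) (∑ l, q y i l • K y l)) (Ioi x) :=
    (integrable_shift (integrable_sum_smul hq hK hB i) (by fun_prop)).integrableOn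
  rw [AKNS.volt, ← ContinuousLinearMap.integral_comp_comm _ hint]
  refine setIntegral_eq_zero_of_forall_eq_zero fun y hy => ?_
  have hy' : x < y := hy
  exact Pos.shift (mul_nonneg (hθ i) (by linarith))
    (Pos.sum _ fun l _ => Pos.smul _ (hp y l)) w hw hb h'

open scoped BoundedContinuousFunction NNReal

lemma exists_kernel (hq : ∀ i l, Integrable fun y => q y i l) (hθ : ∀ i, 0 ≤ θ i)
    {g : ℝ → ι → E1} (hg : Continuous g) {Bg : ℝ} (hgB : ∀ x i, ‖g x i‖ ≤ Bg)
    (hgp : ∀ x i, g x i ∈ Pos) :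
    ∃ K : ℝ → ι → E1, Continuous K ∧ (∃ B, ∀ x i, ‖K x i‖ ≤ B) ∧ (∀ x i, K x i ∈ Pos) ∧
      ∀ x i, K x i = g x i - volt q θ K x i := by
  obtain ⟨W, C, cW, W1, WC, hW⟩ := exists_volterra_weight (integrable_qnorm hq) qnorm_nonneg
  have W0 : ∀ x, 0 < W x := fun x => by linarith [W1 x]
  have hC0 : 0 ≤ C := (W0 0).le.trans (WC 0)
  have hqn := integrable_qnorm hq
  have hqW : Integrable fun y => qnorm q y * W y := hqn.mul_bdd cW.aestronglyMeasurable
    (.of_forall fun y => by rw [Real.norm_eq_abs, abs_of_pos (W0 y)]; exact WC y)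
  -- the unweighted function
  let U : (ℝ →ᵇ (ι → E1)) → ℝ → ι → E1 := fun H y l => (W y : ℂ) • H y l
  have cU : ∀ H, Continuous (U H) := fun H => continuous_pi fun l =>
    (Complex.continuous_ofReal.comp cW).smul ((continuous_apply l).comp H.continuous)
  have nU : ∀ H y l, ‖U H y l‖ ≤ ‖H‖ * W y := fun H y l => by
    simp only [U]
    rw [norm_smul, Complex.norm_real, Real.norm_eq_abs, abs_of_pos (W0 y), mul_comm]
    have := W0 y
    gcongr
    exact (norm_le_pi_norm _ _).trans (H.norm_coe_le_norm y)
  have bU : ∀ H y l, ‖U H y l‖ ≤ ‖H‖ * C := fun H y l =>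
    (nU H y l).trans (by gcongr; exact WC y)
  have vU : ∀ H x i, ‖volt q θ (U H) x i‖ ≤ ‖H‖ * (W x / 2) := fun H x i => by
    refine (norm_volt_le (nU H) ?_ x i).trans ?_
    · exact (hqW.const_mul ‖H‖).congr (.of_forall fun y => by simp only; ring)
    · calc ∫ y in Ioi x, qnorm q y * (‖H‖ * W y) = ‖H‖ * ∫ y in Ioi x, qnorm q y * W y := by
            rw [← integral_const_mul]; congr 1; ext y; ring
        _ ≤ _ := by gcongr; exact hW x
  have cinv : Continuous fun x => ((W x : ℂ))⁻¹ :=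
    (Complex.continuous_ofReal.comp cW).inv₀ fun x => by
      simpa using (W0 x).ne'
  have ninv : ∀ x, ‖((W x : ℂ))⁻¹‖ = (W x)⁻¹ := fun x => by
    rw [norm_inv, Complex.norm_real, Real.norm_eq_abs, abs_of_pos (W0 x)]
  let T : (ℝ →ᵇ (ι → E1)) → (ℝ →ᵇ (ι → E1)) := fun H =>
    BoundedContinuousFunction.ofNormedAddCommGroup
      (fun x => (W x : ℂ)⁻¹ • (g x - volt q θ (U H) x))
      (cinv.smul (hg.sub (continuous_volt hq (cU H) (bU H)))) (max Bg 0 + ‖H‖ * (C / 2)) (by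
        intro x
        rw [norm_smul, ninv]
        refine (mul_le_of_le_one_left (norm_nonneg _) (inv_le_one_of_one_le₀ (W1 x))).trans ?_
        refine (norm_sub_le _ _).trans (add_le_add ?_ ?_)
        · exact (pi_norm_le_iff_of_nonneg (le_max_right _ _)).2 fun i =>
            (hgB x i).trans (le_max_left _ _)
        · refine (pi_norm_le_iff_of_nonneg (by positivity)).2 fun i => (vU H x i).trans ?_
          gcongr; exact WC x)
  have Tapp : ∀ H x i, T H x i = (W x : ℂ)⁻¹ • (g x i - volt q θ (U H) x i) := fun _ _ _ => rfl
  have hTdist : ∀ H H', dist (T H) (T H') ≤ (1 / 2 : ℝ) * dist H H' := by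
    intro H H'
    rw [BoundedContinuousFunction.dist_le (by positivity)]
    intro x
    rw [dist_eq_norm]
    refine (pi_norm_le_iff_of_nonneg (by positivity)).2 fun i => ?_
    have hsub : volt q θ (U H) x i - volt q θ (U H') x i = volt q θ (U (H - H')) x i := by
      have hint : ∀ H, IntegrableOn
          (fun y => shift (θ i * (y - x)) (∑ l, q y i l • U H y l)) (Ioi x) := fun H =>
        (integrable_shift (integrable_sum_smul hq (cU H) (bU H) i) (by fun_prop)).integrableOn
      unfold volt
      rw [← integral_sub (hint H) (hint H')]
      congr 1; ext1 y
      rw [← map_sub, ← Finset.sum_sub_distrib]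
      congr 1
      refine Finset.sum_congr rfl fun l _ => ?_
      simp only [U, BoundedContinuousFunction.coe_sub, Pi.sub_apply, smul_sub]
    have e : T H x i - T H' x i = -((W x : ℂ)⁻¹ • volt q θ (U (H - H')) x i) := by
      rw [Tapp, Tapp, ← hsub, ← smul_sub, ← smul_neg]; congr 1; abel
    rw [Pi.sub_apply, e, norm_neg, norm_smul, ninv, dist_eq_norm]
    have h1 := vU (H - H') x i
    have h2 := W0 x
    rw [inv_mul_le_iff₀ h2]
    linarith
  let s : Set (ℝ →ᵇ (ι → E1)) := {H | ∀ x i, H x i ∈ Pos}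
  have hsc : IsClosed s := by
    have : s = ⋂ x, ⋂ i, {H : ℝ →ᵇ (ι → E1) | H x i ∈ Pos} := by
      ext H; simp [s]
    rw [this]
    refine isClosed_iInter fun x => isClosed_iInter fun i => isClosed_Pos.preimage ?_
    exact (continuous_apply i).comp (continuous_eval_const x)
  have hmaps : MapsTo T s s := fun H hH x i => by
    rw [Tapp]
    refine Pos.smul _ ?_
    rw [sub_eq_add_neg, ← neg_one_smul ℂ]
    exact Pos.add (hgp x i) (Pos.smul _ (Pos.volt hq hθ (cU H) (bU H)
      (fun y l => Pos.smul _ (hH y l)) x i))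
  have hcontr : ContractingWith (1 / 2 : ℝ≥0) (hmaps.restrict T s s) := by
    refine ⟨by rw [div_lt_one (by norm_num)]; norm_num, LipschitzWith.of_dist_le_mul fun H H' => ?_⟩
    exact hTdist H H'
  obtain ⟨H, hHs, hHf, -⟩ := hcontr.exists_fixedPoint' (x := 0) hsc.isComplete hmaps
    (fun x i => Pos.zero) (edist_ne_top _ _)
  refine ⟨U H, cU H, ⟨_, bU H⟩, fun x i => Pos.smul _ (hHs x i), fun x i => ?_⟩
  have h1 : T H x i = H x i := by rw [hHf]
  simp only [U]
  conv_lhs => rw [← h1, Tapp]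
  rw [smul_smul, mul_inv_cancel₀ (by have := (W0 x).ne'; exact_mod_cast this), one_smul]

/-! ### The source term -/

/-- Restriction to the positive half-line. -/
def cut : E1 →L[ℂ] E1 :=
  LinearMap.mkContinuous
    { toFun := fun f => ((L1.integrable_coeFn f).indicator (measurableSet_Ioi (a := (0:ℝ)))).toL1 _
      map_add' := fun f g => by
        rw [← Integrable.toL1_add]
        rw [Integrable.toL1_eq_toL1_iff]
        filter_upwards [Lp.coeFn_add f g] with γ hγ
        by_cases h : γ ∈ Ioi (0:ℝ)
        · simpa only [Pi.add_apply, indicator_of_mem h] using hγ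
        · simp only [Pi.add_apply, indicator_of_notMem h, add_zero]
      map_smul' := fun c f => by
        rw [RingHom.id_apply, ← Integrable.toL1_smul']
        rw [Integrable.toL1_eq_toL1_iff]
        filter_upwards [Lp.coeFn_smul c f] with γ hγ
        by_cases h : γ ∈ Ioi (0:ℝ)
        · simpa only [Pi.smul_apply, indicator_of_mem h] using hγ
        · simp only [Pi.smul_apply, indicator_of_notMem h, smul_zero] }
    1 fun f => by
      rw [one_mul]
      change ‖(((L1.integrable_coeFn f).indicator (measurableSet_Ioi (a := (0:ℝ)))).toL1 _ : E1)‖ ≤ _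
      rw [norm_toL1, L1.norm_eq_integral_norm]
      exact integral_mono ((L1.integrable_coeFn f).indicator measurableSet_Ioi).norm
        (L1.integrable_coeFn f).norm fun γ => norm_indicator_le_norm_self _ _

lemma cut_ae (f : E1) : cut f =ᵐ[volume] (Ioi (0:ℝ)).indicator f :=
  ((L1.integrable_coeFn f).indicator measurableSet_Ioi).coeFn_toL1

lemma norm_cut_le (f : E1) : ‖cut f‖ ≤ ‖f‖ := by
  simpa using cut.le_of_opNorm_le (LinearMap.mkContinuous_norm_le _ zero_le_one _) f

lemma cut_mem_Pos (f : E1) : cut f ∈ Pos := fun w hw hb h => by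
  rw [wInt_apply]
  refine integral_eq_zero_of_ae ?_
  filter_upwards [cut_ae f] with γ hγ
  rw [hγ]
  by_cases h' : γ ∈ Ioi (0:ℝ)
  · simp [h γ h']
  · simp [h']

/-- The function `-(1/t) φ(x + γ/t)` on `γ > 0`; it is zero for `t = 0`. -/
def srcFun (φ : ℝ → ℂ) (t : ℝ) (x : ℝ) : ℝ → ℂ :=
  (Ioi (0:ℝ)).indicator fun γ => -((t⁻¹ : ℝ) * φ (x + t⁻¹ * γ))

lemma exists_source {φ : ℝ → ℂ} (hφ : Integrable φ) (t : ℝ) :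
    ∃ g : ℝ → E1, Continuous g ∧ (∃ B, ∀ x, ‖g x‖ ≤ B) ∧ (∀ x, g x ∈ Pos) ∧
      ∀ x, g x =ᵐ[volume] srcFun φ t x := by
  by_cases ht : t = 0
  · refine ⟨fun _ => 0, continuous_const, ⟨0, by simp⟩, fun _ => Pos.zero, fun x => ?_⟩
    filter_upwards [Lp.coeFn_zero ℂ 1 (volume : Measure ℝ)] with γ hγ
    rw [hγ]; simp [srcFun, ht]
  have hi : Integrable fun γ => -((t⁻¹ : ℝ) * φ (t⁻¹ * γ) : ℂ) :=
    ((hφ.comp_mul_left' (inv_ne_zero ht)).const_mul _).neg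
  refine ⟨fun x => cut (shift (-(t * x)) (hi.toL1 _)), ?_, ⟨‖(hi.toL1 _ : E1)‖, fun x => ?_⟩,
    fun x => cut_mem_Pos _, fun x => ?_⟩
  · exact cut.continuous.comp (continuous_shift.comp
      ((by fun_prop : Continuous fun x : ℝ => -(t * x)).prodMk continuous_const))
  · exact (norm_cut_le _).trans (norm_shift _ _).le
  · have h1 := (measurePreserving_sub_right volume (-(t * x))).quasiMeasurePreserving.ae_eq
      hi.coeFn_toL1
    filter_upwards [cut_ae (shift (-(t * x)) (hi.toL1 _)), shift_ae (-(t * x)) (hi.toL1 _), h1]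
      with γ h2 h3 h4
    rw [h2, srcFun]
    by_cases h : γ ∈ Ioi (0:ℝ)
    · rw [indicator_of_mem h, indicator_of_mem h, h3]
      simp only [Function.comp] at h4
      rw [h4]
      congr 3; field_simp; ring
    · rw [indicator_of_notMem h, indicator_of_notMem h]

end Volt

end AKNS

namespace AKNS

/-! ### The Laplace functional -/

/-- `e^{ikγ}` cut off to `γ > 0`. -/
def cutExp (k : ℂ) : ℝ → ℂ := (Ioi (0:ℝ)).indicator fun γ => Complex.exp (Complex.I * k * γ)

lemma norm_cexp_I_le {k : ℂ} (hk : 0 ≤ k.im) {γ : ℝ} (hγ : 0 ≤ γ) :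
    ‖Complex.exp (Complex.I * k * γ)‖ ≤ 1 := by
  rw [norm_cexp_I, Real.exp_le_one_iff]
  have := mul_nonneg hk hγ
  linarith

lemma norm_cutExp_le {k : ℂ} (hk : 0 ≤ k.im) (γ : ℝ) : ‖cutExp k γ‖ ≤ 1 := by
  by_cases h : γ ∈ Ioi (0:ℝ)
  · rw [cutExp, indicator_of_mem h]
    exact norm_cexp_I_le hk (le_of_lt h)
  · simp [cutExp, indicator_of_notMem h]

lemma aestronglyMeasurable_cutExp (k : ℂ) : AEStronglyMeasurable (cutExp k) volume :=
  (continuous_cexp_I k).aestronglyMeasurable.indicator measurableSet_Ioi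

/-- `u ↦ ∫_{γ>0} e^{ikγ} u(γ) dγ`. -/
def lap (k : ℂ) (hk : 0 ≤ k.im) : E1 →L[ℂ] ℂ :=
  wInt (cutExp k) (aestronglyMeasurable_cutExp k) (norm_cutExp_le hk)

lemma L1_indicator {u : ℝ → ℂ} (hu : Integrable u) : Dom.P.L1 ((Ioi (0:ℝ)).indicator u) :=
  ⟨hu.indicator measurableSet_Ioi, fun _ h => indicator_of_notMem h _⟩

lemma lap_eq_ft (k : ℂ) (hk) (u : E1) : lap k hk u = ft ((Ioi (0:ℝ)).indicator u) k := by
  rw [lap, wInt_apply, ft]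
  congr 1; ext γ
  by_cases h : γ ∈ Ioi (0:ℝ)
  · rw [cutExp, indicator_of_mem h, indicator_of_mem h]
  · rw [cutExp, indicator_of_notMem h, indicator_of_notMem h, mul_zero, zero_mul]

lemma lap_shift {k : ℂ} (hk) {s : ℝ} (hs : 0 ≤ s) {u : E1} (hu : u ∈ Pos) :
    lap k hk (shift s u) = Complex.exp (Complex.I * k * s) * lap k hk u := by
  rw [lap, wInt_shift, wInt_apply, wInt_apply, ← integral_const_mul]
  refine integral_congr_ae ?_
  filter_upwards [Pos.ae hu] with γ hγ
  by_cases h : γ ∈ Ioi (0:ℝ)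
  · have h' : γ + s ∈ Ioi (0:ℝ) := by
      have : (0:ℝ) < γ := h
      simp only [mem_Ioi]; linarith
    rw [cutExp, indicator_of_mem h, indicator_of_mem h', ← mul_assoc, ← Complex.exp_add]
    congr 2; push_cast; ring
  · rw [hγ (not_lt.1 h)]; simp

lemma setIntegral_Ioi_add_right {E : Type*} [NormedAddCommGroup E] [NormedSpace ℝ E] (F : ℝ → E)
    (x : ℝ) : ∫ y in Ioi (0:ℝ), F (y + x) = ∫ y in Ioi x, F y := by
  rw [← (measurePreserving_add_right volume x).setIntegral_preimage_emb
    (measurableEmbedding_addRight x) F (Ioi x)]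
  simp

lemma lap_srcFun {φ : ℝ → ℂ} {t : ℝ} (ht : 0 ≤ t) (h0 : t = 0 → ∀ y, φ y = 0) {k : ℂ}
    (hk : 0 ≤ k.im) {x : ℝ} {g : E1} (hg : g =ᵐ[volume] srcFun φ t x) :
    lap k hk g = -∫ y in Ioi x, Complex.exp (Complex.I * k * ((y - x : ℝ) : ℂ) * (t : ℂ)) * φ y := by
  have e1 : lap k hk g = ∫ γ in Ioi (0:ℝ),
      Complex.exp (Complex.I * k * γ) * -((t⁻¹ : ℝ) * φ (x + t⁻¹ * γ)) := by
    rw [lap, wInt_apply, ← integral_indicator measurableSet_Ioi]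
    refine integral_congr_ae ?_
    filter_upwards [hg] with γ hγ
    rw [hγ, srcFun, cutExp]
    by_cases h : γ ∈ Ioi (0:ℝ)
    · simp only [indicator_of_mem h]
    · simp only [indicator_of_notMem h, mul_zero]
  rw [e1]
  rcases ht.eq_or_lt with ht | ht
  · rw [← ht]; simp [h0 ht.symm]
  · have h1 := integral_comp_mul_left_Ioi (fun y => Complex.exp (Complex.I * k * (y * t : ℝ)) *
      -φ (x + y)) 0 (inv_pos.2 ht)
    have h2 := setIntegral_Ioi_add_right (fun y => Complex.exp (Complex.I * k * ((y - x) * t : ℝ)) *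
      -φ y) x
    simp only [inv_inv, mul_zero] at h1
    have h3 : ∀ γ : ℝ, Complex.exp (Complex.I * k * γ) * -((t⁻¹ : ℝ) * φ (x + t⁻¹ * γ)) =
        (t⁻¹ : ℝ) • (Complex.exp (Complex.I * k * (t⁻¹ * γ * t : ℝ)) * -φ (x + t⁻¹ * γ)) := by
      intro γ
      rw [Complex.real_smul, mul_comm (t⁻¹) γ, mul_assoc γ, inv_mul_cancel₀ ht.ne', mul_one]
      ring
    simp only [h3]
    rw [integral_smul, h1, smul_smul, inv_mul_cancel₀ ht.ne', one_smul, ← integral_neg]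
    have h4 : ∀ y : ℝ, Complex.exp (Complex.I * k * ((y + x - x) * t : ℝ)) * -φ (y + x) =
        Complex.exp (Complex.I * k * (y * t : ℝ)) * -φ (x + y) := fun y => by
      rw [add_sub_cancel_right, add_comm y x]
    simp only [h4] at h2
    rw [h2]
    congr 1; ext y
    push_cast
    rw [mul_neg]; congr 3; ring

section Col

set_option linter.unusedSectionVars false

variable {ι : Type*} [Fintype ι] [DecidableEq ι] {q : ℝ → ι → ι → ℂ} {θ : ι → ℝ} {j : ι} {k : ℂ}
  {f f' : ℝ → ι → ℂ}

/-- Bounded continuous solutions of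
`f_i(x) = δ_{ij} - ∫_x^∞ e^{ik(y-x)θ_i} Σ_l q_{il}(y) f_l(y) dy`. -/
structure IsVolt (q : ℝ → ι → ι → ℂ) (θ : ι → ℝ) (j : ι) (k : ℂ) (f : ℝ → ι → ℂ) : Prop where
  cont : Continuous f
  bdd : ∃ C : ℝ, ∀ x i, ‖f x i‖ ≤ C
  eq : ∀ x i, f x i = (1 : Matrix ι ι ℂ) i j -
    ∫ y in Ioi x, Complex.exp (Complex.I * k * ((y - x : ℝ) : ℂ) * (θ i : ℂ)) * ∑ l, q y i l * f y l

/-- The conditions on the coefficients of the Volterra equations. -/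
structure VoltData (q : ℝ → ι → ι → ℂ) (θ : ι → ℝ) (j : ι) : Prop where
  int : ∀ i l, Integrable fun y => q y i l
  nonneg : ∀ i, 0 ≤ θ i
  zero : θ j = 0
  src : ∀ i, θ i = 0 → ∀ y, q y i j = 0

lemma norm_cexp_theta (hθ : ∀ i, 0 ≤ θ i) (hk : 0 ≤ k.im) {x y : ℝ} (h : x ≤ y) (i : ι) :
    ‖Complex.exp (Complex.I * k * ((y - x : ℝ) : ℂ) * (θ i : ℂ))‖ ≤ 1 := by
  have := norm_cexp_I_le hk (γ := (y - x) * θ i) (mul_nonneg (by linarith) (hθ i))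
  rwa [Complex.ofReal_mul, ← mul_assoc] at this

lemma integrableOn_volt (hq : ∀ i l, Integrable fun y => q y i l) (hθ : ∀ i, 0 ≤ θ i)
    (hk : 0 ≤ k.im) (hf : Continuous f) (hb : ∃ C : ℝ, ∀ x i, ‖f x i‖ ≤ C) (x : ℝ) (i : ι) :
    IntegrableOn (fun y => Complex.exp (Complex.I * k * ((y - x : ℝ) : ℂ) * (θ i : ℂ)) *
      ∑ l, q y i l * f y l) (Ioi x) := by
  obtain ⟨C, hC⟩ := hb
  have h1 : Integrable fun y => ∑ l, q y i l * f y l := integrable_sum_smul hq hf hC i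
  refine Integrable.bdd_mul (c := 1) h1.integrableOn ?_ ?_
  · exact (by fun_prop : Continuous fun y : ℝ =>
      Complex.exp (Complex.I * k * ((y - x : ℝ) : ℂ) * (θ i : ℂ))).aestronglyMeasurable
  · exact (ae_restrict_iff' measurableSet_Ioi).2 (.of_forall fun y hy =>
      norm_cexp_theta hθ hk (le_of_lt hy) i)

lemma IsVolt.unique (h : VoltData q θ j) (hk : 0 ≤ k.im) (hf : IsVolt q θ j k f)
    (hf' : IsVolt q θ j k f') : f = f' := by
  obtain ⟨C, hC⟩ := hf.bdd
  obtain ⟨C', hC'⟩ := hf'.bdd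
  have hc : Continuous fun x => ‖f x - f' x‖ := (hf.cont.sub hf'.cont).norm
  have hB : ∀ x, ‖f x - f' x‖ ≤ max C 0 + max C' 0 := fun x =>
    (pi_norm_le_iff_of_nonneg (by positivity)).2 fun i => (norm_sub_le _ _).trans
      (add_le_add ((hC x i).trans (le_max_left _ _)) ((hC' x i).trans (le_max_left _ _)))
  have key := volterra_unique (integrable_qnorm h.int) qnorm_nonneg (h := fun x => ‖f x - f' x‖)
    hc.aestronglyMeasurable (B := max C 0 + max C' 0)
    (fun x => by rw [abs_of_nonneg (norm_nonneg _)]; exact hB x) (fun x => ?_)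
  · ext1 x
    exact sub_eq_zero.1 (norm_le_zero_iff.1 (key x))
  have hint : Integrable fun y => qnorm q y * ‖f y - f' y‖ :=
    (integrable_qnorm h.int).mul_bdd hc.aestronglyMeasurable
      (.of_forall fun y => by rw [norm_norm]; exact hB y)
  refine (pi_norm_le_iff_of_nonneg (integral_nonneg fun y =>
    mul_nonneg (qnorm_nonneg y) (norm_nonneg _))).2 fun i => ?_
  rw [Pi.sub_apply, hf.eq, hf'.eq, sub_sub_sub_cancel_left, ← integral_sub
    (integrableOn_volt h.int h.nonneg hk hf'.cont hf'.bdd x i)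
    (integrableOn_volt h.int h.nonneg hk hf.cont hf.bdd x i)]
  refine norm_integral_le_of_norm_le hint.integrableOn
    ((ae_restrict_iff' measurableSet_Ioi).2 (.of_forall fun y hy => ?_))
  rw [← mul_sub, ← Finset.sum_sub_distrib, norm_mul]
  refine (mul_le_of_le_one_left (norm_nonneg _) (norm_cexp_theta h.nonneg hk (le_of_lt hy) i)).trans
    ?_
  simp only [← mul_sub]
  exact norm_sum_smul_le (v := fun l => f' y l - f y l) (fun l => by
    rw [norm_sub_rev]; exact norm_le_pi_norm (f y - f' y) l) i y

/-- `K` is the kernel of the column: `K_i(x) = g_i(x) - ∫_x^∞ T_{θ_i(y-x)} Σ_l q_{il}(y) K_l(y) dy`,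
where `g_i(x)` is the source term. -/
structure IsVoltKer (q : ℝ → ι → ι → ℂ) (θ : ι → ℝ) (j : ι) (K g : ℝ → ι → E1) : Prop where
  cont : Continuous K
  bdd : ∃ B, ∀ x i, ‖K x i‖ ≤ B
  pos : ∀ x i, K x i ∈ Pos
  src : ∀ x i, g x i =ᵐ[volume] srcFun (fun y => q y i j) (θ i) x
  eq : ∀ x i, K x i = g x i - volt q θ K x i

lemma VoltData.exists_ker (h : VoltData q θ j) : ∃ K g, IsVoltKer q θ j K g := by
  choose g hg1 hg2 hg3 hg4 using fun i => exists_source (h.int i j) (θ i)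
  choose B hB using hg2
  obtain ⟨K, h1, h2, h3, h4⟩ := exists_kernel h.int h.nonneg (g := fun x i => g i x)
    (continuous_pi hg1) (Bg := ∑ i, |B i|)
    (fun x i => ((hB i x).trans (le_abs_self _)).trans (Finset.single_le_sum
      (f := fun i => |B i|) (fun _ _ => abs_nonneg _) (Finset.mem_univ i))) (fun x i => hg3 i x)
  exact ⟨K, fun x i => g i x, h1, h2, h3, fun x i => hg4 i x, h4⟩

variable {K g : ℝ → ι → E1}

lemma IsVoltKer.isVolt (h : VoltData q θ j) (hK : IsVoltKer q θ j K g) (hk : 0 ≤ k.im) :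
    IsVolt q θ j k (fun x i => (1 : Matrix ι ι ℂ) i j + lap k hk (K x i)) := by
  obtain ⟨B, hB⟩ := hK.bdd
  have hc : Continuous fun x i => (1 : Matrix ι ι ℂ) i j + lap k hk (K x i) :=
    continuous_pi fun i => continuous_const.add
      ((lap k hk).continuous.comp (continuous_pi_iff.1 hK.cont i))
  have hb : ∀ x i, ‖(1 : Matrix ι ι ℂ) i j + lap k hk (K x i)‖ ≤ 1 + B := fun x i => by
    refine (norm_add_le _ _).trans (add_le_add ?_ ((norm_wInt_le _ _ _ _).trans (hB x i)))
    by_cases hij : i = j <;> simp [Matrix.one_apply, hij]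
  refine ⟨hc, ⟨_, hb⟩, fun x i => ?_⟩
  have hint : IntegrableOn (fun y => shift (θ i * (y - x)) (∑ l, q y i l • K y l)) (Ioi x) :=
    (integrable_shift (integrable_sum_smul h.int hK.cont hB i) (by fun_prop)).integrableOn
  have e1 : lap k hk (volt q θ K x i) = ∫ y in Ioi x,
      Complex.exp (Complex.I * k * ((y - x : ℝ) : ℂ) * (θ i : ℂ)) *
        ∑ l, q y i l * lap k hk (K y l) := by
    rw [volt, ← ContinuousLinearMap.integral_comp_comm _ hint]
    refine setIntegral_congr_fun measurableSet_Ioi fun y hy => ?_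
    have hy' : x < y := hy
    rw [lap_shift hk (mul_nonneg (h.nonneg i) (by linarith))
      (Pos.sum _ fun l _ => Pos.smul _ (hK.pos y l)), map_sum]
    simp only [map_smul, smul_eq_mul]
    congr 2; push_cast; ring
  have e2 := lap_srcFun (h.nonneg i) (h.src i) hk (hK.src x i)
  conv_lhs => rw [hK.eq, map_sub, e1, e2]
  have i2 := integrableOn_volt (f := fun y l => lap k hk (K y l)) h.int h.nonneg hk
    (continuous_pi fun l => (lap k hk).continuous.comp (continuous_pi_iff.1 hK.cont l))
    ⟨B, fun y l => (norm_wInt_le _ _ _ _).trans (hB y l)⟩ x i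
  have i1 := integrableOn_volt (f := fun y l => (1 : Matrix ι ι ℂ) l j) h.int h.nonneg hk
    continuous_const ⟨1, fun y l => by by_cases hij : l = j <;> simp [Matrix.one_apply, hij]⟩ x i
  have e3 : ∀ y, ∑ l, q y i l * (1 : Matrix ι ι ℂ) l j = q y i j := fun y => by
    simp [Matrix.one_apply]
  simp only [e3] at i1
  rw [sub_eq_add_neg, ← neg_add, ← integral_add i1 i2, sub_eq_add_neg]
  congr 3; ext y
  simp only [mul_add, Finset.sum_add_distrib, e3]

lemma IsVoltKer.eq_ft (h : VoltData q θ j) (hK : IsVoltKer q θ j K g) (hk : 0 ≤ k.im)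
    (hf : IsVolt q θ j k f) (x : ℝ) (i : ι) :
    f x i = (1 : Matrix ι ι ℂ) i j + ft ((Ioi (0:ℝ)).indicator (K x i)) k := by
  rw [hf.unique h hk (hK.isVolt h hk), ← lap_eq_ft k hk]

lemma VoltData.exists_isVolt (h : VoltData q θ j) (hk : 0 ≤ k.im) : ∃ f, IsVolt q θ j k f :=
  let ⟨_, _, hK⟩ := h.exists_ker
  ⟨_, hK.isVolt h hk⟩

lemma VoltData.wie (h : VoltData q θ j) {F : ℂ → ℝ → ι → ℂ}
    (hF : ∀ k : ℂ, 0 ≤ k.im → IsVolt q θ j k (F k)) (x : ℝ) (i : ι) :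
    Wie .P ((1 : Matrix ι ι ℂ) i j) (fun k => F k x i) := by
  obtain ⟨K, g, hK⟩ := h.exists_ker
  exact ⟨_, L1_indicator (L1.integrable_coeFn (K x i)), fun k hk => hK.eq_ft h hk (hF k hk) x i⟩

end Col

end AKNS

namespace AKNS

/-! ### Absolutely continuous functions -/

/-- `f` is locally absolutely continuous with derivative `f'` almost everywhere. -/
structure ACD (f f' : ℝ → ℂ) : Prop where
  ac : ∀ a b, AbsolutelyContinuousOnInterval f a b
  der : ∀ᵐ x, HasDerivAt f (f' x) x

namespace ACD

variable {f f' g g' : ℝ → ℂ}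

lemma congr (hf : ACD f f') (h : ∀ᵐ x, f' x = g' x) : ACD f g' :=
  ⟨hf.ac, by filter_upwards [hf.der, h] with x h1 h2; rwa [← h2]⟩

lemma const (c : ℂ) : ACD (fun _ => c) (fun _ => 0) :=
  ⟨absolutelyContinuous_const c, .of_forall fun x => hasDerivAt_const x c⟩

lemma add (hf : ACD f f') (hg : ACD g g') : ACD (fun x => f x + g x) (fun x => f' x + g' x) :=
  ⟨fun a b => (hf.ac a b).fun_add (hg.ac a b), by
    filter_upwards [hf.der, hg.der] with x h1 h2 using h1.add h2⟩

lemma mul (hf : ACD f f') (hg : ACD g g') :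
    ACD (fun x => f x * g x) (fun x => f' x * g x + f x * g' x) :=
  ⟨fun a b => (hf.ac a b).fun_smul (hg.ac a b), by
    filter_upwards [hf.der, hg.der] with x h1 h2 using h1.mul h2⟩

lemma const_mul (c : ℂ) (hf : ACD f f') : ACD (fun x => c * f x) (fun x => c * f' x) :=
  ((const c).mul hf).congr (.of_forall fun x => by ring)

lemma neg (hf : ACD f f') : ACD (fun x => -f x) (fun x => -f' x) := by
  simpa using hf.const_mul (-1)

lemma sub (hf : ACD f f') (hg : ACD g g') : ACD (fun x => f x - g x) (fun x => f' x - g' x) := by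
  simpa [sub_eq_add_neg] using hf.add hg.neg

lemma sum {ι : Type*} (s : Finset ι) {f f' : ι → ℝ → ℂ} (h : ∀ i ∈ s, ACD (f i) (f' i)) :
    ACD (fun x => ∑ i ∈ s, f i x) (fun x => ∑ i ∈ s, f' i x) := by
  classical
  induction s using Finset.induction_on with
  | empty => simpa using const 0
  | insert a s ha ih =>
    simp only [Finset.sum_insert ha]
    exact (h a (by simp)).add (ih fun i hi => h i (by simp [hi]))

lemma of_contDiff (h : ContDiff ℝ 1 f) (hf : ∀ x, HasDerivAt f (f' x) x) : ACD f f' :=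
  ⟨fun _ _ => h.contDiffOn.absolutelyContinuousOnInterval, .of_forall hf⟩

lemma cexp (c : ℂ) : ACD (fun x : ℝ => Complex.exp (c * x)) (fun x => c * Complex.exp (c * x)) := by
  refine of_contDiff ?_ fun x => ?_
  · exact (contDiff_const.mul Complex.ofRealCLM.contDiff).cexp
  · have h1 : HasDerivAt (fun x : ℝ => c * (x : ℂ)) (c * 1) x :=
      (Complex.ofRealCLM.hasDerivAt (x := x)).const_mul c
    exact h1.cexp.congr_deriv (by ring)

lemma of_integral (hg : LocallyIntegrable g) : ACD (fun x => ∫ t in (0:ℝ)..x, g t) g := by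
  have hi : ∀ a b, IntervalIntegrable g volume a b := fun a b =>
    ((locallyIntegrable_iff.1 hg) _ isCompact_uIcc).intervalIntegrable
  refine ⟨fun s t => ?_, ?_⟩
  · have key : ∀ h : ℝ → ℝ, (∀ a b, IntervalIntegrable h volume a b) →
        AbsolutelyContinuousOnInterval (fun x => ∫ t in (0:ℝ)..x, h t) s t := fun h hh => by
      have h1 := hh (min 0 (min s t)) (max 0 (max s t))
      have h2 := h1.absolutelyContinuousOnInterval_intervalIntegral (c := 0)
        (by rw [uIcc_of_le (by simp)]; simp)
      exact h2.mono (c := s) (d := t) (by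
        rw [uIcc_of_le (a := min 0 (min s t)) (by simp)]
        exact Icc_subset_Icc (by simp) (by simp))
    have h1 := key (fun x => (g x).re) (fun a b => ⟨(hi a b).1.re, (hi a b).2.re⟩)
    have h2 := key (fun x => (g x).im) (fun a b => ⟨(hi a b).1.im, (hi a b).2.im⟩)
    have h3 := (h1.fun_smul (absolutelyContinuous_const (1:ℂ) s t)).fun_add
      (h2.fun_smul (absolutelyContinuous_const Complex.I s t))
    refine (congrArg (fun F => AbsolutelyContinuousOnInterval F s t) (funext fun x => ?_)).mp h3
    rw [Complex.real_smul, Complex.real_smul, mul_one]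
    have e1 : ∫ t in (0:ℝ)..x, (g t).re = (∫ t in (0:ℝ)..x, g t).re :=
      Complex.reCLM.intervalIntegral_comp_comm (hi 0 x)
    have e2 : ∫ t in (0:ℝ)..x, (g t).im = (∫ t in (0:ℝ)..x, g t).im :=
      Complex.imCLM.intervalIntegral_comp_comm (hi 0 x)
    rw [e1, e2, Complex.re_add_im]
  · filter_upwards [LocallyIntegrable.ae_hasDerivAt_integral hg] with x hx using hx 0

lemma eq_of_zero (hf : ACD f f') (h : ∀ᵐ x, f' x = 0) (x y : ℝ) : f x = f y := by
  have h1 : ∀ᵐ t, HasDerivAt f 0 t := by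
    filter_upwards [hf.der, h] with t h1 h2; rwa [← h2]
  have := (hf.ac x y).const_of_ae_hasDerivAt_zero (h1.mono fun t ht _ => ht)
  obtain ⟨c, hc⟩ := this
  rw [hc _ left_mem_uIcc, hc _ right_mem_uIcc]

lemma eq_integral (hf : ACD f f') (h : LocallyIntegrable f') (x : ℝ) :
    f x = f 0 + ∫ t in (0:ℝ)..x, f' t := by
  have := (hf.sub (of_integral h)).eq_of_zero (.of_forall fun x => by simp) x 0
  simp only [intervalIntegral.integral_same, sub_zero] at this
  rw [← this]; ring

lemma continuous (hf : ACD f f') : Continuous f := by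
  rw [continuous_iff_continuousAt]
  intro x
  have h := (hf.ac (x - 1) (x + 1)).continuousOn
  rw [uIcc_of_le (by linarith)] at h
  exact h.continuousAt (Icc_mem_nhds (by linarith) (by linarith))

lemma _root_.AKNS.locallyIntegrable_neg (h : LocallyIntegrable g) :
    LocallyIntegrable fun x => g (-x) := by
  rw [← Measure.map_neg_eq_self (volume : Measure ℝ)] at h
  exact (locallyIntegrable_map_homeomorph (Homeomorph.neg ℝ)).1 h

lemma neg_comp (hf : ACD f f') (h : LocallyIntegrable f') :
    ACD (fun x => f (-x)) (fun x => -f' (-x)) := by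
  have h1 := locallyIntegrable_neg h
  have e : (fun x => f (-x)) = fun x => f 0 + -∫ t in (0:ℝ)..x, f' (-t) := by
    ext x
    rw [hf.eq_integral h, intervalIntegral.integral_comp_neg, neg_zero,
      intervalIntegral.integral_symm]
  rw [e]
  exact ((const _).add (of_integral h1).neg).congr (.of_forall fun x => by ring)

lemma of_Ioi (hg : ∀ x, IntegrableOn g (Ioi x)) :
    ACD (fun x => ∫ t in Ioi x, g t) (fun x => -g x) := by
  have hl : LocallyIntegrable g := fun x => ⟨Ioi (x - 1), Ioi_mem_nhds (by linarith), hg _⟩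
  have : (fun x => ∫ y in Ioi x, g y) = fun x => (∫ y in Ioi 0, g y) - ∫ y in (0:ℝ)..x, g y := by
    ext x
    rw [← intervalIntegral.integral_interval_add_Ioi (a := 0) (b := x) (hg _) (hg _)]
    abel
  rw [this]
  exact ((const _).sub (of_integral hl)).congr (.of_forall fun x => by ring)

lemma prod {ι : Type*} [DecidableEq ι] (s : Finset ι) {f f' : ι → ℝ → ℂ}
    (h : ∀ i ∈ s, ACD (f i) (f' i)) :
    ACD (fun x => ∏ i ∈ s, f i x) (fun x => ∑ i ∈ s, (∏ j ∈ s.erase i, f j x) * f' i x) := by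
  refine ⟨fun a b => ?_, ?_⟩
  · induction s using Finset.induction_on with
    | empty => simpa using absolutelyContinuous_const (1:ℂ) a b
    | insert i s hi ih =>
      simp only [Finset.prod_insert hi]
      exact ((h i (by simp)).ac a b).fun_smul (ih fun j hj => h j (by simp [hj]))
  · have : ∀ᵐ x, ∀ i ∈ s, HasDerivAt (f i) (f' i x) x :=
      (ae_ball_iff s.countable_toSet).2 fun i hi => (h i hi).der
    filter_upwards [this] with x hx
    exact (HasDerivAt.fun_finsetProd hx).congr_deriv (by simp)

lemma det {ι : Type*} [Fintype ι] [DecidableEq ι] {A A' : ℝ → Matrix ι ι ℂ}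
    (h : ∀ i j, ACD (fun x => A x i j) (fun x => A' x i j)) :
    ACD (fun x => (A x).det) (fun x => ∑ r, ((A x).updateRow r (A' x r)).det) := by
  have e : ∀ x, ∑ r, ((A x).updateRow r (A' x r)).det = ∑ σ : Equiv.Perm ι,
      ((Equiv.Perm.sign σ : ℤ) : ℂ) * ∑ i, (∏ l ∈ Finset.univ.erase i, A x l (σ l)) * A' x i (σ i) := by
    intro x
    simp only [Finset.mul_sum]
    rw [Finset.sum_comm]
    refine Finset.sum_congr rfl fun r _ => ?_
    rw [← Matrix.det_transpose, Matrix.det_apply']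
    refine Finset.sum_congr rfl fun σ _ => ?_
    congr 1
    rw [← Finset.prod_erase_mul _ _ (Finset.mem_univ r)]
    congr 1
    · refine Finset.prod_congr rfl fun l hl => ?_
      rw [Matrix.transpose_apply, Matrix.updateRow_ne (Finset.ne_of_mem_erase hl)]
    · rw [Matrix.transpose_apply, Matrix.updateRow_self]
  refine ACD.congr ?_ (.of_forall fun x => (e x).symm)
  have e2 : (fun x => (A x).det) = fun x => ∑ σ : Equiv.Perm ι,
      ((Equiv.Perm.sign σ : ℤ) : ℂ) * ∏ i, A x i (σ i) := by
    ext x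
    rw [← Matrix.det_transpose, Matrix.det_apply']
    rfl
  rw [e2]
  exact ACD.sum _ fun σ _ => (ACD.prod _ fun i _ => h i (σ i)).const_mul _

end ACD

lemma sum_det_updateRow_vecMul {ι : Type*} [Fintype ι] [DecidableEq ι] (A B : Matrix ι ι ℂ) :
    ∑ r, (A.updateRow r ((A * B) r)).det = B.trace * A.det := by
  have : ∀ r, (A.updateRow r ((A * B) r)).det = (A * B * A.adjugate) r r := by
    intro r
    rw [← Matrix.cramer_transpose_apply, Matrix.cramer_eq_adjugate_mulVec,
      ← Matrix.adjugate_transpose, Matrix.mulVec_transpose]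
    rfl
  simp only [this]
  change Matrix.trace _ = _
  rw [mul_assoc, Matrix.trace_mul_comm, mul_assoc, Matrix.adjugate_mul, Matrix.mul_smul, mul_one,
    Matrix.trace_smul, smul_eq_mul, mul_comm]

section Ode

set_option linter.unusedSectionVars false

variable {ι : Type*} [Fintype ι] [DecidableEq ι] {G : ℝ → ι → ι → ℂ} {y : ℝ → ι → ℂ}

lemma ode_unique_neg (hG : ∀ i l, LocallyIntegrable fun x => G x i l)
    (hy : ∀ i, ACD (fun x => y x i) (fun x => ∑ l, G x i l * y x l)) (h0 : y 0 = 0) {x : ℝ}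
    (hx : x ≤ 0) : y x = 0 := by
  have hyc : Continuous y := continuous_pi fun i => (hy i).continuous
  have hq : LocallyIntegrable (qnorm G) := by
    unfold qnorm
    exact locallyIntegrable_finsetSum _ fun i _ => locallyIntegrable_finsetSum _ fun l _ x =>
      (hG i l x).norm
  have hsum : ∀ i, LocallyIntegrable fun x => ∑ l, G x i l * y x l := fun i =>
    locallyIntegrable_finsetSum _ fun l _ => by
      rw [locallyIntegrable_iff]
      intro K hK
      exact ((locallyIntegrable_iff.1 (hG i l)) K hK).mul_continuousOn
        (continuous_pi_iff.1 hyc l).continuousOn hK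
  set s : Set ℝ := Icc x 0
  have ha : Integrable (s.indicator (qnorm G)) :=
    (integrable_indicator_iff measurableSet_Icc).2 ((locallyIntegrable_iff.1 hq) _ isCompact_Icc)
  obtain ⟨B, hB⟩ := isCompact_Icc.exists_bound_of_continuousOn (s := s) hyc.norm.continuousOn
  have key := volterra_unique ha (fun t => indicator_nonneg (fun t _ => qnorm_nonneg t) t)
    (h := s.indicator fun t => ‖y t‖) (hyc.norm.aestronglyMeasurable.indicator measurableSet_Icc)
    (B := max B 0) (fun t => ?_) (fun t => ?_) x
  · rw [indicator_of_mem (left_mem_Icc.2 hx)] at key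
    exact norm_le_zero_iff.1 key
  · by_cases ht : t ∈ s
    · rw [indicator_of_mem ht]
      exact (hB t ht).trans (le_max_left _ _)
    · rw [indicator_of_notMem ht, abs_zero]; exact le_max_right _ _
  · have hn : 0 ≤ ∫ t in Ioi t, s.indicator (qnorm G) t * s.indicator (fun t => ‖y t‖) t :=
      integral_nonneg fun t => mul_nonneg (indicator_nonneg (fun t _ => qnorm_nonneg t) t)
        (indicator_nonneg (fun t _ => norm_nonneg _) t)
    by_cases ht : t ∈ s
    swap
    · rw [indicator_of_notMem ht]; exact hn
    rw [indicator_of_mem ht]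
    refine (pi_norm_le_iff_of_nonneg hn).2 fun i => ?_
    have h1 := (hy i).eq_integral (hsum i) t
    rw [show y 0 i = 0 by rw [h0]; rfl, zero_add] at h1
    rw [h1, intervalIntegral.integral_symm, norm_neg, intervalIntegral.integral_of_le ht.2]
    have e : ∀ u, s.indicator (qnorm G) u * s.indicator (fun t => ‖y t‖) u =
        s.indicator (fun u => qnorm G u * ‖y u‖) u := fun u => by
      by_cases hu : u ∈ s
      · simp only [indicator_of_mem hu]
      · simp only [indicator_of_notMem hu, mul_zero]
    simp only [e]
    rw [setIntegral_indicator measurableSet_Icc]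
    have e2 : Ioi t ∩ s = Ioc t 0 := by
      ext u; simp only [s, mem_inter_iff, mem_Ioi, mem_Icc, mem_Ioc]
      exact ⟨fun h => ⟨h.1, h.2.2⟩, fun h => ⟨h.1, (ht.1.trans h.1.le), h.2⟩⟩
    rw [e2]
    refine norm_integral_le_of_norm_le ?_ (.of_forall fun u =>
      norm_sum_smul_le (fun l => norm_le_pi_norm (y u) l) i u)
    have := ((locallyIntegrable_iff.1 hq) (Icc t 0) isCompact_Icc).mul_continuousOn
      hyc.norm.continuousOn isCompact_Icc
    exact this.mono_set Ioc_subset_Icc_self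

/-- Solutions of linear systems vanishing at `0` vanish. -/
lemma ode_unique (hG : ∀ i l, LocallyIntegrable fun x => G x i l)
    (hy : ∀ i, ACD (fun x => y x i) (fun x => ∑ l, G x i l * y x l)) (h0 : y 0 = 0) (x : ℝ) :
    y x = 0 := by
  rcases le_total x 0 with hx | hx
  · exact ode_unique_neg hG hy h0 hx
  · have hyc : Continuous y := continuous_pi fun i => (hy i).continuous
    have := ode_unique_neg (y := fun x => y (-x)) (G := fun x i l => -G (-x) i l) (x := -x)
      (fun i l => (locallyIntegrable_neg (hG i l)).neg) (fun i => ?_) (by simpa using h0) (by simpa)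
    · simpa using this
    · refine ((hy i).neg_comp ?_).congr (.of_forall fun x => by simp [Finset.sum_neg_distrib])
      refine locallyIntegrable_finsetSum _ fun l _ => ?_
      rw [locallyIntegrable_iff]
      intro K hK
      exact ((locallyIntegrable_iff.1 (hG i l)) K hK).mul_continuousOn
        (continuous_pi_iff.1 hyc l).continuousOn hK

end Ode

end AKNS

namespace AKNS

section Col

set_option linter.unusedSectionVars false

variable {ι : Type*} [Fintype ι] [DecidableEq ι] {q : ℝ → ι → ι → ℂ} {θ : ι → ℝ} {j : ι} {k : ℂ}
  {f : ℝ → ι → ℂ}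

lemma IsVolt.integrable (h : VoltData q θ j) (hf : IsVolt q θ j k f) (i : ι) :
    Integrable fun y => ∑ l, q y i l * f y l := by
  obtain ⟨C, hC⟩ := hf.bdd
  exact integrable_sum_smul h.int hf.cont hC i

lemma IsVolt.acd (h : VoltData q θ j) (hk : 0 ≤ k.im) (hf : IsVolt q θ j k f) (i : ι) :
    ACD (fun x => f x i) (fun x => (∑ l, q x i l * f x l) - Complex.I * k * θ i * f x i) := by
  set w : ℝ → ℂ := fun y => Complex.exp (Complex.I * k * θ i * y) * ∑ l, q y i l * f y l with hw
  have e0 : ∀ x y : ℝ, Complex.exp (Complex.I * k * ((y - x : ℝ) : ℂ) * (θ i : ℂ)) *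
      ∑ l, q y i l * f y l = Complex.exp (-(Complex.I * k * θ i) * x) * w y := fun x y => by
    simp only [hw]
    rw [← mul_assoc, ← Complex.exp_add]; congr 2; push_cast; ring
  have hwi : ∀ x, IntegrableOn w (Ioi x) := fun x => by
    have := (integrableOn_volt h.int h.nonneg hk hf.cont hf.bdd x i).const_mul
      (Complex.exp (Complex.I * k * θ i * x))
    refine this.congr (.of_forall fun y => ?_)
    simp only [e0]
    rw [← mul_assoc, ← Complex.exp_add, neg_mul, add_neg_cancel, Complex.exp_zero, one_mul]
  have h1 := (ACD.const ((1 : Matrix ι ι ℂ) i j)).sub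
    ((ACD.cexp (-(Complex.I * k * θ i))).mul (ACD.of_Ioi hwi))
  have e1 : (fun x => f x i) = fun x : ℝ => (1 : Matrix ι ι ℂ) i j -
      Complex.exp (-(Complex.I * k * θ i) * x) * ∫ y in Ioi x, w y := by
    ext x
    rw [hf.eq, ← integral_const_mul]
    simp only [e0]
  rw [← e1] at h1
  refine h1.congr (.of_forall fun x => ?_)
  have e2 : Complex.exp (-(Complex.I * k * θ i) * x) * w x = ∑ l, q x i l * f x l := by
    simp only [hw]
    rw [← mul_assoc, ← Complex.exp_add, neg_mul, neg_add_cancel, Complex.exp_zero, one_mul]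
  have e3 : Complex.exp (-(Complex.I * k * θ i) * x) * ∫ y in Ioi x, w y =
      (1 : Matrix ι ι ℂ) i j - f x i := by
    have : f x i = (1 : Matrix ι ι ℂ) i j -
      Complex.exp (-(Complex.I * k * θ i) * x) * ∫ y in Ioi x, w y := congrFun e1 x
    rw [this]; ring
  have e4 : (θ i : ℂ) * (1 : Matrix ι ι ℂ) i j = 0 := by
    by_cases hij : i = j
    · rw [hij, h.zero]; simp
    · simp [hij]
  calc 0 - (-(Complex.I * k * θ i) * Complex.exp (-(Complex.I * k * θ i) * x) *
        (∫ y in Ioi x, w y) + Complex.exp (-(Complex.I * k * θ i) * x) * -w x)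
      = Complex.exp (-(Complex.I * k * θ i) * x) * w x + Complex.I * k * θ i *
          (Complex.exp (-(Complex.I * k * θ i) * x) * ∫ y in Ioi x, w y) := by ring
    _ = _ := by rw [e2, e3]; linear_combination Complex.I * k * e4

lemma tendsto_integral_Ioi_atTop {g : ℝ → ℝ} (hg : Integrable g) :
    Tendsto (fun x => ∫ y in Ioi x, g y) atTop (𝓝 0) := by
  have h1 := intervalIntegral_tendsto_integral_Ioi 0 hg.integrableOn tendsto_id
  have h2 : Tendsto (fun x => (∫ y in Ioi 0, g y) - ∫ y in (0:ℝ)..x, g y) atTop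
      (𝓝 ((∫ y in Ioi 0, g y) - ∫ y in Ioi 0, g y)) := tendsto_const_nhds.sub h1
  rw [sub_self] at h2
  exact h2.congr fun x => (integral_Ioi_eq_sub hg x).symm

lemma IsVolt.tendsto_atTop (h : VoltData q θ j) (hk : 0 ≤ k.im) (hf : IsVolt q θ j k f) (i : ι) :
    Tendsto (fun x => f x i) atTop (𝓝 ((1 : Matrix ι ι ℂ) i j)) := by
  have h1 := tendsto_integral_Ioi_atTop (hf.integrable h i).norm
  rw [tendsto_iff_norm_sub_tendsto_zero]
  refine squeeze_zero (fun _ => norm_nonneg _) (fun x => ?_) h1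
  rw [hf.eq, sub_sub_cancel_left, norm_neg]
  refine norm_integral_le_of_norm_le (hf.integrable h i).norm.integrableOn
    ((ae_restrict_iff' measurableSet_Ioi).2 (.of_forall fun y hy => ?_))
  rw [norm_mul]
  exact mul_le_of_le_one_left (norm_nonneg _) (norm_cexp_theta h.nonneg hk (le_of_lt hy) i)

lemma IsVolt.tendsto_atBot (h : VoltData q θ j) (hf : IsVolt q θ j k f) {i : ι}
    (hi : θ i = 0) : Tendsto (fun x => f x i) atBot
      (𝓝 ((1 : Matrix ι ι ℂ) i j - ∫ y, ∑ l, q y i l * f y l)) := by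
  have hint := hf.integrable h i
  have e : (fun x => f x i) = fun x => (1 : Matrix ι ι ℂ) i j -
      ((∫ y in Ioi 0, ∑ l, q y i l * f y l) + ∫ y in x..0, ∑ l, q y i l * f y l) := by
    ext x
    rw [hf.eq]
    simp only [hi, Complex.ofReal_zero, mul_zero, Complex.exp_zero, one_mul]
    rw [integral_Ioi_eq_sub hint, intervalIntegral.integral_symm x 0, sub_neg_eq_add]
  rw [e]
  have h1 := intervalIntegral_tendsto_integral_Iic 0 hint.integrableOn tendsto_id
  have h2 : ∫ y, ∑ l, q y i l * f y l =
      (∫ y in Ioi 0, ∑ l, q y i l * f y l) + ∫ y in Iic 0, ∑ l, q y i l * f y l := by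
    rw [add_comm, intervalIntegral.integral_Iic_add_Ioi hint.integrableOn hint.integrableOn]
  rw [h2]
  exact tendsto_const_nhds.sub (tendsto_const_nhds.add h1)

end Col

end AKNS

namespace AKNS

variable {p m : ℕ} {Q : ℝ → Matrix (Idx p m) (Idx p m) ℂ} {k : ℂ}

/-! ### Reflection -/

/-- The reflected potential `-Q(-x)`. -/
def sharp (Q : ℝ → Matrix (Idx p m) (Idx p m) ℂ) (x : ℝ) : Matrix (Idx p m) (Idx p m) ℂ := -Q (-x)

lemma sharp_sharp (Q : ℝ → Matrix (Idx p m) (Idx p m) ℂ) : sharp (sharp Q) = Q := by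
  ext x; simp [sharp]

lemma IsPotential.sharp (hQ : IsPotential Q) : IsPotential (sharp Q) :=
  ⟨fun x i j h => by simp [AKNS.sharp, hQ.off (-x) i j h], fun i j => (hQ.int i j).comp_neg.neg⟩

lemma IsPotential.transpose_neg (hQ : IsPotential Q) : IsPotential fun x => (Q (-x)).transpose :=
  ⟨fun x i j h => by simp [hQ.off (-x) j i h.symm], fun i j => (hQ.int j i).comp_neg⟩

lemma IsPotential.neg_transpose (hQ : IsPotential Q) : IsPotential fun x => -(Q x).transpose :=
  ⟨fun x i j h => by simp [hQ.off x j i h.symm], fun i j => (hQ.int j i).neg⟩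

lemma integral_Iio_neg {E : Type*} [NormedAddCommGroup E] [NormedSpace ℝ E] (F : ℝ → E) (x : ℝ) :
    ∫ y in Iio (-x), F y = ∫ y in Ioi x, F (-y) := by
  rw [← integral_Iic_eq_integral_Iio, ← integral_comp_neg_Ioi]

lemma add_integral_eq {a : ℂ} {F G : ℝ → ℂ} {μ : Measure ℝ} (h : ∀ y, F y = -G y) :
    a + ∫ y, F y ∂μ = a - ∫ y, G y ∂μ := by
  simp only [h, integral_neg, sub_eq_add_neg]

lemma sub_integral_eq {a : ℂ} {F G : ℝ → ℂ} {μ : Measure ℝ} (h : ∀ y, F y = G y) :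
    a - ∫ y, F y ∂μ = a - ∫ y, G y ∂μ := by
  simp only [h]

lemma BddCont.neg {f : ℝ → Idx p m → ℂ} (h : BddCont f) : BddCont fun x => f (-x) :=
  ⟨h.1.comp continuous_neg, h.2.imp fun _ hC x i => hC (-x) i⟩

lemma IsColN.sharp {j : Idx p m} {f : ℝ → Idx p m → ℂ} (h : IsColN Q k j f) :
    IsColM (sharp Q) (-k) j (fun x => f (-x)) := by
  refine ⟨h.1.neg, fun x i => ?_⟩
  change f (-x) i = _
  rw [h.2, integral_Iio_neg]
  refine add_integral_eq fun y => ?_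
  simp only [AKNS.sharp, Matrix.neg_apply, neg_mul, Finset.sum_neg_distrib, mul_neg, neg_neg]
  congr 2; push_cast; ring_nf

lemma IsColM.sharp {j : Idx p m} {f : ℝ → Idx p m → ℂ} (h : IsColM Q k j f) :
    IsColN (sharp Q) (-k) j (fun x => f (-x)) := by
  refine ⟨h.1.neg, fun x i => ?_⟩
  change f (-x) i = _
  rw [h.2]
  conv_rhs => rw [← neg_neg x, integral_Iio_neg]
  refine (add_integral_eq fun y => ?_).symm
  simp only [AKNS.sharp, Matrix.neg_apply, neg_mul, Finset.sum_neg_distrib, mul_neg, neg_neg]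
  congr 2; push_cast; ring_nf

lemma IsRowN.sharp {i : Idx p m} {f : ℝ → Idx p m → ℂ} (h : IsRowN Q k i f) :
    IsRowM (sharp Q) (-k) i (fun x => f (-x)) := by
  refine ⟨h.1.neg, fun x j => ?_⟩
  change f (-x) j = _
  rw [h.2, integral_Iio_neg]
  refine (add_integral_eq fun y => ?_).symm
  simp only [AKNS.sharp, Matrix.neg_apply, mul_neg, Finset.sum_neg_distrib, neg_mul, neg_neg]
  congr 2; push_cast; ring_nf

lemma IsRowM.sharp {i : Idx p m} {f : ℝ → Idx p m → ℂ} (h : IsRowM Q k i f) :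
    IsRowN (sharp Q) (-k) i (fun x => f (-x)) := by
  refine ⟨h.1.neg, fun x j => ?_⟩
  change f (-x) j = _
  rw [h.2]
  conv_rhs => rw [← neg_neg x, integral_Iio_neg]
  refine add_integral_eq fun y => ?_
  simp only [AKNS.sharp, Matrix.neg_apply, mul_neg, Finset.sum_neg_distrib, neg_mul, neg_neg]
  congr 2; push_cast; ring_nf

/-! ### The Faddeev functions as solutions of Volterra equations -/

lemma sg_le (i : Idx p m) : sg i ≤ 1 := by rcases i with a | a | a <;> norm_num [sg]
lemma le_sg (i : Idx p m) : -1 ≤ sg i := by rcases i with a | a | a <;> norm_num [sg]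

/-- `1 - Σ_i`. -/
def thP (i : Idx p m) : ℝ := 1 - sg i
/-- `1 + Σ_i`. -/
def thM (i : Idx p m) : ℝ := 1 + sg i

lemma IsPotential.voltP (hQ : IsPotential Q) (a : Fin p) : VoltData (fun y => Q y) thP (pl a) :=
  ⟨hQ.int, fun i => by have := sg_le i; simp only [thP]; linarith, by simp [thP, sg],
    fun i h y => hQ.off y _ _ (show sg i = 1 by simp only [thP] at h; linarith)⟩

lemma IsPotential.voltM (hQ : IsPotential Q) (b : Fin m) : VoltData (fun y => Q y) thM (mi b) :=
  ⟨hQ.int, fun i => by have := le_sg i; simp only [thM]; linarith, by simp [thM, sg],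
    fun i h y => hQ.off y _ _ (show sg i = -1 by simp only [thM] at h; linarith)⟩

lemma isColM_iff {a : Fin p} {f : ℝ → Idx p m → ℂ} :
    IsColM Q k (pl a) f ↔ IsVolt (fun y => Q y) thP (pl a) k f := by
  have e : ∀ (x y : ℝ) (i : Idx p m), -Complex.I * k * ((y - x : ℝ) : ℂ) *
      ((sg i - sg (pl a : Idx p m) : ℝ) : ℂ) = Complex.I * k * ((y - x : ℝ) : ℂ) * (thP i : ℂ) := by
    intro x y i; simp only [thP, sg]; push_cast; ring
  constructor
  · rintro ⟨⟨h1, h2⟩, h3⟩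
    exact ⟨h1, h2, fun x i => by rw [h3]; simp only [e]⟩
  · rintro ⟨h1, h2, h3⟩
    exact ⟨⟨h1, h2⟩, fun x i => by rw [h3]; simp only [e]⟩

lemma isRowM_iff {b : Fin m} {f : ℝ → Idx p m → ℂ} :
    IsRowM Q k (mi b) f ↔ IsVolt (fun y => -(Q y).transpose) thM (mi b) k f := by
  have e : ∀ (x y : ℝ) (j : Idx p m), -Complex.I * k * ((y - x : ℝ) : ℂ) *
      ((sg (mi b : Idx p m) - sg j : ℝ) : ℂ) = Complex.I * k * ((y - x : ℝ) : ℂ) * (thM j : ℂ) := by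
    intro x y i; simp only [thM, sg]; push_cast; ring
  have e2 : ∀ i, (1 : Matrix (Idx p m) (Idx p m) ℂ) (mi b) i = (1 : Matrix (Idx p m) (Idx p m) ℂ) i (mi b) := by
    intro i; simp [Matrix.one_apply, eq_comm]
  constructor
  · rintro ⟨⟨h1, h2⟩, h3⟩
    refine ⟨h1, h2, fun x i => ?_⟩
    rw [h3, e2]
    refine add_integral_eq fun y => ?_
    rw [e]
    simp only [Matrix.neg_apply, Matrix.transpose_apply, neg_mul, Finset.sum_neg_distrib, mul_neg,
      neg_neg, mul_comm (f y _)]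
  · rintro ⟨h1, h2, h3⟩
    refine ⟨⟨h1, h2⟩, fun x i => ?_⟩
    rw [h3, e2]
    refine (add_integral_eq fun y => ?_).symm
    rw [e]
    simp only [Matrix.neg_apply, Matrix.transpose_apply, neg_mul, Finset.sum_neg_distrib, mul_neg,
      neg_neg, mul_comm (f y _)]

lemma isColN_iff {b : Fin m} {f : ℝ → Idx p m → ℂ} :
    IsColN Q k (mi b) f ↔ IsVolt (fun y => sharp Q y) thM (mi b) k (fun x => f (-x)) := by
  have e : ∀ (x y : ℝ) (i : Idx p m), Complex.I * k * ((x - y : ℝ) : ℂ) *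
      ((sg i - sg (mi b : Idx p m) : ℝ) : ℂ) = Complex.I * k * ((x - y : ℝ) : ℂ) * (thM i : ℂ) := by
    intro x y i; simp only [thM, sg]; push_cast; ring
  have e3 : ∀ x y : ℝ, -x - -y = y - x := fun x y => by ring
  constructor
  · rintro ⟨h1, h3⟩
    refine ⟨h1.neg.1, h1.neg.2, fun x i => ?_⟩
    rw [h3, integral_Iio_neg]
    refine add_integral_eq fun y => ?_
    rw [e, e3]
    simp only [sharp, Matrix.neg_apply, neg_mul, Finset.sum_neg_distrib, mul_neg, neg_neg]
  · rintro ⟨h1, h2, h3⟩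
    have h4 : BddCont f := by simpa using BddCont.neg (f := fun x => f (-x)) ⟨h1, h2⟩
    refine ⟨h4, fun x i => ?_⟩
    have := h3 (-x) i
    rw [neg_neg] at this
    rw [this]
    conv_rhs => rw [← neg_neg x, integral_Iio_neg]
    refine (add_integral_eq fun y => ?_).symm
    rw [e, ← e3, neg_neg]
    simp only [sharp, Matrix.neg_apply, neg_mul, Finset.sum_neg_distrib, mul_neg, neg_neg]

lemma isRowN_iff {a : Fin p} {f : ℝ → Idx p m → ℂ} :
    IsRowN Q k (pl a) f ↔ IsVolt (fun y => (Q (-y)).transpose) thP (pl a) k (fun x => f (-x)) := by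
  have e : ∀ (x y : ℝ) (j : Idx p m), Complex.I * k * ((x - y : ℝ) : ℂ) *
      ((sg (pl a : Idx p m) - sg j : ℝ) : ℂ) = Complex.I * k * ((x - y : ℝ) : ℂ) * (thP j : ℂ) := by
    intro x y i; simp only [thP, sg]
  have e3 : ∀ x y : ℝ, -x - -y = y - x := fun x y => by ring
  have e2 : ∀ i, (1 : Matrix (Idx p m) (Idx p m) ℂ) (pl a) i = (1 : Matrix (Idx p m) (Idx p m) ℂ) i (pl a) := by
    intro i; simp [Matrix.one_apply, eq_comm]
  constructor
  · rintro ⟨h1, h3⟩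
    refine ⟨h1.neg.1, h1.neg.2, fun x i => ?_⟩
    rw [h3, e2, integral_Iio_neg]
    refine sub_integral_eq fun y => ?_
    rw [e, e3]
    simp only [Matrix.transpose_apply, mul_comm (f (-y) _)]
  · rintro ⟨h1, h2, h3⟩
    have h4 : BddCont f := by simpa using BddCont.neg (f := fun x => f (-x)) ⟨h1, h2⟩
    refine ⟨h4, fun x i => ?_⟩
    have := h3 (-x) i
    rw [neg_neg] at this
    rw [this, e2]
    conv_rhs => rw [← neg_neg x, integral_Iio_neg]
    refine sub_integral_eq fun y => ?_
    rw [e, ← e3, neg_neg]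
    simp only [Matrix.transpose_apply, mul_comm (f (-y) _)]

lemma isVolt_faddM (hQ : IsPotential Q) (hk : 0 ≤ k.im) (a : Fin p) :
    IsVolt (fun y => Q y) thP (pl a) k (fun x i => faddM Q x k i (pl a)) :=
  isColM_iff.1 (Classical.epsilon_spec (((hQ.voltP a).exists_isVolt hk).imp fun _ h => isColM_iff.2 h))

lemma isVolt_dualM (hQ : IsPotential Q) (hk : 0 ≤ k.im) (b : Fin m) :
    IsVolt (fun y => -(Q y).transpose) thM (mi b) k (fun x i => dualM Q x k (mi b) i) :=
  isRowM_iff.1 (Classical.epsilon_spec ((((hQ.neg_transpose).voltM b).exists_isVolt hk).imp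
    fun _ h => isRowM_iff.2 h))

lemma isVolt_faddN (hQ : IsPotential Q) (hk : 0 ≤ k.im) (b : Fin m) :
    IsVolt (fun y => sharp Q y) thM (mi b) k (fun x i => faddN Q (-x) k i (mi b)) := by
  obtain ⟨f, hf⟩ := (hQ.sharp.voltM b).exists_isVolt hk
  exact isColN_iff.1 (Classical.epsilon_spec (p := IsColN Q k (mi b))
    ⟨fun x => f (-x), isColN_iff.2 (by simpa using hf)⟩)

lemma isVolt_dualN (hQ : IsPotential Q) (hk : 0 ≤ k.im) (a : Fin p) :
    IsVolt (fun y => (Q (-y)).transpose) thP (pl a) k (fun x i => dualN Q (-x) k (pl a) i) := by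
  obtain ⟨f, hf⟩ := (hQ.transpose_neg.voltP a).exists_isVolt hk
  exact isRowN_iff.1 (Classical.epsilon_spec (p := IsRowN Q k (pl a))
    ⟨fun x => f (-x), isRowN_iff.2 (by simpa using hf)⟩)

lemma faddN_sharp (hQ : IsPotential Q) (hk : 0 ≤ k.im) (x : ℝ) (i : Idx p m) (a : Fin p) :
    faddN (sharp Q) x (-k) i (pl a) = faddM Q (-x) k i (pl a) := by
  have h1 := isVolt_faddM hQ hk a
  have h2 : IsColN (sharp Q) (-k) (pl a) (Classical.epsilon (IsColN (sharp Q) (-k) (pl a))) :=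
    Classical.epsilon_spec ⟨_, (isColM_iff.2 h1).sharp⟩
  have h3 := h2.sharp
  rw [sharp_sharp, neg_neg] at h3
  have := congrFun (congrFun ((isColM_iff.1 h3).unique (hQ.voltP a) hk h1) (-x)) i
  simp only [neg_neg] at this
  exact this

lemma faddM_sharp (hQ : IsPotential Q) (hk : 0 ≤ k.im) (x : ℝ) (i : Idx p m) (b : Fin m) :
    faddM (sharp Q) x (-k) i (mi b) = faddN Q (-x) k i (mi b) := by
  have h1 := isVolt_faddN hQ hk b
  have h2 : IsColM (sharp Q) (-k) (mi b) (Classical.epsilon (IsColM (sharp Q) (-k) (mi b))) :=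
    Classical.epsilon_spec ⟨_, (isColN_iff (f := fun x i => faddN Q x k i (mi b)).2 h1).sharp⟩
  have h3 := h2.sharp
  rw [sharp_sharp, neg_neg] at h3
  have := congrFun (congrFun ((isColN_iff.1 h3).unique (hQ.sharp.voltM b) hk h1) x) i
  simp only [neg_neg] at this
  exact this

lemma dualM_sharp (hQ : IsPotential Q) (hk : 0 ≤ k.im) (x : ℝ) (i : Idx p m) (a : Fin p) :
    dualM (sharp Q) x (-k) (pl a) i = dualN Q (-x) k (pl a) i := by
  have h1 := isVolt_dualN hQ hk a
  have h2 : IsRowM (sharp Q) (-k) (pl a) (Classical.epsilon (IsRowM (sharp Q) (-k) (pl a))) :=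
    Classical.epsilon_spec ⟨_, (isRowN_iff (f := fun x i => dualN Q x k (pl a) i).2 h1).sharp⟩
  have h3 := h2.sharp
  rw [sharp_sharp, neg_neg] at h3
  have := congrFun (congrFun ((isRowN_iff.1 h3).unique (hQ.transpose_neg.voltP a) hk h1) x) i
  simp only [neg_neg] at this
  exact this

lemma dualN_sharp (hQ : IsPotential Q) (hk : 0 ≤ k.im) (x : ℝ) (i : Idx p m) (b : Fin m) :
    dualN (sharp Q) x (-k) (mi b) i = dualM Q (-x) k (mi b) i := by
  have h1 := isVolt_dualM hQ hk b
  have h2 : IsRowN (sharp Q) (-k) (mi b) (Classical.epsilon (IsRowN (sharp Q) (-k) (mi b))) :=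
    Classical.epsilon_spec ⟨_, (isRowM_iff.2 h1).sharp⟩
  have h3 := h2.sharp
  rw [sharp_sharp, neg_neg] at h3
  have := congrFun (congrFun ((isRowM_iff.1 h3).unique (hQ.neg_transpose.voltM b) hk h1) (-x)) i
  simp only [neg_neg] at this
  exact this

lemma omegaVecM_sharp (hQ : IsPotential Q) (hk : 0 ≤ k.im) (x : ℝ) :
    omegaVecM (sharp Q) x (-k) = omegaVecP Q (-x) k := by
  ext i
  unfold omegaVecM omegaVecP wedgeVec
  congr 1
  ext r c
  rcases r with a | a | b
  · exact dualM_sharp hQ hk x c a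
  · rfl
  · exact dualN_sharp hQ hk x c b

lemma FM_sharp (hQ : IsPotential Q) (hk : 0 ≤ k.im) (x : ℝ) :
    FM (sharp Q) x (-k) = FP Q (-x) k := by
  ext i j
  rcases j with a | a | b
  · exact faddN_sharp hQ hk x i a
  · exact congrFun (omegaVecM_sharp hQ hk x) i
  · exact faddM_sharp hQ hk x i b

end AKNS

namespace AKNS

lemma locallyIntegrable_mul_continuous {u v : ℝ → ℂ} (hu : LocallyIntegrable u) (hv : Continuous v) :
    LocallyIntegrable fun x => u x * v x := by
  rw [locallyIntegrable_iff] at hu ⊢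
  exact fun K hK => (hu K hK).mul_continuousOn hv.continuousOn hK

section Neg

set_option linter.unusedSectionVars false

variable {ι : Type*} [Fintype ι] [DecidableEq ι] {q : ℝ → ι → ι → ℂ} {θ : ι → ℝ} {j : ι} {k : ℂ}
  {f : ℝ → ι → ℂ}

lemma IsVolt.acd_neg (h : VoltData q θ j) (hk : 0 ≤ k.im) (hf : IsVolt q θ j k f) (i : ι) :
    ACD (fun x => f (-x) i)
      (fun x => (∑ l, -q (-x) i l * f (-x) l) + Complex.I * k * θ i * f (-x) i) := by
  refine ((hf.acd h hk i).neg_comp ?_).congr (.of_forall fun x => ?_)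
  · refine (hf.integrable h i).locallyIntegrable.sub ?_
    exact (continuous_const.mul (continuous_pi_iff.1 hf.cont i)).locallyIntegrable
  · simp only [neg_mul, Finset.sum_neg_distrib]; ring

end Neg

variable {p m : ℕ} {Q : ℝ → Matrix (Idx p m) (Idx p m) ℂ} {k : ℂ} {s t : ℝ}
  {c r : ℝ → Idx p m → ℂ}

/-- `c' = Q c + ik (Σ - s) c`. -/
def ColODE (Q : ℝ → Matrix (Idx p m) (Idx p m) ℂ) (k : ℂ) (s : ℝ) (c : ℝ → Idx p m → ℂ) : Prop :=
  ∀ i, ACD (fun x => c x i)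
    (fun x => (∑ l, Q x i l * c x l) + Complex.I * k * ((sg i - s : ℝ) : ℂ) * c x i)

/-- `r' = -r Q + ik (s - Σ) r`. -/
def RowODE (Q : ℝ → Matrix (Idx p m) (Idx p m) ℂ) (k : ℂ) (s : ℝ) (r : ℝ → Idx p m → ℂ) : Prop :=
  ∀ j, ACD (fun x => r x j)
    (fun x => -(∑ l, r x l * Q x l j) + Complex.I * k * ((s - sg j : ℝ) : ℂ) * r x j)

lemma ColODE.continuous (h : ColODE Q k s c) (i : Idx p m) : Continuous fun x => c x i :=
  (h i).continuous

lemma ColODE.neg_sharp (hQ : IsPotential Q) (h : ColODE (sharp Q) (-k) s c) :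
    ColODE Q k s (fun x => c (-x)) := fun i => by
  refine ((h i).neg_comp ?_).congr (.of_forall fun x => ?_)
  · refine (locallyIntegrable_finsetSum _ fun l _ => ?_).add ?_
    · exact locallyIntegrable_mul_continuous (hQ.sharp.int i l).locallyIntegrable (h.continuous l)
    · exact (continuous_const.mul (h.continuous i)).locallyIntegrable
  · simp only [sharp, Matrix.neg_apply, neg_neg, neg_mul, Finset.sum_neg_distrib]; push_cast; ring

lemma colODE_faddM (hQ : IsPotential Q) (hk : 0 ≤ k.im) (a : Fin p) :
    ColODE Q k 1 (fun x i => faddM Q x k i (pl a)) := fun i =>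
  ((isVolt_faddM hQ hk a).acd (hQ.voltP a) hk i).congr (.of_forall fun x => by
    simp only [thP]; push_cast; ring)

lemma colODE_faddN (hQ : IsPotential Q) (hk : 0 ≤ k.im) (b : Fin m) :
    ColODE Q k (-1) (fun x i => faddN Q x k i (mi b)) := fun i => by
  have := (isVolt_faddN hQ hk b).acd_neg (hQ.sharp.voltM b) hk i
  simp only [neg_neg] at this
  exact this.congr (.of_forall fun x => by
    simp only [thM, sharp, Matrix.neg_apply, neg_neg]; push_cast; ring)

lemma rowODE_dualM (hQ : IsPotential Q) (hk : 0 ≤ k.im) (b : Fin m) :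
    RowODE Q k (-1) (fun x i => dualM Q x k (mi b) i) := fun i =>
  ((isVolt_dualM hQ hk b).acd (hQ.neg_transpose.voltM b) hk i).congr (.of_forall fun x => by
    simp only [thM, Matrix.neg_apply, Matrix.transpose_apply, neg_mul, Finset.sum_neg_distrib]
    push_cast
    simp only [mul_comm (dualM _ _ _ _ _) (Q _ _ _)]; ring)

lemma rowODE_dualN (hQ : IsPotential Q) (hk : 0 ≤ k.im) (a : Fin p) :
    RowODE Q k 1 (fun x i => dualN Q x k (pl a) i) := fun i => by
  have := (isVolt_dualN hQ hk a).acd_neg (hQ.transpose_neg.voltP a) hk i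
  simp only [neg_neg] at this
  exact this.congr (.of_forall fun x => by
    simp only [thP, Matrix.transpose_apply, neg_mul, Finset.sum_neg_distrib]
    push_cast
    simp only [mul_comm (dualN _ _ _ _ _) (Q _ _ _)])

lemma acd_dot (hr : RowODE Q k s r) (hc : ColODE Q k t c) :
    ACD (fun x => ∑ l, r x l * c x l)
      (fun x => Complex.I * k * ((s - t : ℝ) : ℂ) * ∑ l, r x l * c x l) := by
  refine (ACD.sum _ fun l _ => (hr l).mul (hc l)).congr (.of_forall fun x => ?_)
  have e1 : ∑ i, (∑ l, r x l * Q x l i) * c x i = ∑ i, r x i * ∑ l, Q x i l * c x l := by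
    simp only [Finset.sum_mul, Finset.mul_sum, mul_assoc]
    exact Finset.sum_comm
  simp only [add_mul, mul_add, Finset.sum_add_distrib, neg_mul, Finset.sum_neg_distrib, e1]
  rw [Finset.mul_sum]
  have : ∀ i, Complex.I * k * ((s - t : ℝ) : ℂ) * (r x i * c x i) =
      Complex.I * k * ((s - sg i : ℝ) : ℂ) * r x i * c x i +
      r x i * (Complex.I * k * ((sg i - t : ℝ) : ℂ) * c x i) := fun i => by push_cast; ring
  simp only [this, Finset.sum_add_distrib]; ring

lemma dot_mul_exp_const (hr : RowODE Q k s r) (hc : ColODE Q k t c) (x y : ℝ) :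
    (∑ l, r x l * c x l) * Complex.exp (-(Complex.I * k * ((s - t : ℝ) : ℂ)) * x) =
    (∑ l, r y l * c y l) * Complex.exp (-(Complex.I * k * ((s - t : ℝ) : ℂ)) * y) :=
  ((acd_dot hr hc).mul (ACD.cexp _)).eq_of_zero (.of_forall fun x => by ring) x y

lemma dot_const (hr : RowODE Q k s r) (hc : ColODE Q k s c) (x y : ℝ) :
    ∑ l, r x l * c x l = ∑ l, r y l * c y l := by
  simpa using dot_mul_exp_const hr hc x y

lemma tendsto_dot {F : Filter ℝ} {ρ : ℂ} {j : Idx p m} (hr : ∃ C : ℝ, ∀ x i, ‖r x i‖ ≤ C)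
    (hc : ∀ i, Tendsto (fun x => c x i) F (𝓝 ((1 : Matrix (Idx p m) (Idx p m) ℂ) i j)))
    (hρ : Tendsto (fun x => r x j) F (𝓝 ρ)) : Tendsto (fun x => ∑ l, r x l * c x l) F (𝓝 ρ) := by
  obtain ⟨C, hC⟩ := hr
  have e : ∀ x, ∑ l, r x l * c x l =
      r x j + ∑ l, r x l * (c x l - (1 : Matrix (Idx p m) (Idx p m) ℂ) l j) := fun x => by
    simp only [mul_sub, Finset.sum_sub_distrib]
    have : ∑ l, r x l * (1 : Matrix (Idx p m) (Idx p m) ℂ) l j = r x j := by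
      simp only [Matrix.one_apply, mul_ite, mul_one, mul_zero, Finset.sum_ite_eq', Finset.mem_univ,
        if_true]
    rw [this]; ring
  simp only [e]
  rw [← add_zero ρ]
  refine hρ.add ?_
  rw [← Finset.sum_const_zero (ι := Idx p m) (s := Finset.univ)]
  refine tendsto_finsetSum _ fun l _ => ?_
  have h0 : Tendsto (fun x => c x l - (1 : Matrix (Idx p m) (Idx p m) ℂ) l j) F (𝓝 0) := by
    simpa using (hc l).sub_const ((1 : Matrix (Idx p m) (Idx p m) ℂ) l j)
  exact h0.zero_mul_isBoundedUnder_le (isBoundedUnder_of ⟨C, fun x => hC x l⟩) |>.congr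
    fun x => mul_comm _ _

lemma bdd_neg {f : ℝ → Idx p m → ℂ} (h : ∃ C : ℝ, ∀ x i, ‖f (-x) i‖ ≤ C) :
    ∃ C : ℝ, ∀ x i, ‖f x i‖ ≤ C :=
  h.imp fun _ hC x i => by simpa using hC (-x) i

lemma tendsto_of_neg {f : ℝ → ℂ} {l : ℂ} (h : Tendsto (fun x => f (-x)) atTop (𝓝 l)) :
    Tendsto f atBot (𝓝 l) := by
  simpa [Function.comp_def] using h.comp tendsto_neg_atBot_atTop

lemma tendsto_of_neg' {f : ℝ → ℂ} {l : ℂ} (h : Tendsto (fun x => f (-x)) atBot (𝓝 l)) :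
    Tendsto f atTop (𝓝 l) := by
  simpa [Function.comp_def] using h.comp tendsto_neg_atTop_atBot

/-! ### Limits at infinity -/

lemma faddM_bdd (hQ : IsPotential Q) (hk : 0 ≤ k.im) (a : Fin p) :
    ∃ C : ℝ, ∀ x i, ‖faddM Q x k i (pl a)‖ ≤ C := (isVolt_faddM hQ hk a).bdd

lemma faddN_bdd (hQ : IsPotential Q) (hk : 0 ≤ k.im) (b : Fin m) :
    ∃ C : ℝ, ∀ x i, ‖faddN Q x k i (mi b)‖ ≤ C :=
  bdd_neg (f := fun x i => faddN Q x k i (mi b)) (isVolt_faddN hQ hk b).bdd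

lemma dualM_bdd (hQ : IsPotential Q) (hk : 0 ≤ k.im) (b : Fin m) :
    ∃ C : ℝ, ∀ x i, ‖dualM Q x k (mi b) i‖ ≤ C := (isVolt_dualM hQ hk b).bdd

lemma dualN_bdd (hQ : IsPotential Q) (hk : 0 ≤ k.im) (a : Fin p) :
    ∃ C : ℝ, ∀ x i, ‖dualN Q x k (pl a) i‖ ≤ C :=
  bdd_neg (f := fun x i => dualN Q x k (pl a) i) (isVolt_dualN hQ hk a).bdd

lemma tendsto_faddM (hQ : IsPotential Q) (hk : 0 ≤ k.im) (a : Fin p) (i : Idx p m) :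
    Tendsto (fun x => faddM Q x k i (pl a)) atTop
      (𝓝 ((1 : Matrix (Idx p m) (Idx p m) ℂ) i (pl a))) :=
  (isVolt_faddM hQ hk a).tendsto_atTop (hQ.voltP a) hk i

lemma tendsto_faddN (hQ : IsPotential Q) (hk : 0 ≤ k.im) (b : Fin m) (i : Idx p m) :
    Tendsto (fun x => faddN Q x k i (mi b)) atBot
      (𝓝 ((1 : Matrix (Idx p m) (Idx p m) ℂ) i (mi b))) :=
  tendsto_of_neg ((isVolt_faddN hQ hk b).tendsto_atTop (hQ.sharp.voltM b) hk i)

lemma tendsto_dualM (hQ : IsPotential Q) (hk : 0 ≤ k.im) (b : Fin m) (i : Idx p m) :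
    Tendsto (fun x => dualM Q x k (mi b) i) atTop
      (𝓝 ((1 : Matrix (Idx p m) (Idx p m) ℂ) i (mi b))) :=
  (isVolt_dualM hQ hk b).tendsto_atTop (hQ.neg_transpose.voltM b) hk i

lemma tendsto_dualN (hQ : IsPotential Q) (hk : 0 ≤ k.im) (a : Fin p) (i : Idx p m) :
    Tendsto (fun x => dualN Q x k (pl a) i) atBot
      (𝓝 ((1 : Matrix (Idx p m) (Idx p m) ℂ) i (pl a))) :=
  tendsto_of_neg ((isVolt_dualN hQ hk a).tendsto_atTop (hQ.transpose_neg.voltP a) hk i)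

lemma tendsto_faddM_atBot (hQ : IsPotential Q) (hk : 0 ≤ k.im) (a a' : Fin p) :
    Tendsto (fun x => faddM Q x k (pl a') (pl a)) atBot (𝓝 (transL Q k (pl a') (pl a))) := by
  have := (isVolt_faddM hQ hk a).tendsto_atBot (hQ.voltP a) (i := pl a') (by simp [thP, sg])
  convert this using 2
  simp only [transL, Matrix.of_apply, Matrix.mul_apply, sg, sub_self, Complex.ofReal_zero, mul_zero,
    Complex.exp_zero, one_mul]

lemma tendsto_faddN_atTop (hQ : IsPotential Q) (hk : 0 ≤ k.im) (b b' : Fin m) :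
    Tendsto (fun x => faddN Q x k (mi b') (mi b)) atTop (𝓝 (transR Q k (mi b') (mi b))) := by
  have := (isVolt_faddN hQ hk b).tendsto_atBot (hQ.sharp.voltM b) (i := mi b') (by simp [thM, sg])
  have h2 := tendsto_of_neg' (f := fun x => faddN Q x k (mi b') (mi b)) this
  convert h2 using 2
  simp only [transR, Matrix.of_apply, Matrix.mul_apply, sg, sub_self, Complex.ofReal_zero, mul_zero,
    Complex.exp_zero, one_mul]
  have e := integral_neg_eq_self (fun y => ∑ l, Q y (mi b') l * faddN Q y k l (mi b)) volume
  simp only [sharp, Matrix.neg_apply, neg_mul, Finset.sum_neg_distrib]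
  rw [integral_neg, e, sub_neg_eq_add]

/-! ### Pairings of rows and columns -/

lemma dualN_faddM (hQ : IsPotential Q) (hk : 0 ≤ k.im) (x : ℝ) (a a' : Fin p) :
    ∑ l, dualN Q x k (pl a) l * faddM Q x k l (pl a') = transL Q k (pl a) (pl a') := by
  have h1 := dot_const (rowODE_dualN hQ hk a) (colODE_faddM hQ hk a')
  have h2 : Tendsto (fun x => ∑ l, faddM Q x k l (pl a') * dualN Q x k (pl a) l) atBot _ :=
    tendsto_dot (faddM_bdd hQ hk a') (tendsto_dualN hQ hk a) (tendsto_faddM_atBot hQ hk a' a)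
  simp only [mul_comm (faddM _ _ _ _ _)] at h2
  exact tendsto_nhds_unique (tendsto_const_nhds.congr fun y => h1 x y) h2

lemma dualM_faddN (hQ : IsPotential Q) (hk : 0 ≤ k.im) (x : ℝ) (b b' : Fin m) :
    ∑ l, dualM Q x k (mi b) l * faddN Q x k l (mi b') = transR Q k (mi b) (mi b') := by
  have h1 := dot_const (rowODE_dualM hQ hk b) (colODE_faddN hQ hk b')
  have h2 : Tendsto (fun x => ∑ l, faddN Q x k l (mi b') * dualM Q x k (mi b) l) atTop _ :=
    tendsto_dot (faddN_bdd hQ hk b') (tendsto_dualM hQ hk b) (tendsto_faddN_atTop hQ hk b' b)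
  simp only [mul_comm (faddN _ _ _ _ _)] at h2
  exact tendsto_nhds_unique (tendsto_const_nhds.congr fun y => h1 x y) h2

lemma dualM_faddM (hQ : IsPotential Q) (hk : 0 ≤ k.im) (x : ℝ) (b : Fin m) (a : Fin p) :
    ∑ l, dualM Q x k (mi b) l * faddM Q x k l (pl a) = 0 := by
  have h1 := dot_mul_exp_const (rowODE_dualM hQ hk b) (colODE_faddM hQ hk a)
  have h2 := tendsto_dot (dualM_bdd hQ hk b) (tendsto_faddM hQ hk a) (tendsto_dualM hQ hk b (pl a))
  rw [Matrix.one_apply_ne (by simp)] at h2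
  have h3 := h2.zero_mul_isBoundedUnder_le (g := fun y : ℝ =>
    Complex.exp (-(Complex.I * k * ((-1 - 1 : ℝ) : ℂ)) * y)) ?_
  · have h4 := tendsto_nhds_unique (tendsto_const_nhds.congr fun y => h1 x y) h3
    exact (mul_eq_zero.1 h4).resolve_right (Complex.exp_ne_zero _)
  · refine isBoundedUnder_of_eventually_le (a := 1) ?_
    filter_upwards [eventually_ge_atTop 0] with y hy
    have := norm_cexp_I_le hk (γ := 2 * y) (by linarith)
    rwa [show Complex.I * k * ((2 * y : ℝ) : ℂ) = -(Complex.I * k * ((-1 - 1 : ℝ) : ℂ)) * y by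
      push_cast; ring] at this

lemma dualN_faddN (hQ : IsPotential Q) (hk : 0 ≤ k.im) (x : ℝ) (a : Fin p) (b : Fin m) :
    ∑ l, dualN Q x k (pl a) l * faddN Q x k l (mi b) = 0 := by
  have h1 := dot_mul_exp_const (rowODE_dualN hQ hk a) (colODE_faddN hQ hk b)
  have h2 := tendsto_dot (dualN_bdd hQ hk a) (tendsto_faddN hQ hk b) (tendsto_dualN hQ hk a (mi b))
  rw [Matrix.one_apply_ne (by simp)] at h2
  have h3 := h2.zero_mul_isBoundedUnder_le (g := fun y : ℝ =>
    Complex.exp (-(Complex.I * k * ((1 - -1 : ℝ) : ℂ)) * y)) ?_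
  · have h4 := tendsto_nhds_unique (tendsto_const_nhds.congr fun y => h1 x y) h3
    exact (mul_eq_zero.1 h4).resolve_right (Complex.exp_ne_zero _)
  · refine isBoundedUnder_of_eventually_le (a := 1) ?_
    filter_upwards [eventually_le_atBot 0] with y hy
    have := norm_cexp_I_le hk (γ := -2 * y) (by linarith)
    rwa [show Complex.I * k * ((-2 * y : ℝ) : ℂ) = -(Complex.I * k * ((1 - -1 : ℝ) : ℂ)) * y by
      push_cast; ring] at this

end AKNS

namespace AKNS

variable {p m : ℕ} {Q : ℝ → Matrix (Idx p m) (Idx p m) ℂ} {k : ℂ} {s t : ℝ}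

/-! ### The wedge product -/

lemma det_updateRow_eq {ι : Type*} [Fintype ι] [DecidableEq ι] (A : Matrix ι ι ℂ) (r : ι)
    (b : ι → ℂ) : (A.updateRow r b).det = ∑ c, b c * A.adjugate c r := by
  rw [← Matrix.cramer_transpose_apply, Matrix.cramer_eq_adjugate_mulVec,
    ← Matrix.adjugate_transpose, Matrix.mulVec_transpose]
  rfl

/-- The matrix with the `+` rows of `A`, the row `v`, and the `-` rows of `B`. -/
def wedgeMat (A B : Matrix (Idx p m) (Idx p m) ℂ) (v : Idx p m → ℂ) :
    Matrix (Idx p m) (Idx p m) ℂ :=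
  Matrix.of fun r c => match r with
    | Sum.inl a => A (pl a) c
    | Sum.inr (Sum.inl _) => v c
    | Sum.inr (Sum.inr b) => B (mi b) c

lemma wedgeMat_updateRow (A B : Matrix (Idx p m) (Idx p m) ℂ) (v w : Idx p m → ℂ) :
    (wedgeMat A B v).updateRow ze w = wedgeMat A B w := by
  ext r c
  rcases r with a | a | b
  · rw [Matrix.updateRow_ne (by simp)]; rfl
  · rw [Matrix.updateRow_self]; rfl
  · rw [Matrix.updateRow_ne (by simp)]; rfl

lemma wedgeVec_eq (A B : Matrix (Idx p m) (Idx p m) ℂ) (i : Idx p m) :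
    wedgeVec A B i = (wedgeMat A B ((1 : Matrix (Idx p m) (Idx p m) ℂ) i)).det := rfl

lemma det_wedgeMat (A B : Matrix (Idx p m) (Idx p m) ℂ) (v : Idx p m → ℂ) :
    (wedgeMat A B v).det = ∑ l, v l * wedgeVec A B l := by
  simp only [wedgeVec_eq]
  have h : ∀ w, (wedgeMat A B w).det = ∑ c, w c * (wedgeMat A B v).adjugate c ze := fun w => by
    rw [← wedgeMat_updateRow A B v w, det_updateRow_eq]
  rw [h v]
  refine Finset.sum_congr rfl fun l _ => ?_
  rw [h]
  simp only [Matrix.one_apply, ite_mul, one_mul, zero_mul, Finset.sum_ite_eq, Finset.mem_univ,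
    if_true]

lemma row_wedgeVec_plus (A B : Matrix (Idx p m) (Idx p m) ℂ) (a : Fin p) :
    ∑ l, A (pl a) l * wedgeVec A B l = 0 := by
  rw [← det_wedgeMat]
  exact Matrix.det_zero_of_row_eq (i := pl a) (j := ze) (by simp) rfl

lemma row_wedgeVec_minus (A B : Matrix (Idx p m) (Idx p m) ℂ) (b : Fin m) :
    ∑ l, B (mi b) l * wedgeVec A B l = 0 := by
  rw [← det_wedgeMat]
  exact Matrix.det_zero_of_row_eq (i := mi b) (j := ze) (by simp) rfl

open scoped ComplexOrder in
/-- The wedge product of independent rows does not vanish. -/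
lemma exists_wedgeVec_ne_zero {A B : Matrix (Idx p m) (Idx p m) ℂ}
    (h : ∀ (α : Fin p → ℂ) (β : Fin m → ℂ),
      (∀ l, ∑ a, α a * A (pl a) l + ∑ b, β b * B (mi b) l = 0) → α = 0 ∧ β = 0) :
    ∃ l, wedgeVec A B l ≠ 0 := by
  by_contra! hw
  have hdet : ∀ v, (wedgeMat A B v).det = 0 := fun v => by rw [det_wedgeMat]; simp [hw]
  obtain ⟨v, hv0, hv⟩ := Matrix.exists_mulVec_eq_zero_iff.2 (hdet 0)
  obtain ⟨u, hu0, hu⟩ := Matrix.exists_vecMul_eq_zero_iff.2 (hdet (star v))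
  have h1 : ∀ a, ∑ l, A (pl a) l * v l = 0 := fun a => congrFun hv (pl a)
  have h2 : ∀ b, ∑ l, B (mi b) l * v l = 0 := fun b => congrFun hv (mi b)
  have h3 : ∀ l, ∑ a, u (pl a) * A (pl a) l + (u ze * star (v l) + ∑ b, u (mi b) * B (mi b) l)
      = 0 := fun l => by
    have := congrFun hu l
    simp only [Matrix.vecMul, dotProduct, Fintype.sum_sum_type, Finset.univ_unique,
      Finset.sum_singleton] at this
    exact this
  have h4 : u ze * ∑ l, star (v l) * v l = 0 := by
    have e : ∑ l, (∑ a, u (pl a) * A (pl a) l + (u ze * star (v l) + ∑ b, u (mi b) * B (mi b) l)) *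
        v l = 0 := Finset.sum_eq_zero fun l _ => by rw [h3, zero_mul]
    simp only [add_mul, Finset.sum_add_distrib, Finset.sum_mul] at e
    rw [Finset.sum_comm, Finset.sum_comm (s := Finset.univ (α := Idx p m)) (t := Finset.univ (α := Fin m))] at e
    simp only [mul_assoc, ← Finset.mul_sum, h1, h2, mul_zero, Finset.sum_const_zero, zero_add,
      add_zero] at e
    exact e
  have h5 : u ze = 0 := by
    refine (mul_eq_zero.1 h4).resolve_right fun h => hv0 ?_
    exact dotProduct_star_self_eq_zero.1 (by
      rw [← h]; rfl)
  obtain ⟨h6, h7⟩ := h (fun a => u (pl a)) (fun b => u (mi b)) fun l => by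
    have := h3 l
    rw [h5, zero_mul, zero_add] at this
    exact this
  refine hu0 (funext fun r => ?_)
  rcases r with a | a | b
  · exact congrFun h6 a
  · exact h5
  · exact congrFun h7 b

lemma colODE_wedgeVec (hQ : IsPotential Q) {A B : ℝ → Matrix (Idx p m) (Idx p m) ℂ}
    (hA : ∀ a, RowODE Q k 1 (fun x => A x (pl a))) (hB : ∀ b, RowODE Q k (-1) (fun x => B x (mi b))) :
    ColODE Q k 0 (fun x => wedgeVec (A x) (B x)) := by
  intro i
  set W : ℝ → Matrix (Idx p m) (Idx p m) ℂ := fun x =>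
    wedgeMat (A x) (B x) ((1 : Matrix (Idx p m) (Idx p m) ℂ) i) with hW
  set G : ℝ → Matrix (Idx p m) (Idx p m) ℂ := fun x =>
    -(Q x + Matrix.diagonal fun j => Complex.I * k * ((sg j : ℝ) : ℂ)) with hG
  set W' : ℝ → Matrix (Idx p m) (Idx p m) ℂ := fun x => Matrix.of fun r c =>
    (W x * G x) r c + Complex.I * k * ((sg r : ℝ) : ℂ) * W x r c -
      (if r = ze then G x i c else 0) with hW'
  have hmul : ∀ x r c, (W x * G x) r c = -(∑ l, W x r l * Q x l c) -
      Complex.I * k * ((sg c : ℝ) : ℂ) * W x r c := fun x r c => by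
    simp only [hG, Matrix.mul_neg, Matrix.mul_add, Matrix.neg_apply, Matrix.add_apply,
      Matrix.mul_diagonal, Matrix.mul_apply (N := Q x)]
    ring
  have hd : ∀ r c, ACD (fun x => W x r c) (fun x => W' x r c) := by
    intro r c
    rcases r with a | u | b
    · refine (hA a c).congr (.of_forall fun x => ?_)
      simp only [hW', Matrix.of_apply, hmul]
      rw [if_neg (by simp)]
      simp only [hW, wedgeMat, Matrix.of_apply, sg]; push_cast; ring
    · refine (ACD.const _).congr (.of_forall fun x => ?_)
      simp only [hW', Matrix.of_apply]
      have e : (W x * G x) (Sum.inr (Sum.inl u)) c = G x i c := by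
        rw [Matrix.mul_apply]
        simp only [hW, wedgeMat, Matrix.of_apply, Matrix.one_apply, ite_mul, one_mul, zero_mul,
          Finset.sum_ite_eq, Finset.mem_univ, if_true]
      rw [e]
      simp [sg]
    · refine (hB b c).congr (.of_forall fun x => ?_)
      simp only [hW', Matrix.of_apply, hmul]
      rw [if_neg (by simp)]
      simp only [hW, wedgeMat, Matrix.of_apply, sg]; push_cast; ring
  refine (ACD.det hd).congr (.of_forall fun x => ?_)
  have e1 : ∀ r, ((W x).updateRow r (W' x r)).det =
      ((W x).updateRow r ((W x * G x) r)).det + Complex.I * k * ((sg r : ℝ) : ℂ) * (W x).det -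
        (if r = ze then ((W x).updateRow r (G x i)).det else 0) := by
    intro r
    have hWr : (W x).det = ((W x).updateRow r (W x r)).det := by rw [Matrix.updateRow_eq_self]
    rw [hWr]
    simp only [det_updateRow_eq, hW', Matrix.of_apply]
    by_cases hr : r = ze
    · simp only [hr, if_true, sub_mul, add_mul, Finset.sum_sub_distrib, Finset.sum_add_distrib,
        mul_assoc, Finset.mul_sum]
    · simp only [hr, if_false, sub_zero, add_mul, Finset.sum_add_distrib, mul_assoc, Finset.mul_sum]
  have e2 : (G x).trace = -∑ r : Idx p m, Complex.I * k * ((sg r : ℝ) : ℂ) := by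
    simp only [hG, Matrix.trace, Matrix.diag_apply, Matrix.neg_apply, Matrix.add_apply,
      Matrix.diagonal_apply_eq, Finset.sum_neg_distrib, hQ.off x _ _ rfl, zero_add]
  simp only [e1, Finset.sum_sub_distrib, Finset.sum_add_distrib, sum_det_updateRow_vecMul, e2,
    ← Finset.sum_mul, Finset.sum_ite_eq', Finset.mem_univ, if_true]
  have e3 : ((W x).updateRow ze (G x i)).det = ∑ l, G x i l * wedgeVec (A x) (B x) l := by
    rw [hW, wedgeMat_updateRow, det_wedgeMat]
  rw [e3]
  simp only [hG, Matrix.neg_apply, Matrix.add_apply, Matrix.diagonal_apply, neg_mul, add_mul,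
    Finset.sum_neg_distrib, Finset.sum_add_distrib, ite_mul, zero_mul, Finset.sum_ite_eq,
    Finset.mem_univ, if_true, sub_zero]
  ring

lemma colODE_omegaVecP (hQ : IsPotential Q) (hk : 0 ≤ k.im) :
    ColODE Q k 0 (fun x => omegaVecP Q x k) :=
  colODE_wedgeVec hQ (rowODE_dualN hQ hk) (rowODE_dualM hQ hk)

lemma colODE_FP (hQ : IsPotential Q) (hk : 0 ≤ k.im) (j : Idx p m) :
    ColODE Q k (sg j) (fun x i => FP Q x k i j) := by
  rcases j with a | u | b
  · exact colODE_faddM hQ hk a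
  · exact colODE_omegaVecP hQ hk
  · exact colODE_faddN hQ hk b

lemma FM_eq (hQ : IsPotential Q) (hk : k.im ≤ 0) (x : ℝ) : FM Q x k = FP (sharp Q) (-x) (-k) := by
  have := FM_sharp hQ.sharp (k := -k) (by simpa using hk) x
  rwa [sharp_sharp, neg_neg] at this

lemma colODE_FM (hQ : IsPotential Q) (hk : k.im ≤ 0) (j : Idx p m) :
    ColODE Q k (sg j) (fun x i => FM Q x k i j) := by
  simp only [FM_eq hQ hk]
  exact (colODE_FP hQ.sharp (k := -k) (by simpa using hk) j).neg_sharp hQ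

/-! ### Wiener classes of the Faddeev functions -/

lemma one_apply_comm {ι : Type*} [DecidableEq ι] (i j : ι) :
    (1 : Matrix ι ι ℂ) i j = (1 : Matrix ι ι ℂ) j i := by
  simp [Matrix.one_apply, eq_comm]

lemma wie_FP (hQ : IsPotential Q) (x : ℝ) (i j : Idx p m) :
    Wie .P ((1 : Matrix (Idx p m) (Idx p m) ℂ) i j) (fun k => FP Q x k i j) := by
  rcases j with a | u | b
  · exact (hQ.voltP a).wie (fun k hk => isVolt_faddM hQ hk a) x i
  · have h : ∀ r c, Wie .P ((1 : Matrix (Idx p m) (Idx p m) ℂ).updateRow ze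
        ((1 : Matrix (Idx p m) (Idx p m) ℂ) i) r c)
        (fun k => wedgeMat (dualN Q x k) (dualM Q x k) ((1 : Matrix (Idx p m) (Idx p m) ℂ) i) r c) := by
      intro r c
      rcases r with a | u | b
      · have h1 := (hQ.transpose_neg.voltP a).wie (fun k hk => isVolt_dualN hQ hk a) (-x) c
        simp only [neg_neg] at h1
        rw [Matrix.updateRow_ne (by simp), one_apply_comm]
        exact h1
      · rw [Matrix.updateRow_self]
        exact Wie.const _
      · have h1 := (hQ.neg_transpose.voltM b).wie (fun k hk => isVolt_dualM hQ hk b) x c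
        rw [Matrix.updateRow_ne (by simp), one_apply_comm]
        exact h1
    have h2 := Wie.det h
    rw [det_updateRow_eq, Matrix.adjugate_one] at h2
    convert h2 using 1
    simp only [Matrix.one_apply, mul_ite, mul_one, mul_zero, Finset.sum_ite_eq', Finset.mem_univ,
      if_true]
    rfl
  · have h1 := (hQ.sharp.voltM b).wie (fun k hk => isVolt_faddN hQ hk b) (-x) i
    simp only [neg_neg] at h1
    exact h1

lemma wie_dualN (hQ : IsPotential Q) (x : ℝ) (a : Fin p) (i : Idx p m) :
    Wie .P ((1 : Matrix (Idx p m) (Idx p m) ℂ) (pl a) i) (fun k => dualN Q x k (pl a) i) := by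
  have h1 := (hQ.transpose_neg.voltP a).wie (fun k hk => isVolt_dualN hQ hk a) (-x) i
  simp only [neg_neg] at h1
  rw [one_apply_comm]
  exact h1

lemma wie_dualM (hQ : IsPotential Q) (x : ℝ) (b : Fin m) (i : Idx p m) :
    Wie .P ((1 : Matrix (Idx p m) (Idx p m) ℂ) (mi b) i) (fun k => dualM Q x k (mi b) i) := by
  rw [one_apply_comm]
  exact (hQ.neg_transpose.voltM b).wie (fun k hk => isVolt_dualM hQ hk b) x i

lemma wie_transL (hQ : IsPotential Q) (a a' : Fin p) :
    Wie .P ((1 : Matrix (Fin p) (Fin p) ℂ) a a') (fun k => transL Q k (pl a) (pl a')) := by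
  have h := Wie.sum Finset.univ fun l (_ : l ∈ Finset.univ) =>
    (wie_dualN hQ 0 a l).mul (wie_FP hQ 0 l (pl a'))
  refine Wie.congr (F := _) ?_ fun k hk => dualN_faddM hQ hk 0 a a'
  rw [← Matrix.mul_apply, one_mul] at h
  convert h using 1
  · simp [Matrix.one_apply]
  · rfl

lemma wie_transR (hQ : IsPotential Q) (b b' : Fin m) :
    Wie .P ((1 : Matrix (Fin m) (Fin m) ℂ) b b') (fun k => transR Q k (mi b) (mi b')) := by
  have h := Wie.sum Finset.univ fun l (_ : l ∈ Finset.univ) =>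
    (wie_dualM hQ 0 b l).mul (wie_FP hQ 0 l (mi b'))
  refine Wie.congr (F := _) ?_ fun k hk => dualM_faddN hQ hk 0 b b'
  rw [← Matrix.mul_apply, one_mul] at h
  convert h using 1
  · simp [Matrix.one_apply]
  · rfl

lemma wie_detLP (hQ : IsPotential Q) : Wie .P 1 (detLP Q) := by
  have := Wie.det (C := 1) (A := fun k => blkP (transL Q k)) (wie_transL hQ)
  rwa [Matrix.det_one] at this

lemma wie_detRM (hQ : IsPotential Q) : Wie .P 1 (detRM Q) := by
  have := Wie.det (C := 1) (A := fun k => blkM (transR Q k)) (wie_transR hQ)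
  rwa [Matrix.det_one] at this

lemma wie_FM (hQ : IsPotential Q) (x : ℝ) (i j : Idx p m) :
    Wie .M ((1 : Matrix (Idx p m) (Idx p m) ℂ) i j) (fun k => FM Q x k i j) := by
  refine Wie.congr (wie_FP hQ.sharp (-x) i j).to_M fun k hk => ?_
  rw [FM_eq hQ hk]

end AKNS

namespace AKNS

variable {p m : ℕ} {Q : ℝ → Matrix (Idx p m) (Idx p m) ℂ} {k : ℂ} {s t : ℝ}

/-! ### Transition matrices under reflection -/

lemma transL_apply (k : ℂ) {i j : Idx p m} (h : sg i = sg j) : transL Q k i j =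
    (1 : Matrix (Idx p m) (Idx p m) ℂ) i j - ∫ y, ∑ l, Q y i l * faddM Q y k l j := by
  simp only [transL, Matrix.of_apply, h, sub_self, Complex.ofReal_zero, mul_zero, Complex.exp_zero,
    one_mul, Matrix.mul_apply]

lemma transR_apply (k : ℂ) {i j : Idx p m} (h : sg i = sg j) : transR Q k i j =
    (1 : Matrix (Idx p m) (Idx p m) ℂ) i j + ∫ y, ∑ l, Q y i l * faddN Q y k l j := by
  simp only [transR, Matrix.of_apply, h, sub_self, Complex.ofReal_zero, mul_zero, Complex.exp_zero,
    one_mul, Matrix.mul_apply]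

lemma transR_sharp (hQ : IsPotential Q) (hk : 0 ≤ k.im) :
    blkP (transR (sharp Q) (-k)) = blkP (transL Q k) := by
  ext a a'
  simp only [blkP, Matrix.submatrix_apply]
  rw [transR_apply _ (i := pl a) (j := pl a') rfl, transL_apply _ (i := pl a) (j := pl a') rfl,
    ← integral_neg_eq_self (fun y => ∑ l, Q y (pl a) l * faddM Q y k l (pl a'))]
  refine add_integral_eq fun y => ?_
  simp only [faddN_sharp hQ hk, sharp, Matrix.neg_apply, neg_mul, Finset.sum_neg_distrib]

lemma transL_sharp (hQ : IsPotential Q) (hk : 0 ≤ k.im) :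
    blkM (transL (sharp Q) (-k)) = blkM (transR Q k) := by
  ext a a'
  simp only [blkM, Matrix.submatrix_apply]
  rw [transR_apply _ (i := mi a) (j := mi a') rfl, transL_apply _ (i := mi a) (j := mi a') rfl,
    ← integral_neg_eq_self (fun y => ∑ l, Q y (mi a) l * faddN Q y k l (mi a'))]
  refine (add_integral_eq fun y => ?_).symm
  simp only [faddM_sharp hQ hk, sharp, Matrix.neg_apply, neg_mul, Finset.sum_neg_distrib, neg_neg]

lemma blkP_transR (hQ : IsPotential Q) (hk : k.im ≤ 0) :
    blkP (transR Q k) = blkP (transL (sharp Q) (-k)) := by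
  have := transR_sharp hQ.sharp (k := -k) (by simpa using hk)
  rwa [sharp_sharp, neg_neg] at this

lemma blkM_transL (hQ : IsPotential Q) (hk : k.im ≤ 0) :
    blkM (transL Q k) = blkM (transR (sharp Q) (-k)) := by
  have := transL_sharp hQ.sharp (k := -k) (by simpa using hk)
  rwa [sharp_sharp, neg_neg] at this

/-! ### The Jost matrix -/

lemma row_ode_unique {r : ℝ → Idx p m → ℂ} (hQ : IsPotential Q) (h : RowODE Q k s r) (h0 : r 0 = 0)
    (x : ℝ) : r x = 0 := by
  refine ode_unique (G := fun x i l => -Q x l i +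
    (if l = i then Complex.I * k * ((s - sg i : ℝ) : ℂ) else 0)) (fun i l => ?_) (fun i => ?_) h0 x
  · exact (hQ.int l i).neg.locallyIntegrable.add (continuous_const.locallyIntegrable)
  · refine (h i).congr (.of_forall fun x => ?_)
    simp only [add_mul, Finset.sum_add_distrib, ite_mul, zero_mul, Finset.sum_ite_eq',
      Finset.mem_univ, if_true, neg_mul, Finset.sum_neg_distrib, mul_comm (Q x _ _)]

lemma RowODE.sum {ι : Type*} (S : Finset ι) {r : ι → ℝ → Idx p m → ℂ} (α : ι → ℂ)
    (h : ∀ a ∈ S, RowODE Q k s (r a)) : RowODE Q k s (fun x l => ∑ a ∈ S, α a * r a x l) := by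
  intro l
  refine (ACD.sum S fun a ha => ((h a ha) l).const_mul (α a)).congr (.of_forall fun x => ?_)
  simp only [mul_add, Finset.sum_add_distrib, mul_neg, Finset.sum_neg_distrib, Finset.mul_sum,
    Finset.sum_mul]
  congr 1
  · rw [Finset.sum_comm]; simp only [mul_assoc]
  · refine Finset.sum_congr rfl fun a _ => ?_; ring

lemma dualN_independent (hQ : IsPotential Q) (hk : 0 ≤ k.im) {α : Fin p → ℂ}
    (h : ∀ l, ∑ a, α a * dualN Q 0 k (pl a) l = 0) : α = 0 := by
  have h1 := row_ode_unique hQ (RowODE.sum Finset.univ α fun a _ => rowODE_dualN hQ hk a)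
    (funext h)
  ext a
  have h2 : Tendsto (fun x => ∑ a', α a' * dualN Q x k (pl a') (pl a)) atBot
      (𝓝 (∑ a', α a' * (1 : Matrix (Idx p m) (Idx p m) ℂ) (pl a) (pl a'))) :=
    tendsto_finsetSum _ fun a' _ => (tendsto_dualN hQ hk a' (pl a)).const_mul _
  have h3 := tendsto_nhds_unique (tendsto_const_nhds.congr fun x => (congrFun (h1 x) (pl a)).symm) h2
  simpa [Matrix.one_apply] using h3.symm

lemma dualM_independent (hQ : IsPotential Q) (hk : 0 ≤ k.im) {β : Fin m → ℂ}
    (h : ∀ l, ∑ b, β b * dualM Q 0 k (mi b) l = 0) : β = 0 := by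
  have h1 := row_ode_unique hQ (RowODE.sum Finset.univ β fun a _ => rowODE_dualM hQ hk a)
    (funext h)
  ext b
  have h2 : Tendsto (fun x => ∑ b', β b' * dualM Q x k (mi b') (mi b)) atTop
      (𝓝 (∑ b', β b' * (1 : Matrix (Idx p m) (Idx p m) ℂ) (mi b) (mi b'))) :=
    tendsto_finsetSum _ fun a' _ => (tendsto_dualM hQ hk a' (mi b)).const_mul _
  have h3 := tendsto_nhds_unique (tendsto_const_nhds.congr fun x => (congrFun (h1 x) (mi b)).symm) h2
  simpa [Matrix.one_apply] using h3.symm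

lemma sum_idx (F : Idx p m → ℂ) : ∑ l, F l = ∑ a, F (pl a) + F ze + ∑ b, F (mi b) := by
  simp [Fintype.sum_sum_type, add_assoc]

lemma dualN_omega (Q : ℝ → Matrix (Idx p m) (Idx p m) ℂ) (k : ℂ) (x : ℝ) (a : Fin p) :
    ∑ l, dualN Q x k (pl a) l * omegaVecP Q x k l = 0 := row_wedgeVec_plus _ _ a

lemma dualM_omega (Q : ℝ → Matrix (Idx p m) (Idx p m) ℂ) (k : ℂ) (x : ℝ) (b : Fin m) :
    ∑ l, dualM Q x k (mi b) l * omegaVecP Q x k l = 0 := row_wedgeVec_minus _ _ b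

lemma eq_zero_of_dualN_comb (hQ : IsPotential Q) (hk : 0 ≤ k.im) (hd : detLP Q k ≠ 0)
    {α : Fin p → ℂ} {β : Fin m → ℂ} {x : ℝ}
    (h : ∀ l, ∑ a, α a * dualN Q x k (pl a) l + ∑ b, β b * dualM Q x k (mi b) l = 0) : α = 0 := by
  refine Matrix.eq_zero_of_vecMul_eq_zero hd (funext fun a' => ?_)
  have h1 : ∑ l, (∑ a, α a * dualN Q x k (pl a) l + ∑ b, β b * dualM Q x k (mi b) l) *
      faddM Q x k l (pl a') = 0 := Finset.sum_eq_zero fun l _ => by rw [h, zero_mul]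
  simp only [add_mul, Finset.sum_add_distrib, Finset.sum_mul] at h1
  rw [Finset.sum_comm, Finset.sum_comm (s := Finset.univ (α := Idx p m))] at h1
  simp only [mul_assoc, ← Finset.mul_sum, dualN_faddM hQ hk, dualM_faddM hQ hk, mul_zero,
    Finset.sum_const_zero, add_zero] at h1
  exact h1

lemma eq_zero_of_dualM_comb (hQ : IsPotential Q) (hk : 0 ≤ k.im) (hd : detRM Q k ≠ 0)
    {α : Fin p → ℂ} {β : Fin m → ℂ} {x : ℝ}
    (h : ∀ l, ∑ a, α a * dualN Q x k (pl a) l + ∑ b, β b * dualM Q x k (mi b) l = 0) : β = 0 := by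
  refine Matrix.eq_zero_of_vecMul_eq_zero hd (funext fun a' => ?_)
  have h1 : ∑ l, (∑ a, α a * dualN Q x k (pl a) l + ∑ b, β b * dualM Q x k (mi b) l) *
      faddN Q x k l (mi a') = 0 := Finset.sum_eq_zero fun l _ => by rw [h, zero_mul]
  simp only [add_mul, Finset.sum_add_distrib, Finset.sum_mul] at h1
  rw [Finset.sum_comm, Finset.sum_comm (s := Finset.univ (α := Idx p m))] at h1
  simp only [mul_assoc, ← Finset.mul_sum, dualN_faddN hQ hk, dualM_faddN hQ hk, mul_zero,
    Finset.sum_const_zero, zero_add] at h1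
  exact h1

lemma exists_omega_ne_zero (hQ : IsPotential Q) (hk : 0 ≤ k.im) (hd : detLP Q k ≠ 0 ∨ detRM Q k ≠ 0) :
    ∃ l, omegaVecP Q 0 k l ≠ 0 := by
  refine exists_wedgeVec_ne_zero fun α β h => ?_
  rcases hd with hd | hd
  · have hα := eq_zero_of_dualN_comb hQ hk hd h
    exact ⟨hα, dualM_independent hQ hk fun l => by simpa [hα] using h l⟩
  · have hβ := eq_zero_of_dualM_comb hQ hk hd h
    exact ⟨dualN_independent hQ hk fun l => by simpa [hβ] using h l, hβ⟩

lemma dualN_FP (hQ : IsPotential Q) (hk : 0 ≤ k.im) (x : ℝ) (a : Fin p) (v : Idx p m → ℂ) :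
    ∑ l, dualN Q x k (pl a) l * (∑ j, FP Q x k l j * v j) =
      ∑ c, transL Q k (pl a) (pl c) * v (pl c) := by
  simp only [Finset.mul_sum]
  rw [Finset.sum_comm, sum_idx]
  simp only [FP, Matrix.of_apply, ← mul_assoc, ← Finset.sum_mul, dualN_faddM hQ hk, dualN_omega, dualN_faddN hQ hk,
    zero_mul, Finset.sum_const_zero, add_zero]

lemma dualM_FP (hQ : IsPotential Q) (hk : 0 ≤ k.im) (x : ℝ) (b : Fin m) (v : Idx p m → ℂ) :
    ∑ l, dualM Q x k (mi b) l * (∑ j, FP Q x k l j * v j) =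
      ∑ c, transR Q k (mi b) (mi c) * v (mi c) := by
  simp only [Finset.mul_sum]
  rw [Finset.sum_comm, sum_idx]
  simp only [FP, Matrix.of_apply, ← mul_assoc, ← Finset.sum_mul, dualM_faddM hQ hk, dualM_omega, dualM_faddN hQ hk,
    zero_mul, Finset.sum_const_zero, zero_add]

lemma det_FP_ne_zero (hQ : IsPotential Q) (hk : 0 ≤ k.im) (h1 : detLP Q k ≠ 0)
    (h2 : detRM Q k ≠ 0) : (FP Q 0 k).det ≠ 0 := by
  intro h0
  obtain ⟨v, hv0, hv⟩ := Matrix.exists_mulVec_eq_zero_iff.2 h0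
  have hv' : ∀ l, ∑ j, FP Q 0 k l j * v j = 0 := fun l => congrFun hv l
  have h3 : (fun c => v (pl c)) = 0 := Matrix.eq_zero_of_mulVec_eq_zero h1 (funext fun a => by
    have := dualN_FP hQ hk 0 a v
    simp only [hv', mul_zero, Finset.sum_const_zero] at this
    exact this.symm)
  have h4 : (fun c => v (mi c)) = 0 := Matrix.eq_zero_of_mulVec_eq_zero h2 (funext fun a => by
    have := dualM_FP hQ hk 0 a v
    simp only [hv', mul_zero, Finset.sum_const_zero] at this
    exact this.symm)
  have h3' : ∀ c, v (pl c) = 0 := fun c => congrFun h3 c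
  have h4' : ∀ c, v (mi c) = 0 := fun c => congrFun h4 c
  obtain ⟨l, hl⟩ := exists_omega_ne_zero hQ hk (Or.inl h1)
  have h5 := hv' l
  rw [sum_idx] at h5
  simp only [h3', h4', mul_zero, Finset.sum_const_zero, zero_add, add_zero] at h5
  have h6 : v ze = 0 := (mul_eq_zero.1 h5).resolve_left hl
  refine hv0 (funext fun r => ?_)
  rcases r with a | a | b
  · exact h3' a
  · exact h6
  · exact h4' b

/-! ### The scattering matrix -/

lemma acd_mul_exp {c : ℝ → Idx p m → ℂ} (h : ColODE Q k s c) (i : Idx p m) :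
    ACD (fun x => c x i * Complex.exp (Complex.I * k * x * s))
      (fun x => ∑ l, (Q x i l + if i = l then Complex.I * k * (sg i : ℝ) else 0) *
        (c x l * Complex.exp (Complex.I * k * x * s))) := by
  have h1 := (h i).mul (ACD.cexp (Complex.I * k * s))
  have e : ∀ x : ℝ, Complex.I * k * s * (x : ℂ) = Complex.I * k * x * s := fun x => by ring
  simp only [e] at h1
  refine h1.congr (.of_forall fun x => ?_)
  simp only [add_mul, Finset.sum_add_distrib, ite_mul, zero_mul, Finset.sum_ite_eq, Finset.mem_univ,
    if_true, ← mul_assoc, ← Finset.sum_mul]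
  push_cast; ring

lemma XiP_apply (x : ℝ) (i j : Idx p m) :
    XiP Q x k i j = FP Q x k i j * Complex.exp (Complex.I * k * x * (sg j : ℝ)) := by
  rw [XiP, expS, Matrix.mul_diagonal]

lemma XiM_apply (x : ℝ) (i j : Idx p m) :
    XiM Q x k i j = FM Q x k i j * Complex.exp (Complex.I * k * x * (sg j : ℝ)) := by
  rw [XiM, expS, Matrix.mul_diagonal]

/-- Column combinations of `Ξ⁺` that vanish at `0` vanish. -/
lemma XiP_mulVec_eq_zero (hQ : IsPotential Q) (hk : 0 ≤ k.im) {v : Idx p m → ℂ}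
    (h0 : ∀ i, ∑ j, XiP Q 0 k i j * v j = 0) (x : ℝ) (i : Idx p m) :
    ∑ j, XiP Q x k i j * v j = 0 := by
  refine congrFun (ode_unique (y := fun x i => ∑ j, XiP Q x k i j * v j) (G := fun x i l => Q x i l +
    if i = l then Complex.I * k * (sg i : ℝ) else 0) (fun i l => ?_) (fun i => ?_) (funext h0) x) i
  · exact (hQ.int i l).locallyIntegrable.add continuous_const.locallyIntegrable
  · have := ACD.sum Finset.univ fun j (_ : j ∈ Finset.univ) =>
      (acd_mul_exp (colODE_FP hQ hk j) i).const_mul (v j)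
    simp only [← XiP_apply] at this
    simp only [mul_comm (v _)] at this
    refine this.congr (.of_forall fun x => ?_)
    simp only [Finset.sum_mul, Finset.mul_sum, mul_assoc]
    exact Finset.sum_comm

lemma expS_zero : (expS k 0 : Matrix (Idx p m) (Idx p m) ℂ) = 1 := by
  simp [expS]

lemma XiP_zero : XiP Q 0 k = FP Q 0 k := by rw [XiP, expS_zero, mul_one]
lemma XiM_zero : XiM Q 0 k = FM Q 0 k := by rw [XiM, expS_zero, mul_one]

lemma XiM_eq (hQ : IsPotential Q) {k : ℝ} (h1 : detLP Q k ≠ 0) (h2 : detRM Q k ≠ 0) (x : ℝ) :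
    XiM Q x k = XiP Q x k * scatS Q k := by
  have h0 : XiM Q 0 k = XiP Q 0 k * scatS Q k := by
    rw [scatS, Matrix.mul_nonsing_inv_cancel_left]
    rw [XiP_zero]
    exact (det_FP_ne_zero hQ (by simp) h1 h2).isUnit
  ext i j
  rw [← sub_eq_zero]
  refine congrFun (ode_unique (y := fun x i => XiM Q x k i j - (XiP Q x k * scatS Q k) i j)
    (G := fun x i l => Q x i l +
    if i = l then Complex.I * k * (sg i : ℝ) else 0) (fun i l => ?_) (fun i => ?_) (funext fun i => ?_) x) i
  · exact (hQ.int i l).locallyIntegrable.add continuous_const.locallyIntegrable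
  · have a1 := ACD.sum Finset.univ fun l (_ : l ∈ Finset.univ) =>
      (acd_mul_exp (k := (k : ℂ)) (colODE_FP hQ (by simp) l) i).const_mul (scatS Q k l j)
    have a2 := acd_mul_exp (k := (k : ℂ)) (colODE_FM hQ (by simp) j) i
    simp only [← XiP_apply, ← XiM_apply] at a1 a2
    simp only [mul_comm (scatS Q k _ _)] at a1
    simp only [Matrix.mul_apply]
    refine (a2.sub a1).congr (.of_forall fun x => ?_)
    simp only [mul_sub, Finset.sum_sub_distrib]
    congr 1
    simp only [Finset.sum_mul, Finset.mul_sum, mul_assoc]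
    exact Finset.sum_comm
  · simp only [h0, sub_self, Pi.zero_apply]

end AKNS

namespace AKNS

variable {p m : ℕ} {Q : ℝ → Matrix (Idx p m) (Idx p m) ℂ} {k : ℂ}

/-! ### Matrices over Wiener classes -/

/-- All entries are in the Wiener class. -/
def WieM {ι κ : Type*} (d : Dom) (C : Matrix ι κ ℂ) (A : ℂ → Matrix ι κ ℂ) : Prop :=
  ∀ i j, Wie d (C i j) (fun k => A k i j)

section

variable {ι : Type*} [Fintype ι] [DecidableEq ι] {d : Dom} {C D : Matrix ι ι ℂ}
  {A B : ℂ → Matrix ι ι ℂ}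

omit [DecidableEq ι] in
lemma WieM.mul (hA : WieM d C A) (hB : WieM d D B) : WieM d (C * D) (fun k => A k * B k) :=
  fun i j => by
    simp only [Matrix.mul_apply]
    exact Wie.sum _ fun l _ => (hA i l).mul (hB l j)

omit [Fintype ι] [DecidableEq ι] in
lemma WieM.sub (hA : WieM d C A) (hB : WieM d D B) : WieM d (C - D) (fun k => A k - B k) :=
  fun i j => (hA i j).sub (hB i j)

omit [Fintype ι] [DecidableEq ι] in
lemma WieM.congr (hA : WieM d C A) (h : ∀ k ∈ d.D, A k = B k) : WieM d C B :=
  fun i j => (hA i j).congr fun k hk => by rw [h k hk]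

lemma WieM.inv_real (hA : WieM .R 1 A) (h : ∀ k : ℝ, (A k).det ≠ 0) :
    WieM .R 1 (fun k => (A k)⁻¹) := fun i j => by
  have h1 := (Wie.det hA)
  rw [Matrix.det_one] at h1
  have h2 := (h1.inv_real one_ne_zero h).mul (Wie.adjugate hA i j)
  rw [inv_one, one_mul, Matrix.adjugate_one] at h2
  refine h2.congr fun k _ => ?_
  change _ = (A k)⁻¹ i j
  rw [Matrix.inv_def, Ring.inverse_eq_inv', Matrix.smul_apply, smul_eq_mul]

end

lemma blockDiag_pl (P : Matrix (Fin p) (Fin p) ℂ) (z : ℂ) (R : Matrix (Fin m) (Fin m) ℂ) (a a') :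
    blockDiag P z R (pl a) (pl a') = P a a' := rfl
lemma blockDiag_ze (P : Matrix (Fin p) (Fin p) ℂ) (z : ℂ) (R : Matrix (Fin m) (Fin m) ℂ) :
    blockDiag P z R ze ze = z := rfl
lemma blockDiag_mi (P : Matrix (Fin p) (Fin p) ℂ) (z : ℂ) (R : Matrix (Fin m) (Fin m) ℂ) (a a') :
    blockDiag P z R (mi a) (mi a') = R a a' := rfl
lemma blockDiag_off (P : Matrix (Fin p) (Fin p) ℂ) (z : ℂ) (R : Matrix (Fin m) (Fin m) ℂ)
    {i j : Idx p m} (h : sg i ≠ sg j) : blockDiag P z R i j = 0 := by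
  rcases i with a | a | a <;> rcases j with b | b | b <;> first | rfl | exact absurd rfl h

lemma sg_cases (i j : Idx p m) (h : sg i = sg j) : (∃ a b, i = pl a ∧ j = pl b) ∨
    (i = ze ∧ j = ze) ∨ ∃ a b, i = mi a ∧ j = mi b := by
  rcases i with a | a | a <;> rcases j with b | b | b <;> simp [sg] at h ⊢ <;> norm_num at h

/-- Two matrices agree if their block diagonal parts and their off-diagonal parts do. -/
lemma ext_block {A B : Matrix (Idx p m) (Idx p m) ℂ} (h1 : ∀ a a', A (pl a) (pl a') = B (pl a) (pl a'))
    (h2 : A ze ze = B ze ze) (h3 : ∀ b b', A (mi b) (mi b') = B (mi b) (mi b'))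
    (h4 : ∀ i j, sg i ≠ sg j → A i j = B i j) : A = B := by
  ext i j
  by_cases h : sg i = sg j
  · rcases sg_cases i j h with ⟨a, b, rfl, rfl⟩ | ⟨rfl, rfl⟩ | ⟨a, b, rfl, rfl⟩
    · exact h1 a b
    · exact h2
    · exact h3 a b
  · exact h4 i j h

lemma blockDiag_mul (P P' : Matrix (Fin p) (Fin p) ℂ) (z z' : ℂ) (R R' : Matrix (Fin m) (Fin m) ℂ) :
    blockDiag P z R * blockDiag P' z' R' = blockDiag (P * P') (z * z') (R * R') := by
  unfold blockDiag
  rw [Matrix.fromBlocks_multiply, Matrix.fromBlocks_multiply]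
  simp only [Matrix.zero_mul, Matrix.mul_zero, add_zero, zero_add]
  congr 1
  congr 1
  ext; simp [Matrix.mul_apply]

lemma blockDiag_one : blockDiag (1 : Matrix (Fin p) (Fin p) ℂ) 1 (1 : Matrix (Fin m) (Fin m) ℂ) = 1 := by
  unfold blockDiag
  rw [← Matrix.fromBlocks_one, ← Matrix.fromBlocks_one]
  congr 2

lemma blockDiag_inv {z : ℂ} (hz : z ≠ 0) :
    (blockDiag (1 : Matrix (Fin p) (Fin p) ℂ) z (1 : Matrix (Fin m) (Fin m) ℂ))⁻¹ =
      blockDiag 1 z⁻¹ 1 := by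
  refine Matrix.inv_eq_right_inv ?_
  rw [blockDiag_mul, one_mul, one_mul, mul_inv_cancel₀ hz, blockDiag_one]

lemma WieM.blockDiag {d : Dom} {P : ℂ → Matrix (Fin p) (Fin p) ℂ} {z : ℂ → ℂ}
    {R : ℂ → Matrix (Fin m) (Fin m) ℂ} (hP : WieM d 1 P) (hz : Wie d 1 z) (hR : WieM d 1 R) :
    WieM d (1 : Matrix (Idx p m) (Idx p m) ℂ) (fun k => AKNS.blockDiag (P k) (z k) (R k)) := by
  rw [← blockDiag_one]
  intro i j
  by_cases h : sg i = sg j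
  · rcases sg_cases i j h with ⟨a, b, rfl, rfl⟩ | ⟨rfl, rfl⟩ | ⟨a, b, rfl, rfl⟩
    · exact hP a b
    · exact hz
    · exact hR a b
  · simp only [blockDiag_off _ _ _ h]
    exact Wie.const 0

lemma WieM.one {ι : Type*} [DecidableEq ι] {d : Dom} : WieM d (1 : Matrix ι ι ℂ) (fun _ => 1) :=
  fun _ _ => Wie.const _

/-! ### Wiener classes of the scattering matrix -/

lemma FM_FP_scat (hQ : IsPotential Q) {k : ℝ} (h1 : detLP Q k ≠ 0) (h2 : detRM Q k ≠ 0) :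
    FP Q 0 k * scatS Q k = FM Q 0 k := by
  rw [← XiP_zero, ← XiM_zero, XiM_eq hQ h1 h2]

lemma dualN_FM (hQ : IsPotential Q) (k : ℝ) (x : ℝ) (a a' : Fin p) :
    ∑ l, dualN Q x k (pl a) l * FM Q x k l (pl a') = (1 : Matrix (Fin p) (Fin p) ℂ) a a' := by
  have hk : 0 ≤ (k : ℂ).im := by simp
  have h1 := dot_const (rowODE_dualN hQ hk a) (colODE_FM hQ (k := k) (by simp) (pl a'))
  have h3 : ∀ l, Tendsto (fun x => FM Q x k l (pl a')) atBot
      (𝓝 ((1 : Matrix (Idx p m) (Idx p m) ℂ) l (pl a'))) := fun l => by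
    refine tendsto_of_neg ?_
    have := tendsto_faddM hQ.sharp (k := -k) (by simp) a' l
    refine this.congr fun x => ?_
    rw [FM_eq hQ (by simp), neg_neg]
    rfl
  have h2 := tendsto_dot (dualN_bdd hQ hk a) h3 (tendsto_dualN hQ hk a (pl a'))
  have h4 := tendsto_nhds_unique (tendsto_const_nhds.congr fun y => h1 x y) h2
  rw [h4]; simp [Matrix.one_apply, eq_comm]

lemma dualM_FM (hQ : IsPotential Q) (k : ℝ) (x : ℝ) (a a' : Fin m) :
    ∑ l, dualM Q x k (mi a) l * FM Q x k l (mi a') = (1 : Matrix (Fin m) (Fin m) ℂ) a a' := by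
  have hk : 0 ≤ (k : ℂ).im := by simp
  have h1 := dot_const (rowODE_dualM hQ hk a) (colODE_FM hQ (k := k) (by simp) (mi a'))
  have h3 : ∀ l, Tendsto (fun x => FM Q x k l (mi a')) atTop
      (𝓝 ((1 : Matrix (Idx p m) (Idx p m) ℂ) l (mi a'))) := fun l => by
    refine tendsto_of_neg' ?_
    have := tendsto_faddN hQ.sharp (k := -k) (by simp) a' l
    refine this.congr fun x => ?_
    rw [FM_eq hQ (by simp), neg_neg]
    rfl
  have h2 := tendsto_dot (dualM_bdd hQ hk a) h3 (tendsto_dualM hQ hk a (mi a'))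
  have h4 := tendsto_nhds_unique (tendsto_const_nhds.congr fun y => h1 x y) h2
  rw [h4]; simp [Matrix.one_apply, eq_comm]

lemma blkP_scatS (hQ : IsPotential Q) {k : ℝ} (h1 : detLP Q k ≠ 0) (h2 : detRM Q k ≠ 0) :
    blkP (scatS Q k) = (blkP (transL Q k))⁻¹ := by
  refine (Matrix.inv_eq_right_inv ?_).symm
  ext a a'
  have := dualN_FP hQ (k := k) (by simp) 0 a (fun j => scatS Q k j (pl a'))
  simp only [← Matrix.mul_apply (M := FP Q 0 k), FM_FP_scat hQ h1 h2, dualN_FM hQ k] at this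
  rw [this]; rfl

lemma blkM_scatS (hQ : IsPotential Q) {k : ℝ} (h1 : detLP Q k ≠ 0) (h2 : detRM Q k ≠ 0) :
    blkM (scatS Q k) = (blkM (transR Q k))⁻¹ := by
  refine (Matrix.inv_eq_right_inv ?_).symm
  ext a a'
  have := dualM_FP hQ (k := k) (by simp) 0 a (fun j => scatS Q k j (mi a'))
  simp only [← Matrix.mul_apply (M := FP Q 0 k), FM_FP_scat hQ h1 h2, dualM_FM hQ k] at this
  rw [this]; rfl

lemma re_of_mem_R {k : ℂ} (hk : k ∈ Dom.R.D) : ((k.re : ℝ) : ℂ) = k := by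
  have : k.im = 0 := hk
  exact Complex.ext (by simp) (by simp [this])

lemma wie_scatS (hQ : IsPotential Q) (h : ∀ k : ℝ, detLP Q k ≠ 0 ∧ detRM Q k ≠ 0) :
    WieM .R 1 (fun k => scatS Q k.re) := by
  have h1 : WieM .R 1 (fun k => FP Q 0 k) := fun i j => (wie_FP hQ 0 i j).real
  have h2 : WieM .R 1 (fun k => FM Q 0 k) := fun i j => (wie_FM hQ 0 i j).real'
  have h3 := (h1.inv_real fun k => det_FP_ne_zero hQ (by simp) (h k).1 (h k).2).mul h2
  rw [one_mul] at h3
  refine h3.congr fun k hk => ?_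
  rw [scatS, XiP_zero, XiM_zero, re_of_mem_R hk]

lemma FP_sharp (hQ : IsPotential Q) (hk : k.im ≤ 0) (x : ℝ) :
    FP (sharp Q) x (-k) = FM Q (-x) k := by rw [FM_eq hQ hk, neg_neg]

lemma expS_neg (k : ℂ) (x : ℝ) : (expS (-k) (-x) : Matrix (Idx p m) (Idx p m) ℂ) = expS k x := by
  unfold expS
  congr 1; ext j; congr 1; push_cast; ring

lemma XiP_sharp (hQ : IsPotential Q) (hk : k.im ≤ 0) (x : ℝ) :
    XiP (sharp Q) x (-k) = XiM Q (-x) k := by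
  rw [XiP, XiM, FP_sharp hQ hk, ← expS_neg k, neg_neg]

lemma XiM_sharp (hQ : IsPotential Q) (hk : 0 ≤ k.im) (x : ℝ) :
    XiM (sharp Q) x (-k) = XiP Q (-x) k := by
  rw [XiP, XiM, FM_sharp hQ hk, ← expS_neg k, neg_neg]

lemma scatS_sharp (hQ : IsPotential Q) (k : ℝ) : scatS (sharp Q) k = scatSt Q (-k) := by
  have h1 := XiP_sharp hQ (k := ((-k : ℝ) : ℂ)) (by simp) 0
  have h2 := XiM_sharp hQ (k := ((-k : ℝ) : ℂ)) (by simp) 0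
  push_cast at h1 h2
  rw [neg_neg, neg_zero] at h1 h2
  rw [scatS, scatSt, h1, h2]; push_cast; rfl

lemma scatSt_sharp (hQ : IsPotential Q) (k : ℝ) : scatSt (sharp Q) k = scatS Q (-k) := by
  have := scatS_sharp hQ.sharp (-k)
  rw [sharp_sharp, neg_neg] at this
  exact this.symm

end AKNS

namespace AKNS

variable {p m : ℕ} {Q : ℝ → Matrix (Idx p m) (Idx p m) ℂ} {k : ℂ}

/-! ### Regular potentials -/

/-- The standing hypotheses on the potential. -/
structure Good (Q : ℝ → Matrix (Idx p m) (Idx p m) ℂ) : Prop where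
  pot : IsPotential Q
  reg : NoSpectralSingularities Q
  simple : SimpleNonoverlapping Q
  wind : HasWindingNumber (fun k => scatS Q k ze ze) 0
  windt : HasWindingNumber (fun k => scatSt Q k ze ze) 0

lemma HasWindingNumber.reflect {f : ℝ → ℂ} (h : HasWindingNumber f 0) :
    HasWindingNumber (fun k => f (-k)) 0 := by
  obtain ⟨φ, h1, h2, a, b, ha, hb, hab⟩ := h
  refine ⟨fun t => φ (-t), h1.comp continuous_neg, fun t => h2 _, b, a,
    hb.comp tendsto_neg_atBot_atTop, ha.comp tendsto_neg_atTop_atBot, ?_⟩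
  simp only [Int.cast_zero, mul_zero] at hab ⊢
  linear_combination -hab

lemma detRP_sharp (hQ : IsPotential Q) (hk : k.im ≤ 0) : detRP (sharp Q) k = detLP Q (-k) := by
  rw [detRP, detLP, blkP_transR hQ.sharp hk, sharp_sharp]

lemma detLM_sharp (hQ : IsPotential Q) (hk : k.im ≤ 0) : detLM (sharp Q) k = detRM Q (-k) := by
  rw [detLM, detRM, blkM_transL hQ.sharp hk, sharp_sharp]

lemma detLP_sharp (hQ : IsPotential Q) (hk : 0 ≤ k.im) : detLP (sharp Q) k = detRP Q (-k) := by
  rw [detRP, detLP, blkP_transR hQ (by simpa using hk), neg_neg]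

lemma detRM_sharp (hQ : IsPotential Q) (hk : 0 ≤ k.im) : detRM (sharp Q) k = detLM Q (-k) := by
  rw [detLM, detRM, blkM_transL hQ (by simpa using hk), neg_neg]

lemma deriv_ne_of_neg {f g : ℂ → ℂ} {U : Set ℂ} (hU : IsOpen U) (hk : k ∈ U)
    (h : ∀ z ∈ U, f z = g (-z)) (hg : deriv g (-k) ≠ 0) : deriv f k ≠ 0 := by
  have h1 : f =ᶠ[𝓝 k] fun z => g (-z) := by
    filter_upwards [hU.mem_nhds hk] with z hz using h z hz
  rw [h1.deriv_eq, deriv_comp_neg]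
  exact neg_ne_zero.2 hg

lemma isOpen_up : IsOpen {k : ℂ | 0 < k.im} := isOpen_lt continuous_const Complex.continuous_im
lemma isOpen_lo : IsOpen {k : ℂ | k.im < 0} := isOpen_lt Complex.continuous_im continuous_const

lemma Good.sharp (h : Good Q) : Good (sharp Q) where
  pot := h.pot.sharp
  reg k := by
    obtain ⟨h1, h2, h3, h4, h5, h6⟩ := h.reg (-k)
    push_cast at h1 h2 h3 h4
    rw [detLP_sharp h.pot (by simp), detRP_sharp h.pot (by simp), detLM_sharp h.pot (by simp),
      detRM_sharp h.pot (by simp), scatS_sharp h.pot, scatSt_sharp h.pot]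
    exact ⟨h2, h1, h4, h3, h6, h5⟩
  simple := by
    have e1 : ∀ k : ℂ, 0 < k.im → (-k).im < 0 := fun k hk => by simpa using hk
    have e2 : ∀ k : ℂ, k.im < 0 → 0 < (-k).im := fun k hk => by simpa using hk
    refine ⟨fun k hk h0 => ?_, fun k hk h0 => ?_, fun k hk h0 => ?_, fun k hk h0 => ?_,
      fun k hk h0 => ?_, fun k hk h0 => ?_⟩
    · rw [detLP_sharp h.pot hk.le] at h0
      exact deriv_ne_of_neg isOpen_up hk (fun z hz => detLP_sharp h.pot (le_of_lt hz))
        (h.simple.simpleRP _ (e1 k hk) h0)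
    · rw [detRM_sharp h.pot hk.le] at h0
      exact deriv_ne_of_neg isOpen_up hk (fun z hz => detRM_sharp h.pot (le_of_lt hz))
        (h.simple.simpleLM _ (e1 k hk) h0)
    · rw [detRP_sharp h.pot hk.le] at h0
      exact deriv_ne_of_neg isOpen_lo hk (fun z hz => detRP_sharp h.pot (le_of_lt hz))
        (h.simple.simpleLP _ (e2 k hk) h0)
    · rw [detLM_sharp h.pot hk.le] at h0
      exact deriv_ne_of_neg isOpen_lo hk (fun z hz => detLM_sharp h.pot (le_of_lt hz))
        (h.simple.simpleRM _ (e2 k hk) h0)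
    · rw [detLP_sharp h.pot hk.le, detRM_sharp h.pot hk.le] at h0
      exact h.simple.disjLo _ (e1 k hk) h0
    · rw [detRP_sharp h.pot hk.le, detLM_sharp h.pot hk.le] at h0
      exact h.simple.disjUp _ (e2 k hk) h0
  wind := by simpa only [scatS_sharp h.pot] using h.windt.reflect
  windt := by simpa only [scatSt_sharp h.pot] using h.wind.reflect

lemma Good.detLP (h : Good Q) (k : ℝ) : detLP Q k ≠ 0 := (h.reg k).1
lemma Good.detRM (h : Good Q) (k : ℝ) : detRM Q k ≠ 0 := (h.reg k).2.2.2.1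

lemma Good.wie_scatS (h : Good Q) : WieM .R 1 (fun k => scatS Q k.re) :=
  AKNS.wie_scatS h.pot fun k => ⟨h.detLP k, h.detRM k⟩

lemma Good.wh (h : Good Q) : IsWienerHopf (fun k => scatS Q k ze ze) (AlP Q, AlM Q) ∧
    Wie .P 1 (AlP Q) ∧ Wie .P 1 (fun k => (AlP Q k)⁻¹) ∧ Wie .M 1 (AlM Q) ∧
      Wie .M 1 (fun k => (AlM Q k)⁻¹) := by
  have h1 := h.wie_scatS ze ze
  rw [Matrix.one_apply_eq] at h1
  exact wienerHopf_spec h1 (fun k => by simp) h.wind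

lemma Good.wht_aux (h : Good Q) : IsWienerHopf (fun k => scatSt Q k ze ze) (ArP Q, ArM Q) := by
  have h1 := (h.sharp.wie_scatS ze ze).neg_real
  rw [Matrix.one_apply_eq] at h1
  refine (wienerHopf_spec h1 (fun k => ?_) h.windt).1
  simp only [scatS_sharp h.pot]
  simp

lemma IsWienerHopf.reflect {f : ℝ → ℂ} {A : (ℂ → ℂ) × (ℂ → ℂ)} (h : IsWienerHopf f A) :
    IsWienerHopf (fun k => f (-k)) (fun k => A.2 (-k), fun k => A.1 (-k)) := by
  have m1 : MapsTo (fun k : ℂ => -k) {k | 0 ≤ k.im} {k | k.im ≤ 0} := fun k hk => by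
    simpa using hk
  have m2 : MapsTo (fun k : ℂ => -k) {k | k.im ≤ 0} {k | 0 ≤ k.im} := fun k hk => by
    simpa using hk
  have t : Tendsto (fun k : ℂ => -k) (cocompact ℂ) (cocompact ℂ) :=
    (Homeomorph.neg ℂ).isClosedEmbedding.tendsto_cocompact
  refine ⟨h.contM.comp continuous_neg.continuousOn m1, h.contP.comp continuous_neg.continuousOn m2,
    h.analM.comp differentiable_neg.differentiableOn fun k hk => ?_,
    h.analP.comp differentiable_neg.differentiableOn fun k hk => ?_,
    fun k hk => h.nzM _ (m1 hk), fun k hk => h.nzP _ (m2 hk),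
    h.limM.comp ?_, h.limP.comp ?_, fun k => ?_⟩
  · simpa using hk
  · simpa using hk
  · exact tendsto_inf.2 ⟨t.mono_left inf_le_left, (tendsto_principal_principal.2 m1).mono_left inf_le_right⟩
  · exact tendsto_inf.2 ⟨t.mono_left inf_le_left, (tendsto_principal_principal.2 m2).mono_left inf_le_right⟩
  · have := h.fact (-k)
    push_cast at this
    rw [this, mul_comm]

lemma Good.A_sharp (h : Good Q) : (∀ k : ℂ, 0 ≤ k.im → AlP (AKNS.sharp Q) k = ArM Q (-k)) ∧
    ∀ k : ℂ, k.im ≤ 0 → AlM (AKNS.sharp Q) k = ArP Q (-k) := by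
  have h1 := h.wht_aux.reflect
  have h2 := h.sharp.wh.1
  simp only [scatS_sharp h.pot] at h2
  exact h2.unique h1

lemma Good.wht (h : Good Q) : Wie .P 1 (ArP Q) ∧ Wie .P 1 (fun k => (ArP Q k)⁻¹) ∧
    (∀ k : ℂ, 0 ≤ k.im → ArP Q k ≠ 0) := by
  have h1 := h.A_sharp.2
  have h2 := h.sharp.wh
  refine ⟨h2.2.2.2.1.of_M.congr fun k hk => ?_, h2.2.2.2.2.of_M.congr fun k hk => ?_,
    h.wht_aux.nzP⟩
  · rw [h1 _ (by simpa [Dom.P] using hk), neg_neg]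
  · rw [h1 _ (by simpa [Dom.P] using hk), neg_neg]

lemma Good.corrC_sharp (h : Good Q) (hk : k.im ≤ 0) : corrC (AKNS.sharp Q) k = corrCt Q (-k) := by
  rw [corrC, corrCt, h.A_sharp.2 k hk]

lemma Good.corrCt_sharp (h : Good Q) (hk : 0 ≤ k.im) : corrCt (AKNS.sharp Q) k = corrC Q (-k) := by
  have := h.sharp.corrC_sharp (k := -k) (by simpa using hk)
  rw [sharp_sharp, neg_neg] at this
  exact this.symm

lemma Good.corrT_sharp (h : Good Q) (hk : 0 ≤ k.im) : corrT (AKNS.sharp Q) k = corrTt Q (-k) := by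
  rw [corrT, corrTt, h.A_sharp.1 k hk, blkP_transR h.pot (by simpa using hk),
    blkM_transL h.pot (by simpa using hk), neg_neg]

lemma Good.corrR_sharp (h : Good Q) (k : ℝ) : corrR (AKNS.sharp Q) k = corrRt Q (-k) := by
  rw [corrR, corrRt, h.corrCt_sharp (by simp), h.corrT_sharp (by simp), h.corrC_sharp (by simp),
    scatS_sharp h.pot]
  push_cast; rfl

lemma Good.corrRt_sharp (h : Good Q) (k : ℝ) : corrRt (AKNS.sharp Q) k = corrR Q (-k) := by
  have := h.sharp.corrR_sharp (-k)
  rw [sharp_sharp, neg_neg] at this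
  exact this.symm

lemma Good.eigUp_sharp (h : Good Q) : k ∈ eigUp (AKNS.sharp Q) ↔ -k ∈ eigLo Q := by
  simp only [eigUp, eigLo, mem_ofPred_eq, Complex.neg_im, neg_neg_iff_pos]
  refine and_congr_right fun hk => ?_
  rw [detLP_sharp h.pot hk.le, detRM_sharp h.pot hk.le]

lemma Good.eigLo_sharp (h : Good Q) : k ∈ eigLo (AKNS.sharp Q) ↔ -k ∈ eigUp Q := by
  have := h.sharp.eigUp_sharp (k := -k)
  rw [sharp_sharp, neg_neg] at this
  exact this.symm

/-! ### The corrected reflection coefficient -/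

lemma Good.corrCt_inv (h : Good Q) (hk : 0 ≤ k.im) :
    (corrCt Q k)⁻¹ = blockDiag 1 (ArP Q k)⁻¹ 1 := blockDiag_inv (h.wht.2.2 k hk)

lemma Good.corrC_inv (h : Good Q) (hk : k.im ≤ 0) :
    (corrC Q k)⁻¹ = blockDiag 1 (AlM Q k)⁻¹ 1 := blockDiag_inv (h.wh.1.nzM k hk)

lemma Good.wie_corrCt_inv (h : Good Q) : WieM .P 1 (fun k => (corrCt Q k)⁻¹) :=
  (WieM.blockDiag WieM.one h.wht.2.1 WieM.one).congr fun _ hk => (h.corrCt_inv hk).symm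

lemma Good.wie_corrC_inv (h : Good Q) : WieM .M 1 (fun k => (corrC Q k)⁻¹) :=
  (WieM.blockDiag WieM.one h.wh.2.2.2.2 WieM.one).congr fun _ hk => (h.corrC_inv hk).symm

lemma WieM.real {ι κ : Type*} {C : Matrix ι κ ℂ} {A : ℂ → Matrix ι κ ℂ} (h : WieM .P C A) :
    WieM .R C A := fun i j => (h i j).real
lemma WieM.real' {ι κ : Type*} {C : Matrix ι κ ℂ} {A : ℂ → Matrix ι κ ℂ} (h : WieM .M C A) :
    WieM .R C A := fun i j => (h i j).real'

lemma Good.wie_corrT (h : Good Q) : WieM .R 1 (corrT Q) :=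
  WieM.blockDiag
    (WieM.inv_real (A := fun k => blkP (transL Q k)) (WieM.real (wie_transL h.pot)) h.detLP)
    h.wh.2.1.real
    (WieM.inv_real (A := fun k => blkM (transR Q k)) (WieM.real (wie_transR h.pot)) h.detRM)

lemma Good.wie_corrR (h : Good Q) : WieM .R 0 (fun k => corrR Q k.re) := by
  have h1 : WieM .R 1 (corrCt Q) := (WieM.blockDiag WieM.one h.wht.1 WieM.one).real
  have h2 := h1.mul (h.wie_corrT.sub (h.wie_scatS.mul h.wie_corrC_inv.real'))
  rw [one_mul, one_mul, sub_self] at h2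
  refine h2.congr fun k hk => ?_
  rw [corrR, re_of_mem_R hk]

lemma Good.corrR_off (h : Good Q) (k : ℝ) : OffBlock (corrR Q k) := by
  have hC := h.corrC_inv (k := k) (by simp)
  have e : ∀ (D M : Matrix (Idx p m) (Idx p m) ℂ) (z : ℂ) (i j : Idx p m),
      (∀ i j, sg i = sg j → M i j = 0) → sg i = sg j →
      (blockDiag (1 : Matrix (Fin p) (Fin p) ℂ) z (1 : Matrix (Fin m) (Fin m) ℂ) * M) i j = 0 := by
    intro D M z i j hM hij
    rw [Matrix.mul_apply]
    refine Finset.sum_eq_zero fun l _ => ?_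
    by_cases hl : sg i = sg l
    · rw [hM l j (hl ▸ hij), mul_zero]
    · rw [blockDiag_off _ _ _ hl, zero_mul]
  have e2 : ∀ (z : ℂ) (i : Idx p m) (a : Fin p), (scatS Q k * blockDiag (1 : Matrix (Fin p) (Fin p) ℂ)
      z (1 : Matrix (Fin m) (Fin m) ℂ)) i (pl a) = scatS Q k i (pl a) := by
    intro z i a
    rw [Matrix.mul_apply, sum_idx]
    have : ∀ b, blockDiag (1 : Matrix (Fin p) (Fin p) ℂ) z (1 : Matrix (Fin m) (Fin m) ℂ) (pl b) (pl a)
      = (1 : Matrix (Fin p) (Fin p) ℂ) b a := fun b => rfl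
    rw [blockDiag_off _ _ _ (i := ze) (by simp [sg])]
    simp only [this, blockDiag_off _ _ _ (show sg (mi _ : Idx p m) ≠ sg (pl a : Idx p m) by
      simp only [sg]; norm_num)]
    simp [Matrix.one_apply]
  have e3 : ∀ (z : ℂ) (i : Idx p m) (a : Fin m), (scatS Q k * blockDiag (1 : Matrix (Fin p) (Fin p) ℂ)
      z (1 : Matrix (Fin m) (Fin m) ℂ)) i (mi a) = scatS Q k i (mi a) := by
    intro z i a
    rw [Matrix.mul_apply, sum_idx]
    have : ∀ b, blockDiag (1 : Matrix (Fin p) (Fin p) ℂ) z (1 : Matrix (Fin m) (Fin m) ℂ) (mi b) (mi a)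
      = (1 : Matrix (Fin m) (Fin m) ℂ) b a := fun b => rfl
    rw [blockDiag_off _ _ _ (i := ze) (by simp [sg])]
    simp only [this, blockDiag_off _ _ _ (show sg (pl _ : Idx p m) ≠ sg (mi a : Idx p m) by
      simp only [sg]; norm_num)]
    simp [Matrix.one_apply]
  have e4 : ∀ (z : ℂ) (i : Idx p m), (scatS Q k * blockDiag (1 : Matrix (Fin p) (Fin p) ℂ)
      z (1 : Matrix (Fin m) (Fin m) ℂ)) i ze = scatS Q k i ze * z := by
    intro z i
    rw [Matrix.mul_apply, sum_idx, blockDiag_ze]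
    simp only [blockDiag_off _ _ _ (show sg (pl _ : Idx p m) ≠ sg (ze : Idx p m) by simp [sg]),
      blockDiag_off _ _ _ (show sg (mi _ : Idx p m) ≠ sg (ze : Idx p m) by simp [sg])]
    simp
  intro i j hij
  rw [corrR, hC]
  refine e 0 _ _ i j (fun i j hij => ?_) hij
  rw [Matrix.sub_apply]
  rcases sg_cases i j hij with ⟨a, b, rfl, rfl⟩ | ⟨rfl, rfl⟩ | ⟨a, b, rfl, rfl⟩
  · rw [e2, corrT, blockDiag_pl, ← blkP_scatS h.pot (h.detLP k) (h.detRM k)]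
    simp [blkP]
  · rw [e4, corrT, blockDiag_ze, sub_eq_zero]
    have h1 := h.wh.1.fact k
    have h2 := h.wh.1.nzM k (by simp)
    simp only at h1 h2
    rw [h1, mul_assoc, mul_inv_cancel₀ h2, mul_one]
  · rw [e3, corrT, blockDiag_mi, ← blkM_scatS h.pot (h.detLP k) (h.detRM k)]
    simp [blkM]

lemma Good.exists_hatR (h : Good Q) : ∃ Rh : ℝ → Matrix (Idx p m) (Idx p m) ℂ,
    (∀ γ, OffBlock (Rh γ)) ∧ (∀ i j, Integrable (fun γ => Rh γ i j)) ∧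
    ∀ (k : ℝ) (i j), corrR Q k i j = ∫ γ : ℝ, Complex.exp (-Complex.I * k * γ) * Rh γ i j := by
  choose u hu he using h.wie_corrR
  refine ⟨fun γ => Matrix.of fun i j => if sg i = sg j then 0 else u i j (-γ), fun γ i j hij => ?_,
    fun i j => ?_, fun k i j => ?_⟩
  · simp [hij]
  · by_cases hij : sg i = sg j
    · simp [hij]
    · simpa [hij] using (hu i j).int.comp_neg
  · by_cases hij : sg i = sg j
    · simp [hij, h.corrR_off k i j hij]
    · have := he i j k (mem_R k)
      simp only [Complex.ofReal_re, Matrix.zero_apply, zero_add] at this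
      simp only [Matrix.of_apply, if_neg hij]
      rw [this, ft, ← integral_neg_eq_self]
      congr 1; ext γ; congr 2; push_cast; ring

end AKNS

namespace AKNS

variable {p m : ℕ} {Q : ℝ → Matrix (Idx p m) (Idx p m) ℂ} {k : ℂ}

/-! ### Discrete eigenvalues -/

lemma Wie.finite_zeros {F : ℂ → ℂ} (hF : Wie .P 1 F) (hr : ∀ k : ℝ, F k ≠ 0)
    (hs : ∀ k : ℂ, 0 < k.im → F k = 0 → deriv F k ≠ 0) : {k | 0 < k.im ∧ F k = 0}.Finite := by
  have h1 : ∀ᶠ k in cocompact ℂ ⊓ 𝓟 {k : ℂ | 0 ≤ k.im}, F k ≠ 0 :=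
    hF.tendsto_P.eventually_ne one_ne_zero
  rw [eventually_inf_principal, (hasBasis_cocompact).eventually_iff] at h1
  obtain ⟨K, hK, h2⟩ := h1
  by_contra hinf
  obtain ⟨x, -, hx⟩ := Set.Infinite.exists_accPt_of_subset_isCompact hinf hK (fun k hk => by
    by_contra hkK
    exact h2 hkK (show 0 ≤ k.im from hk.1.le) hk.2)
  have hcl : IsClosed ({k : ℂ | 0 ≤ k.im} ∩ F ⁻¹' {0}) :=
    hF.continuousOn.preimage_isClosed_of_isClosed
      (isClosed_le continuous_const Complex.continuous_im) isClosed_singleton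
  have hxm : x ∈ {k : ℂ | 0 ≤ k.im} ∩ F ⁻¹' {0} := by
    have := mem_closure_iff_clusterPt.2 hx.clusterPt
    exact hcl.closure_subset_iff.2 (fun k hk => ⟨hk.1.le, hk.2⟩) this
  have hx0 : 0 < x.im := by
    refine lt_of_le_of_ne hxm.1 fun h => hr x.re ?_
    have : ((x.re : ℝ) : ℂ) = x := Complex.ext rfl (by simpa using h)
    rw [this]; exact hxm.2
  have hd : DifferentiableAt ℂ F x := hF.differentiableOn_P.differentiableAt (isOpen_up.mem_nhds hx0)
  have h3 := hd.hasDerivAt.eventually_ne (c := 0) (hs x hx0 hxm.2)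
  rw [accPt_iff_frequently_nhdsNE] at hx
  exact hx (h3.mono fun k hk h => hk h.2)

lemma Good.finite_eigUp (h : Good Q) : (eigUp Q).Finite := by
  refine ((wie_detLP h.pot).finite_zeros h.detLP h.simple.simpleLP |>.union
    ((wie_detRM h.pot).finite_zeros h.detRM h.simple.simpleRM)).subset ?_
  rintro k ⟨hk, h1 | h1⟩
  · exact .inl ⟨hk, h1⟩
  · exact .inr ⟨hk, h1⟩

lemma Good.finite_eigLo (h : Good Q) : (eigLo Q).Finite := by
  have : eigLo Q = (fun k => -k) ⁻¹' (eigUp (AKNS.sharp Q)) := by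
    ext k
    rw [mem_preimage, h.eigUp_sharp, neg_neg]
  rw [this]
  exact h.sharp.finite_eigUp.preimage neg_injective.injOn

/-! ### Norming constants -/

section
variable {ι : Type*} [Fintype ι] [DecidableEq ι]

/-- The residue of an inverse matrix at a point where the determinant has at most a simple zero. -/
lemma exists_residue_inv {A : ℂ → Matrix ι ι ℂ} {k₀ : ℂ}
    (hA : ∀ i j, DifferentiableAt ℂ (fun k => A k i j) k₀)
    (h : (A k₀).det ≠ 0 ∨ deriv (fun k => (A k).det) k₀ ≠ 0) :
    ∃ τ, Tendsto (fun k => (k - k₀) • (A k)⁻¹) (𝓝[≠] k₀) (𝓝 τ) ∧ A k₀ * τ = 0 := by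
  have hc : ContinuousAt A k₀ := continuousAt_pi.2 fun i => continuousAt_pi.2 fun j =>
    (hA i j).continuousAt
  have hdet : DifferentiableAt ℂ (fun k => (A k).det) k₀ := by
    simp only [Matrix.det_apply]
    refine DifferentiableAt.fun_sum fun σ _ => DifferentiableAt.const_smul ?_ _
    exact DifferentiableAt.fun_finsetProd fun i _ => hA _ _
  have hadj : Tendsto (fun k => (A k).adjugate) (𝓝[≠] k₀) (𝓝 (A k₀).adjugate) :=
    ((continuous_id.matrix_adjugate.tendsto _).comp hc.tendsto).mono_left nhdsWithin_le_nhds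
  obtain ⟨c, hc1, hc2⟩ : ∃ c, Tendsto (fun k => (k - k₀) * (A k).det⁻¹) (𝓝[≠] k₀) (𝓝 c) ∧
      c * (A k₀).det = 0 := by
    by_cases h0 : (A k₀).det = 0
    · have hd : deriv (fun k => (A k).det) k₀ ≠ 0 := h.resolve_left (not_not.2 h0)
      refine ⟨_, (hdet.hasDerivAt.tendsto_slope.inv₀ hd).congr fun k => ?_, by rw [h0, mul_zero]⟩
      simp only [slope, vsub_eq_sub, smul_eq_mul, h0, sub_zero, mul_inv, inv_inv]
    · refine ⟨0, ?_, zero_mul _⟩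
      have h1 : Tendsto (fun k => (k - k₀) * (A k).det⁻¹) (𝓝 k₀) (𝓝 ((k₀ - k₀) * (A k₀).det⁻¹)) :=
        ((continuous_id.sub continuous_const).tendsto k₀).mul (hdet.continuousAt.tendsto.inv₀ h0)
      rw [sub_self, zero_mul] at h1
      exact h1.mono_left nhdsWithin_le_nhds
  refine ⟨c • (A k₀).adjugate, (hc1.smul hadj).congr fun k => ?_, ?_⟩
  · rw [Matrix.inv_def, Ring.inverse_eq_inv', smul_smul]
  · rw [Matrix.mul_smul, Matrix.mul_adjugate, smul_smul, hc2, zero_smul]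

end

lemma tendsto_blockDiag {α : Type*} {l : Filter α} {P : α → Matrix (Fin p) (Fin p) ℂ} {z : α → ℂ}
    {R : α → Matrix (Fin m) (Fin m) ℂ} {P' z' R'} (hP : Tendsto P l (𝓝 P')) (hz : Tendsto z l (𝓝 z'))
    (hR : Tendsto R l (𝓝 R')) :
    Tendsto (fun a => blockDiag (P a) (z a) (R a)) l (𝓝 (blockDiag P' z' R')) := by
  have : Continuous fun t : Matrix (Fin p) (Fin p) ℂ × ℂ × Matrix (Fin m) (Fin m) ℂ =>
      blockDiag t.1 t.2.1 t.2.2 :=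
    continuous_fst.matrix_fromBlocks continuous_const continuous_const
      (Continuous.matrix_fromBlocks
        (continuous_matrix fun _ _ => continuous_snd.fst) continuous_const continuous_const
        continuous_snd.snd)
  exact (this.tendsto (P', z', R')).comp (hP.prodMk_nhds (hz.prodMk_nhds hR))

lemma smul_blockDiag (c : ℂ) (P : Matrix (Fin p) (Fin p) ℂ) (z : ℂ) (R : Matrix (Fin m) (Fin m) ℂ) :
    c • blockDiag P z R = blockDiag (c • P) (c * z) (c • R) := by
  refine ext_block (fun _ _ => rfl) rfl (fun _ _ => rfl) fun i j hij => ?_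
  rw [Matrix.smul_apply, blockDiag_off _ _ _ hij, blockDiag_off _ _ _ hij, smul_zero]

/-- The residue of the corrected transmission coefficients. -/
lemma Good.exists_residue (h : Good Q) {k₀ : ℂ} (hk : 0 < k₀.im) :
    ∃ τ₁ τ₂, Tendsto (fun k => (k - k₀) • corrT Q k) (𝓝[≠] k₀) (𝓝 (blockDiag τ₁ 0 τ₂)) ∧
      blkP (transL Q k₀) * τ₁ = 0 ∧ blkM (transR Q k₀) * τ₂ = 0 := by
  have hn := isOpen_up.mem_nhds hk
  obtain ⟨τ₁, h1, h1'⟩ := exists_residue_inv (A := fun k => blkP (transL Q k)) (k₀ := k₀)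
    (fun i j => (wie_transL h.pot i j).differentiableOn_P.differentiableAt hn)
    (or_iff_not_imp_left.2 fun h0 => h.simple.simpleLP _ hk (not_not.1 h0))
  obtain ⟨τ₂, h2, h2'⟩ := exists_residue_inv (A := fun k => blkM (transR Q k)) (k₀ := k₀)
    (fun i j => (wie_transR h.pot i j).differentiableOn_P.differentiableAt hn)
    (or_iff_not_imp_left.2 fun h0 => h.simple.simpleRM _ hk (not_not.1 h0))
  refine ⟨τ₁, τ₂, ?_, h1', h2'⟩
  have h3 : Tendsto (fun k => (k - k₀) * AlP Q k) (𝓝[≠] k₀) (𝓝 0) := by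
    have : Tendsto (fun k => (k - k₀) * AlP Q k) (𝓝 k₀) (𝓝 ((k₀ - k₀) * AlP Q k₀)) :=
      ((continuous_id.sub continuous_const).tendsto k₀).mul
        (h.wh.2.1.differentiableOn_P.differentiableAt hn).continuousAt.tendsto
    rw [sub_self, zero_mul] at this
    exact this.mono_left nhdsWithin_le_nhds
  refine (tendsto_blockDiag h1 h3 h2).congr fun k => ?_
  rw [corrT, smul_blockDiag]

lemma wedgeMat_mulVec {A B : Matrix (Idx p m) (Idx p m) ℂ} {u v : Idx p m → ℂ}
    (h1 : ∀ a, ∑ l, A (pl a) l * v l = 0) (h2 : ∀ b, ∑ l, B (mi b) l * v l = 0)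
    (h3 : ∑ l, u l * v l = 0) : Matrix.mulVec (wedgeMat A B u) v = 0 := by
  ext r
  rcases r with a | t | b
  · exact h1 a
  · exact h3
  · exact h2 b

lemma Good.exists_norming (h : Good Q) {k₀ : ℂ} (hk : k₀ ∈ eigUp Q) : ∃ N, IsNormingUp Q k₀ N := by
  have hk0 := hk.1
  obtain ⟨τ₁, τ₂, hτ, h1, h2⟩ := h.exists_residue hk0
  set τ : Matrix (Idx p m) (Idx p m) ℂ := blockDiag τ₁ 0 τ₂ with hτd
  obtain ⟨l₀, hl₀⟩ := exists_omega_ne_zero h.pot hk0.le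
    (not_and_or.1 (h.simple.disjUp k₀ hk0))
  have hr : ∀ j a, ∑ c, transL Q k₀ (pl a) (pl c) * τ (pl c) j = 0 := fun j a => by
    rcases j with j | j | j
    · exact congrFun (congrFun h1 a) j
    · exact Finset.sum_eq_zero fun c _ => by rw [hτd, blockDiag_off _ _ _ (by simp [sg]), mul_zero]
    · exact Finset.sum_eq_zero fun c _ => by
        rw [hτd, blockDiag_off _ _ _ (by simp only [sg]; norm_num), mul_zero]
  have hs : ∀ j a, ∑ c, transR Q k₀ (mi a) (mi c) * τ (mi c) j = 0 := fun j a => by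
    rcases j with j | j | j
    · exact Finset.sum_eq_zero fun c _ => by
        rw [hτd, blockDiag_off _ _ _ (by simp only [sg]; norm_num), mul_zero]
    · exact Finset.sum_eq_zero fun c _ => by rw [hτd, blockDiag_off _ _ _ (by simp [sg]), mul_zero]
    · exact congrFun (congrFun h2 a) j
  have hτ0 : ∀ l, τ l ze = 0 := fun l => by
    rcases l with a | a | a
    · exact blockDiag_off _ _ _ (by simp [sg])
    · rfl
    · exact blockDiag_off _ _ _ (by simp [sg])
  set Ω := omegaVecP Q 0 k₀ with hΩ
  set lam : Idx p m → ℂ := fun j => (∑ l, FP Q 0 k₀ l₀ l * τ l j) / Ω l₀ with hlam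
  have hlam0 : lam ze = 0 := by simp [hlam, hτ0]
  have key : ∀ j i, ∑ l, FP Q 0 k₀ i l * τ l j = lam j * Ω i := fun j => by
    have h3 : Matrix.mulVec (wedgeMat (dualN Q 0 k₀) (dualM Q 0 k₀)
        ((1 : Matrix (Idx p m) (Idx p m) ℂ) l₀))
        (fun i => ∑ l, FP Q 0 k₀ i l * τ l j - lam j * Ω i) = 0 := by
      refine wedgeMat_mulVec (fun a => ?_) (fun b => ?_) ?_
      · simp only [mul_sub, Finset.sum_sub_distrib]
        rw [dualN_FP h.pot hk0.le 0 a fun l => τ l j, hr]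
        simp only [mul_left_comm _ (lam j), ← Finset.mul_sum]
        rw [hΩ, dualN_omega, mul_zero, sub_zero]
      · simp only [mul_sub, Finset.sum_sub_distrib]
        rw [dualM_FP h.pot hk0.le 0 b fun l => τ l j, hs]
        simp only [mul_left_comm _ (lam j), ← Finset.mul_sum]
        rw [hΩ, dualM_omega, mul_zero, sub_zero]
      · simp only [Matrix.one_apply, ite_mul, one_mul, zero_mul, Finset.sum_ite_eq,
          Finset.mem_univ, if_true]
        rw [hlam, div_mul_cancel₀ _ hl₀, sub_self]
    have hdet : (wedgeMat (dualN Q 0 k₀) (dualM Q 0 k₀)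
        ((1 : Matrix (Idx p m) (Idx p m) ℂ) l₀)).det ≠ 0 := hl₀
    intro i
    exact sub_eq_zero.1 (congrFun (Matrix.eq_zero_of_mulVec_eq_zero hdet h3) i)
  set N : Matrix (Idx p m) (Idx p m) ℂ := Matrix.of fun i j =>
    if i = ze then -Complex.I * ArP Q k₀ * lam j else 0 with hN
  have hA := h.wht.2.2 k₀ hk0.le
  refine ⟨N, fun i j hij => ?_, τ, hτ, fun x => ?_⟩
  · rw [hN, Matrix.of_apply]
    split_ifs with hi
    · subst hi
      rcases sg_cases _ _ hij with ⟨a, b, ha, hb⟩ | ⟨-, rfl⟩ | ⟨a, b, ha, hb⟩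
      · simp at ha
      · rw [hlam0, mul_zero]
      · simp at ha
    · rfl
  · have hCN : (corrCt Q k₀)⁻¹ * N = Matrix.of fun i j =>
        if i = ze then -Complex.I * lam j else 0 := by
      rw [h.corrCt_inv hk0.le]
      ext i j
      rw [Matrix.mul_apply]
      rcases i with a | a | a
      · rw [sum_idx]
        simp [hN, blockDiag_off (p := p) (m := m) _ _ _ (show sg (pl a : Idx p m) ≠ sg (ze : Idx p m) by simp [sg])]
      · rw [sum_idx]
        simp only [hN, Matrix.of_apply, reduceCtorEq, if_false, if_true, mul_zero,
          Finset.sum_const_zero, zero_add, add_zero, Sum.inr.injEq]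
        rw [blockDiag_ze]
        field_simp
      · rw [sum_idx]
        simp [hN, blockDiag_off (p := p) (m := m) _ _ _ (show sg (mi a : Idx p m) ≠ sg (ze : Idx p m) by simp [sg])]
    rw [mul_assoc, hCN]
    ext i j
    have h0 := XiP_mulVec_eq_zero h.pot hk0.le
      (v := fun l => τ l j - if l = ze then lam j else 0) (fun i => ?_) x i
    · simp only [mul_sub, Finset.sum_sub_distrib, mul_ite, mul_zero, Finset.sum_ite_eq',
        Finset.mem_univ, if_true, sub_eq_zero] at h0
      rw [Matrix.mul_apply, h0, Matrix.smul_apply, Matrix.mul_apply]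
      simp only [Matrix.of_apply, mul_ite, mul_zero, Finset.sum_ite_eq', Finset.mem_univ, if_true,
        smul_eq_mul]
      linear_combination (XiP Q x k₀ i ze * lam j) * Complex.I_mul_I
    · simp only [mul_sub, Finset.sum_sub_distrib, mul_ite, mul_zero, Finset.sum_ite_eq',
        Finset.mem_univ, if_true, XiP_zero]
      rw [key]
      change lam j * Ω i - omegaVecP Q 0 k₀ i * lam j = 0
      rw [← hΩ]; ring

/-! ### Triangular representations -/

lemma Good.exists_KP (h : Good Q) : ∃ KP : ℝ → ℝ → Matrix (Idx p m) (Idx p m) ℂ,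
    (∀ x i j, IntegrableOn (fun γ => KP x (x + γ) i j) (Ioi 0)) ∧
    ∀ (x : ℝ) (k : ℂ), 0 ≤ k.im → XiP Q x k * (corrCt Q k)⁻¹ =
    (1 + Matrix.of fun i j => ∫ γ in Ioi (0 : ℝ),
      Complex.exp (Complex.I * k * γ) * KP x (x + γ) i j) * expS k x := by
  have h1 : ∀ x, WieM .P 1 (fun k => FP Q x k * (corrCt Q k)⁻¹) := fun x => by
    have := WieM.mul (wie_FP h.pot x) h.wie_corrCt_inv
    rwa [one_mul] at this
  choose u hu he using h1
  refine ⟨fun x y => Matrix.of fun i j => u x i j (y - x), fun x i j => ?_, fun x k hk => ?_⟩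
  · simpa using (hu x i j).int.integrableOn
  · have hcomm : XiP Q x k * (corrCt Q k)⁻¹ = FP Q x k * (corrCt Q k)⁻¹ * expS k x := by
      rw [XiP, mul_assoc, mul_assoc]
      congr 1
      rw [h.corrCt_inv hk, expS]
      ext i j
      rw [Matrix.diagonal_mul, Matrix.mul_diagonal]
      by_cases hij : sg i = sg j
      · rw [hij, mul_comm]
      · rw [blockDiag_off _ _ _ hij]; ring
    rw [hcomm]
    congr 1
    ext i j
    refine (he x i j k hk).trans ?_
    simp only [Matrix.add_apply, Matrix.of_apply, add_sub_cancel_left]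
    congr 1
    rw [ft, ← integral_indicator measurableSet_Ioi]
    congr 1; ext γ
    by_cases hγ : γ ∈ Ioi (0 : ℝ)
    · rw [indicator_of_mem hγ]
    · rw [indicator_of_notMem hγ, (hu x i j).supp γ hγ, mul_zero]

/-! ### Reflection of the data -/

lemma tendsto_neg_nhdsNE (a : ℂ) : Tendsto (fun k => -k) (𝓝[≠] a) (𝓝[≠] (-a)) :=
  continuous_neg.continuousAt.tendsto.inf (tendsto_principal_principal.2 fun k hk => by
    simpa using hk)

lemma Good.normingUp_sharp (h : Good Q) {k₀ : ℂ} (hk : k₀.im < 0) {N : Matrix (Idx p m) (Idx p m) ℂ} :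
    IsNormingUp (AKNS.sharp Q) (-k₀) N ↔ IsNormingLo Q k₀ N := by
  have hk' : 0 < (-k₀).im := by simpa using hk
  refine and_congr_right fun _ => ⟨fun ⟨τ, h1, h2⟩ => ⟨-τ, ?_, fun x => ?_⟩,
    fun ⟨τ, h1, h2⟩ => ⟨-τ, ?_, fun x => ?_⟩⟩
  · refine ((h1.comp (tendsto_neg_nhdsNE k₀)).neg).congr' ?_
    filter_upwards [mem_nhdsWithin_of_mem_nhds (isOpen_lo.mem_nhds hk)] with k hk
    have hk : k.im < 0 := hk
    simp only [Function.comp_apply]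
    rw [h.corrT_sharp (by simpa using hk.le), neg_neg, ← neg_smul]
    congr 1; ring
  · have := h2 (-x)
    rw [XiP_sharp h.pot hk.le, h.corrCt_sharp hk'.le, neg_neg, neg_neg] at this
    rw [mul_neg, this, neg_smul]
  · have h1' := h1
    rw [← neg_neg k₀] at h1
    have h3 := tendsto_neg_nhdsNE (-k₀)
    refine ((h1.comp h3).neg).congr' ?_
    filter_upwards [mem_nhdsWithin_of_mem_nhds (isOpen_up.mem_nhds hk')] with k hk
    have hk : 0 < k.im := hk
    simp only [Function.comp_apply]
    rw [h.corrT_sharp hk.le, neg_neg, ← neg_smul]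
    congr 1; ring
  · rw [XiP_sharp h.pot hk.le, h.corrCt_sharp hk'.le, neg_neg, mul_neg, h2, neg_smul, neg_neg]

lemma Good.normingLo_sharp (h : Good Q) {k₀ : ℂ} (hk : 0 < k₀.im) {N : Matrix (Idx p m) (Idx p m) ℂ} :
    IsNormingLo (AKNS.sharp Q) (-k₀) N ↔ IsNormingUp Q k₀ N := by
  have := h.sharp.normingUp_sharp (k₀ := -k₀) (N := N) (by simpa using hk)
  rw [sharp_sharp, neg_neg] at this
  exact this.symm

lemma Good.scatteringData_sharp (h : Good Q) {N Nt : ℂ → Matrix (Idx p m) (Idx p m) ℂ}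
    {Rh Rht : ℝ → Matrix (Idx p m) (Idx p m) ℂ} (H : IsScatteringData Q N Nt Rh Rht) :
    IsScatteringData (AKNS.sharp Q) (fun k => Nt (-k)) (fun k => N (-k)) Rht Rh where
  normUp k hk := by
    have h1 := h.eigUp_sharp.1 hk
    have := (h.normingUp_sharp h1.1).2 (H.normLo _ h1)
    rwa [neg_neg] at this
  normLo k hk := by
    have h1 := h.eigLo_sharp.1 hk
    have := (h.normingLo_sharp h1.1).2 (H.normUp _ h1)
    rwa [neg_neg] at this
  offR := H.offRt
  offRt := H.offR
  intR := H.intRt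
  intRt := H.intR
  fourR k i j := by
    rw [h.corrR_sharp, H.fourRt]; push_cast; simp only [mul_neg, neg_mul]
  fourRt k i j := by
    rw [h.corrRt_sharp, H.fourR]; push_cast; simp only [mul_neg, neg_mul, neg_neg]

lemma expS_sharp (x : ℝ) : (expS (-k) (-x) : Matrix (Idx p m) (Idx p m) ℂ) = expS k x := by
  simp [expS]

/-- The representation of `Ξ⁻ C⁻¹` is that of `Ξ⁺ C̃⁻¹` for the reflected potential. -/
lemma Good.rep_sharp (h : Good Q) {KP : ℝ → ℝ → Matrix (Idx p m) (Idx p m) ℂ} :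
    (∀ (x : ℝ) (k : ℂ), 0 ≤ k.im → XiP (AKNS.sharp Q) x k * (corrCt (AKNS.sharp Q) k)⁻¹ =
      (1 + Matrix.of fun i j => ∫ γ in Ioi (0 : ℝ),
        Complex.exp (Complex.I * k * γ) * KP x (x + γ) i j) * expS k x) ↔
    ∀ (x : ℝ) (k : ℂ), k.im ≤ 0 → XiM Q x k * (corrC Q k)⁻¹ =
      (1 + Matrix.of fun i j => ∫ γ in Ioi (0 : ℝ),
        Complex.exp (-Complex.I * k * γ) * KP (-x) (-(x - γ)) i j) * expS k x := by
  refine ⟨fun H x k hk => ?_, fun H x k hk => ?_⟩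
  · have h1 := H (-x) (-k) (by simpa using hk)
    rw [XiP_sharp h.pot hk, h.corrCt_sharp (by simpa using hk), neg_neg, neg_neg, expS_sharp] at h1
    have e : ∀ γ : ℝ, -(x - γ) = -x + γ := fun γ => by ring
    rw [h1]
    simp only [e, neg_mul, mul_neg]
  · have h1 := H (-x) (-k) (by simpa using hk)
    have h2 := XiP_sharp h.pot (k := -k) (by simpa using hk) x
    have h3 := h.corrCt_sharp hk
    rw [neg_neg] at h2
    rw [h2, h3, h1, expS_sharp]
    have e : ∀ γ : ℝ, -(-x - γ) = x + γ := fun γ => by ring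
    simp only [e, neg_mul, mul_neg, neg_neg]

lemma Good.kernelPair_sharp (h : Good Q) {KP KM : ℝ → ℝ → Matrix (Idx p m) (Idx p m) ℂ}
    (H : IsKernelPair Q KP KM) :
    IsKernelPair (AKNS.sharp Q) (fun x y => KM (-x) (-y)) (fun x y => KP (-x) (-y)) where
  intP x i j := by
    have e : ∀ γ : ℝ, -(x + γ) = -x - γ := fun γ => by ring
    simpa only [e] using H.intM (-x) i j
  intM x i j := by
    have e : ∀ γ : ℝ, -(x - γ) = -x + γ := fun γ => by ring
    simpa only [e] using H.intP (-x) i j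
  repP := (h.rep_sharp (KP := fun x y => KM (-x) (-y))).2 (by simpa only [neg_neg] using H.repM)
  repM := by
    have := (h.sharp.rep_sharp (KP := KP)).1
    rw [sharp_sharp] at this
    exact this H.repP

lemma Good.exists_kernelPair (h : Good Q) : ∃ KP KM, IsKernelPair Q KP KM := by
  obtain ⟨KP, h1, h2⟩ := h.exists_KP
  obtain ⟨KM, h3, h4⟩ := h.sharp.exists_KP
  refine ⟨KP, fun x y => KM (-x) (-y), h1, fun x i j => ?_, h2, h.rep_sharp.1 h4⟩
  have e : ∀ γ : ℝ, -(x - γ) = -x + γ := fun γ => by ring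
  simpa only [e] using h3 (-x) i j

lemma Good.exists_scatteringData (h : Good Q) : ∃ N Nt Rh Rht, IsScatteringData Q N Nt Rh Rht := by
  classical
  have h1 : ∀ k, ∃ N, k ∈ eigUp Q → IsNormingUp Q k N := fun k => by
    by_cases hk : k ∈ eigUp Q
    · obtain ⟨N, hN⟩ := h.exists_norming hk
      exact ⟨N, fun _ => hN⟩
    · exact ⟨0, fun h => absurd h hk⟩
  have h2 : ∀ k, ∃ N, k ∈ eigLo Q → IsNormingLo Q k N := fun k => by
    by_cases hk : k ∈ eigLo Q
    · obtain ⟨N, hN⟩ := h.sharp.exists_norming (k₀ := -k) (by rwa [h.eigUp_sharp, neg_neg])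
      exact ⟨N, fun _ => (h.normingUp_sharp hk.1).1 hN⟩
    · exact ⟨0, fun h => absurd h hk⟩
  choose N hN using h1
  choose Nt hNt using h2
  obtain ⟨Rh, h3, h4, h5⟩ := h.exists_hatR
  obtain ⟨Rht, h6, h7, h8⟩ := h.sharp.exists_hatR
  refine ⟨N, Nt, Rh, Rht, hN, hNt, h3, h6, h4, h7, h5, fun k i j => ?_⟩
  have := h8 (-k) i j
  rw [h.corrR_sharp, neg_neg] at this
  rw [this]; push_cast; simp only [mul_neg, neg_mul, neg_neg]

end AKNS

namespace AKNS

variable {p m : ℕ} {Q : ℝ → Matrix (Idx p m) (Idx p m) ℂ} {k : ℂ}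

/-! ### Pole expansions -/

/-- The inverse Fourier transform of `-i/(k - z)`. -/
def poleFun (z : ℂ) : ℝ → ℂ := (Iic (0 : ℝ)).indicator fun γ => Complex.exp (-Complex.I * z * γ)

lemma L1_poleFun {z : ℂ} (hz : 0 < z.im) : Dom.R.L1 (poleFun z) := by
  refine L1_R ?_
  rw [poleFun, integrable_indicator_iff measurableSet_Iic]
  exact integrableOn_exp_mul_complex_Iic (a := -Complex.I * z) (by simpa using hz) 0

lemma ft_poleFun {z : ℂ} (hz : 0 < z.im) (k : ℝ) : Complex.I * ft (poleFun z) k = 1 / (k - z) := by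
  have h0 : (k : ℂ) - z ≠ 0 := fun h => by
    have := congrArg Complex.im h
    simp at this; linarith
  have h1 : ft (poleFun z) k = ∫ γ in Iic (0 : ℝ), Complex.exp (Complex.I * (k - z) * γ) := by
    rw [ft, ← integral_indicator measurableSet_Iic]
    congr 1; ext γ
    rw [poleFun]
    by_cases hγ : γ ∈ Iic (0 : ℝ)
    · rw [indicator_of_mem hγ, indicator_of_mem hγ, ← Complex.exp_add]; congr 1; ring
    · rw [indicator_of_notMem hγ, indicator_of_notMem hγ, mul_zero]
  rw [h1, integral_exp_mul_complex_Iic (by simpa using hz)]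
  simp only [Complex.ofReal_zero, mul_zero, Complex.exp_zero]
  have := Complex.I_ne_zero
  field_simp

lemma wie_pole {z : ℂ} (hz : 0 < z.im) : Wie .R 0 (fun k => 1 / (k - z)) := by
  refine ⟨_, (L1_poleFun hz).const_mul Complex.I, fun k hk => ?_⟩
  rw [ft_const_mul, zero_add]
  have := ft_poleFun hz k.re
  rw [re_of_mem_R hk] at this
  exact this.symm

lemma tendsto_pole (z : ℂ) : Tendsto (fun k : ℂ => 1 / (k - z)) (cocompact ℂ) (𝓝 0) := by
  simp only [one_div]
  refine tendsto_inv₀_cobounded.comp ?_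
  rw [← Metric.cobounded_eq_cocompact]
  exact tendsto_sub_const_cobounded z

/-- A function on the upper half-plane with finitely many simple poles and boundary values in the
Wiener algebra is a sum of principal parts and the transform of a function on the half-line. -/
lemma exists_pole_expansion {Z : Finset ℂ} (hZ : ∀ z ∈ Z, 0 < z.im) {G r : ℂ → ℂ} {c : ℂ}
    (hd : ∀ k : ℂ, 0 < k.im → k ∉ Z → DifferentiableAt ℂ G k)
    (hc : ∀ k : ℂ, k.im = 0 → ContinuousWithinAt G {k | 0 ≤ k.im} k)
    (hl : Tendsto G (cocompact ℂ ⊓ 𝓟 {k | 0 ≤ k.im}) (𝓝 c)) (hW : Wie .R c G)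
    (hr : ∀ z ∈ Z, Tendsto (fun k => (k - z) * G k) (𝓝[≠] z) (𝓝 (r z))) :
    ∃ v, Dom.P.L1 v ∧ ∀ k : ℝ, G k = c + ∑ z ∈ Z, r z * (1 / (k - z)) + ft v k := by
  classical
  set H : ℂ → ℂ := fun k => G k - ∑ z ∈ Z, r z * (1 / (k - z)) with hH
  have hsum : ∀ (S : Finset ℂ) (k : ℂ), k ∉ S →
      DifferentiableAt ℂ (fun k => ∑ z ∈ S, r z * (1 / (k - z))) k := fun S k hk => by
    refine DifferentiableAt.fun_sum fun z hz => ?_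
    have : k - z ≠ 0 := sub_ne_zero.2 fun h => hk (h ▸ hz)
    fun_prop (disch := assumption)
  have hHd : ∀ k : ℂ, 0 < k.im → k ∉ Z → DifferentiableAt ℂ H k := fun k hk hkZ =>
    (hd k hk hkZ).sub (hsum Z k hkZ)
  have hr' : ∀ z ∈ Z, Tendsto (fun k => (k - z) * H k) (𝓝[≠] z) (𝓝 0) := fun z hz => by
    have h1 : Tendsto (fun k => (k - z) * ∑ y ∈ Z.erase z, r y * (1 / (k - y))) (𝓝[≠] z) (𝓝 0) := by
      have : Tendsto (fun k => (k - z) * ∑ y ∈ Z.erase z, r y * (1 / (k - y))) (𝓝 z)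
          (𝓝 ((z - z) * ∑ y ∈ Z.erase z, r y * (1 / (z - y)))) :=
        ((continuous_id.sub continuous_const).tendsto z).mul
          (hsum (Z.erase z) z (by simp)).continuousAt.tendsto
      rw [sub_self, zero_mul] at this
      exact this.mono_left nhdsWithin_le_nhds
    have h2 := ((hr z hz).sub_const (r z)).sub h1
    rw [sub_self, sub_zero] at h2
    refine h2.congr' ?_
    filter_upwards [self_mem_nhdsWithin] with k hk
    have hk0 : k - z ≠ 0 := sub_ne_zero.2 hk
    rw [hH]
    simp only
    rw [← Finset.add_sum_erase Z _ hz]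
    field_simp
    ring
  set H' : ℂ → ℂ := fun k => if k ∈ Z then limUnder (𝓝[≠] k) H else H k with hH'
  have hZc : ∀ k ∉ Z, ∀ᶠ w in 𝓝 k, w ∉ Z := fun k hk =>
    (Z.finite_toSet.isClosed.isOpen_compl).mem_nhds hk
  have hHH' : ∀ k ∉ Z, H' =ᶠ[𝓝 k] H := fun k hk => by
    filter_upwards [hZc k hk] with w hw using if_neg hw
  have hd' : ∀ k : ℂ, 0 < k.im → DifferentiableAt ℂ H' k := fun k hk => by
    by_cases hkZ : k ∈ Z
    · have hs : {w : ℂ | 0 < w.im} ∩ (↑(Z.erase k))ᶜ ∈ 𝓝 k :=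
        inter_mem (isOpen_up.mem_nhds hk)
          (((Z.erase k).finite_toSet.isClosed.isOpen_compl).mem_nhds (by simp))
      have h1 := Complex.differentiableOn_update_limUnder_of_isLittleO hs (f := H)
        (fun w hw => (hHd w hw.1.1 (fun hwZ => hw.1.2 (by
          simp only [Finset.coe_erase, Set.mem_sdiff, Finset.mem_coe]
          exact ⟨hwZ, hw.2⟩))).differentiableWithinAt) ?_
      · refine (h1.differentiableAt hs).congr_of_eventuallyEq ?_
        filter_upwards [hs] with w hw
        rw [hH']
        simp only
        by_cases hwk : w = k
        · subst hwk; simp [hkZ]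
        · rw [Function.update_of_ne hwk, if_neg]
          intro hwZ
          exact hw.2 (by simp [hwZ, hwk])
      · have h2 : Tendsto (fun w => (w - k) * (H w - H k)) (𝓝[≠] k) (𝓝 0) := by
          have h3 : Tendsto (fun w => (w - k) * H k) (𝓝[≠] k) (𝓝 0) := by
            have : Tendsto (fun w => (w - k) * H k) (𝓝 k) (𝓝 ((k - k) * H k)) :=
              ((continuous_id.sub continuous_const).mul continuous_const).tendsto k
            rw [sub_self, zero_mul] at this
            exact this.mono_left nhdsWithin_le_nhds
          have := (hr' k hkZ).sub h3
          rw [sub_zero] at this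
          refine this.congr fun w => by ring
        rw [Asymptotics.isLittleO_iff_tendsto']
        · refine h2.congr fun w => ?_
          rw [div_inv_eq_mul, mul_comm]
        · filter_upwards [self_mem_nhdsWithin] with w hw h0
          exact absurd (inv_eq_zero.1 h0) (sub_ne_zero.2 hw)
    · exact (hHd k hk hkZ).congr_of_eventuallyEq (hHH' k hkZ)
  have hreal : ∀ k : ℂ, k.im = 0 → k ∉ Z := fun k hk hkZ => (hZ k hkZ).ne' hk
  have hW' : Wie .R c H' := by
    have h1 := hW.sub (Wie.sum Z fun z hz => (wie_pole (hZ z hz)).const_mul (r z))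
    simp only [mul_zero, Finset.sum_const_zero, sub_zero] at h1
    exact h1.congr fun k hk => (if_neg (hreal k hk)).symm
  have hc' : ContinuousOn H' {k | 0 ≤ k.im} := fun k hk => by
    rcases (show 0 ≤ k.im from hk).eq_or_lt with h0 | h0
    · exact ((hc k h0.symm).sub
        (hsum Z k (hreal k h0.symm)).continuousAt.continuousWithinAt).congr_of_eventuallyEq
        ((hHH' k (hreal k h0.symm)).filter_mono nhdsWithin_le_nhds) (if_neg (hreal k h0.symm))
    · exact (hd' k h0).continuousAt.continuousWithinAt
  have hl' : Tendsto H' (cocompact ℂ ⊓ 𝓟 {k | 0 ≤ k.im}) (𝓝 c) := by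
    have h1 : Tendsto (fun k : ℂ => ∑ z ∈ Z, r z * (1 / (k - z))) (cocompact ℂ) (𝓝 0) := by
      have := tendsto_finsetSum Z fun z _ => (tendsto_pole z).const_mul (r z)
      simpa only [mul_zero, Finset.sum_const_zero] using this
    have h2 := hl.sub (h1.mono_left inf_le_left)
    rw [sub_zero] at h2
    refine h2.congr' (Eventually.filter_mono inf_le_left ?_)
    filter_upwards [Z.finite_toSet.isCompact.compl_mem_cocompact] with k hk
    exact (if_neg hk).symm
  obtain ⟨v, hv, e⟩ := Wie.of_analytic hW' hc' (fun k hk => (hd' k hk).differentiableWithinAt) hl'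
  refine ⟨v, hv, fun k => ?_⟩
  have h1 := e k (show (0 : ℝ) ≤ (k : ℂ).im by simp)
  rw [hH'] at h1
  simp only [if_neg (hreal k (Complex.ofReal_im k)), hH] at h1
  rw [sub_eq_iff_eq_add] at h1
  rw [h1]; ring

end AKNS

namespace AKNS

variable {p m : ℕ} {Q : ℝ → Matrix (Idx p m) (Idx p m) ℂ} {k : ℂ}

/-! ### The Marchenko equation -/

lemma expS_mul_blockDiag (x : ℝ) (P : Matrix (Fin p) (Fin p) ℂ) (z : ℂ) (R : Matrix (Fin m) (Fin m) ℂ) :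
    expS k x * blockDiag P z R = blockDiag P z R * expS k x := by
  rw [expS]
  ext i j
  rw [Matrix.diagonal_mul, Matrix.mul_diagonal]
  by_cases hij : sg i = sg j
  · rw [hij, mul_comm]
  · rw [blockDiag_off _ _ _ hij]; ring

lemma mul_expS_cancel {A B : Matrix (Idx p m) (Idx p m) ℂ} {x : ℝ}
    (h : A * expS k x = B * expS k x) : A = B := by
  ext i j
  have := congrFun (congrFun h i) j
  rw [expS, Matrix.mul_diagonal, Matrix.mul_diagonal] at this
  exact mul_right_cancel₀ (Complex.exp_ne_zero _) this

/-- The plus kernel, extended by zero. -/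
def kerP (KP : ℝ → ℝ → Matrix (Idx p m) (Idx p m) ℂ) (x : ℝ) (i j : Idx p m) : ℝ → ℂ :=
  (Ioi (0 : ℝ)).indicator fun γ => KP x (x + γ) i j

/-- The minus kernel, extended by zero and reflected. -/
def kerM (KM : ℝ → ℝ → Matrix (Idx p m) (Idx p m) ℂ) (x : ℝ) (i j : Idx p m) : ℝ → ℂ :=
  (Iio (0 : ℝ)).indicator fun γ => KM x (x + γ) i j

lemma ft_kerP (KP : ℝ → ℝ → Matrix (Idx p m) (Idx p m) ℂ) (x : ℝ) (i j) (k : ℂ) :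
    ft (kerP KP x i j) k = ∫ γ in Ioi (0 : ℝ), Complex.exp (Complex.I * k * γ) * KP x (x + γ) i j := by
  rw [ft, ← integral_indicator measurableSet_Ioi]
  congr 1; ext γ
  rw [kerP]
  by_cases hγ : γ ∈ Ioi (0 : ℝ)
  · rw [indicator_of_mem hγ, indicator_of_mem hγ]
  · rw [indicator_of_notMem hγ, indicator_of_notMem hγ, mul_zero]

lemma ft_kerM (KM : ℝ → ℝ → Matrix (Idx p m) (Idx p m) ℂ) (x : ℝ) (i j) (k : ℂ) :
    ft (kerM KM x i j) k = ∫ γ in Ioi (0 : ℝ), Complex.exp (-Complex.I * k * γ) * KM x (x - γ) i j := by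
  rw [ft, ← integral_neg_eq_self, ← integral_indicator measurableSet_Ioi]
  congr 1; ext γ
  rw [kerM]
  by_cases hγ : γ ∈ Ioi (0 : ℝ)
  · rw [indicator_of_mem hγ, indicator_of_mem (by simpa using hγ)]
    push_cast; simp only [mul_neg, neg_mul, sub_eq_add_neg]
  · rw [indicator_of_notMem hγ, indicator_of_notMem (by simpa using hγ), mul_zero]

section
variable {KP KM : ℝ → ℝ → Matrix (Idx p m) (Idx p m) ℂ}

lemma IsKernelPair.L1P (H : IsKernelPair Q KP KM) (x i j) : Dom.P.L1 (kerP KP x i j) :=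
  ⟨(integrable_indicator_iff measurableSet_Ioi).2 (H.intP x i j), fun _ hγ => indicator_of_notMem hγ _⟩

lemma IsKernelPair.L1M (H : IsKernelPair Q KP KM) (x i j) : Integrable (kerM KM x i j) := by
  have h1 : Integrable ((Ioi (0 : ℝ)).indicator fun γ => KM x (x - γ) i j) :=
    (integrable_indicator_iff measurableSet_Ioi).2 (H.intM x i j)
  refine h1.comp_neg.congr (.of_forall fun γ => ?_)
  simp only [kerM, indicator, mem_Ioi, mem_Iio, Left.neg_pos_iff, sub_neg_eq_add]

lemma Good.FP_corrCt (h : Good Q) (H : IsKernelPair Q KP KM) (x : ℝ) (hk : 0 ≤ k.im) (i j) :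
    (FP Q x k * (corrCt Q k)⁻¹) i j = (1 : Matrix (Idx p m) (Idx p m) ℂ) i j + ft (kerP KP x i j) k := by
  have h1 := H.repP x k hk
  rw [XiP, mul_assoc, h.corrCt_inv hk, expS_mul_blockDiag, ← mul_assoc] at h1
  rw [h.corrCt_inv hk, mul_expS_cancel h1, ft_kerP]
  rfl

lemma Good.FM_corrC (h : Good Q) (H : IsKernelPair Q KP KM) (x : ℝ) (hk : k.im ≤ 0) (i j) :
    (FM Q x k * (corrC Q k)⁻¹) i j = (1 : Matrix (Idx p m) (Idx p m) ℂ) i j + ft (kerM KM x i j) k := by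
  have h1 := H.repM x k hk
  rw [XiM, mul_assoc, h.corrC_inv hk, expS_mul_blockDiag, ← mul_assoc] at h1
  rw [h.corrC_inv hk, mul_expS_cancel h1, ft_kerM]
  rfl

/-- The Riemann-Hilbert problem on the line. -/
lemma Good.riemannHilbert (h : Good Q) (x k : ℝ) (i j : Idx p m) :
    (FM Q x k * (corrC Q k)⁻¹) i j = (FP Q x k * corrT Q k) i j -
      ∑ l, (FP Q x k * (corrCt Q k)⁻¹) i l *
        (Complex.exp (Complex.I * k * x * ((sg l - sg j : ℝ) : ℂ)) * corrR Q k l j) := by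
  have hne := h.wht.2.2 k (by simp)
  have h1 : (corrCt Q k)⁻¹ * corrR Q k = corrT Q k - scatS Q k * (corrC Q k)⁻¹ := by
    rw [corrR, h.corrCt_inv (by simp), corrCt, ← mul_assoc, blockDiag_mul, one_mul, one_mul,
      inv_mul_cancel₀ hne, blockDiag_one, one_mul]
  have h2 : XiM Q x k * (corrC Q k)⁻¹ =
      XiP Q x k * corrT Q k - XiP Q x k * (corrCt Q k)⁻¹ * corrR Q k := by
    rw [mul_assoc (XiP Q x k), h1, mul_sub, sub_sub_cancel, XiM_eq h.pot (h.detLP k) (h.detRM k),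
      mul_assoc]
  rw [XiM, XiP, mul_assoc, mul_assoc (FP Q x k), mul_assoc (FP Q x k) (expS _ _) (corrCt Q k)⁻¹,
    h.corrC_inv (by simp), h.corrCt_inv (by simp), corrT, expS_mul_blockDiag, expS_mul_blockDiag,
    expS_mul_blockDiag, ← mul_assoc, ← mul_assoc, ← mul_assoc] at h2
  rw [h.corrC_inv (by simp), h.corrCt_inv (by simp), corrT]
  have h3 := congrFun (congrFun h2 i) j
  rw [Matrix.sub_apply, Matrix.mul_apply (M := _ * expS _ _), expS, Matrix.mul_diagonal,
    Matrix.mul_diagonal] at h3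
  refine mul_right_cancel₀ (Complex.exp_ne_zero _) (h3.trans ?_)
  rw [sub_mul, Finset.sum_mul]
  congr 1
  refine Finset.sum_congr rfl fun l _ => ?_
  rw [Matrix.mul_diagonal]
  have e : Complex.exp (Complex.I * k * x * (sg l : ℝ)) =
      Complex.exp (Complex.I * k * x * ((sg l - sg j : ℝ) : ℂ)) *
        Complex.exp (Complex.I * k * x * (sg j : ℝ)) := by
    rw [← Complex.exp_add]; congr 1; push_cast; ring
  rw [e]; ring

/-- The residue of `F⁺ T` at a discrete eigenvalue. -/
lemma Good.tendsto_residue (h : Good Q) (H : IsKernelPair Q KP KM) {z : ℂ} (hz : z ∈ eigUp Q)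
    {N : Matrix (Idx p m) (Idx p m) ℂ} (hN : IsNormingUp Q z N) (x : ℝ) (i j : Idx p m) :
    Tendsto (fun k => (k - z) * (FP Q x k * corrT Q k) i j) (𝓝[≠] z)
      (𝓝 (Complex.I * ∑ l, ((1 : Matrix (Idx p m) (Idx p m) ℂ) i l + ft (kerP KP x i l) z) *
        (Complex.exp (Complex.I * z * x * ((sg l - sg j : ℝ) : ℂ)) * N l j))) := by
  obtain ⟨-, τ, h1, h2⟩ := hN
  have hn := isOpen_up.mem_nhds hz.1
  have hF : Tendsto (FP Q x) (𝓝[≠] z) (𝓝 (FP Q x z)) :=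
    (tendsto_pi_nhds.2 fun i => tendsto_pi_nhds.2 fun l =>
      ((wie_FP h.pot x i l).differentiableOn_P.differentiableAt hn).continuousAt.tendsto).mono_left
        nhdsWithin_le_nhds
  have h3 : Tendsto (fun k => FP Q x k * ((k - z) • corrT Q k)) (𝓝[≠] z) (𝓝 (FP Q x z * τ)) :=
    hF.mul h1
  have h4 := tendsto_pi_nhds.1 (tendsto_pi_nhds.1 h3 i) j
  have hoff : ∀ i j, sg i ≠ sg j → τ i j = 0 := fun i j hij => by
    refine tendsto_nhds_unique (tendsto_pi_nhds.1 (tendsto_pi_nhds.1 h1 i) j)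
      (tendsto_const_nhds.congr fun k => ?_)
    rw [Matrix.smul_apply, corrT, blockDiag_off _ _ _ hij, smul_zero]
  have hcomm : expS z x * τ = τ * expS z x := by
    rw [expS]
    ext i j
    rw [Matrix.diagonal_mul, Matrix.mul_diagonal]
    by_cases hij : sg i = sg j
    · rw [hij, mul_comm]
    · rw [hoff i j hij]; ring
  have h5 := h2 x
  have h6 : XiP Q x z * (corrCt Q z)⁻¹ = FP Q x z * (corrCt Q z)⁻¹ * expS z x := by
    rw [XiP, mul_assoc, h.corrCt_inv hz.1.le, expS_mul_blockDiag, mul_assoc]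
  rw [h6, XiP, mul_assoc, hcomm, ← mul_assoc] at h5
  have h7 := congrFun (congrFun h5 i) j
  rw [expS, Matrix.mul_diagonal, Matrix.smul_apply, Matrix.mul_apply (M := _ * Matrix.diagonal _)] at h7
  have h8 : (FP Q x z * τ) i j =
      Complex.I * ∑ l, ((1 : Matrix (Idx p m) (Idx p m) ℂ) i l + ft (kerP KP x i l) z) *
        (Complex.exp (Complex.I * z * x * ((sg l - sg j : ℝ) : ℂ)) * N l j) := by
    refine mul_right_cancel₀ (Complex.exp_ne_zero _) (h7.trans ?_)
    rw [smul_eq_mul, mul_assoc Complex.I (∑ l, _) _, Finset.sum_mul]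
    congr 1
    refine Finset.sum_congr rfl fun l _ => ?_
    rw [Matrix.mul_diagonal, h.FP_corrCt H x hz.1.le]
    have e : Complex.exp (Complex.I * z * x * (sg l : ℝ)) =
        Complex.exp (Complex.I * z * x * ((sg l - sg j : ℝ) : ℂ)) *
          Complex.exp (Complex.I * z * x * (sg j : ℝ)) := by
      rw [← Complex.exp_add]; congr 1; push_cast; ring
    rw [e]; ring
  rw [← h8]
  refine h4.congr fun k => ?_
  rw [Matrix.mul_smul, Matrix.smul_apply, smul_eq_mul]

lemma Good.exists_expansion (h : Good Q) (H : IsKernelPair Q KP KM)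
    {N : ℂ → Matrix (Idx p m) (Idx p m) ℂ} (hN : ∀ z ∈ eigUp Q, IsNormingUp Q z (N z))
    (x : ℝ) (i j : Idx p m) : ∃ v, Dom.P.L1 v ∧ ∀ k : ℝ, (FP Q x k * corrT Q k) i j =
      (1 : Matrix (Idx p m) (Idx p m) ℂ) i j + ∑ z ∈ h.finite_eigUp.toFinset,
        (Complex.I * ∑ l, ((1 : Matrix (Idx p m) (Idx p m) ℂ) i l + ft (kerP KP x i l) z) *
        (Complex.exp (Complex.I * z * x * ((sg l - sg j : ℝ) : ℂ)) * N z l j)) * (1 / (k - z)) +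
      ft v k := by
  have hWF := wie_FP h.pot x
  have hP : WieM .P 1 (fun k => blkP (transL Q k)) := wie_transL h.pot
  have hM : WieM .P 1 (fun k => blkM (transR Q k)) := wie_transR h.pot
  have hne : ∀ k : ℂ, 0 ≤ k.im → k ∉ eigUp Q → AKNS.detLP Q k ≠ 0 ∧ AKNS.detRM Q k ≠ 0 := by
    intro k hk hkZ
    rcases hk.eq_or_lt with h0 | h0
    · have : ((k.re : ℝ) : ℂ) = k := Complex.ext rfl (by simpa using h0)
      rw [← this]
      exact ⟨h.detLP _, h.detRM _⟩
    · exact not_or.1 fun h1 => hkZ ⟨h0, h1⟩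
  have inv_apply : ∀ {ι : Type} [Fintype ι] [DecidableEq ι] (A : Matrix ι ι ℂ) (a b : ι),
      A⁻¹ a b = A.det⁻¹ * A.adjugate a b := fun A a b => by
    rw [Matrix.inv_def, Ring.inverse_eq_inv']; rfl
  -- entries of `T`
  have hTd : ∀ k : ℂ, 0 < k.im → k ∉ eigUp Q → ∀ l, DifferentiableAt ℂ (fun k => corrT Q k l j) k := by
    intro k hk hkZ l
    have hn := isOpen_up.mem_nhds hk
    obtain ⟨h1, h2⟩ := hne k hk.le hkZ
    by_cases hlj : sg l = sg j
    · rcases sg_cases _ _ hlj with ⟨a, b, rfl, rfl⟩ | ⟨rfl, rfl⟩ | ⟨a, b, rfl, rfl⟩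
      · simp only [corrT, blockDiag_pl, inv_apply]
        exact (((Wie.det hP).differentiableOn_P.differentiableAt hn).fun_inv h1).fun_mul
          ((Wie.adjugate hP a b).differentiableOn_P.differentiableAt hn)
      · simp only [corrT, blockDiag_ze]
        exact h.wh.2.1.differentiableOn_P.differentiableAt hn
      · simp only [corrT, blockDiag_mi, inv_apply]
        exact (((Wie.det hM).differentiableOn_P.differentiableAt hn).fun_inv h2).fun_mul
          ((Wie.adjugate hM a b).differentiableOn_P.differentiableAt hn)
    · simp only [corrT, blockDiag_off _ _ _ hlj]
      fun_prop
  have hTc : ∀ k : ℂ, k.im = 0 → ∀ l, ContinuousWithinAt (fun k => corrT Q k l j) {k | 0 ≤ k.im} k := by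
    intro k hk l
    have hn : k ∈ {k : ℂ | 0 ≤ k.im} := hk.ge
    obtain ⟨h1, h2⟩ := hne k hk.ge fun h => h.1.ne' hk
    by_cases hlj : sg l = sg j
    · rcases sg_cases _ _ hlj with ⟨a, b, rfl, rfl⟩ | ⟨rfl, rfl⟩ | ⟨a, b, rfl, rfl⟩
      · simp only [corrT, blockDiag_pl, inv_apply]
        exact (((Wie.det hP).continuousOn k hn).inv₀ h1).mul ((Wie.adjugate hP a b).continuousOn k hn)
      · simp only [corrT, blockDiag_ze]
        exact h.wh.2.1.continuousOn k hn
      · simp only [corrT, blockDiag_mi, inv_apply]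
        exact (((Wie.det hM).continuousOn k hn).inv₀ h2).mul ((Wie.adjugate hM a b).continuousOn k hn)
    · simp only [corrT, blockDiag_off _ _ _ hlj]
      exact continuousWithinAt_const
  have hTl : ∀ l, Tendsto (fun k => corrT Q k l j) (cocompact ℂ ⊓ 𝓟 {k | 0 ≤ k.im})
      (𝓝 ((1 : Matrix (Idx p m) (Idx p m) ℂ) l j)) := by
    intro l
    have hdet : ∀ {ι : Type} [Fintype ι] [DecidableEq ι] {A : ℂ → Matrix ι ι ℂ},
        WieM .P 1 A → ∀ a b, Tendsto (fun k => (A k)⁻¹ a b) (cocompact ℂ ⊓ 𝓟 {k | 0 ≤ k.im})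
          (𝓝 ((1 : Matrix ι ι ℂ) a b)) := by
      intro ι _ _ A hA a b
      have h1 := ((Wie.det hA).tendsto_P.inv₀ (by simp)).mul (Wie.adjugate hA a b).tendsto_P
      simp only [Matrix.det_one, inv_one, Matrix.adjugate_one, one_mul] at h1
      exact h1.congr fun k => (inv_apply _ a b).symm
    by_cases hlj : sg l = sg j
    · rcases sg_cases _ _ hlj with ⟨a, b, rfl, rfl⟩ | ⟨rfl, rfl⟩ | ⟨a, b, rfl, rfl⟩
      · have := hdet hP a b
        simpa only [corrT, blockDiag_pl, Matrix.one_apply, Sum.inl.injEq] using this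
      · simpa only [corrT, blockDiag_ze, Matrix.one_apply_eq] using h.wh.2.1.tendsto_P
      · have := hdet hM a b
        simpa only [corrT, blockDiag_mi, Matrix.one_apply, Sum.inr.injEq] using this
    · simp only [corrT, blockDiag_off _ _ _ hlj]
      rw [Matrix.one_apply_ne fun h' => hlj (congrArg sg h')]
      exact tendsto_const_nhds
  refine exists_pole_expansion (Z := h.finite_eigUp.toFinset)
    (G := fun k => (FP Q x k * corrT Q k) i j)
    (r := fun z => Complex.I * ∑ l, ((1 : Matrix (Idx p m) (Idx p m) ℂ) i l + ft (kerP KP x i l) z) *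
        (Complex.exp (Complex.I * z * x * ((sg l - sg j : ℝ) : ℂ)) * N z l j))
    (fun z hz => ((Finite.mem_toFinset _).1 hz).1) (fun k hk hkZ => ?_) (fun k hk => ?_) ?_ ?_
    (fun z hz => ?_)
  · simp only [Matrix.mul_apply]
    exact DifferentiableAt.fun_sum fun l _ =>
      ((hWF i l).differentiableOn_P.differentiableAt (isOpen_up.mem_nhds hk)).fun_mul
        (hTd k hk (fun h' => hkZ ((Finite.mem_toFinset _).2 h')) l)
  · simp only [Matrix.mul_apply]
    exact tendsto_finsetSum _ fun l _ => ((hWF i l).continuousOn k hk.ge).mul (hTc k hk l)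
  · simp only [Matrix.mul_apply]
    have := tendsto_finsetSum Finset.univ fun l _ => (hWF i l).tendsto_P.mul (hTl l)
    rwa [← Matrix.mul_apply, one_mul] at this
  · have h1 := WieM.mul (WieM.real hWF) h.wie_corrT i j
    rwa [one_mul] at h1
  · have hz := (Finite.mem_toFinset _).1 hz
    exact h.tendsto_residue H hz (hN z hz) x i j

end

end AKNS

namespace AKNS

variable {p m : ℕ} {Q : ℝ → Matrix (Idx p m) (Idx p m) ℂ} {k : ℂ}

/-- `F` is the transform of the integrable function `u` on the real line. -/
def IsFT (u : ℝ → ℂ) (F : ℝ → ℂ) : Prop := Integrable u ∧ ∀ k : ℝ, ft u k = F k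

section
variable {u v : ℝ → ℂ} {F G : ℝ → ℂ}

lemma IsFT.add (hu : IsFT u F) (hv : IsFT v G) : IsFT (fun γ => u γ + v γ) (fun k => F k + G k) :=
  ⟨hu.1.add hv.1, fun k => by rw [ft_add (L1_R hu.1) (L1_R hv.1) (mem_R k), hu.2, hv.2]⟩

lemma IsFT.const_mul (hu : IsFT u F) (a : ℂ) : IsFT (fun γ => a * u γ) (fun k => a * F k) :=
  ⟨hu.1.const_mul a, fun k => by rw [ft_const_mul, hu.2]⟩

lemma IsFT.cv (hu : IsFT u F) (hv : IsFT v G) : IsFT (AKNS.cv u v) (fun k => F k * G k) :=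
  ⟨((L1_R hu.1).cv (L1_R hv.1)).int, fun k => by
    rw [ft_cv (L1_R hu.1) (L1_R hv.1) (mem_R k), hu.2, hv.2]⟩

lemma IsFT.sum {ι : Type*} (s : Finset ι) {u : ι → ℝ → ℂ} {F : ι → ℝ → ℂ}
    (h : ∀ i ∈ s, IsFT (u i) (F i)) : IsFT (fun γ => ∑ i ∈ s, u i γ) (fun k => ∑ i ∈ s, F i k) := by
  classical
  induction s using Finset.induction_on with
  | empty =>
    refine ⟨by simp, fun k => by simp [ft]⟩
  | insert a s ha ih =>
    simp only [Finset.sum_insert ha]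
    exact (h a (Finset.mem_insert_self a s)).add (ih fun i hi => h i (Finset.mem_insert_of_mem hi))

end

section
variable {KP KM : ℝ → ℝ → Matrix (Idx p m) (Idx p m) ℂ} {N Nt : ℂ → Matrix (Idx p m) (Idx p m) ℂ}
  {Rh Rht : ℝ → Matrix (Idx p m) (Idx p m) ℂ}

lemma Good.omegaP_apply (h : Good Q) (x γ : ℝ) (i j : Idx p m) : omegaP Q N Rh x γ i j =
    ∑ z ∈ h.finite_eigUp.toFinset,
      Complex.exp (Complex.I * z * ((γ + (sg i - sg j) * x : ℝ) : ℂ)) * N z i j +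
      Rh (γ + (sg i - sg j) * x) i j := by
  rw [omegaP, Matrix.of_apply, finsum_mem_eq_finite_toFinset_sum _ h.finite_eigUp]

lemma Good.omegaP_off (h : Good Q) (D : IsScatteringData Q N Nt Rh Rht) (x γ : ℝ) :
    OffBlock (omegaP Q N Rh x γ) := fun i j hij => by
  rw [h.omegaP_apply, D.offR _ i j hij, add_zero]
  refine Finset.sum_eq_zero fun z hz => ?_
  rw [(D.normUp z ((Finite.mem_toFinset _).1 hz)).1 i j hij, mul_zero]

lemma Good.integrableOn_omegaP (h : Good Q) (D : IsScatteringData Q N Nt Rh Rht) (x : ℝ)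
    (i j : Idx p m) : IntegrableOn (fun γ => omegaP Q N Rh x γ i j) (Ioi 0) := by
  simp only [h.omegaP_apply]
  refine Integrable.add (integrable_finsetSum _ fun z hz => Integrable.mul_const ?_ _)
    ((D.intR i j).comp_add_right _).integrableOn
  have hz := ((Finite.mem_toFinset _).1 hz).1
  have h1 := (integrableOn_exp_mul_complex_Ioi (a := Complex.I * z) (by simpa using hz) 0).const_mul
    (Complex.exp (Complex.I * z * (((sg i - sg j) * x : ℝ) : ℂ)))
  refine h1.congr (.of_forall fun γ => ?_)
  simp only
  rw [← Complex.exp_add]; congr 1; push_cast; ring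

/-- The shifted, reflected transform of the reflection coefficient. -/
def reflFun (Rh : ℝ → Matrix (Idx p m) (Idx p m) ℂ) (x : ℝ) (l j : Idx p m) (γ : ℝ) : ℂ :=
  Rh (-γ + (sg l - sg j) * x) l j

lemma IsScatteringData.isFT_reflFun (D : IsScatteringData Q N Nt Rh Rht) (x : ℝ) (l j : Idx p m) :
    IsFT (reflFun Rh x l j) (fun k =>
      Complex.exp (Complex.I * k * x * ((sg l - sg j : ℝ) : ℂ)) * corrR Q k l j) := by
  refine ⟨((D.intR l j).comp_add_right ((sg l - sg j) * x)).comp_neg, fun k => ?_⟩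
  change _ = Complex.exp (Complex.I * k * x * ((sg l - sg j : ℝ) : ℂ)) * corrR Q k l j
  symm
  rw [D.fourR, ← integral_const_mul,
    ← integral_add_right_eq_self _ ((sg l - sg j) * x), ← integral_neg_eq_self]
  refine integral_congr_ae (.of_forall fun γ => ?_)
  simp only [reflFun]
  rw [← mul_assoc, ← Complex.exp_add]
  congr 1
  congr 2; push_cast; ring

lemma Good.marchenko_ae (h : Good Q) (H : IsKernelPair Q KP KM)
    (D : IsScatteringData Q N Nt Rh Rht) (x : ℝ) (i j : Idx p m) : ∃ v, Dom.P.L1 v ∧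
    ∀ᵐ γ : ℝ, kerM KM x i j γ = ∑ z ∈ h.finite_eigUp.toFinset,
      -(∑ l, ((1 : Matrix (Idx p m) (Idx p m) ℂ) i l + ft (kerP KP x i l) z) *
        (Complex.exp (Complex.I * z * x * ((sg l - sg j : ℝ) : ℂ)) * N z l j)) * poleFun z γ + v γ +
      (-1) * (reflFun Rh x i j γ + ∑ l, cv (kerP KP x i l) (reflFun Rh x l j) γ) := by
  obtain ⟨v, hv, e⟩ := h.exists_expansion H D.normUp x i j
  refine ⟨v, hv, ?_⟩
  have hP : ∀ l, IsFT (kerP KP x i l) (fun k => ft (kerP KP x i l) k) := fun l =>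
    ⟨(H.L1P x i l).int, fun _ => rfl⟩
  have hR := fun l => D.isFT_reflFun x l j
  have h1 := ((IsFT.sum h.finite_eigUp.toFinset fun z hz => IsFT.const_mul
      ⟨(L1_poleFun ((Finite.mem_toFinset _).1 hz).1).int, fun _ => rfl⟩
      (-(∑ l, ((1 : Matrix (Idx p m) (Idx p m) ℂ) i l + ft (kerP KP x i l) z) *
        (Complex.exp (Complex.I * z * x * ((sg l - sg j : ℝ) : ℂ)) * N z l j)))).add
      (⟨hv.int, fun _ => rfl⟩ : IsFT v fun k => ft v k)).add
      (((hR i).add (IsFT.sum Finset.univ fun l _ => (hP l).cv (hR l))).const_mul (-1))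
  refine ae_eq_of_ft_eq (H.L1M x i j) h1.1 fun k => ?_
  rw [h1.2]
  have h2 := h.riemannHilbert x k i j
  rw [h.FM_corrC H x (by simp), e] at h2
  simp only [h.FP_corrCt H x (k := k) (by simp), add_mul, Finset.sum_add_distrib] at h2
  simp only [Matrix.one_apply, ite_mul, one_mul, zero_mul, Finset.sum_ite_eq, Finset.mem_univ,
    if_true] at h2
  simp only [Matrix.one_apply, ite_mul, one_mul, zero_mul, Finset.sum_ite_eq, Finset.mem_univ,
    if_true, add_mul, Finset.sum_add_distrib]
  have h3 : ∀ z ∈ h.finite_eigUp.toFinset, 1 / ((k : ℂ) - z) = Complex.I * ft (poleFun z) k :=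
    fun z hz => (ft_poleFun ((Finite.mem_toFinset _).1 hz).1 k).symm
  rw [Finset.sum_congr rfl fun z hz => by rw [h3 z hz]] at h2
  have h4 : ∀ (a b : ℂ), Complex.I * a * (Complex.I * b) = -a * b := fun a b => by
    linear_combination (a * b) * Complex.I_mul_I
  simp only [h4] at h2
  linear_combination h2

theorem Good.marchenko (h : Good Q) (H : IsKernelPair Q KP KM)
    (D : IsScatteringData Q N Nt Rh Rht) (x : ℝ) :
    ∀ᵐ γ ∂(volume.restrict (Ioi (0 : ℝ))), ∀ i j,
      IntegrableOn (fun g => (KP x (x + g) * omegaP Q N Rh x (g + γ)) i j) (Ioi 0) volume ∧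
      KM x (x - γ) i j + omegaP Q N Rh x γ i j +
        ∫ g in Ioi (0 : ℝ), (KP x (x + g) * omegaP Q N Rh x (g + γ)) i j = 0 := by
  rw [ae_restrict_iff' measurableSet_Ioi]
  have neg_ae : ∀ {q : ℝ → Prop}, (∀ᵐ γ, q γ) → ∀ᵐ γ, q (-γ) := fun hq =>
    (Measure.measurePreserving_neg (volume : Measure ℝ)).quasiMeasurePreserving.ae hq
  choose v hv e using fun i j => h.marchenko_ae H D x i j
  have hc : ∀ i l j, ∀ᵐ γ, Integrable fun t => kerP KP x i l t * reflFun Rh x l j (γ - t) :=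
    fun i l j => (H.L1P x i l).int.ae_convolution_exists (ContinuousLinearMap.mul ℂ ℂ)
      (D.isFT_reflFun x l j).1
  have hall := neg_ae ((ae_all_iff.2 fun i => ae_all_iff.2 fun j => e i j).and
    (ae_all_iff.2 fun i => ae_all_iff.2 fun l => ae_all_iff.2 fun j => hc i l j))
  filter_upwards [hall] with γ ⟨h1, h2⟩ hγ i j
  have hγ0 : (0 : ℝ) < γ := hγ
  set Z := h.finite_eigUp.toFinset with hZ
  have hω : ∀ g l, omegaP Q N Rh x (g + γ) l j = ∑ z ∈ Z, Complex.exp (Complex.I * z * g) *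
      (Complex.exp (Complex.I * z * γ) * (Complex.exp (Complex.I * z * x * ((sg l - sg j : ℝ) : ℂ)) *
        N z l j)) + reflFun Rh x l j (-γ - g) := fun g l => by
    rw [h.omegaP_apply, reflFun]
    congr 1
    · refine Finset.sum_congr rfl fun z _ => ?_
      rw [← mul_assoc, ← mul_assoc, ← Complex.exp_add, ← Complex.exp_add]
      congr 2; push_cast; ring
    · congr 1; ring
  have hf : (Ioi (0 : ℝ)).indicator (fun g => (KP x (x + g) * omegaP Q N Rh x (g + γ)) i j) =
      fun g : ℝ => ∑ l, (∑ z ∈ Z, (Complex.exp (Complex.I * z * g) * kerP KP x i l g) *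
        (Complex.exp (Complex.I * z * γ) * (Complex.exp (Complex.I * z * x * ((sg l - sg j : ℝ) : ℂ)) *
        N z l j)) + kerP KP x i l g * reflFun Rh x l j (-γ - g)) := by
    ext g
    by_cases hg : g ∈ Ioi (0 : ℝ)
    · rw [indicator_of_mem hg, Matrix.mul_apply]
      refine Finset.sum_congr rfl fun l _ => ?_
      rw [hω, kerP, indicator_of_mem hg, mul_add, Finset.mul_sum]
      congr 1
      exact Finset.sum_congr rfl fun z _ => by ring
    · rw [indicator_of_notMem hg]
      simp [kerP, indicator_of_notMem hg]
  have hi1 : ∀ l, ∀ z ∈ Z, Integrable fun g : ℝ => (Complex.exp (Complex.I * z * g) * kerP KP x i l g) *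
        (Complex.exp (Complex.I * z * γ) * (Complex.exp (Complex.I * z * x * ((sg l - sg j : ℝ) : ℂ)) *
        N z l j)) := fun l z hz =>
    ((H.L1P x i l).integrable_exp (show (0 : ℝ) ≤ z.im from
      ((Finite.mem_toFinset _).1 hz).1.le)).mul_const _
  have hi2 : ∀ l, Integrable fun g => kerP KP x i l g * reflFun Rh x l j (-γ - g) := fun l => h2 i l j
  have hi3 : ∀ l, Integrable fun g : ℝ => ∑ z ∈ Z, (Complex.exp (Complex.I * z * g) *
      kerP KP x i l g) * (Complex.exp (Complex.I * z * γ) * (Complex.exp (Complex.I * z * x *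
        ((sg l - sg j : ℝ) : ℂ)) * N z l j)) + kerP KP x i l g * reflFun Rh x l j (-γ - g) :=
    fun l => (integrable_finsetSum _ (hi1 l)).add (hi2 l)
  refine ⟨?_, ?_⟩
  · rw [← integrable_indicator_iff measurableSet_Ioi, hf]
    exact integrable_finsetSum _ fun l _ => hi3 l
  · have hint : ∫ g in Ioi (0 : ℝ), (KP x (x + g) * omegaP Q N Rh x (g + γ)) i j =
        ∑ l, (∑ z ∈ Z, ft (kerP KP x i l) z * (Complex.exp (Complex.I * z * γ) *
          (Complex.exp (Complex.I * z * x * ((sg l - sg j : ℝ) : ℂ)) * N z l j)) +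
          cv (kerP KP x i l) (reflFun Rh x l j) (-γ)) := by
      rw [← integral_indicator measurableSet_Ioi, hf]
      beta_reduce
      rw [integral_finsetSum _ fun l _ => hi3 l]
      refine Finset.sum_congr rfl fun l _ => ?_
      refine (integral_add (integrable_finsetSum _ (hi1 l)) (hi2 l)).trans ?_
      rw [integral_finsetSum _ (hi1 l)]
      congr 1
      refine Finset.sum_congr rfl fun z _ => ?_
      rw [integral_mul_const]; rfl
    have h3 := h1 i j
    have hm : kerM KM x i j (-γ) = KM x (x - γ) i j := by
      rw [kerM, indicator_of_mem (by simpa using hγ0), sub_eq_add_neg]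
    have hpole : ∀ z, poleFun z (-γ) = Complex.exp (Complex.I * z * γ) := fun z => by
      rw [poleFun, indicator_of_mem (by simpa using hγ0.le)]
      congr 1; push_cast; ring
    rw [hm, (hv i j).supp (-γ) (by simpa [Dom.P] using hγ0.le), add_zero] at h3
    have hω0 := hω 0 i
    simp only [zero_add, Complex.ofReal_zero, mul_zero, Complex.exp_zero, one_mul, sub_zero] at hω0
    rw [h3, hint, hω0]
    simp only [hpole, add_mul, Finset.sum_add_distrib, Matrix.one_apply, ite_mul, one_mul, zero_mul,
      Finset.sum_ite_eq, Finset.mem_univ, if_true, neg_mul, Finset.sum_neg_distrib]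
    rw [Finset.sum_comm (s := Finset.univ)]
    simp only [Finset.sum_mul, neg_add]
    have e1 : ∀ (z : ℂ) (l : Idx p m), ft (kerP KP x i l) z * (Complex.exp (Complex.I * z * x *
        ((sg l - sg j : ℝ) : ℂ)) * N z l j) * Complex.exp (Complex.I * z * γ) =
        ft (kerP KP x i l) z * (Complex.exp (Complex.I * z * γ) * (Complex.exp (Complex.I * z * x *
        ((sg l - sg j : ℝ) : ℂ)) * N z l j)) := fun z l => by ring
    have e2 : ∀ z : ℂ, Complex.exp (Complex.I * z * x * ((sg i - sg j : ℝ) : ℂ)) * N z i j *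
        Complex.exp (Complex.I * z * γ) = Complex.exp (Complex.I * z * γ) *
        (Complex.exp (Complex.I * z * x * ((sg i - sg j : ℝ) : ℂ)) * N z i j) := fun z => by ring
    simp only [e1, e2]
    ring

lemma omegaP_sharp (hQ : Good Q) (x γ : ℝ) :
    omegaP (sharp Q) (fun k => Nt (-k)) Rht x γ = omegaM Q Nt Rht (-x) γ := by
  ext i j
  rw [omegaP, omegaM, Matrix.of_apply, Matrix.of_apply]
  have e : γ + (sg i - sg j) * x = γ + (sg j - sg i) * -x := by ring
  rw [e]
  congr 1
  have hb : (eigUp (sharp Q)).BijOn (fun k => -k) (eigLo Q) := by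
    refine ⟨fun k hk => hQ.eigUp_sharp.1 hk, neg_injective.injOn, fun k hk => ⟨-k, ?_, neg_neg k⟩⟩
    rwa [hQ.eigUp_sharp, neg_neg]
  refine finsum_mem_eq_of_bijOn _ hb fun k _ => ?_
  congr 2; ring

end

end AKNS

namespace AKNS

open scoped Convolution

/-! ### Averages -/

section Avg
variable {E : Type*} [NormedAddCommGroup E] [NormedSpace ℝ E]

/-- The mean value of `f` over `(x, x + ε)`. -/
def avg (f : ℝ → E) (x ε : ℝ) : E := ε⁻¹ • ∫ t in x..x + ε, f t

lemma ae_tendsto_avg [CompleteSpace E] {f : ℝ → E} (hf : LocallyIntegrable f volume) :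
    ∀ᵐ x, Tendsto (avg f x) (𝓝[>] 0) (𝓝 (f x)) := by
  filter_upwards [LocallyIntegrable.ae_hasDerivAt_integral hf] with x hx
  have h1 := (hasDerivAt_iff_tendsto_slope_zero.1 (hx x)).mono_left
    (nhdsWithin_mono _ fun t (ht : 0 < t) => ht.ne')
  refine h1.congr fun ε => ?_
  rw [avg, intervalIntegral.integral_same, sub_zero]

lemma avg_mono {f g : ℝ → ℝ} (hf : Integrable f) (hg : Integrable g) (h : ∀ t, f t ≤ g t) (x : ℝ)
    {ε : ℝ} (hε : 0 < ε) : avg f x ε ≤ avg g x ε :=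
  mul_le_mul_of_nonneg_left (intervalIntegral.integral_mono_on (by linarith)
    hf.intervalIntegrable hg.intervalIntegrable fun t _ => h t) (inv_pos.2 hε).le

lemma norm_avg_le (f : ℝ → E) (x : ℝ) {ε : ℝ} (hε : 0 < ε) :
    ‖avg f x ε‖ ≤ avg (fun t => ‖f t‖) x ε := by
  rw [avg, norm_smul, Real.norm_of_nonneg (inv_pos.2 hε).le]
  exact mul_le_mul_of_nonneg_left (intervalIntegral.norm_integral_le_integral_norm (by linarith))
    (inv_pos.2 hε).le

lemma avg_eq_convolution (f : ℝ → ℝ) {ε : ℝ} (hε : 0 < ε) : (fun x => avg f x ε) =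
    ((Ico (-ε) 0).indicator fun _ => ε⁻¹) ⋆[ContinuousLinearMap.mul ℝ ℝ, volume] f := by
  ext x
  have h1 : ∀ t, (Ico (-ε) 0).indicator (fun _ => ε⁻¹) t * f (x - t) =
      (Ico (-ε) 0).indicator (fun t => ε⁻¹ * f (x - t)) t := fun t => by
    by_cases ht : t ∈ Ico (-ε) 0 <;> simp [ht]
  change _ = ∫ t, (Ico (-ε) 0).indicator (fun _ => ε⁻¹) t * f (x - t)
  simp only [h1]
  rw [integral_indicator measurableSet_Ico, integral_Ico_eq_integral_Ioc,
    ← intervalIntegral.integral_of_le (by linarith), intervalIntegral.integral_const_mul,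
    intervalIntegral.integral_comp_sub_left (fun t => f t), sub_zero, sub_neg_eq_add, avg, smul_eq_mul]

lemma integrable_avg {f : ℝ → ℝ} (hf : Integrable f) {ε : ℝ} (hε : 0 < ε) :
    Integrable (fun x => avg f x ε) ∧ ∫ x, avg f x ε = ∫ x, f x := by
  have h0 : Integrable ((Ico (-ε) 0).indicator fun _ : ℝ => ε⁻¹) :=
    (integrable_indicator_iff measurableSet_Ico).2 (integrableOn_const (by simp))
  rw [avg_eq_convolution f hε]
  refine ⟨h0.integrable_convolution _ hf, ?_⟩
  rw [integral_convolution _ h0 hf, integral_indicator measurableSet_Ico]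
  simp [hε.le, hε.ne']

end Avg

/-- Dominated convergence with a converging sequence of bounds. -/
lemma tendsto_integral_of_tendsto_bound {α : Type*} [MeasurableSpace α] {μ : Measure α}
    {f : ℕ → α → ℂ} {f' : α → ℂ} {G : ℕ → α → ℝ} {G' : α → ℝ}
    (hf : ∀ n, AEStronglyMeasurable (f n) μ) (hG : ∀ n, Integrable (G n) μ) (hG' : Integrable G' μ)
    (hle : ∀ n, ∀ᵐ x ∂μ, ‖f n x‖ ≤ G n x)
    (hlim : ∀ᵐ x ∂μ, Tendsto (fun n => f n x) atTop (𝓝 (f' x)))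
    (hGlim : ∀ᵐ x ∂μ, Tendsto (fun n => G n x) atTop (𝓝 (G' x)))
    (hint : Tendsto (fun n => ∫ x, G n x ∂μ) atTop (𝓝 (∫ x, G' x ∂μ))) :
    Tendsto (fun n => ∫ x, f n x ∂μ) atTop (𝓝 (∫ x, f' x ∂μ)) := by
  have hle' : ∀ᵐ x ∂μ, ‖f' x‖ ≤ G' x := by
    filter_upwards [hlim, hGlim, ae_all_iff.2 hle] with x h1 h2 h3
    exact le_of_tendsto_of_tendsto' h1.norm h2 h3
  have hf'm : AEStronglyMeasurable f' μ := aestronglyMeasurable_of_tendsto_ae atTop hf hlim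
  have hf'i : Integrable f' μ := hG'.mono' hf'm hle'
  have hfi : ∀ n, Integrable (f n) μ := fun n => (hG n).mono' (hf n) (hle n)
  -- the excess of `G n` over `G'` tends to zero in the mean
  have h1 : Tendsto (fun n => ∫ x, max (G' x - G n x) 0 ∂μ) atTop (𝓝 0) := by
    have := tendsto_integral_of_dominated_convergence (F := fun n x => max (G' x - G n x) 0)
      (f := fun _ => (0 : ℝ)) (μ := μ) G'
      (fun n => ((hG'.sub (hG n)).sup (integrable_zero _ _ _)).1) hG' (fun n => ?_) ?_
    · simpa using this
    · filter_upwards [hle n, hle'] with x h2 h3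
      rw [Real.norm_of_nonneg (le_max_right _ _)]
      exact max_le (by linarith [norm_nonneg (f n x)]) (by linarith [norm_nonneg (f' x)])
    · filter_upwards [hGlim] with x h2
      have := (tendsto_const_nhds (x := G' x)).sub h2 |>.max (tendsto_const_nhds (x := (0 : ℝ)))
      simpa using this
  have h2 : Tendsto (fun n => ∫ x, max (G n x - G' x) 0 ∂μ) atTop (𝓝 0) := by
    have e : ∀ n, ∫ x, max (G n x - G' x) 0 ∂μ =
        (∫ x, G n x ∂μ) - (∫ x, G' x ∂μ) + ∫ x, max (G' x - G n x) 0 ∂μ := fun n => by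
      have i1 : Integrable (fun x => max (G' x - G n x) 0) μ :=
        (hG'.sub (hG n)).sup (integrable_zero _ _ _)
      have i2 : Integrable (fun x => G n x - G' x) μ := (hG n).sub hG'
      rw [← integral_sub (hG n) hG', ← integral_add i2 i1]
      congr 1; ext x
      rcases le_total (G n x) (G' x) with h | h
      · rw [max_eq_right (by linarith), max_eq_left (by linarith)]; ring
      · rw [max_eq_left (by linarith), max_eq_right (by linarith)]; ring
    simp only [e]
    have := (hint.sub_const (∫ x, G' x ∂μ)).add h1
    simpa using this
  have h3 : Tendsto (fun n => ∫ x, max (‖f n x - f' x‖ - max (G n x - G' x) 0) 0 ∂μ) atTop (𝓝 0) := by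
    have := tendsto_integral_of_dominated_convergence (μ := μ)
      (F := fun n x => max (‖f n x - f' x‖ - max (G n x - G' x) 0) 0)
      (f := fun _ => (0 : ℝ)) (fun x => 2 * G' x)
      (fun n => ((((hfi n).sub hf'i).norm.sub
        (((hG n).sub hG').sup (integrable_zero _ _ _))).sup (integrable_zero _ _ _)).1)
      (hG'.const_mul 2) (fun n => ?_) ?_
    · simpa using this
    · filter_upwards [hle n, hle'] with x h4 h5
      rw [Real.norm_of_nonneg (le_max_right _ _)]
      refine max_le ?_ (by linarith [norm_nonneg (f' x)])
      linarith [norm_sub_le (f n x) (f' x), le_max_left (G n x - G' x) 0]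
    · filter_upwards [hlim, hGlim] with x h4 h5
      have h6 := ((h4.sub_const (f' x)).norm.sub
        ((h5.sub_const (G' x)).max (tendsto_const_nhds (x := (0 : ℝ))))).max
          (tendsto_const_nhds (x := (0 : ℝ)))
      simpa using h6
  rw [tendsto_iff_norm_sub_tendsto_zero]
  refine squeeze_zero (fun n => norm_nonneg _) (fun n => ?_) (by simpa using h3.add h2)
  have i1 : Integrable (fun x => max (G n x - G' x) 0) μ :=
    ((hG n).sub hG').sup (integrable_zero _ _ _)
  have i2 : Integrable (fun x => max (‖f n x - f' x‖ - max (G n x - G' x) 0) 0) μ :=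
    (((hfi n).sub hf'i).norm.sub i1).sup (integrable_zero _ _ _)
  rw [← integral_sub (hfi n) hf'i, ← integral_add i2 i1]
  refine norm_integral_le_of_norm_le (i2.add i1) (.of_forall fun x => ?_)
  linarith [le_max_left (‖f n x - f' x‖ - max (G n x - G' x) 0) 0]

/-! ### Means of kernels -/

lemma norm_indicator_one_le (s : Set ℝ) (γ : ℝ) : ‖s.indicator (fun _ => (1 : ℂ)) γ‖ ≤ 1 :=
  (norm_indicator_le_norm_self _ _).trans (by simp)

/-- The mean value over `(0, ε)` as a functional. -/
def meanL (ε : ℝ) : E1 →L[ℂ] ℂ := ((ε⁻¹ : ℝ) : ℂ) •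
  wInt ((Ioc 0 ε).indicator fun _ => 1)
    ((aestronglyMeasurable_const (b := (1 : ℂ))).indicator measurableSet_Ioc)
    (norm_indicator_one_le _)

/-- The mass near `0`. -/
def massNear (ε : ℝ) (u : E1) : ℝ := ∫ γ in Ioc 0 ε, ‖u γ‖

lemma massNear_nonneg (ε : ℝ) (u : E1) : 0 ≤ massNear ε u :=
  setIntegral_nonneg measurableSet_Ioc fun _ _ => norm_nonneg _

lemma massNear_add_le (ε : ℝ) (u v : E1) : massNear ε (u + v) ≤ massNear ε u + massNear ε v := by
  rw [massNear, massNear, massNear, ← integral_add (L1.integrable_coeFn u).norm.integrableOn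
    (L1.integrable_coeFn v).norm.integrableOn]
  refine integral_mono_ae (L1.integrable_coeFn _).norm.integrableOn
    ((L1.integrable_coeFn u).norm.integrableOn.add (L1.integrable_coeFn v).norm.integrableOn) ?_
  refine ae_restrict_of_ae ?_
  filter_upwards [Lp.coeFn_add u v] with γ hγ
  rw [hγ]
  exact norm_add_le _ _

lemma massNear_smul (ε : ℝ) (c : ℂ) (u : E1) : massNear ε (c • u) = ‖c‖ * massNear ε u := by
  rw [massNear, massNear, ← integral_const_mul]
  refine integral_congr_ae (ae_restrict_of_ae ?_)
  filter_upwards [Lp.coeFn_smul c u] with γ hγ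
  rw [hγ, Pi.smul_apply, norm_smul]

lemma massNear_zero (ε : ℝ) : massNear ε 0 = 0 := by
  have := massNear_smul ε 0 0
  simpa using this

lemma massNear_sum_le {ι : Type*} (s : Finset ι) (ε : ℝ) (u : ι → E1) :
    massNear ε (∑ i ∈ s, u i) ≤ ∑ i ∈ s, massNear ε (u i) :=
  Finset.le_sum_of_subadditive _ (massNear_zero ε).le (massNear_add_le ε) _ _

lemma massNear_le (ε : ℝ) (u : E1) : massNear ε u ≤ ‖u‖ := by
  rw [L1.norm_eq_integral_norm]
  exact setIntegral_le_integral (L1.integrable_coeFn u).norm (.of_forall fun _ => norm_nonneg _)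

lemma tendsto_massNear (u : E1) : Tendsto (fun ε => massNear ε u) (𝓝[>] 0) (𝓝 0) := by
  have hu := (L1.integrable_coeFn u).norm
  have h1 : Continuous fun ε => ∫ γ in (0 : ℝ)..ε, ‖u γ‖ :=
    intervalIntegral.continuous_primitive (fun _ _ => hu.intervalIntegrable) 0
  have h2 := (h1.tendsto 0).mono_left (nhdsWithin_le_nhds (s := Ioi 0))
  rw [intervalIntegral.integral_same] at h2
  refine h2.congr' ?_
  filter_upwards [self_mem_nhdsWithin] with ε hε
  rw [massNear, intervalIntegral.integral_of_le (le_of_lt hε)]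

lemma meanL_apply {ε : ℝ} (hε : 0 < ε) (u : E1) : meanL ε u = avg (fun γ => u γ) 0 ε := by
  change ((ε⁻¹ : ℝ) : ℂ) * ∫ γ, (Ioc 0 ε).indicator (fun _ => (1 : ℂ)) γ * u γ = _
  rw [avg, zero_add, intervalIntegral.integral_of_le hε.le, ← integral_indicator measurableSet_Ioc,
    Complex.real_smul]
  congr 2; ext γ
  by_cases h : γ ∈ Ioc 0 ε <;> simp [h]

lemma meanL_congr {ε : ℝ} (hε : 0 < ε) {u : E1} {v : ℝ → ℂ} (h : ∀ᵐ γ, 0 < γ → u γ = v γ) :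
    meanL ε u = avg v 0 ε := by
  rw [meanL_apply hε, avg, avg]
  congr 1
  refine intervalIntegral.integral_congr_ae ?_
  filter_upwards [h] with γ hγ h'
  rw [zero_add, uIoc_of_le hε.le] at h'
  exact hγ h'.1

lemma norm_meanL_shift_le {ε s : ℝ} (hε : 0 < ε) (hs : 0 ≤ s) {u : E1} (hu : u ∈ Pos) :
    ‖meanL ε (shift s u)‖ ≤ if s < ε then ε⁻¹ * massNear ε u else 0 := by
  have e : meanL ε (shift s u) = ((ε⁻¹ : ℝ) : ℂ) *
      ∫ γ, (Ioc 0 ε).indicator (fun _ => (1 : ℂ)) (γ + s) * u γ := by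
    change ((ε⁻¹ : ℝ) : ℂ) * wInt _ _ _ (shift s u) = _
    rw [wInt_shift, wInt_apply]
  have h0 := Pos.ae hu
  rw [e, norm_mul, Complex.norm_real, Real.norm_of_nonneg (inv_pos.2 hε).le]
  split_ifs with h
  · refine mul_le_mul_of_nonneg_left ?_ (inv_pos.2 hε).le
    rw [massNear, ← integral_indicator measurableSet_Ioc]
    refine norm_integral_le_of_norm_le ((L1.integrable_coeFn u).norm.indicator measurableSet_Ioc) ?_
    filter_upwards [h0] with γ hγ
    by_cases h1 : γ ∈ Ioc 0 ε
    · rw [indicator_of_mem h1, norm_mul]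
      exact mul_le_of_le_one_left (norm_nonneg _) (norm_indicator_one_le _ _)
    · rw [indicator_of_notMem h1]
      by_cases h2 : γ ≤ 0
      · simp [hγ h2]
      · rw [indicator_of_notMem, zero_mul, norm_zero]
        intro h3
        exact h1 ⟨not_le.1 h2, by linarith [h3.2]⟩
  · rw [integral_eq_zero_of_ae, norm_zero, mul_zero]
    filter_upwards [h0] with γ hγ
    by_cases h2 : γ ≤ 0
    · simp [hγ h2]
    · rw [indicator_of_notMem, zero_mul]; rfl
      intro h3
      linarith [h3.2, not_le.1 h2]

end AKNS

namespace AKNS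

/-! ### Diagonal values of the Volterra kernels -/

section Col

set_option linter.unusedSectionVars false

variable {ι : Type*} [Fintype ι] [DecidableEq ι] {q : ℝ → ι → ι → ℂ} {θ : ι → ℝ} {j : ι}
  {K g : ℝ → ι → E1}

lemma IsVoltKer.meanL_volt (h : VoltData q θ j) (hK : IsVoltKer q θ j K g) (ε x : ℝ) (i : ι) :
    meanL ε (volt q θ K x i) =
      ∫ y in Ioi x, meanL ε (shift (θ i * (y - x)) (∑ l, q y i l • K y l)) := by
  obtain ⟨B, hB⟩ := hK.bdd
  have hint : IntegrableOn (fun y => shift (θ i * (y - x)) (∑ l, q y i l • K y l)) (Ioi x) :=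
    (integrable_shift (integrable_sum_smul h.int hK.cont hB i) (by fun_prop)).integrableOn
  rw [volt, ← ContinuousLinearMap.integral_comp_comm _ hint]

lemma IsVoltKer.norm_meanL_volt_le (h : VoltData q θ j) (hK : IsVoltKer q θ j K g) {ε x : ℝ}
    (hε : 0 < ε) {i : ι} (hi : 0 < θ i) {C : ℝ}
    (hC : ∀ y, x < y → y < x + (θ i)⁻¹ * ε → ∑ l, massNear ε (K y l) ≤ C) :
    ‖meanL ε (volt q θ K x i)‖ ≤ C * ((θ i)⁻¹ * avg (qnorm q) x ((θ i)⁻¹ * ε)) := by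
  have hδ : 0 < (θ i)⁻¹ * ε := mul_pos (inv_pos.2 hi) hε
  have hqn := integrable_qnorm h.int
  rw [hK.meanL_volt h]
  have e : C * ((θ i)⁻¹ * avg (qnorm q) x ((θ i)⁻¹ * ε)) =
      ∫ y in Ioi x, (Ioc x (x + (θ i)⁻¹ * ε)).indicator (fun y => ε⁻¹ * C * qnorm q y) y := by
    rw [setIntegral_indicator measurableSet_Ioc, inter_eq_self_of_subset_right
      (fun y hy => hy.1), ← intervalIntegral.integral_of_le (by linarith),
      intervalIntegral.integral_const_mul, avg, smul_eq_mul]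
    field_simp
  rw [e]
  refine norm_integral_le_of_norm_le
    (((hqn.const_mul _).indicator measurableSet_Ioc).integrableOn) ?_
  rw [ae_restrict_iff' measurableSet_Ioi]
  have hne : ∀ᵐ y : ℝ, y ≠ x + (θ i)⁻¹ * ε := by
    simp [ae_iff, measure_singleton]
  filter_upwards [hne] with y hy1 hy
  have hy' : x < y := hy
  have h1 := norm_meanL_shift_le hε (mul_nonneg hi.le (sub_nonneg.2 hy'.le))
    (Pos.sum Finset.univ fun l _ => Pos.smul (q y i l) (hK.pos y l))
  refine h1.trans ?_
  by_cases h2 : θ i * (y - x) < ε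
  · have h3 : y < x + (θ i)⁻¹ * ε := by
      have := (lt_inv_mul_iff₀ hi).2 h2
      linarith
    rw [if_pos h2, indicator_of_mem (show y ∈ Ioc x (x + (θ i)⁻¹ * ε) from ⟨hy', h3.le⟩),
      mul_assoc]
    refine mul_le_mul_of_nonneg_left ?_ (inv_pos.2 hε).le
    have h4 := hC y hy' h3
    have hs : 0 ≤ ∑ l, massNear ε (K y l) := Finset.sum_nonneg fun l _ => massNear_nonneg _ _
    calc massNear ε (∑ l, q y i l • K y l) ≤ ∑ l, ‖q y i l‖ * massNear ε (K y l) := by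
          refine (massNear_sum_le _ _ _).trans (le_of_eq ?_)
          simp only [massNear_smul]
      _ ≤ ∑ l, ‖q y i l‖ * ∑ l', massNear ε (K y l') := by
          gcongr with l
          exact Finset.single_le_sum (f := fun l => massNear ε (K y l))
            (fun _ _ => massNear_nonneg _ _) (Finset.mem_univ l)
      _ ≤ qnorm q y * C := by
          rw [← Finset.sum_mul]
          exact mul_le_mul (sum_norm_le_qnorm i y) h4 hs (qnorm_nonneg y)
      _ = _ := mul_comm _ _
  · rw [if_neg h2, indicator_of_notMem]
    rintro ⟨-, h3⟩
    have h4 : y < x + (θ i)⁻¹ * ε := lt_of_le_of_ne h3 hy1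
    exact h2 ((lt_inv_mul_iff₀ hi).1 (by linarith))

lemma IsVoltKer.meanL_src (hK : IsVoltKer q θ j K g) {ε : ℝ} (hε : 0 < ε) (x : ℝ) {i : ι}
    (hi : 0 < θ i) : meanL ε (g x i) =
      -(((θ i)⁻¹ : ℝ) : ℂ) * avg (fun y => q y i j) x ((θ i)⁻¹ * ε) := by
  have h1 : meanL ε (g x i) = avg (fun γ => -(((θ i)⁻¹ : ℝ) * q (x + (θ i)⁻¹ * γ) i j : ℂ)) 0 ε := by
    refine meanL_congr hε ?_
    filter_upwards [hK.src x i] with γ hγ h0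
    rw [hγ, srcFun, indicator_of_mem (show γ ∈ Ioi (0 : ℝ) from h0)]
  rw [h1, avg, avg, zero_add, intervalIntegral.integral_neg, intervalIntegral.integral_const_mul,
    intervalIntegral.integral_comp_add_mul (fun y => q y i j) (inv_pos.2 hi).ne', mul_zero, add_zero]
  simp only [Complex.real_smul, mul_inv, inv_inv]
  push_cast
  have : (θ i : ℂ) ≠ 0 := by exact_mod_cast hi.ne'
  field_simp

/-- The components with positive rate have the source term as their value on the diagonal. -/
lemma IsVoltKer.ae_tendsto_meanL (h : VoltData q θ j) (hK : IsVoltKer q θ j K g) :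
    ∀ᵐ x : ℝ, ∀ i, 0 < θ i → Tendsto (fun ε => meanL ε (K x i)) (𝓝[>] 0)
      (𝓝 (-(((θ i)⁻¹ : ℝ) : ℂ) * q x i j)) := by
  have hqn := integrable_qnorm h.int
  filter_upwards [ae_tendsto_avg hqn.locallyIntegrable,
    ae_all_iff.2 fun i => ae_tendsto_avg (h.int i j).locallyIntegrable] with x h1 h2 i hi
  have hδ : Tendsto (fun ε => (θ i)⁻¹ * ε) (𝓝[>] 0) (𝓝[>] 0) := by
    refine tendsto_nhdsWithin_iff.2 ⟨?_, ?_⟩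
    · have : Tendsto (fun ε => (θ i)⁻¹ * ε) (𝓝 0) (𝓝 ((θ i)⁻¹ * 0)) :=
        (continuous_const.mul continuous_id).tendsto 0
      rw [mul_zero] at this
      exact this.mono_left nhdsWithin_le_nhds
    · filter_upwards [self_mem_nhdsWithin] with ε hε using mul_pos (inv_pos.2 hi) hε
  have hsrc := ((h2 i).comp hδ).const_mul (-(((θ i)⁻¹ : ℝ) : ℂ))
  have hvolt : Tendsto (fun ε => meanL ε (volt q θ K x i)) (𝓝[>] 0) (𝓝 0) := by
    rw [Metric.tendsto_nhds]
    intro e he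
    set M := (θ i)⁻¹ * (qnorm q x + 1) with hM
    have hM0 : 0 < M := mul_pos (inv_pos.2 hi) (by linarith [qnorm_nonneg (q := q) x])
    set δ := e / (2 * M) with hδd
    have hδ0 : 0 < δ := div_pos he (by positivity)
    have hψ : Continuous fun y => ∑ l, ‖K y l - K x l‖ :=
      continuous_finsetSum _ fun l _ =>
        ((continuous_pi_iff.1 hK.cont l).sub continuous_const).norm
    obtain ⟨ρ, hρ, hρ'⟩ := Metric.continuous_iff.1 hψ x (δ / 2) (by positivity)
    have hmass : Tendsto (fun ε => ∑ l, massNear ε (K x l)) (𝓝[>] 0) (𝓝 0) := by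
      simpa using tendsto_finsetSum Finset.univ fun l _ => tendsto_massNear (K x l)
    have hlt : ∀ᶠ ε in 𝓝[>] (0 : ℝ), (θ i)⁻¹ * ε < ρ :=
      (tendsto_nhdsWithin_iff.1 hδ).1.eventually_lt_const hρ
    filter_upwards [self_mem_nhdsWithin, hlt, hmass.eventually_lt_const (half_pos hδ0),
      (h1.comp hδ).eventually_lt_const (lt_add_one (qnorm q x))] with ε hε h3 h4 h5
    have hε0 : 0 < ε := hε
    rw [dist_zero_right]
    have h6 := hK.norm_meanL_volt_le h hε0 hi (x := x) (C := δ) fun y hy1 hy2 => by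
      have h7 := hρ' y (by rw [Real.dist_eq, abs_of_pos] <;> linarith)
      simp only [sub_self, norm_zero, Finset.sum_const_zero, dist_zero_right] at h7
      have h8 : ∑ l, massNear ε (K y l) ≤ ∑ l, massNear ε (K x l) + ∑ l, ‖K y l - K x l‖ := by
        rw [← Finset.sum_add_distrib]
        refine Finset.sum_le_sum fun l _ => ?_
        have h9 := massNear_add_le ε (K x l) (K y l - K x l)
        rw [add_sub_cancel] at h9
        linarith [massNear_le ε (K y l - K x l)]
      have h9 := (abs_lt.1 h7).2
      linarith
    refine h6.trans_lt ?_
    have h7 : (θ i)⁻¹ * avg (qnorm q) x ((θ i)⁻¹ * ε) ≤ M :=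
      mul_le_mul_of_nonneg_left h5.le (inv_pos.2 hi).le
    calc δ * ((θ i)⁻¹ * avg (qnorm q) x ((θ i)⁻¹ * ε)) ≤ δ * M := by gcongr
      _ = e / 2 := by rw [hδd]; field_simp
      _ < e := half_lt_self he
  have h3 := hsrc.sub hvolt
  rw [sub_zero] at h3
  refine h3.congr' ?_
  filter_upwards [self_mem_nhdsWithin] with ε hε
  rw [hK.eq, map_sub, hK.meanL_src hε x hi]
  rfl

lemma integrable_qnorm_sq (h2 : ∀ i l, MemLp (fun y => q y i l) 2 volume) :
    Integrable fun y => qnorm q y ^ 2 := by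
  have : MemLp (qnorm q) 2 volume :=
    memLp_finsetSum _ fun i _ => memLp_finsetSum _ fun l _ => (h2 i l).norm
  exact this.integrable_sq

lemma mul_avg_le {f : ℝ → ℝ} (hf : Integrable f) (hf2 : Integrable fun y => f y ^ 2) (y : ℝ) {δ : ℝ}
    (hδ : 0 < δ) : f y * avg f y δ ≤ f y ^ 2 + avg (fun y => f y ^ 2) y δ := by
  have h1 : 0 ≤ ∫ t in y..y + δ, (f y ^ 2 + f t ^ 2 - f y * f t) :=
    intervalIntegral.integral_nonneg (by linarith) fun t _ => by
      nlinarith [sq_nonneg (f y - f t), sq_nonneg (f y), sq_nonneg (f t)]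
  rw [intervalIntegral.integral_sub (intervalIntegrable_const.add hf2.intervalIntegrable)
    (hf.intervalIntegrable.const_mul _), intervalIntegral.integral_add intervalIntegrable_const
    hf2.intervalIntegrable, intervalIntegral.integral_const_mul, intervalIntegral.integral_const,
    add_sub_cancel_left, smul_eq_mul] at h1
  have h2 := mul_nonneg (inv_pos.2 hδ).le h1
  rw [avg, avg, smul_eq_mul, smul_eq_mul]
  have h3 : δ⁻¹ * δ = 1 := inv_mul_cancel₀ hδ.ne'
  nlinarith

/-- The components with rate zero. -/
lemma IsVoltKer.tendsto_meanL (h : VoltData q θ j) (hK : IsVoltKer q θ j K g)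
    (h2 : ∀ i l, MemLp (fun y => q y i l) 2 volume) {i : ι} (hi : θ i = 0)
    (hz : ∀ l, θ l = 0 → ∀ y, q y i l = 0) (x : ℝ) :
    Tendsto (fun ε => meanL ε (K x i)) (𝓝[>] 0)
      (𝓝 (∫ y in Ioi x, ∑ l, q y i l * ((((θ l)⁻¹ : ℝ) : ℂ) * q y l j))) := by
  obtain ⟨B, hB⟩ := hK.bdd
  have hqn := integrable_qnorm h.int
  have hqn2 := integrable_qnorm_sq h2
  set B₁ : ℝ := ∑ _l : ι, |B| with hB₁
  have hmass : ∀ ε y, ∑ l, massNear ε (K y l) ≤ B₁ := fun ε y =>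
    Finset.sum_le_sum fun l _ => ((massNear_le _ _).trans (hB y l)).trans (le_abs_self B)
  have hB₁0 : 0 ≤ B₁ := Finset.sum_nonneg fun _ _ => abs_nonneg _
  -- a pointwise bound for the means
  have hbound : ∀ {ε : ℝ}, 0 < ε → ∀ y l, 0 < θ l → ‖meanL ε (K y l)‖ ≤
      (1 + B₁) * (θ l)⁻¹ * avg (qnorm q) y ((θ l)⁻¹ * ε) := fun {ε} hε y l hl => by
    have hδ : 0 < (θ l)⁻¹ * ε := mul_pos (inv_pos.2 hl) hε
    rw [hK.eq, map_sub]
    refine (norm_sub_le _ _).trans ?_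
    have h3 := hK.norm_meanL_volt_le h hε hl (x := y) fun z _ _ => hmass ε z
    have h4 : ‖meanL ε (g y l)‖ ≤ (θ l)⁻¹ * avg (qnorm q) y ((θ l)⁻¹ * ε) := by
      rw [hK.meanL_src hε y hl, norm_mul, norm_neg, Complex.norm_real,
        Real.norm_of_nonneg (inv_pos.2 hl).le]
      refine mul_le_mul_of_nonneg_left ((norm_avg_le _ _ hδ).trans
        (avg_mono (h.int l j).norm hqn (fun t => ?_) y hδ)) (inv_pos.2 hl).le
      exact (Finset.single_le_sum (f := fun j => ‖q t l j‖) (fun _ _ => norm_nonneg _)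
        (Finset.mem_univ j)).trans (sum_norm_le_qnorm l t)
    linarith
  have key : ∀ ε, meanL ε (K x i) = -∑ l, ∫ y, (Ioi x).indicator (fun y => q y i l) y *
      meanL ε (K y l) := fun ε => by
    have hg : meanL ε (g x i) = 0 := by
      have : g x i = 0 := by
        refine Lp.ext ?_
        filter_upwards [hK.src x i, Lp.coeFn_zero ℂ 1 (volume : Measure ℝ)] with γ h3 h4
        rw [h3, h4, srcFun]
        simp [hi]
      rw [this, map_zero]
    have hc : ∀ l, Continuous fun y => meanL ε (K y l) := fun l =>
      (meanL ε).continuous.comp (continuous_pi_iff.1 hK.cont l)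
    have hint : ∀ l, Integrable fun y => (Ioi x).indicator (fun y => q y i l) y * meanL ε (K y l) :=
      fun l => ((h.int i l).indicator measurableSet_Ioi).mul_bdd (c := ‖meanL ε‖ * B)
        (hc l).aestronglyMeasurable
        (.of_forall fun y => ((meanL ε).le_opNorm _).trans
          (mul_le_mul_of_nonneg_left (hB y l) (norm_nonneg _)))
    rw [hK.eq, map_sub, hg, zero_sub, hK.meanL_volt h, ← integral_indicator measurableSet_Ioi,
      ← integral_finsetSum _ fun l _ => hint l]
    congr 2; ext y
    by_cases hy : y ∈ Ioi x
    · simp only [indicator_of_mem hy, hi, zero_mul]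
      have hs : ∀ u : E1, shift 0 u = u := fun u => by
        refine Lp.ext ?_
        filter_upwards [shift_ae 0 u] with γ hγ
        rw [hγ, sub_zero]
      rw [hs, map_sum]
      simp only [map_smul, smul_eq_mul]
    · simp only [indicator_of_notMem hy, zero_mul, Finset.sum_const_zero]
  have hlim : ∀ l, Tendsto (fun ε => ∫ y, (Ioi x).indicator (fun y => q y i l) y * meanL ε (K y l))
      (𝓝[>] 0) (𝓝 (∫ y, (Ioi x).indicator (fun y => q y i l) y *
        (-(((θ l)⁻¹ : ℝ) : ℂ) * q y l j))) := fun l => by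
    rcases (h.nonneg l).eq_or_lt with hl | hl
    · have hz' := hz l hl.symm
      have : (fun y => q y i l) = fun _ => 0 := funext hz'
      simp [this]
    refine tendsto_of_seq_tendsto fun u hu => ?_
    obtain ⟨hu0, hup⟩ := tendsto_nhdsWithin_iff.1 hu
    obtain ⟨n₀, hn₀⟩ := eventually_atTop.1 hup
    rw [← tendsto_add_atTop_iff_nat n₀]
    have hpos : ∀ n, 0 < u (n + n₀) := fun n => hn₀ _ (Nat.le_add_left _ _)
    have hpos' : ∀ n, 0 < (θ l)⁻¹ * u (n + n₀) := fun n => mul_pos (inv_pos.2 hl) (hpos n)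
    have hu' : Tendsto (fun n => u (n + n₀)) atTop (𝓝[>] 0) :=
      hu.comp (tendsto_add_atTop_nat n₀)
    have hu2 : Tendsto (fun n => (θ l)⁻¹ * u (n + n₀)) atTop (𝓝[>] 0) := by
      refine tendsto_nhdsWithin_iff.2 ⟨?_, .of_forall hpos'⟩
      simpa using (tendsto_nhdsWithin_iff.1 hu').1.const_mul (θ l)⁻¹
    set C := (1 + B₁) * (θ l)⁻¹ with hC
    have hC0 : 0 ≤ C := mul_nonneg (by linarith) (inv_pos.2 hl).le
    refine tendsto_integral_of_tendsto_bound
      (G := fun n y => C * (qnorm q y ^ 2 + avg (fun y => qnorm q y ^ 2) y ((θ l)⁻¹ * u (n + n₀))))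
      (G' := fun y => C * (qnorm q y ^ 2 + qnorm q y ^ 2)) (fun n => ?_)
      (fun n => (hqn2.add (integrable_avg hqn2 (hpos' n)).1).const_mul C)
      ((hqn2.add hqn2).const_mul C) (fun n => .of_forall fun y => ?_) ?_ ?_ ?_
    · exact ((h.int i l).indicator measurableSet_Ioi).1.mul
        ((meanL _).continuous.comp (continuous_pi_iff.1 hK.cont l)).aestronglyMeasurable
    · rw [norm_mul]
      have h3 : ‖(Ioi x).indicator (fun y => q y i l) y‖ ≤ qnorm q y :=
        (norm_indicator_le_norm_self _ _).trans
          ((Finset.single_le_sum (f := fun l => ‖q y i l‖) (fun _ _ => norm_nonneg _)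
            (Finset.mem_univ l)).trans (sum_norm_le_qnorm i y))
      calc _ ≤ qnorm q y * (C * avg (qnorm q) y ((θ l)⁻¹ * u (n + n₀))) :=
            mul_le_mul h3 (hbound (hpos n) y l hl) (norm_nonneg _) (qnorm_nonneg y)
        _ = C * (qnorm q y * avg (qnorm q) y ((θ l)⁻¹ * u (n + n₀))) := by ring
        _ ≤ _ := mul_le_mul_of_nonneg_left (mul_avg_le hqn hqn2 y (hpos' n)) hC0
    · filter_upwards [hK.ae_tendsto_meanL h] with y hy
      exact ((hy l hl).comp hu').const_mul _
    · filter_upwards [ae_tendsto_avg hqn2.locallyIntegrable] with y hy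
      exact ((hy.comp hu2).const_add _).const_mul C
    · refine tendsto_const_nhds.congr fun n => ?_
      obtain ⟨i1, i2⟩ := integrable_avg hqn2 (hpos' n)
      rw [integral_const_mul, integral_const_mul, integral_add hqn2 hqn2, integral_add hqn2 i1, i2]
  have h3 := (tendsto_finsetSum Finset.univ fun l _ => hlim l).neg
  simp only [← key] at h3
  convert h3 using 2
  have hint : ∀ l, Integrable fun y => (Ioi x).indicator (fun y => q y i l) y *
        (-(((θ l)⁻¹ : ℝ) : ℂ) * q y l j) := fun l => by
    have h4 := ((h2 i l).integrable_mul (h2 l j)).indicator (measurableSet_Ioi (a := x)) |>.const_mul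
      (-(((θ l)⁻¹ : ℝ) : ℂ))
    refine h4.congr (.of_forall fun y => ?_)
    by_cases hy : y ∈ Ioi x
    · simp only [indicator_of_mem hy, Pi.mul_apply]; ring
    · simp only [indicator_of_notMem hy]; ring
  rw [← integral_finsetSum _ fun l _ => hint l, ← integral_neg, ← integral_indicator measurableSet_Ioi]
  congr 1; ext y
  by_cases hy : y ∈ Ioi x
  · simp only [indicator_of_mem hy, ← Finset.sum_neg_distrib]
    exact Finset.sum_congr rfl fun l _ => by ring
  · simp only [indicator_of_notMem hy, zero_mul, Finset.sum_const_zero, neg_zero]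

end Col

end AKNS

namespace AKNS

variable {p m : ℕ} {Q : ℝ → Matrix (Idx p m) (Idx p m) ℂ} {k : ℂ}
  {KP KM : ℝ → ℝ → Matrix (Idx p m) (Idx p m) ℂ}

/-! ### Diagonal values of the kernels of the triangular representations -/

lemma hasValueAtZero_of_meanL {f : ℝ → ℂ} {u : E1} {v : ℂ}
    (h : (Ioi (0 : ℝ)).indicator f =ᵐ[volume] (Ioi (0 : ℝ)).indicator u)
    (hu : Tendsto (fun ε => meanL ε u) (𝓝[>] 0) (𝓝 v)) : HasValueAtZero f v := by
  refine hu.congr' ?_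
  filter_upwards [self_mem_nhdsWithin] with ε hε
  rw [meanL_congr hε (v := f), avg, mean, zero_add, Complex.real_smul, Complex.ofReal_inv]
  filter_upwards [h] with γ hγ h0
  have h0' : γ ∈ Ioi (0 : ℝ) := h0
  rw [indicator_of_mem h0', indicator_of_mem h0'] at hγ
  exact hγ.symm

lemma mul_blockDiag_pl (A : Matrix (Idx p m) (Idx p m) ℂ) (z : ℂ) (i : Idx p m) (a : Fin p) :
    (A * blockDiag (1 : Matrix (Fin p) (Fin p) ℂ) z (1 : Matrix (Fin m) (Fin m) ℂ)) i (pl a) =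
      A i (pl a) := by
  rw [Matrix.mul_apply, sum_idx, blockDiag_off _ _ _ (i := ze) (by simp [sg])]
  simp only [blockDiag_pl, blockDiag_off _ _ _ (show sg (mi _ : Idx p m) ≠ sg (pl a : Idx p m) by
      simp only [sg]; norm_num)]
  simp [Matrix.one_apply]

lemma mul_blockDiag_mi (A : Matrix (Idx p m) (Idx p m) ℂ) (z : ℂ) (i : Idx p m) (a : Fin m) :
    (A * blockDiag (1 : Matrix (Fin p) (Fin p) ℂ) z (1 : Matrix (Fin m) (Fin m) ℂ)) i (mi a) =
      A i (mi a) := by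
  rw [Matrix.mul_apply, sum_idx, blockDiag_off _ _ _ (i := ze) (by simp [sg])]
  simp only [blockDiag_mi, blockDiag_off _ _ _ (show sg (pl _ : Idx p m) ≠ sg (mi a : Idx p m) by
      simp only [sg]; norm_num)]
  simp [Matrix.one_apply]

/-- The columns of the plus block are Volterra kernels. -/
lemma Good.kerP_pl (h : Good Q) (H : IsKernelPair Q KP KM) (a : Fin p) :
    ∃ K g, IsVoltKer (fun y => Q y) thP (pl a) K g ∧ ∀ x i,
      kerP KP x i (pl a) =ᵐ[volume] (Ioi (0 : ℝ)).indicator (K x i) := by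
  obtain ⟨K, g, hK⟩ := (h.pot.voltP a).exists_ker
  refine ⟨K, g, hK, fun x i => ae_eq_of_ft_eq (H.L1P x i _).int
    ((L1.integrable_coeFn _).indicator measurableSet_Ioi) fun k => ?_⟩
  have hk : 0 ≤ (k : ℂ).im := by simp
  have h1 := h.FP_corrCt H x hk i (pl a)
  rw [h.corrCt_inv hk, mul_blockDiag_pl] at h1
  have h2 := hK.eq_ft (h.pot.voltP a) hk (isVolt_faddM h.pot hk a) x i
  exact add_left_cancel (h1.symm.trans h2)

/-- The columns of the minus block are Volterra kernels of the reflected potential. -/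
lemma Good.kerP_mi (h : Good Q) (H : IsKernelPair Q KP KM) (b : Fin m) :
    ∃ K g, IsVoltKer (fun y => AKNS.sharp Q y) thM (mi b) K g ∧ ∀ x i,
      kerP KP x i (mi b) =ᵐ[volume] (Ioi (0 : ℝ)).indicator (K (-x) i) := by
  obtain ⟨K, g, hK⟩ := (h.pot.sharp.voltM b).exists_ker
  refine ⟨K, g, hK, fun x i => ae_eq_of_ft_eq (H.L1P x i _).int
    ((L1.integrable_coeFn _).indicator measurableSet_Ioi) fun k => ?_⟩
  have hk : 0 ≤ (k : ℂ).im := by simp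
  have h1 := h.FP_corrCt H x hk i (mi b)
  rw [h.corrCt_inv hk, mul_blockDiag_mi] at h1
  have h2 := hK.eq_ft (h.pot.sharp.voltM b) hk (isVolt_faddN h.pot hk b) (-x) i
  rw [neg_neg] at h2
  exact add_left_cancel (h1.symm.trans h2)

lemma ae_neg {q : ℝ → Prop} (h : ∀ᵐ x, q x) : ∀ᵐ x, q (-x) :=
  (Measure.measurePreserving_neg (volume : Measure ℝ)).quasiMeasurePreserving.ae h

lemma Good.ae_value_pl (h : Good Q) (H : IsKernelPair Q KP KM) (a : Fin p) :
    ∀ᵐ x : ℝ, ∀ i, 0 < thP i →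
      HasValueAtZero (fun γ => KP x (x + γ) i (pl a)) (-(((thP i)⁻¹ : ℝ) : ℂ) * Q x i (pl a)) := by
  obtain ⟨K, g, hK, e⟩ := h.kerP_pl H a
  filter_upwards [hK.ae_tendsto_meanL (h.pot.voltP a)] with x hx i hi
  exact hasValueAtZero_of_meanL (e x i) (hx i hi)

lemma Good.ae_value_mi (h : Good Q) (H : IsKernelPair Q KP KM) (b : Fin m) :
    ∀ᵐ x : ℝ, ∀ i, 0 < thM i →
      HasValueAtZero (fun γ => KP x (x + γ) i (mi b)) ((((thM i)⁻¹ : ℝ) : ℂ) * Q x i (mi b)) := by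
  obtain ⟨K, g, hK, e⟩ := h.kerP_mi H b
  filter_upwards [ae_neg (hK.ae_tendsto_meanL (h.pot.sharp.voltM b))] with x hx i hi
  have := hasValueAtZero_of_meanL (f := fun γ => KP x (x + γ) i (mi b)) (e x i) (hx i hi)
  simpa only [AKNS.sharp, neg_neg, Matrix.neg_apply, neg_mul, mul_neg] using this

lemma Good.value_pl (h : Good Q) (H : IsKernelPair Q KP KM)
    (h2 : ∀ i j, MemLp (fun x => Q x i j) 2 volume) (x : ℝ) (a b : Fin p) :
    HasValueAtZero (fun γ => KP x (x + γ) (pl a) (pl b)) (∫ z in Ioi x, prodP Q z a b) := by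
  obtain ⟨K, g, hK, e⟩ := h.kerP_pl H b
  have h1 := hK.tendsto_meanL (h.pot.voltP b) h2 (i := pl a) (by simp [thP, sg])
    (fun l hl y => h.pot.off y _ _ (show (1 : ℝ) = sg l by simp only [thP] at hl; linarith)) x
  have h3 := hasValueAtZero_of_meanL (f := fun γ => KP x (x + γ) (pl a) (pl b)) (e x (pl a)) h1
  refine (congrArg (HasValueAtZero _) (integral_congr_ae (.of_forall fun z => ?_))).mpr h3
  rw [prodP, sum_idx]
  simp only [thP, sg, sub_self, sub_zero, inv_one, inv_zero, Complex.ofReal_zero, Complex.ofReal_one,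
    zero_mul, mul_zero, Finset.sum_const_zero, zero_add, one_mul]
  congr 1
  rw [Finset.mul_sum]
  refine Finset.sum_congr rfl fun c _ => ?_
  norm_num
  ring

lemma Good.value_mi (h : Good Q) (H : IsKernelPair Q KP KM)
    (h2 : ∀ i j, MemLp (fun x => Q x i j) 2 volume) (x : ℝ) (a b : Fin m) :
    HasValueAtZero (fun γ => KP x (x + γ) (mi a) (mi b)) (∫ z in Iio x, prodM Q z a b) := by
  obtain ⟨K, g, hK, e⟩ := h.kerP_mi H b
  have h1 := hK.tendsto_meanL (h.pot.sharp.voltM b)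
    (fun i l => ((h2 i l).comp_measurePreserving (Measure.measurePreserving_neg volume)).neg)
    (i := mi a) (by simp [thM, sg])
    (fun l hl y => h.pot.sharp.off y _ _ (show (-1 : ℝ) = sg l by simp only [thM] at hl; linarith)) (-x)
  have h3 := hasValueAtZero_of_meanL (f := fun γ => KP x (x + γ) (mi a) (mi b)) (e x (mi a)) h1
  have h4 := integral_Iio_neg (fun z => prodM Q z a b) (-x)
  rw [neg_neg] at h4
  rw [h4]
  refine (congrArg (HasValueAtZero _) (integral_congr_ae (.of_forall fun z => ?_))).mpr h3
  rw [prodM, sum_idx]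
  simp only [thM, sg, AKNS.sharp, Matrix.neg_apply, add_neg_cancel, add_zero, inv_one, inv_zero,
    Complex.ofReal_zero, Complex.ofReal_one, zero_mul, mul_zero, Finset.sum_const_zero, one_mul,
    mul_neg, neg_mul, neg_neg, neg_zero]
  congr 1
  rw [Finset.mul_sum]
  refine Finset.sum_congr rfl fun c _ => ?_
  norm_num
  ring

/-- The off-diagonal blocks of the first and third column of the potential read off from the
diagonal values `E`. -/
structure DiagVal (E q : Matrix (Idx p m) (Idx p m) ℂ) : Prop where
  zp : ∀ b, E ze (pl b) = -q ze (pl b)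
  zm : ∀ b, E ze (mi b) = q ze (mi b)
  pm : ∀ a b, E (pl a) (mi b) = 1 / 2 * q (pl a) (mi b)
  mp : ∀ a b, E (mi a) (pl b) = -(1 / 2) * q (mi a) (pl b)

/-- The values of the plus kernel on the diagonal. -/
def OffValP (KP : ℝ → ℝ → Matrix (Idx p m) (Idx p m) ℂ) (x : ℝ)
    (q : Matrix (Idx p m) (Idx p m) ℂ) : Prop :=
  (∀ b : Fin p, HasValueAtZero (fun γ => KP x (x + γ) ze (pl b)) (-q ze (pl b))) ∧
  (∀ b : Fin m, HasValueAtZero (fun γ => KP x (x + γ) ze (mi b)) (q ze (mi b))) ∧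
  (∀ (a : Fin p) (b : Fin m),
    HasValueAtZero (fun γ => KP x (x + γ) (pl a) (mi b)) (1 / 2 * q (pl a) (mi b))) ∧
  (∀ (a : Fin m) (b : Fin p),
    HasValueAtZero (fun γ => KP x (x + γ) (mi a) (pl b)) (-(1 / 2) * q (mi a) (pl b)))

lemma Good.ae_offValP (h : Good Q) (H : IsKernelPair Q KP KM) : ∀ᵐ x : ℝ, OffValP KP x (Q x) := by
  filter_upwards [ae_all_iff.2 fun a => h.ae_value_pl H a, ae_all_iff.2 fun b => h.ae_value_mi H b]
    with x h1 h2
  refine ⟨fun b => ?_, fun b => ?_, fun a b => ?_, fun a b => ?_⟩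
  · simpa [thP, sg] using h1 b ze (by simp [thP, sg])
  · simpa [thM, sg] using h2 b ze (by simp [thM, sg])
  · have := h2 b (pl a) (by simp only [thM, sg]; norm_num)
    convert this using 2
    simp only [thM, sg]; norm_num
  · have := h1 b (mi a) (by simp only [thP, sg]; norm_num)
    convert this using 2
    simp only [thP, sg]; norm_num

lemma HasValueAtZero.limUnder_eq {f : ℝ → ℂ} {v : ℂ} (h : HasValueAtZero f v) :
    limUnder (𝓝[>] 0) (mean f) = v := Tendsto.limUnder_eq h

lemma OffValP.diagVal {x : ℝ} {q : Matrix (Idx p m) (Idx p m) ℂ} (h : OffValP KP x q) :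
    DiagVal (diagP KP x) q :=
  ⟨fun b => (h.1 b).limUnder_eq, fun b => (h.2.1 b).limUnder_eq, fun a b => (h.2.2.1 a b).limUnder_eq,
    fun a b => (h.2.2.2 a b).limUnder_eq⟩

/-- The reflected minus kernel is a plus kernel. -/
lemma diagP_reflect (KM : ℝ → ℝ → Matrix (Idx p m) (Idx p m) ℂ) (x : ℝ) :
    diagP (fun x y => KM (-x) (-y)) (-x) = diagM KM x := by
  have e : ∀ γ : ℝ, -(-x + γ) = x - γ := fun γ => by ring
  simp only [diagP, diagM, neg_neg, e]

lemma DiagVal.neg {E q : Matrix (Idx p m) (Idx p m) ℂ} (h : DiagVal E (-q)) : DiagVal (-E) q := by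
  refine ⟨fun b => ?_, fun b => ?_, fun a b => ?_, fun a b => ?_⟩
  · simp [h.zp]
  · simp [h.zm]
  · simp [h.pm]
  · simp [h.mp]

/-! ### Focusing potentials -/

lemma focusColumn_eq {σ E : Matrix (Idx p m) (Idx p m) ℂ} {x : ℝ} (hσ : IsFocusing σ Q)
    (hx : (Q x).conjTranspose = -(σ * Q x * σ)) (hoff : OffBlock (Q x)) (hE : DiagVal E (Q x))
    (l : Idx p m) : Q x l ze = focusColumn σ E l := by
  have h0 : ∀ j : Idx p m, sg j ≠ 0 → σ j ze = 0 := fun j hj => by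
    have hj' : ((sg j : ℝ) : ℂ) ≠ 0 := by exact_mod_cast hj
    rcases hσ.comm with h | h
    · have := h j ze
      simp only [sg, Complex.ofReal_zero, mul_zero] at this
      exact (mul_eq_zero.1 this).resolve_left hj'
    · have := h j ze
      simp only [sg, Complex.ofReal_zero, mul_zero, neg_zero] at this
      exact (mul_eq_zero.1 this).resolve_left hj'
  have h1 : Q x = -(σ * (Q x).conjTranspose * σ) := by
    rw [hx, mul_neg, neg_mul, neg_neg, mul_assoc σ (Q x) σ, ← mul_assoc σ σ, hσ.unit, one_mul,
      mul_assoc, hσ.unit, mul_one]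
  have hEz : ∀ i : Idx p m, sg i ≠ 0 → ((sg i : ℝ) : ℂ) * star (E ze i) = -star (Q x ze i) := by
    intro i hi
    rcases i with a | a | a
    · rw [hE.zp]; simp [sg]
    · exact absurd rfl hi
    · rw [hE.zm]; simp [sg]
  have h2 := congrFun (congrFun h1 l) ze
  rw [h2, Matrix.neg_apply, Matrix.mul_apply, focusColumn, ← Finset.sum_neg_distrib]
  have h3 : ∀ j : Idx p m, j ≠ ze → σ j ze = 0 := fun j hj => h0 j (by
    rcases j with a | a | a
    · simp [sg]
    · exact absurd rfl hj
    · simp [sg])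
  rw [Finset.sum_eq_single ze (fun j _ hj => by rw [h3 j hj, mul_zero, neg_zero])
    (fun h => absurd (Finset.mem_univ _) h), Matrix.mul_apply, Finset.sum_mul, ← Finset.sum_neg_distrib]
  refine Finset.sum_congr rfl fun i _ => ?_
  rw [Matrix.conjTranspose_apply]
  by_cases hi : sg i = 0
  · have : Q x ze i = 0 := hoff _ _ (show (0 : ℝ) = sg i from hi.symm)
    rw [this, hi]; simp
  · have := hEz i hi
    linear_combination (-(σ l i * σ ze ze)) * this

/-! ### Reconstruction -/

lemma reconstruct_eq {E : ℝ → Matrix (Idx p m) (Idx p m) ℂ} {x : ℝ} (hoff : OffBlock (Q x))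
    (hE : DiagVal (E x) (Q x))
    (hP : ∀ a b, HasDerivAt (fun t => E t (pl a) (pl b)) (-prodP Q x a b) x)
    (hM : ∀ a b, HasDerivAt (fun t => E t (mi a) (mi b)) (prodM Q x a b) x)
    (h1 : ∃ b, Q x ze (pl b) ≠ 0) (h2 : ∃ b, Q x ze (mi b) ≠ 0) : reconstruct E x = Q x := by
  have hnorm : ∀ {n : ℕ} {f : Fin n → ℂ}, (∃ b, f b ≠ 0) →
      ∑ b, f b * star (f b) ≠ 0 ∧ ∑ b, ((‖f b‖ ^ 2 : ℝ) : ℂ) = ∑ b, f b * star (f b) := by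
    intro n f ⟨b, hb⟩
    have e : ∀ b, f b * star (f b) = ((‖f b‖ ^ 2 : ℝ) : ℂ) := fun b => by
      push_cast; exact Complex.mul_conj' _
    simp only [e, and_true]
    rw [← Complex.ofReal_sum]
    have : 0 < ∑ b, ‖f b‖ ^ 2 := Finset.sum_pos' (fun _ _ => by positivity)
      ⟨b, Finset.mem_univ b, by positivity⟩
    exact_mod_cast this.ne'
  obtain ⟨n1, n1'⟩ := hnorm h1
  obtain ⟨n2, n2'⟩ := hnorm h2
  ext i j
  rcases i with a | a | a <;> rcases j with b | b | b
  · exact (hoff (pl a) (pl b) rfl).symm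
  · change (∑ b, (deriv (fun t => E t (pl a) (pl b)) x - 2 * ∑ c, E x (pl a) (mi c) *
      E x (mi c) (pl b)) * star (E x ze (pl b))) / ∑ b : Fin p, ((‖E x ze (pl b)‖ ^ 2 : ℝ) : ℂ) =
        Q x (pl a) ze
    simp only [(hP _ _).deriv, hE.zp, hE.pm, hE.mp, norm_neg, star_neg, n1']
    rw [div_eq_iff n1, Finset.mul_sum]
    refine Finset.sum_congr rfl fun b _ => ?_
    have e : ∀ c, 1 / 2 * Q x (pl a) (mi c) * (-(1 / 2) * Q x (mi c) (pl b)) =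
        -(1 / 4) * (Q x (pl a) (mi c) * Q x (mi c) (pl b)) := fun c => by ring
    simp only [e, ← Finset.mul_sum, prodP]
    ring
  · change 2 * E x (pl a) (mi b) = _
    rw [hE.pm]; ring
  · change -E x ze (pl b) = _
    rw [hE.zp]; exact neg_neg _
  · exact (hoff ze ze rfl).symm
  · exact hE.zm b
  · change -2 * E x (mi a) (pl b) = _
    rw [hE.mp]; ring
  · change (∑ b, (deriv (fun t => E t (mi a) (mi b)) x + 2 * ∑ c, E x (mi a) (pl c) *
      E x (pl c) (mi b)) * star (E x ze (mi b))) / ∑ b : Fin m, ((‖E x ze (mi b)‖ ^ 2 : ℝ) : ℂ) =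
        Q x (mi a) ze
    simp only [(hM _ _).deriv, hE.zm, hE.pm, hE.mp, n2']
    rw [div_eq_iff n2, Finset.mul_sum]
    refine Finset.sum_congr rfl fun b _ => ?_
    have e : ∀ c, -(1 / 2) * Q x (mi a) (pl c) * (1 / 2 * Q x (pl c) (mi b)) =
        -(1 / 4) * (Q x (mi a) (pl c) * Q x (pl c) (mi b)) := fun c => by ring
    simp only [e, ← Finset.mul_sum, prodM]
    ring
  · exact (hoff (mi a) (mi b) rfl).symm

lemma ae_hasDerivAt_Ioi {f : ℝ → ℂ} (hf : Integrable f) :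
    ∀ᵐ x, HasDerivAt (fun t => ∫ z in Ioi t, f z) (-f x) x := by
  filter_upwards [LocallyIntegrable.ae_hasDerivAt_integral hf.locallyIntegrable] with x hx
  have e := funext (integral_Ioi_eq_sub hf)
  rw [e]
  exact (hx 0).const_sub _

lemma ae_hasDerivAt_Iio {f : ℝ → ℂ} (hf : Integrable f) :
    ∀ᵐ x, HasDerivAt (fun t => ∫ z in Iio t, f z) (f x) x := by
  filter_upwards [LocallyIntegrable.ae_hasDerivAt_integral hf.locallyIntegrable] with x hx
  have e : ∀ t, ∫ z in Iio t, f z = (∫ z in Iic 0, f z) + ∫ z in (0 : ℝ)..t, f z := fun t => by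
    rw [← integral_Iic_eq_integral_Iio, ← intervalIntegral.integral_Iic_sub_Iic hf.integrableOn
      hf.integrableOn, add_sub_cancel]
  rw [funext e]
  exact (hx 0).const_add _

lemma integrable_prodP (h2 : ∀ i j, MemLp (fun x => Q x i j) 2 volume) (a b : Fin p) :
    Integrable fun z => prodP Q z a b :=
  ((h2 _ _).integrable_mul (h2 _ _)).add ((integrable_finsetSum _ fun _ _ =>
    (h2 _ _).integrable_mul (h2 _ _)).const_mul _)

lemma integrable_prodM (h2 : ∀ i j, MemLp (fun x => Q x i j) 2 volume) (a b : Fin m) :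
    Integrable fun z => prodM Q z a b :=
  ((integrable_finsetSum _ fun _ _ => (h2 _ _).integrable_mul (h2 _ _)).const_mul _).add
    ((h2 _ _).integrable_mul (h2 _ _))

end AKNS

end

theorem mainTheorem3 (p m : ℕ) (hp : 1 ≤ p) (hm : 1 ≤ m)
    (Q : ℝ → Matrix (Idx p m) (Idx p m) ℂ) (hQ : IsPotential Q)
    (hreg : NoSpectralSingularities Q) (hsimple : SimpleNonoverlapping Q)
    (hw : HasWindingNumber (fun k => scatS Q k ze ze) 0)
    (hwt : HasWindingNumber (fun k => scatSt Q k ze ze) 0) :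
    -- the data are well defined
    (∀ x k : ℝ, XiM Q x k = XiP Q x k * scatS Q k ∧ XiP Q x k = XiM Q x k * scatSt Q k) ∧
    (eigUp Q).Finite ∧ (eigLo Q).Finite ∧
    (∃ N Nt Rh Rht, IsScatteringData Q N Nt Rh Rht) ∧
    (∃ KP KM, IsKernelPair Q KP KM) ∧
    ∀ N Nt Rh Rht KP KM, IsScatteringData Q N Nt Rh Rht → IsKernelPair Q KP KM →
      -- the Marchenko kernels are off-block-diagonal with entries in `L¹(0,∞)`
      (∀ x γ, OffBlock (omegaP Q N Rh x γ) ∧ OffBlock (omegaM Q Nt Rht x γ)) ∧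
      (∀ x i j, IntegrableOn (fun γ => omegaP Q N Rh x γ i j) (Ioi 0) volume ∧
        IntegrableOn (fun γ => omegaM Q Nt Rht x γ i j) (Ioi 0) volume) ∧
      -- the coupled Marchenko equations
      (∀ x : ℝ, ∀ᵐ γ ∂(volume.restrict (Ioi (0 : ℝ))), ∀ i j,
        IntegrableOn (fun g => (KP x (x + g) * omegaP Q N Rh x (g + γ)) i j) (Ioi 0) volume ∧
        KM x (x - γ) i j + omegaP Q N Rh x γ i j +
          ∫ g in Ioi (0 : ℝ), (KP x (x + g) * omegaP Q N Rh x (g + γ)) i j = 0) ∧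
      (∀ x : ℝ, ∀ᵐ γ ∂(volume.restrict (Ioi (0 : ℝ))), ∀ i j,
        IntegrableOn (fun g => (KM x (x - g) * omegaM Q Nt Rht x (g + γ)) i j) (Ioi 0) volume ∧
        KP x (x + γ) i j + omegaM Q Nt Rht x γ i j +
          ∫ g in Ioi (0 : ℝ), (KM x (x - g) * omegaM Q Nt Rht x (g + γ)) i j = 0) ∧
      -- the off-diagonal blocks of the potential from the diagonal values of the kernels
      (∀ᵐ x : ℝ,
        (∀ b : Fin p,
          HasValueAtZero (fun γ => KP x (x + γ) ze (pl b)) (-Q x ze (pl b)) ∧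
          HasValueAtZero (fun γ => KM x (x - γ) ze (pl b)) (Q x ze (pl b))) ∧
        (∀ b : Fin m,
          HasValueAtZero (fun γ => KP x (x + γ) ze (mi b)) (Q x ze (mi b)) ∧
          HasValueAtZero (fun γ => KM x (x - γ) ze (mi b)) (-Q x ze (mi b))) ∧
        (∀ (a : Fin p) (b : Fin m),
          HasValueAtZero (fun γ => KP x (x + γ) (pl a) (mi b)) (1 / 2 * Q x (pl a) (mi b)) ∧
          HasValueAtZero (fun γ => KM x (x - γ) (pl a) (mi b)) (-(1 / 2) * Q x (pl a) (mi b))) ∧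
        (∀ (a : Fin m) (b : Fin p),
          HasValueAtZero (fun γ => KP x (x + γ) (mi a) (pl b)) (-(1 / 2) * Q x (mi a) (pl b)) ∧
          HasValueAtZero (fun γ => KM x (x - γ) (mi a) (pl b)) (1 / 2 * Q x (mi a) (pl b)))) ∧
      -- the remaining two blocks for focusing potentials
      (∀ σ : Matrix (Idx p m) (Idx p m) ℂ, IsFocusing σ Q → ∀ᵐ x : ℝ, ∀ l, (sg l : ℝ) ≠ 0 →
        Q x l ze = focusColumn σ (diagP KP x) l ∧ Q x l ze = focusColumn σ (-diagM KM x) l) ∧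
      -- the diagonal blocks of the kernels, and the whole potential, for square integrable entries
      ((∀ i j, MemLp (fun x => Q x i j) 2 volume) →
        (∀ (x : ℝ) (a b : Fin p),
          HasValueAtZero (fun γ => KP x (x + γ) (pl a) (pl b)) (∫ z in Ioi x, prodP Q z a b) ∧
          HasValueAtZero (fun γ => KM x (x - γ) (pl a) (pl b)) (∫ z in Iio x, prodP Q z a b)) ∧
        (∀ (x : ℝ) (a b : Fin m),
          HasValueAtZero (fun γ => KP x (x + γ) (mi a) (mi b)) (∫ z in Iio x, prodM Q z a b) ∧
          HasValueAtZero (fun γ => KM x (x - γ) (mi a) (mi b)) (∫ z in Ioi x, prodM Q z a b)) ∧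
        (∀ᵐ x : ℝ, (∃ b, Q x ze (pl b) ≠ 0) → (∃ b, Q x ze (mi b) ≠ 0) →
          reconstruct (diagP KP) x = Q x ∧ reconstruct (fun t => -diagM KM t) x = Q x)) := by
  have h : Good Q := ⟨hQ, hreg, hsimple, hw, hwt⟩
  refine ⟨fun x k => ⟨XiM_eq h.pot (h.detLP k) (h.detRM k) x, ?_⟩, h.finite_eigUp, h.finite_eigLo,
    h.exists_scatteringData, h.exists_kernelPair, fun N Nt Rh Rht KP KM D H => ?_⟩
  · have h1 := XiM_eq h.sharp.pot (k := -k) (h.sharp.detLP _) (h.sharp.detRM _) (-x)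
    have h2 := XiM_sharp h.pot (k := (k : ℂ)) (by simp) (-x)
    have h3 := XiP_sharp h.pot (k := (k : ℂ)) (by simp) (-x)
    push_cast at h1
    rw [neg_neg] at h2
    rw [neg_neg] at h3
    rw [h2, h3, scatS_sharp h.pot, neg_neg] at h1
    exact h1
  have D' := h.scatteringData_sharp D
  have H' := h.kernelPair_sharp H
  have hω : ∀ x γ, omegaM Q Nt Rht x γ = omegaP (sharp Q) (fun k => Nt (-k)) Rht (-x) γ := fun x γ => by
    rw [omegaP_sharp h, neg_neg]
  have hoffP : ∀ᵐ x, OffValP KP x (Q x) := h.ae_offValP H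
  have hoffM : ∀ᵐ x, OffValP (fun x y => KM (-x) (-y)) (-x) (-Q x) := by
    filter_upwards [ae_neg (h.sharp.ae_offValP H')] with x hx
    simpa only [sharp, neg_neg] using hx
  have hdM : ∀ {x}, OffValP (fun x y => KM (-x) (-y)) (-x) (-Q x) → DiagVal (-diagM KM x) (Q x) :=
    fun {x} hx => by
      have := hx.diagVal
      rw [diagP_reflect] at this
      exact this.neg
  refine ⟨fun x γ => ⟨h.omegaP_off D x γ, hω x γ ▸ h.sharp.omegaP_off D' _ γ⟩,
    fun x i j => ⟨h.integrableOn_omegaP D x i j, ?_⟩, fun x => h.marchenko H D x, fun x => ?_, ?_, ?_, ?_⟩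
  · simp only [hω]
    exact h.sharp.integrableOn_omegaP D' _ i j
  · filter_upwards [h.sharp.marchenko H' D' (-x)] with γ hγ i j
    have e₂ : ∀ g : ℝ, -(-x + g) = x - g := fun g => by ring
    have e₃ : ∀ g : ℝ, -(-x - g) = x + g := fun g => by ring
    simpa only [hω, neg_neg, e₂, e₃] using hγ i j
  · filter_upwards [hoffP, hoffM] with x hP hM
    obtain ⟨m1, m2, m3, m4⟩ := hM
    have e₂ : ∀ g : ℝ, -(-x + g) = x - g := fun g => by ring
    simp only [neg_neg, e₂, Matrix.neg_apply] at m1 m2 m3 m4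
    exact ⟨fun b => ⟨hP.1 b, m1 b⟩, fun b => ⟨hP.2.1 b, m2 b⟩,
      fun a b => ⟨hP.2.2.1 a b, by simpa only [mul_neg, neg_mul] using m3 a b⟩,
      fun a b => ⟨hP.2.2.2 a b, by simpa only [mul_neg, neg_mul, neg_neg] using m4 a b⟩⟩
  · intro σ hσ
    filter_upwards [hoffP, hoffM, hσ.foc] with x hP hM hx l _
    exact ⟨focusColumn_eq hσ hx (hQ.off x) hP.diagVal l, focusColumn_eq hσ hx (hQ.off x) (hdM hM) l⟩
  · intro h2
    have h2' : ∀ i j, MemLp (fun x => sharp Q x i j) 2 volume := fun i j =>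
      ((h2 i j).comp_measurePreserving (Measure.measurePreserving_neg volume)).neg
    have vP := h.value_pl H h2
    have vM := h.value_mi H h2
    have e₂ : ∀ x g : ℝ, -(-x + g) = x - g := fun x g => by ring
    have wP : ∀ (x : ℝ) (a b : Fin p), HasValueAtZero (fun γ => KM x (x - γ) (pl a) (pl b))
        (∫ z in Iio x, prodP Q z a b) := fun x a b => by
      have h3 := h.sharp.value_pl H' h2' (-x) a b
      have h4 := integral_Iio_neg (fun z => prodP Q z a b) (-x)
      rw [neg_neg] at h4
      simp only [e₂, neg_neg] at h3
      rw [h4]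
      simpa only [prodP, sharp, Matrix.neg_apply, neg_mul_neg] using h3
    have wM : ∀ (x : ℝ) (a b : Fin m), HasValueAtZero (fun γ => KM x (x - γ) (mi a) (mi b))
        (∫ z in Ioi x, prodM Q z a b) := fun x a b => by
      have h3 := h.sharp.value_mi H' h2' (-x) a b
      rw [integral_Iio_neg] at h3
      simp only [e₂, neg_neg] at h3
      simpa only [prodM, sharp, Matrix.neg_apply, neg_mul_neg, neg_neg] using h3
    refine ⟨fun x a b => ⟨vP x a b, wP x a b⟩, fun x a b => ⟨vM x a b, wM x a b⟩, ?_⟩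
    filter_upwards [hoffP, hoffM,
      ae_all_iff.2 fun a => ae_all_iff.2 fun b => ae_hasDerivAt_Ioi (integrable_prodP h2 a b),
      ae_all_iff.2 fun a => ae_all_iff.2 fun b => ae_hasDerivAt_Iio (integrable_prodP h2 a b),
      ae_all_iff.2 fun a => ae_all_iff.2 fun b => ae_hasDerivAt_Ioi (integrable_prodM h2 a b),
      ae_all_iff.2 fun a => ae_all_iff.2 fun b => ae_hasDerivAt_Iio (integrable_prodM h2 a b)]
      with x hP hM d1 d2 d3 d4 n1 n2
    refine ⟨reconstruct_eq (hQ.off x) hP.diagVal (fun a b => ?_) (fun a b => ?_) n1 n2,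
      reconstruct_eq (hQ.off x) (hdM hM) (fun a b => ?_) (fun a b => ?_) n1 n2⟩
    · exact (d1 a b).congr_of_eventuallyEq (.of_forall fun t => (vP t a b).limUnder_eq)
    · exact (d4 a b).congr_of_eventuallyEq (.of_forall fun t => (vM t a b).limUnder_eq)
    · exact (d2 a b).neg.congr_of_eventuallyEq
        (.of_forall fun t => congrArg Neg.neg (wP t a b).limUnder_eq)
    · exact ((d3 a b).neg.congr_of_eventuallyEq
        (.of_forall fun t => congrArg Neg.neg (wM t a b).limUnder_eq)).congr_deriv (neg_neg _)
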